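/- Let $P\subset\mathbb R^2$ be the bounded domain enclosed by a simple closed polygon of perimeter one with $d\ge 3$ sides. Parametrize $\partial P$ by arc length $s\in S^1=\mathbb R/\mathbb Z$, positively oriented, with a vertex at $s=0$, and let $M=S^1\times[-\pi/2,\pi/2]$, where $(s,\theta)$ stands for the unit vector based at the point $s$ of $\partial P$ that makes the signed angle $\theta$ with the inner normal (positive towards the tangent). Let $f\colon[-\pi/2,\pi/2]\to[-\pi/2,\pi/2]$ be a $C^2$ embedding with $f(0)=0$, $f'>0$ on $(-\pi/2,\pi/2)$ and $\sup_{(-\pi/2,\pi/2)}|f'|<1$. Let $V\subset M$ be the set of the vectors with $|\theta|<\pi/2$ based at a vertex of $P$, let $S\subset M$ be the set of the vectors whose forward trajectory hits a vertex of $P$ at its first collision with $\partial P$, and put $N^+=V\cup S\cup\partial M$. The billiard map $\Phi\colon M\setminus N^+\to M$ with reflection law $f$ sends $(s,\theta)$ to $(s_1,f(\bar\theta_1))$, where $(s_1,\bar\theta_1)$ is the vector obtained by specular reflection at the first collision. For $n\ge1$ let $N^+_n=N^+\cup\Phi^{-1}(N^+)\cup\dots\cup\Phi^{-n+1}(N^+)$.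 A sector of order $n$ with vertex $x\in N_n^+$ is a connected component $\Delta$ of $U\setminus N_n^+$, where $U\subset M$ is an open ball centered at $x$ so small that its closure meets only smooth branches of $N_n^+$ that meet at $x$ (that is, $N_n^+\cap\overline U$ is a finite union of regular $C^2$ arcs issuing from $x$ and otherwise pairwise disjoint). The sector is regular if $\Phi^n|_\Delta$ extends to a $C^2$ diffeomorphism from $\overline\Delta$ onto its image. Let $b_n$ be the maximal number of distinct regular sectors of order $n$ with the same vertex $x$ (in one and the same ball $U$), the maximum being over all $x\in N_n^+$ and all such $U$. Theorem. For every $n\ge1$ the number $b_n$ is finite, and $$b_n\le(2n-1)\,b_1 .$$ -/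

import Mathlib

noncomputable section

/-- A (simple) polygonal domain `P` of the plane `ℂ`, with `d` sides and perimeter one, together with
the arc-length parametrization `bdry` of its boundary (period one, positively oriented, with a vertex
at the parameter `0`).  The vertices have parameters `0 = corner 0 < ⋯ < corner (d - 1) < 1`, and
`corner d = 1` is the parameter `0` again. -/
structure PolygonalTable where
  /-- the number of sides -/
  d : ℕ
  three_le : 3 ≤ d
  /-- the polygonal domain -/
  P : Set ℂ
  isOpen : IsOpen P
  isConnected : IsConnected P
  isBounded : Bornology.IsBounded P
  /-- the arc-length parameters of the vertices -/
  corner : Fin (d + 1) → ℝ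
  corner_zero : corner 0 = 0
  corner_last : corner (Fin.last d) = 1
  corner_strictMono : StrictMono corner
  /-- the arc-length parametrization of the boundary -/
  bdry : ℝ → ℂ
  periodic : Function.Periodic bdry 1
  /-- the boundary is a simple closed curve -/
  injOn : Set.InjOn bdry (Set.Ico 0 1)
  /-- each side is a segment, traversed at unit speed -/
  side : ∀ i : Fin d, ∃ u : ℂ, ‖u‖ = 1 ∧
    ∀ s ∈ Set.Icc (corner i.castSucc) (corner i.succ),
      bdry s = bdry (corner i.castSucc) + (s - corner i.castSucc) • u
  /-- consecutive sides are not aligned -/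
  angle : ∀ i, ¬ DifferentiableAt ℝ bdry (corner i)
  frontier_eq : frontier P = Set.range bdry
  /-- positive orientation: `P` lies to the left of every side -/
  left : ∀ s : ℝ, (∀ i, bdry s ≠ bdry (corner i)) →
    ∀ᶠ ε : ℝ in nhdsWithin 0 (Set.Ioi 0), bdry s + ε • (Complex.I * deriv bdry s) ∈ P

/-- The standing assumptions on the reflection law `f`: a `C²` embedding of `[-π/2, π/2]` into
itself, contracting (`sup |f'| < 1`), with `f 0 = 0`, and `f' > 0` on `(-π/2, π/2)`. -/
structure IsContractingLaw (f : ℝ → ℝ) : Prop where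
  mapsTo : Set.MapsTo f (Set.Icc (-(Real.pi / 2)) (Real.pi / 2))
    (Set.Icc (-(Real.pi / 2)) (Real.pi / 2))
  contDiffOn : ContDiffOn ℝ 2 f (Set.Icc (-(Real.pi / 2)) (Real.pi / 2))
  injOn : Set.InjOn f (Set.Icc (-(Real.pi / 2)) (Real.pi / 2))
  immersion : ∀ θ ∈ Set.Icc (-(Real.pi / 2)) (Real.pi / 2),
    derivWithin f (Set.Icc (-(Real.pi / 2)) (Real.pi / 2)) θ ≠ 0
  contracting : ∃ c : ℝ, c < 1 ∧ ∀ θ ∈ Set.Ioo (-(Real.pi / 2)) (Real.pi / 2), |deriv f θ| ≤ c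
  map_zero : f 0 = 0
  deriv_pos : ∀ θ ∈ Set.Ioo (-(Real.pi / 2)) (Real.pi / 2), 0 < deriv f θ

/-- The phase space `M = S¹ × [-π/2, π/2]`, written in the coordinates `(s, θ) ∈ ℝ × [-π/2, π/2]` in
which the arc-length parameter `s` is read modulo one (all sets below are invariant under
`s ↦ s + 1`). -/
def phaseSpace : Set (ℝ × ℝ) := {x | x.2 ∈ Set.Icc (-(Real.pi / 2)) (Real.pi / 2)}

/-- The boundary `∂M`. -/
def phaseBoundary : Set (ℝ × ℝ) := {x | x.2 = -(Real.pi / 2) ∨ x.2 = Real.pi / 2}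

/-- The open Euclidean ball of `M` with center `x` and radius `r`. -/
def phaseBall (x : ℝ × ℝ) (r : ℝ) : Set (ℝ × ℝ) :=
  {y | y ∈ phaseSpace ∧ (y.1 - x.1) ^ 2 + (y.2 - x.2) ^ 2 < r ^ 2}

namespace PolygonalTable

/-- The point of `∂P` with parameter `s` is a vertex of `P`. -/
def IsCorner (T : PolygonalTable) (s : ℝ) : Prop := ∃ i, T.bdry s = T.bdry (T.corner i)

/-- The unit vector of `(s, θ)`: it makes the signed angle `θ` with the inner normal `i * bdry' s`,
positive towards the positively oriented tangent `bdry' s`. -/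
def direction (T : PolygonalTable) (x : ℝ × ℝ) : ℂ :=
  Real.sin x.2 • deriv T.bdry x.1 + Real.cos x.2 • (Complex.I * deriv T.bdry x.1)

/-- The time of the first collision with `∂P`, along the ray leaving from `(s, θ)`. -/
def hitTime (T : PolygonalTable) (x : ℝ × ℝ) : ℝ :=
  sInf {t : ℝ | 0 < t ∧ T.bdry x.1 + t • T.direction x ∉ T.P}

/-- The point of the first collision with `∂P`. -/
def hitPoint (T : PolygonalTable) (x : ℝ × ℝ) : ℂ :=
  T.bdry x.1 + T.hitTime x • T.direction x

/-- The arc-length parameter, in `[0, 1)`, of the first collision point. -/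
def hitParam (T : PolygonalTable) (x : ℝ × ℝ) : ℝ :=
  Function.invFunOn T.bdry (Set.Ico 0 1) (T.hitPoint x)

/-- The billiard map `Φ_P` with the specular law: the tangential component of the velocity, which is
the sine of the new angle, is kept at the collision.  Used only outside `N⁺`. -/
def specularMap (T : PolygonalTable) (x : ℝ × ℝ) : ℝ × ℝ :=
  (T.hitParam x,
    Real.arcsin (T.direction x * (starRingEnd ℂ) (deriv T.bdry (T.hitParam x))).re)

/-- The billiard map `Φ = R_f ∘ Φ_P` with reflection law `f`. -/
def billiardMap (T : PolygonalTable) (f : ℝ → ℝ) (x : ℝ × ℝ) : ℝ × ℝ :=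
  ((T.specularMap x).1, f (T.specularMap x).2)

/-- The set `V` of the vectors based at a vertex of `P`. -/
def vertexSet (T : PolygonalTable) : Set (ℝ × ℝ) :=
  {x | T.IsCorner x.1 ∧ x.2 ∈ Set.Ioo (-(Real.pi / 2)) (Real.pi / 2)}

/-- The set `S` of the vectors whose first collision with `∂P` is at a vertex.  (Vectors in
`V ∪ ∂M`, for which the first collision need not make sense, are left out; they are in `N⁺`
anyway.) -/
def hitVertexSet (T : PolygonalTable) : Set (ℝ × ℝ) :=
  {x | ¬ T.IsCorner x.1 ∧ x.2 ∈ Set.Ioo (-(Real.pi / 2)) (Real.pi / 2) ∧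
    ∃ i, T.hitPoint x = T.bdry (T.corner i)}

/-- The singular set `N⁺ = V ∪ S ∪ ∂M`. -/
def singularSet (T : PolygonalTable) : Set (ℝ × ℝ) :=
  T.vertexSet ∪ T.hitVertexSet ∪ phaseBoundary

/-- The set `N⁺ₙ = N⁺ ∪ Φ⁻¹(N⁺) ∪ ⋯ ∪ Φ⁻ⁿ⁺¹(N⁺)`.  (The values given to `Φ` on `N⁺` play no role: a
point whose orbit meets `N⁺` before time `n` is in the set, whatever the later iterates are.) -/
def singularSetOfOrder (T : PolygonalTable) (f : ℝ → ℝ) (n : ℕ) : Set (ℝ × ℝ) :=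
  {x | x ∈ phaseSpace ∧ ∃ k < n, (T.billiardMap f)^[k] x ∈ T.singularSet}

/-- The open ball `U` of `M` with center `x ∈ N⁺ₙ` and radius `r` may be used to define the sectors
of order `n` with vertex `x`: the closure of `U` meets only smooth branches of `N⁺ₙ` that meet at
`x`.  That is, the part of `N⁺ₙ` in the closure of `U` consists of finitely many regular `C²` arcs
issuing from `x` and having no other common point. -/
def IsSectorBall (T : PolygonalTable) (f : ℝ → ℝ) (n : ℕ) (x : ℝ × ℝ) (r : ℝ) : Prop :=
  0 < r ∧ x ∈ T.singularSetOfOrder f n ∧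
  ∃ (m : ℕ) (γ : Fin m → ℝ → ℝ × ℝ),
    (∀ i, γ i 0 = x ∧ ContDiffOn ℝ 2 (γ i) (Set.Icc 0 1) ∧ Set.InjOn (γ i) (Set.Icc 0 1) ∧
      ∀ t ∈ Set.Icc (0 : ℝ) 1, derivWithin (γ i) (Set.Icc 0 1) t ≠ 0) ∧
    (∀ i j, i ≠ j → Disjoint (γ i '' Set.Ioc 0 1) (γ j '' Set.Ioc 0 1)) ∧
    T.singularSetOfOrder f n ∩ closure (phaseBall x r) = ⋃ i, γ i '' Set.Icc 0 1

/-- The sectors of order `n` with vertex `x` cut out in the ball of radius `r`: the connected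
components of `U \ N⁺ₙ`. -/
def sectors (T : PolygonalTable) (f : ℝ → ℝ) (n : ℕ) (x : ℝ × ℝ) (r : ℝ) : Set (Set (ℝ × ℝ)) :=
  {Δ | ∃ y ∈ phaseBall x r \ T.singularSetOfOrder f n,
    Δ = connectedComponentIn (phaseBall x r \ T.singularSetOfOrder f n) y}

/-- A sector `Δ` of order `n` is regular if `Φⁿ|_Δ` extends to a `C²` diffeomorphism `Ψ` from the
closure of `Δ` onto its image (with inverse `Ψ'`). -/
def IsRegular (T : PolygonalTable) (f : ℝ → ℝ) (n : ℕ) (Δ : Set (ℝ × ℝ)) : Prop :=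
  ∃ Ψ Ψ' : ℝ × ℝ → ℝ × ℝ,
    Set.EqOn Ψ (T.billiardMap f)^[n] Δ ∧
    ContDiffOn ℝ 2 Ψ (closure Δ) ∧
    Set.LeftInvOn Ψ' Ψ (closure Δ) ∧
    ContDiffOn ℝ 2 Ψ' (Ψ '' closure Δ)

/-- The branching number `bₙ`: the maximal number of distinct regular sectors of order `n` with the
same vertex (sectors of the same vertex being counted in one and the same ball). -/
def branchingNumber (T : PolygonalTable) (f : ℝ → ℝ) (n : ℕ) : ℕ∞ :=
  ⨆ (x : ℝ × ℝ) (r : ℝ) (_ : T.IsSectorBall f n x r),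
    {Δ ∈ T.sectors f n x r | T.IsRegular f n Δ}.encard

end PolygonalTable

end

noncomputable section

open Set Filter Topology

/-- The planar cross product. -/
def cr (a b : ℂ) : ℝ := a.re * b.im - a.im * b.re

lemma cr_self (a : ℂ) : cr a a = 0 := by simp only [cr]; ring
lemma cr_swap (a b : ℂ) : cr a b = - cr b a := by simp only [cr]; ring
lemma cr_add_right (a b c : ℂ) : cr a (b + c) = cr a b + cr a c := by simp [cr]; ring
lemma cr_sub_right (a b c : ℂ) : cr a (b - c) = cr a b - cr a c := by simp [cr]; ring
lemma cr_smul_right (a b : ℂ) (t : ℝ) : cr a (t • b) = t * cr a b := by simp [cr]; ring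
lemma cr_smul_left (a b : ℂ) (t : ℝ) : cr (t • a) b = t * cr a b := by simp [cr]; ring
lemma cr_neg_left (a b : ℂ) : cr (-a) b = - cr a b := by simp [cr]; ring

@[fun_prop]
lemma continuous_cr {X : Type*} [TopologicalSpace X] {f g : X → ℂ} (hf : Continuous f)
    (hg : Continuous g) : Continuous fun x => cr (f x) (g x) := by
  unfold cr; fun_prop

/-- A vector which is parallel to a unit vector is a multiple of it. -/
lemma eq_smul_of_cr_eq_zero {u p : ℂ} (hu : ‖u‖ = 1) (h : cr u p = 0) :
    p = (u.re * p.re + u.im * p.im) • u := by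
  have h1 : u.re * u.re + u.im * u.im = 1 := by
    have := Complex.sq_norm u
    rw [hu, Complex.normSq_apply] at this; linarith
  simp only [cr] at h
  apply Complex.ext
  · simp only [Complex.real_smul, Complex.mul_re, Complex.ofReal_re, Complex.ofReal_im]
    linear_combination (-p.re) * h1 + (-u.im) * h
  · simp only [Complex.real_smul, Complex.mul_im, Complex.ofReal_re, Complex.ofReal_im]
    linear_combination (-p.im) * h1 + u.re * h

namespace PolygonalTable

variable (T : PolygonalTable)

/-- The sides of the universal cover of the boundary. -/
abbrev Side (T : PolygonalTable) := Fin T.d × ℤ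

/-- The parameter of the initial point of a side. -/
def lo (j : T.Side) : ℝ := T.corner j.1.castSucc + j.2
/-- The parameter of the final point of a side. -/
def hi (j : T.Side) : ℝ := T.corner j.1.succ + j.2
/-- The unit tangent vector of a side. -/
def dir (j : T.Side) : ℂ := (T.side j.1).choose
/-- The arc-length parametrization of the line through a side. -/
def lineP (j : T.Side) (s : ℝ) : ℂ := T.bdry (T.lo j) + (s - T.lo j) • T.dir j

lemma lo_lt_hi (j : T.Side) : T.lo j < T.hi j := by
  unfold lo hi
  have := T.corner_strictMono (Fin.castSucc_lt_succ (i := j.1))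
  linarith

lemma corner_nonneg (i) : 0 ≤ T.corner i := by
  rw [← T.corner_zero]; exact T.corner_strictMono.monotone (Fin.zero_le i)

lemma corner_le_one (i) : T.corner i ≤ 1 := by
  rw [← T.corner_last]; exact T.corner_strictMono.monotone (Fin.le_last i)

lemma norm_dir (j : T.Side) : ‖T.dir j‖ = 1 := (T.side j.1).choose_spec.1

lemma dir_sq (j : T.Side) : (T.dir j).re ^ 2 + (T.dir j).im ^ 2 = 1 := by
  have := Complex.sq_norm (T.dir j)
  rw [norm_dir, Complex.normSq_apply] at this; linarith

lemma dir_ne_zero (j : T.Side) : T.dir j ≠ 0 := by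
  intro h; have := T.norm_dir j; rw [h] at this; simp at this

lemma bdry_add_int (s : ℝ) (n : ℤ) : T.bdry (s + n) = T.bdry s := by
  have := T.periodic.int_mul n s
  simpa using this

lemma bdry_eq {j : T.Side} {s : ℝ} (hs : s ∈ Icc (T.lo j) (T.hi j)) : T.bdry s = T.lineP j s := by
  have h := (T.side j.1).choose_spec.2 (s - j.2) (by
    unfold lo hi at hs; constructor <;> linarith [hs.1, hs.2])
  have e1 : T.bdry (s - j.2) = T.bdry s := by
    rw [← T.bdry_add_int (s - j.2) j.2]; congr 1; ring
  have e2 : T.bdry (T.lo j) = T.bdry (T.corner j.1.castSucc) := T.bdry_add_int _ _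
  rw [e1] at h
  rw [h, lineP, e2]
  congr 2
  unfold lo; ring

lemma lineP_lo (j : T.Side) : T.lineP j (T.lo j) = T.bdry (T.lo j) := by simp [lineP]

lemma lineP_hi (j : T.Side) : T.lineP j (T.hi j) = T.bdry (T.hi j) :=
  (T.bdry_eq ⟨(T.lo_lt_hi j).le, le_rfl⟩).symm

lemma lineP_sub (j : T.Side) (s s' : ℝ) : T.lineP j s - T.lineP j s' = (s - s') • T.dir j := by
  simp only [lineP]; rw [add_sub_add_left_eq_sub, ← sub_smul]; congr 1; ring

@[fun_prop]
lemma continuous_lineP (j : T.Side) : Continuous (T.lineP j) := by unfold lineP; fun_prop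

lemma deriv_bdry {j : T.Side} {s : ℝ} (hs : s ∈ Ioo (T.lo j) (T.hi j)) :
    deriv T.bdry s = T.dir j := by
  have h : T.bdry =ᶠ[𝓝 s] T.lineP j := by
    filter_upwards [Ioo_mem_nhds hs.1 hs.2] with s' hs'
    exact T.bdry_eq ⟨hs'.1.le, hs'.2.le⟩
  rw [h.deriv_eq]
  have : HasDerivAt (T.lineP j) ((1:ℝ) • T.dir j) s := by
    unfold lineP
    exact (((hasDerivAt_id s).sub_const _).smul_const _).const_add _
  simpa using this.deriv

lemma exists_int_of_bdry_eq {s s' : ℝ} (h : T.bdry s = T.bdry s') : ∃ n : ℤ, s' = s + n := by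
  have h1 : T.bdry (Int.fract s) = T.bdry (Int.fract s') := by
    have a : ∀ r : ℝ, T.bdry (Int.fract r) = T.bdry r := fun r => by
      rw [← T.bdry_add_int (Int.fract r) ⌊r⌋]; simp
    rw [a, a, h]
  have h2 := T.injOn ⟨Int.fract_nonneg s, Int.fract_lt_one s⟩
    ⟨Int.fract_nonneg s', Int.fract_lt_one s'⟩ h1
  refine ⟨⌊s'⌋ - ⌊s⌋, ?_⟩
  have := Int.floor_add_fract s; have := Int.floor_add_fract s'
  push_cast; linarith

/-- Every parameter lies in a half-open side. -/
lemma exists_side_Ico (s : ℝ) : ∃ j : T.Side, s ∈ Ico (T.lo j) (T.hi j) := by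
  obtain ⟨i, hi⟩ : ∃ i : Fin T.d, T.corner i.castSucc ≤ Int.fract s ∧
      Int.fract s < T.corner i.succ := by
    by_contra! hcon
    have : ∀ k : Fin (T.d + 1), T.corner k ≤ Int.fract s := by
      intro k
      induction k using Fin.induction with
      | zero => rw [T.corner_zero]; exact Int.fract_nonneg s
      | succ i ih => exact hcon i ih
    have h := this (Fin.last _)
    rw [T.corner_last] at h
    linarith [Int.fract_lt_one s]
  refine ⟨(i, ⌊s⌋), ?_⟩
  have := Int.floor_add_fract s
  unfold lo PolygonalTable.hi
  constructor <;> simp only <;> linarith [hi.1, hi.2]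

lemma lo_add_one_side (j : T.Side) : ∃ j' : T.Side, T.hi j' = T.lo j := by
  obtain ⟨i, n⟩ := j
  by_cases h : (i : ℕ) = 0
  · have hd := T.three_le
    refine ⟨(⟨T.d - 1, by omega⟩, n - 1), ?_⟩
    have e1 : (⟨T.d - 1, by omega⟩ : Fin T.d).succ = Fin.last T.d := by
      ext; simp; omega
    have e2 : i.castSucc = 0 := by ext; simpa using h
    simp only [hi, lo, e1, e2, T.corner_zero, T.corner_last]; push_cast; ring
  · refine ⟨(⟨i - 1, by omega⟩, n), ?_⟩
    have e1 : (⟨(i:ℕ) - 1, by omega⟩ : Fin T.d).succ = i.castSucc := by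
      ext; simp; omega
    simp only [hi, lo, e1]

lemma exists_side_Ioc (s : ℝ) : ∃ j : T.Side, s ∈ Ioc (T.lo j) (T.hi j) := by
  obtain ⟨j, h1, h2⟩ := T.exists_side_Ico s
  rcases h1.eq_or_lt with h | h
  · obtain ⟨j', hj'⟩ := T.lo_add_one_side j
    exact ⟨j', by rw [← h, ← hj']; exact T.lo_lt_hi j', by rw [hj', h]⟩
  · exact ⟨j, h, h2.le⟩

/-- Distinct sides do not overlap. -/
lemma side_eq_of_mem {j j' : T.Side} {s : ℝ} (h : s ∈ Ioo (T.lo j) (T.hi j))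
    (h' : s ∈ Icc (T.lo j') (T.hi j')) : j = j' := by
  obtain ⟨i, n⟩ := j
  obtain ⟨i', n'⟩ := j'
  simp only [lo, hi, mem_Ioo, mem_Icc] at h h'
  have a1 := T.corner_nonneg i.castSucc
  have a2 := T.corner_le_one i.succ
  have a3 := T.corner_nonneg i'.castSucc
  have a4 := T.corner_le_one i'.succ
  have hn : n = n' := by
    have b1 : (n : ℝ) < n' + 1 := by linarith
    have b2 : (n' : ℝ) < n + 1 := by linarith
    have b1' : n < n' + 1 := by exact_mod_cast b1
    have b2' : n' < n + 1 := by exact_mod_cast b2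
    omega
  subst hn
  congr 1
  rcases lt_trichotomy i i' with hlt | heq | hlt
  · have := T.corner_strictMono.monotone (show i.succ ≤ i'.castSucc by
      rw [Fin.le_def]; simpa using hlt)
    linarith
  · exact heq
  · have := T.corner_strictMono.monotone (show i'.succ ≤ i.castSucc by
      rw [Fin.le_def]; simpa using hlt)
    linarith

lemma isCorner_lo (j : T.Side) : T.IsCorner (T.lo j) :=
  ⟨j.1.castSucc, T.bdry_add_int _ _⟩

lemma isCorner_hi (j : T.Side) : T.IsCorner (T.hi j) := ⟨j.1.succ, T.bdry_add_int _ _⟩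

lemma IsCorner.exists_lo {T : PolygonalTable} {s : ℝ} (h : T.IsCorner s) :
    ∃ j : T.Side, T.lo j = s := by
  obtain ⟨i, hi⟩ := h
  obtain ⟨n, hn⟩ := T.exists_int_of_bdry_eq hi.symm
  by_cases hl : i = Fin.last _
  · subst hl
    have hd := T.three_le
    refine ⟨(⟨0, by omega⟩, n + 1), ?_⟩
    have e2 : (⟨0, by omega⟩ : Fin T.d).castSucc = 0 := by ext; simp
    simp only [lo, e2, hn, T.corner_zero, T.corner_last]; push_cast; ring
  · refine ⟨(i.castPred hl, n), ?_⟩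
    simp [lo, hn]

lemma not_isCorner_of_mem {j : T.Side} {s : ℝ} (h : s ∈ Ioo (T.lo j) (T.hi j)) :
    ¬ T.IsCorner s := by
  intro hc
  obtain ⟨j', hj'⟩ := hc.exists_lo
  have := T.side_eq_of_mem h (j' := j') (by rw [← hj']; exact ⟨le_rfl, (T.lo_lt_hi j').le⟩)
  subst this
  rw [← hj'] at h
  exact lt_irrefl _ h.1

lemma exists_side_of_not_isCorner {s : ℝ} (h : ¬ T.IsCorner s) :
    ∃ j : T.Side, s ∈ Ioo (T.lo j) (T.hi j) := by
  obtain ⟨j, h1, h2⟩ := T.exists_side_Ico s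
  refine ⟨j, lt_of_le_of_ne h1 ?_, h2⟩
  rintro rfl
  exact h (T.isCorner_lo j)

lemma lo_shift (j : T.Side) (n : ℤ) : T.lo (j.1, j.2 + n) = T.lo j + n := by
  simp [lo]; ring
lemma hi_shift (j : T.Side) (n : ℤ) : T.hi (j.1, j.2 + n) = T.hi j + n := by
  simp [hi]; ring

lemma bdry_notMem (s : ℝ) : T.bdry s ∉ T.P := by
  have h : T.bdry s ∈ frontier T.P := by rw [T.frontier_eq]; exact ⟨s, rfl⟩
  intro hs
  rw [T.isOpen.frontier_eq] at h
  exact h.2 hs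

lemma lineP_notMem {j : T.Side} {s : ℝ} (hs : s ∈ Icc (T.lo j) (T.hi j)) : T.lineP j s ∉ T.P := by
  rw [← T.bdry_eq hs]; exact T.bdry_notMem s

/-- The boundary is the union of the closed sides. -/
lemma range_bdry : range T.bdry = ⋃ i : Fin T.d, T.lineP (i, 0) '' Icc (T.lo (i, 0)) (T.hi (i, 0)) := by
  ext p
  constructor
  · rintro ⟨s, rfl⟩
    obtain ⟨j, h1, h2⟩ := T.exists_side_Ico s
    refine mem_iUnion.2 ⟨j.1, s - j.2, ?_, ?_⟩
    · unfold lo hi at *; constructor <;> push_cast <;> linarith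
    · rw [← T.bdry_eq, ← T.bdry_add_int (s - j.2) j.2]
      · congr 1; ring
      · unfold lo hi at *; constructor <;> push_cast <;> linarith
  · intro h
    obtain ⟨i, s, hs, rfl⟩ := mem_iUnion.1 h
    exact ⟨s, T.bdry_eq hs⟩

/-- Near a boundary point which is not a vertex, the boundary is a line. -/
lemma eventually_mem_range_iff {j : T.Side} {s : ℝ} (hs : s ∈ Ioo (T.lo j) (T.hi j)) :
    ∀ᶠ p in 𝓝 (T.bdry s), p ∈ range T.bdry ↔ cr (T.dir j) (p - T.bdry s) = 0 := by
  have hb := T.bdry_eq (Ioo_subset_Icc_self hs)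
  have h1 : ∀ᶠ p in 𝓝 (T.bdry s), ∀ i : Fin T.d, i ≠ j.1 →
      p ∉ T.lineP (i, 0) '' Icc (T.lo (i, 0)) (T.hi (i, 0)) := by
    rw [eventually_all]
    intro i
    by_cases hi : i = j.1
    · simp [hi]
    have hc : IsClosed (T.lineP (i, 0) '' Icc (T.lo (i, 0)) (T.hi (i, 0))) :=
      (isCompact_Icc.image (T.continuous_lineP _)).isClosed
    have hn : T.bdry s ∉ T.lineP (i, 0) '' Icc (T.lo (i, 0)) (T.hi (i, 0)) := by
      rintro ⟨s', hs', he⟩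
      rw [← T.bdry_eq hs'] at he
      obtain ⟨n, rfl⟩ := T.exists_int_of_bdry_eq he
      have := T.side_eq_of_mem hs (j' := (i, n)) (by
        have a := T.lo_shift (i, 0) n
        have b := T.hi_shift (i, 0) n
        simp only [zero_add] at a b
        rw [a, b]; constructor <;> linarith [hs'.1, hs'.2])
      apply hi; rw [this]
    filter_upwards [hc.isOpen_compl.mem_nhds hn] with p hp _ using hp
  have h2 : ∀ᶠ p in 𝓝 (T.bdry s), s + ((T.dir j).re * (p - T.bdry s).re +
      (T.dir j).im * (p - T.bdry s).im) ∈ Ioo (T.lo j) (T.hi j) := by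
    have hc : Continuous fun p => s + ((T.dir j).re * (p - T.bdry s).re +
      (T.dir j).im * (p - T.bdry s).im) := by fun_prop
    apply hc.continuousAt.eventually_mem
    apply isOpen_Ioo.mem_nhds
    simpa using hs
  filter_upwards [h1, h2] with p hp1 hp2
  constructor
  · intro hp
    rw [T.range_bdry] at hp
    obtain ⟨i, hi⟩ := mem_iUnion.1 hp
    have hij : i = j.1 := by
      by_contra hne; exact hp1 i hne hi
    subst hij
    obtain ⟨s', hs', rfl⟩ := hi
    have e : T.lineP (j.1, 0) s' = T.lineP j (s' + j.2) := by
      rw [← T.bdry_eq hs', ← T.bdry_eq, T.bdry_add_int]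
      unfold lo hi at *; push_cast at hs'; constructor <;> linarith [hs'.1, hs'.2]
    rw [e, hb, T.lineP_sub, cr_smul_right, cr_self, mul_zero]
  · intro h
    have := eq_smul_of_cr_eq_zero (T.norm_dir j) h
    refine ⟨_, (T.bdry_eq (Ioo_subset_Icc_self hp2)).trans ?_⟩
    rw [sub_eq_iff_eq_add] at this
    conv_rhs => rw [this]
    rw [hb]
    have e := T.lineP_sub j (s + ((T.dir j).re * (p - T.bdry s).re +
      (T.dir j).im * (p - T.bdry s).im)) s
    rw [sub_eq_iff_eq_add, add_sub_cancel_left, hb] at e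
    exact e

end PolygonalTable

namespace PolygonalTable

variable (T : PolygonalTable)

/-- A connected set which avoids the boundary and meets `P` is contained in `P`. -/
lemma subset_P_of_isPreconnected {s : Set ℂ} (hs : IsPreconnected s)
    (hb : ∀ p ∈ s, p ∉ range T.bdry) {p : ℂ} (hp : p ∈ s) (hpP : p ∈ T.P) : s ⊆ T.P := by
  have hd : Disjoint T.P (closure T.P)ᶜ :=
    disjoint_compl_right.mono_left subset_closure
  refine hs.subset_left_of_subset_union T.isOpen isClosed_closure.isOpen_compl hd ?_ ⟨p, hp, hpP⟩
  intro q hq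
  by_contra hcon
  simp only [mem_union, mem_compl_iff, not_or, not_not] at hcon
  refine hb q hq ?_
  rw [← T.frontier_eq, T.isOpen.frontier_eq]
  exact ⟨hcon.2, hcon.1⟩

lemma convex_half (a q : ℂ) (ρ : ℝ) : Convex ℝ {p | p ∈ Metric.ball q ρ ∧ 0 < cr a (p - q)} := by
  refine (convex_ball q ρ).inter (t := {p | 0 < cr a (p - q)}) ?_
  intro x hx y hy α β hα hβ hab
  have hx : 0 < cr a (x - q) := hx
  have hy : 0 < cr a (y - q) := hy
  change 0 < cr a (α • x + β • y - q)
  have : cr a (α • x + β • y - q) = α * cr a (x - q) + β * cr a (y - q) := by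
    have : q = (α + β) • q := by rw [hab, one_smul]
    conv_lhs => rw [this]
    simp [cr]; ring
  rw [this]
  rcases hα.eq_or_lt with h | h
  · have : β = 1 := by linarith
    rw [← h, this]; simpa using hy
  · have := mul_pos h hx
    have := mul_nonneg hβ hy.le
    linarith

/-- The structure of `P` near a boundary point which is not a vertex. -/
lemma half_disc_aux {j : T.Side} {s : ℝ} (hs : s ∈ Ioo (T.lo j) (T.hi j)) :
    ∃ ρ > 0, (∀ p ∈ Metric.ball (T.bdry s) ρ,
        0 < cr (T.dir j) (p - T.bdry s) → p ∈ T.P) ∧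
      ((∀ p ∈ Metric.ball (T.bdry s) ρ, cr (T.dir j) (p - T.bdry s) < 0 → p ∈ T.P) ∨
       (∀ p ∈ Metric.ball (T.bdry s) ρ, cr (T.dir j) (p - T.bdry s) < 0 → p ∉ T.P)) := by
  obtain ⟨ρ, hρ, h⟩ := Metric.eventually_nhds_iff_ball.1 (T.eventually_mem_range_iff hs)
  have hleft := T.left s (by
    have := T.not_isCorner_of_mem hs
    simpa [IsCorner] using this)
  refine ⟨ρ, hρ, ?_, ?_⟩
  · obtain ⟨ε, hε1, hε2, hε3⟩ := (hleft.and (Ioo_mem_nhdsGT hρ)).exists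
    rw [T.deriv_bdry hs] at hε1
    have := T.subset_P_of_isPreconnected (convex_half (T.dir j) (T.bdry s) ρ).isPreconnected
      (fun p hp hr => hp.2.ne' ((h p hp.1).1 hr))
      (p := T.bdry s + ε • (Complex.I * T.dir j)) ⟨?_, ?_⟩ hε1
    · intro p hp hp'; exact this ⟨hp, hp'⟩
    · simpa [T.norm_dir, abs_of_pos hε2] using hε3
    · have := T.dir_sq j
      have e : cr (T.dir j) (T.bdry s + ε • (Complex.I * T.dir j) - T.bdry s) = ε := by
        rw [add_sub_cancel_left]; simp [cr]; linear_combination ε * this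
      rw [e]; exact hε2
  · by_contra! hcon
    obtain ⟨⟨p, hp, hp', hpn⟩, ⟨p2, hp2, hp2', hp2n⟩⟩ := hcon
    refine hpn (T.subset_P_of_isPreconnected (convex_half (- T.dir j) (T.bdry s) ρ).isPreconnected
      (fun p hp hr => ?_) (p := p2) ⟨hp2, ?_⟩ hp2n ⟨hp, ?_⟩)
    · have h1 := hp.2
      rw [cr_neg_left, (h p hp.1).1 hr] at h1; simp at h1
    · rw [cr_neg_left]; linarith
    · rw [cr_neg_left]; linarith

/-- The side `j` has the domain on its right too (this never happens). -/
def RightIn (j : T.Side) (s : ℝ) : Prop :=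
  ∃ ρ > 0, ∀ p ∈ Metric.ball (T.lineP j s) ρ, cr (T.dir j) (p - T.lineP j s) < 0 → p ∈ T.P

lemma isOpen_right (j : T.Side) (Q : Set ℂ) :
    IsOpen {s | ∃ ρ > 0, ∀ p ∈ Metric.ball (T.lineP j s) ρ,
      cr (T.dir j) (p - T.lineP j s) < 0 → p ∈ Q} := by
  rw [isOpen_iff_mem_nhds]
  rintro s ⟨ρ, hρ, h⟩
  have hc : ∀ᶠ s' in 𝓝 s, T.lineP j s' ∈ Metric.ball (T.lineP j s) (ρ / 2) :=
    (T.continuous_lineP j).continuousAt.eventually_mem (Metric.ball_mem_nhds _ (by positivity))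
  filter_upwards [hc] with s' hs'
  refine ⟨ρ / 2, by positivity, fun p hp hp' => h p ?_ ?_⟩
  · rw [Metric.mem_ball] at *
    linarith [dist_triangle p (T.lineP j s') (T.lineP j s)]
  · have e : p - T.lineP j s = (p - T.lineP j s') + (s' - s) • T.dir j := by
      rw [← T.lineP_sub]; ring
    rw [e, cr_add_right, cr_smul_right, cr_self]; linarith

lemma exists_right_point {j : T.Side} (s : ℝ) {ρ : ℝ} (hρ : 0 < ρ) :
    ∃ p ∈ Metric.ball (T.lineP j s) ρ, cr (T.dir j) (p - T.lineP j s) < 0 := by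
  refine ⟨T.lineP j s + (-(ρ/2)) • (Complex.I * T.dir j), ?_, ?_⟩
  · simp [T.norm_dir, abs_of_pos hρ]; linarith
  · have := T.dir_sq j
    have e : cr (T.dir j) (T.lineP j s + (-(ρ/2)) • (Complex.I * T.dir j) - T.lineP j s)
        = -(ρ/2) := by
      rw [add_sub_cancel_left]; simp [cr]; linear_combination (-(ρ/2)) * this
    rw [e]; linarith

lemma RightIn.all {T : PolygonalTable} {j : T.Side} {s : ℝ} (hs : s ∈ Ioo (T.lo j) (T.hi j))
    (h : T.RightIn j s) {s' : ℝ} (hs' : s' ∈ Ioo (T.lo j) (T.hi j)) : T.RightIn j s' := by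
  have hd : Disjoint {s | ∃ ρ > 0, ∀ p ∈ Metric.ball (T.lineP j s) ρ,
      cr (T.dir j) (p - T.lineP j s) < 0 → p ∈ T.P} {s | ∃ ρ > 0, ∀ p ∈ Metric.ball (T.lineP j s) ρ,
      cr (T.dir j) (p - T.lineP j s) < 0 → p ∈ T.Pᶜ} := by
    rw [Set.disjoint_left]
    rintro r ⟨ρ, hρ, h1⟩ ⟨ρ', hρ', h2⟩
    obtain ⟨p, hp, hp'⟩ := T.exists_right_point (j := j) r (lt_min hρ hρ')
    exact h2 p (Metric.ball_subset_ball (min_le_right _ _) hp) hp'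
      (h1 p (Metric.ball_subset_ball (min_le_left _ _) hp) hp')
  refine (isPreconnected_Ioo.subset_left_of_subset_union (T.isOpen_right j _) (T.isOpen_right j _)
    hd ?_ ⟨s, hs, h⟩) hs'
  intro r hr
  obtain ⟨ρ, hρ, -, h1⟩ := T.half_disc_aux hr
  rw [T.bdry_eq (Ioo_subset_Icc_self hr)] at h1
  exact h1.imp (fun h => ⟨ρ, hρ, h⟩) (fun h => ⟨ρ, hρ, h⟩)

lemma side_eq_of_lo {j j' : T.Side} (h : T.lo j = T.lo j') : j = j' := by
  have h1 := T.lo_lt_hi j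
  have h2 := T.lo_lt_hi j'
  obtain ⟨s, hs, hs'⟩ := exists_between (lt_min h1 (h ▸ h2))
  exact T.side_eq_of_mem (s := s) ⟨hs, hs'.trans_le (min_le_left _ _)⟩
    ⟨h ▸ hs.le, hs'.le.trans (min_le_right _ _)⟩

lemma side_eq_of_hi {j j' : T.Side} (h : T.hi j = T.hi j') : j = j' := by
  have h1 := T.lo_lt_hi j
  have h2 := T.lo_lt_hi j'
  obtain ⟨s, hs, hs'⟩ := exists_between (max_lt h1 (h ▸ h2))
  exact T.side_eq_of_mem (s := s) ⟨(le_max_left _ _).trans_lt hs, hs'⟩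
    ⟨(le_max_right _ _).trans hs.le, h ▸ hs'.le⟩

/-- Near a vertex, the boundary consists of two radii. -/
lemma eventually_corner {j j' : T.Side} (hj : T.hi j = T.lo j') :
    ∀ᶠ p in 𝓝 (T.bdry (T.hi j)), p ∈ range T.bdry →
      (∃ r ≥ (0:ℝ), p = T.bdry (T.hi j) - r • T.dir j) ∨
      (∃ r ≥ (0:ℝ), p = T.bdry (T.hi j) + r • T.dir j') := by
  have h1 : ∀ᶠ p in 𝓝 (T.bdry (T.hi j)), ∀ i : Fin T.d, i ≠ j.1 → i ≠ j'.1 →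
      p ∉ T.lineP (i, 0) '' Icc (T.lo (i, 0)) (T.hi (i, 0)) := by
    rw [eventually_all]
    intro i
    by_cases hi : i = j.1
    · simp [hi]
    by_cases hi' : i = j'.1
    · simp [hi']
    have hc : IsClosed (T.lineP (i, 0) '' Icc (T.lo (i, 0)) (T.hi (i, 0))) :=
      (isCompact_Icc.image (T.continuous_lineP _)).isClosed
    have hn : T.bdry (T.hi j) ∉ T.lineP (i, 0) '' Icc (T.lo (i, 0)) (T.hi (i, 0)) := by
      rintro ⟨s', hs', he⟩
      rw [← T.bdry_eq hs'] at he
      obtain ⟨n, hn⟩ := T.exists_int_of_bdry_eq he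
      have a := T.lo_shift (i, 0) n
      have b := T.hi_shift (i, 0) n
      simp only [zero_add] at a b
      have hs2 : T.hi j ∈ Icc (T.lo (i, n)) (T.hi (i, n)) := by
        rw [a, b, hn]; constructor <;> linarith [hs'.1, hs'.2]
      rcases hs2.1.eq_or_lt with h | h
      · exact hi' (by rw [← T.side_eq_of_lo (h.trans hj)])
      · rcases hs2.2.eq_or_lt with h' | h'
        · exact hi (by rw [T.side_eq_of_hi h'])
        · exact T.not_isCorner_of_mem ⟨h, h'⟩ (T.isCorner_hi j)
    filter_upwards [hc.isOpen_compl.mem_nhds hn] with p hp _ _ using hp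
  have key : ∀ (j : T.Side) (p : ℂ), p ∈ T.lineP (j.1, 0) '' Icc (T.lo (j.1, 0)) (T.hi (j.1, 0)) →
      ∃ s ∈ Icc (T.lo j) (T.hi j), p = T.lineP j s := by
    rintro j p ⟨s', hs', rfl⟩
    have hm : s' + j.2 ∈ Icc (T.lo j) (T.hi j) := by
      unfold lo hi at *; push_cast at hs'; constructor <;> linarith [hs'.1, hs'.2]
    refine ⟨s' + j.2, hm, ?_⟩
    rw [← T.bdry_eq hs', ← T.bdry_eq hm, T.bdry_add_int]
  filter_upwards [h1] with p hp1 hp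
  rw [T.range_bdry] at hp
  obtain ⟨i, hi⟩ := mem_iUnion.1 hp
  by_cases hij : i = j.1
  · left
    subst hij
    obtain ⟨s, hs, rfl⟩ := key j p hi
    refine ⟨T.hi j - s, by linarith [hs.2], ?_⟩
    rw [← T.lineP_hi, ← T.lineP_sub]; ring
  by_cases hij' : i = j'.1
  · right
    subst hij'
    obtain ⟨s, hs, rfl⟩ := key j' p hi
    refine ⟨s - T.lo j', by linarith [hs.1], ?_⟩
    rw [hj, ← T.lineP_lo, ← T.lineP_sub]; ring
  exact absurd hi (hp1 i hij hij')

/-- The two sides at a vertex do not overlap. -/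
lemma dir_ne_neg_dir {j j' : T.Side} (hj : T.hi j = T.lo j') : T.dir j' ≠ - T.dir j := by
  intro h
  have h1 := T.lo_lt_hi j
  have h2 := T.lo_lt_hi j'
  obtain ⟨ε, hε, hε'⟩ := exists_between (lt_min (sub_pos.2 h1) (sub_pos.2 h2))
  have e1 : ε < T.hi j - T.lo j := hε'.trans_le (min_le_left _ _)
  have e2 : ε < T.hi j' - T.lo j' := hε'.trans_le (min_le_right _ _)
  have hm : T.hi j - ε ∈ Ioo (T.lo j) (T.hi j) := ⟨by linarith, by linarith⟩
  have hm' : T.lo j' + ε ∈ Icc (T.lo j') (T.hi j') := ⟨by linarith, by linarith⟩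
  have e : T.bdry (T.lo j' + ε) = T.bdry (T.hi j - ε) := by
    rw [T.bdry_eq (Ioo_subset_Icc_self hm), T.bdry_eq hm']
    have a := T.lineP_sub j (T.hi j - ε) (T.hi j)
    have b := T.lineP_sub j' (T.lo j' + ε) (T.lo j')
    rw [sub_eq_iff_eq_add] at a b
    rw [a, b, T.lineP_lo, T.lineP_hi, hj, h]
    simp
  obtain ⟨n, hn⟩ := T.exists_int_of_bdry_eq e
  have a := T.lo_shift j' n
  have b := T.hi_shift j' n
  have := T.side_eq_of_mem hm (j' := (j'.1, j'.2 + n)) (by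
    rw [a, b]; constructor <;> linarith)
  have hl : T.lo j = T.lo j' + n := by rw [this, a]
  have hr : T.hi j = T.hi j' + n := by rw [this, b]
  rw [hj] at hr hn
  have hn1 : (n : ℝ) = 0 ∨ True := Or.inr trivial
  have h4 : T.dir j = T.dir j' := by
    have : T.dir j = T.dir (j'.1, j'.2 + n) := by rw [this]
    exact this
  rw [h4] at h
  have h5 : (2 : ℂ) * T.dir j' = 0 := by linear_combination h
  simp [T.dir_ne_zero] at h5

lemma exists_rotation {u u' : ℂ} (hu : ‖u‖ = 1) (hu' : ‖u'‖ = 1) (hne : u' ≠ -u) :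
    ∃ φ ∈ Ioo 0 (2 * Real.pi), u' = - u * Complex.exp (φ * Complex.I) := by
  have hu0 : u ≠ 0 := by intro h; simp [h] at hu
  set z := - u' / u with hz
  have hzn : ‖z‖ = 1 := by rw [hz]; simp [hu, hu']
  have e : z = Complex.exp (z.arg * Complex.I) := by
    have := Complex.norm_mul_exp_arg_mul_I z
    rw [hzn] at this; simpa using this.symm
  have e' : u' = - u * z := by rw [hz]; field_simp
  have hz1 : z.arg ≠ 0 := by
    intro h
    rw [h] at e
    simp at e
    rw [e, mul_one] at e'
    exact hne e'
  have hp := Real.pi_pos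
  rcases lt_or_gt_of_ne hz1 with h | h
  · refine ⟨z.arg + 2 * Real.pi, ⟨by linarith [Complex.neg_pi_lt_arg z], by linarith⟩, ?_⟩
    rw [e']
    congr 1
    push_cast
    rw [add_mul, Complex.exp_add, Complex.exp_two_pi_mul_I, mul_one, ← e]
  · exact ⟨z.arg, ⟨h, by linarith [Complex.arg_le_pi z]⟩, by rw [← e, e']⟩

lemma exp_eq_of_smul_eq {u : ℂ} (hu : u ≠ 0) {R r a b : ℝ} (hR : 0 < R) (hr : 0 ≤ r)
    (h : R • (u * Complex.exp (a * Complex.I)) = r • (u * Complex.exp (b * Complex.I)))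
    (hab : |a - b| < 2 * Real.pi) : a = b := by
  have h1 : R = r := by
    have := congrArg norm h
    have hu' : ‖u‖ ≠ 0 := by simpa using hu
    simp only [norm_smul, norm_mul, Complex.norm_exp_ofReal_mul_I, mul_one, Real.norm_eq_abs,
      abs_of_pos hR, abs_of_nonneg hr] at this
    exact mul_right_cancel₀ hu' this
  subst h1
  have h2 : Complex.exp (a * Complex.I) = Complex.exp (b * Complex.I) :=
    mul_left_cancel₀ hu (smul_right_injective _ hR.ne' h)
  obtain ⟨n, hn⟩ := Complex.exp_eq_exp_iff_exists_int.1 h2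
  have h3 : a = b + n * (2 * Real.pi) := by
    have : (a : ℂ) = b + n * (2 * Real.pi) := by
      have h4 : (a : ℂ) * Complex.I = (b + n * (2 * Real.pi)) * Complex.I := by rw [hn]; ring
      exact mul_right_cancel₀ Complex.I_ne_zero h4
    exact_mod_cast this
  have hp := Real.pi_pos
  have h5 : |(n:ℝ)| < 1 := by
    have : a - b = n * (2 * Real.pi) := by linarith
    rw [this, abs_mul, abs_of_pos (by positivity : (0:ℝ) < 2 * Real.pi)] at hab
    nlinarith
  have h6 : n = 0 := by
    have : |n| < 1 := by exact_mod_cast h5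
    exact Int.abs_lt_one_iff.1 this
  rw [h3, h6]; simp

/-- The domain on the right of a side is on the right of the next one. -/
lemma RightIn.next {T : PolygonalTable} {j j' : T.Side} (hj : T.hi j = T.lo j')
    (h : ∀ s ∈ Ioo (T.lo j) (T.hi j), T.RightIn j s) :
    ∀ s ∈ Ioo (T.lo j') (T.hi j'), T.RightIn j' s := by
  obtain ⟨φ, ⟨hφ0, hφ1⟩, hφ⟩ := exists_rotation (T.norm_dir j) (T.norm_dir j') (T.dir_ne_neg_dir hj)
  obtain ⟨ρ, hρ, hρ'⟩ := Metric.eventually_nhds_iff_ball.1 (T.eventually_corner hj)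
  have h1 := T.lo_lt_hi j
  have h2 := T.lo_lt_hi j'
  obtain ⟨R, hR, hR'⟩ := exists_between (lt_min hρ (lt_min (sub_pos.2 h1) (sub_pos.2 h2)))
  obtain ⟨R1, R2, R3⟩ : R < ρ ∧ R < T.hi j - T.lo j ∧ R < T.hi j' - T.lo j' := by
    simpa [lt_min_iff] using hR'
  set v := T.bdry (T.hi j) with hv
  have hm : T.hi j - R ∈ Ioo (T.lo j) (T.hi j) := ⟨by linarith, by linarith⟩
  have hm' : T.lo j' + R ∈ Ioo (T.lo j') (T.hi j') := ⟨by linarith, by linarith⟩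
  have e1 : T.lineP j (T.hi j - R) = v - R • T.dir j := by
    have := T.lineP_sub j (T.hi j - R) (T.hi j)
    rw [sub_eq_iff_eq_add] at this
    rw [this, T.lineP_hi]; simp; ring
  have e2 : T.lineP j' (T.lo j' + R) = v + R • T.dir j' := by
    have := T.lineP_sub j' (T.lo j' + R) (T.lo j')
    rw [sub_eq_iff_eq_add] at this
    rw [this, T.lineP_lo, ← hj]; simp; ring
  set γ : ℝ → ℂ := fun ψ => v - R • (T.dir j * Complex.exp (ψ * Complex.I)) with hγ
  have hγc : Continuous γ := by rw [hγ]; fun_prop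
  have hu0 := T.dir_ne_zero j
  have hpre : IsPreconnected (γ '' Ioo 0 φ) := isPreconnected_Ioo.image _ hγc.continuousOn
  have havoid : ∀ p ∈ γ '' Ioo 0 φ, p ∉ range T.bdry := by
    rintro p ⟨ψ, hψ, rfl⟩ hp
    have hb : γ ψ ∈ Metric.ball v ρ := by
      rw [hγ]; simp [T.norm_dir, abs_of_pos hR, R1, Complex.norm_exp_ofReal_mul_I]
    rcases hρ' _ hb hp with ⟨r, hr, he⟩ | ⟨r, hr, he⟩
    · have := exp_eq_of_smul_eq hu0 hR hr (a := ψ) (b := 0) (by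
        simp only [hγ, sub_right_inj] at he; simpa using he)
        (by rw [sub_zero, abs_of_pos hψ.1]; linarith [hψ.2])
      exact hψ.1.ne' this
    · have := exp_eq_of_smul_eq hu0 hR hr (a := ψ) (b := φ) (by
        rw [hφ] at he; simp only [hγ] at he
        rw [neg_mul, smul_neg, ← sub_eq_add_neg, sub_right_inj] at he; exact he)
        (by rw [abs_lt]; constructor <;> linarith [hψ.1, hψ.2])
      exact hψ.2.ne this
  have hcr : ∀ (w : ℂ), ‖w‖ = 1 → ∀ ψ : ℝ, cr w (w * Complex.exp (ψ * Complex.I)) = Real.sin ψ := by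
    intro w hw ψ
    have h1 : w.re ^ 2 + w.im ^ 2 = 1 := by
      have := Complex.sq_norm w
      rw [hw, Complex.normSq_apply] at this; linarith
    simp only [cr, Complex.mul_re, Complex.mul_im, Complex.exp_ofReal_mul_I_re,
      Complex.exp_ofReal_mul_I_im]
    linear_combination Real.sin ψ * h1
  obtain ⟨ρ1, hρ1, hr1⟩ := h _ hm
  have hsub : γ '' Ioo 0 φ ⊆ T.P := by
    have c1 : ∀ᶠ ψ in 𝓝[>] (0:ℝ), γ ψ ∈ Metric.ball (T.lineP j (T.hi j - R)) ρ1 := by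
      apply eventually_nhdsWithin_of_eventually_nhds
      apply hγc.continuousAt.eventually_mem
      apply Metric.isOpen_ball.mem_nhds
      rw [e1, hγ]; simpa using hρ1
    have hmin : (0:ℝ) < min φ Real.pi := lt_min hφ0 Real.pi_pos
    obtain ⟨ψ, hψ1, hψ2⟩ := (c1.and (Ioo_mem_nhdsGT hmin)).exists
    refine T.subset_P_of_isPreconnected hpre havoid
      ⟨ψ, ⟨hψ2.1, hψ2.2.trans_le (min_le_left _ _)⟩, rfl⟩ (hr1 _ hψ1 ?_)
    have : γ ψ - T.lineP j (T.hi j - R) =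
        (-R) • (T.dir j * Complex.exp (ψ * Complex.I)) + R • T.dir j := by
      rw [e1, hγ]; simp only [neg_smul]; ring
    rw [this, cr_add_right, cr_smul_right, cr_smul_right, cr_self, hcr _ (T.norm_dir j)]
    have := Real.sin_pos_of_pos_of_lt_pi hψ2.1 (hψ2.2.trans_le (min_le_right _ _))
    nlinarith
  obtain ⟨ρ2, hρ2, -, hr2⟩ := T.half_disc_aux hm'
  rw [T.bdry_eq (Ioo_subset_Icc_self hm')] at hr2
  intro s hs
  refine RightIn.all hm' ⟨ρ2, hρ2, hr2.resolve_right ?_⟩ hs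
  intro hcon
  have c1 : ∀ᶠ ψ in 𝓝[<] φ, γ ψ ∈ Metric.ball (T.lineP j' (T.lo j' + R)) ρ2 := by
    apply eventually_nhdsWithin_of_eventually_nhds
    apply hγc.continuousAt.eventually_mem
    apply Metric.isOpen_ball.mem_nhds
    have : γ φ = T.lineP j' (T.lo j' + R) := by
      rw [e2, hφ]; simp only [hγ, neg_mul, smul_neg]; ring
    rw [this]; exact Metric.mem_ball_self hρ2
  have hmax : max 0 (φ - Real.pi) < φ := max_lt hφ0 (by linarith [Real.pi_pos])
  obtain ⟨ψ, hψ1, hψ2⟩ := (c1.and (Ioo_mem_nhdsLT hmax)).exists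
  have hψ3 : 0 < ψ := (le_max_left _ _).trans_lt hψ2.1
  have hψ4 : φ - Real.pi < ψ := (le_max_right _ _).trans_lt hψ2.1
  refine hcon _ hψ1 ?_ (hsub ⟨ψ, ⟨hψ3, hψ2.2⟩, rfl⟩)
  have : γ ψ - T.lineP j' (T.lo j' + R) =
      R • (T.dir j' * Complex.exp ((ψ - φ : ℝ) * Complex.I)) - R • T.dir j' := by
    rw [e2]
    have e3 : T.dir j' * Complex.exp ((ψ - φ : ℝ) * Complex.I) =
        - T.dir j * Complex.exp (ψ * Complex.I) := by
      rw [hφ, mul_assoc, ← Complex.exp_add]; congr 2; push_cast; ring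
    rw [e3]; simp only [hγ, neg_mul, smul_neg]; ring
  rw [this, cr_sub_right, cr_smul_right, cr_smul_right, cr_self, hcr _ (T.norm_dir j')]
  have := Real.sin_neg_of_neg_of_neg_pi_lt (x := ψ - φ) (by linarith [hψ2.2]) (by linarith)
  nlinarith

lemma not_rightIn {j : T.Side} {s : ℝ} (hs : s ∈ Ioo (T.lo j) (T.hi j)) : ¬ T.RightIn j s := by
  intro h
  have hall : ∀ k : ℕ, ∃ n : ℤ, ∀ s ∈ Ioo (T.lo (⟨(j.1 + k) % T.d, Nat.mod_lt _ (by
      have := T.three_le; omega)⟩, n)) (T.hi (⟨(j.1 + k) % T.d, Nat.mod_lt _ (by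
      have := T.three_le; omega)⟩, n)), T.RightIn (⟨(j.1 + k) % T.d, Nat.mod_lt _ (by
      have := T.three_le; omega)⟩, n) s := by
    intro k
    have hd := T.three_le
    induction k with
    | zero =>
      have : (⟨((j.1 : ℕ) + 0) % T.d, Nat.mod_lt _ (by omega)⟩ : Fin T.d) = j.1 := by
        ext; simp [Nat.mod_eq_of_lt j.1.2]
      exact ⟨j.2, by rw [this]; exact fun s' hs' => h.all hs hs'⟩
    | succ k ih =>
      obtain ⟨n, hn⟩ := ih
      set i := ((j.1 : ℕ) + k) % T.d with hi
      have hilt : i < T.d := Nat.mod_lt _ (by omega)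
      by_cases hl : i + 1 = T.d
      · have e0 : ((j.1 : ℕ) + (k + 1)) % T.d = 0 := by
          rw [← add_assoc, Nat.add_mod, ← hi, Nat.mod_eq_of_lt (show 1 < T.d by omega), hl,
            Nat.mod_self]
        refine ⟨n + 1, RightIn.next ?_ hn⟩
        have e1 : (⟨((j.1 : ℕ) + k) % T.d, hilt⟩ : Fin T.d).succ = Fin.last T.d := by
          ext; simpa using hl
        have e2 : (⟨((j.1 : ℕ) + (k + 1)) % T.d, Nat.mod_lt _ (by omega)⟩ : Fin T.d).castSucc = 0 := by
          ext; simpa using e0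
        simp only [lo, PolygonalTable.hi, e1, e2, T.corner_zero, T.corner_last]; push_cast; ring
      · have e0 : ((j.1 : ℕ) + (k + 1)) % T.d = i + 1 := by
          rw [← add_assoc, Nat.add_mod, ← hi, Nat.mod_eq_of_lt (show 1 < T.d by omega),
            Nat.mod_eq_of_lt (by omega)]
        refine ⟨n, RightIn.next ?_ hn⟩
        have e1 : (⟨((j.1 : ℕ) + (k + 1)) % T.d, Nat.mod_lt _ (by omega)⟩ : Fin T.d).castSucc =
            (⟨((j.1 : ℕ) + k) % T.d, hilt⟩ : Fin T.d).succ := by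
          ext; simpa using e0
        simp only [lo, PolygonalTable.hi, e1]
  have hall' : ∀ (j' : T.Side) (s' : ℝ), s' ∈ Ioo (T.lo j') (T.hi j') → T.RightIn j' s' := by
    intro j' s' hs'
    obtain ⟨n, hn⟩ := hall (j'.1 + T.d - j.1)
    have e : (⟨((j.1 : ℕ) + (j'.1 + T.d - j.1)) % T.d, Nat.mod_lt _ (by
        have := T.three_le; omega)⟩ : Fin T.d) = j'.1 := by
      ext
      have := j.1.2
      simp only
      rw [show (j.1 : ℕ) + (j'.1 + T.d - j.1) = j'.1 + T.d by omega, Nat.add_mod_right,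
        Nat.mod_eq_of_lt j'.1.2]
    rw [e] at hn
    have hm : s' - j'.2 + n ∈ Ioo (T.lo (j'.1, n)) (T.hi (j'.1, n)) := by
      unfold lo hi at *; simp only; constructor <;> linarith [hs'.1, hs'.2]
    have e2 : T.lineP j' s' = T.lineP (j'.1, n) (s' - j'.2 + n) := by
      rw [← T.bdry_eq (Ioo_subset_Icc_self hs'), ← T.bdry_eq (Ioo_subset_Icc_self hm),
        T.bdry_add_int, ← T.bdry_add_int (s' - j'.2) j'.2, sub_add_cancel]
    unfold RightIn
    rw [e2]
    exact hn _ hm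
  set V : Set ℂ := range fun i => T.bdry (T.corner i) with hV
  have hVf : V.Finite := finite_range _
  have hconn : IsPreconnected Vᶜ :=
    (hVf.countable.isConnected_compl_of_one_lt_rank (by simp)).isPreconnected
  have hcl : closure T.P = T.P ∪ range T.bdry := by
    rw [closure_eq_self_union_frontier, T.frontier_eq]
  have hPV : T.P ⊆ Vᶜ := by
    rintro p hp ⟨i, rfl⟩
    exact T.bdry_notMem _ hp
  have hPi : T.P ⊆ interior (closure T.P) := interior_maximal subset_closure T.isOpen
  obtain ⟨p0, hp0⟩ := T.isConnected.nonempty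
  have hsub : Vᶜ ⊆ interior (closure T.P) := by
    refine hconn.subset_left_of_subset_union isOpen_interior isClosed_closure.isOpen_compl
      (disjoint_compl_right.mono_left interior_subset) ?_ ⟨p0, hPV hp0, hPi hp0⟩
    intro p hp
    by_cases hpc : p ∈ closure T.P
    · left
      rw [hcl] at hpc
      rcases hpc with h | ⟨s', rfl⟩
      · exact hPi h
      · have hnc : ¬ T.IsCorner s' := by
          rintro ⟨i, hi⟩; exact hp ⟨i, hi.symm⟩
        obtain ⟨j', hj'⟩ := T.exists_side_of_not_isCorner hnc
        obtain ⟨ρ, hρ, h1, -⟩ := T.half_disc_aux hj'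
        obtain ⟨ρ', hρ', h2⟩ := hall' j' s' hj'
        obtain ⟨ρ'', hρ'', h3⟩ := Metric.eventually_nhds_iff_ball.1 (T.eventually_mem_range_iff hj')
        rw [← T.bdry_eq (Ioo_subset_Icc_self hj')] at h2
        rw [mem_interior_iff_mem_nhds]
        filter_upwards [Metric.ball_mem_nhds _ hρ, Metric.ball_mem_nhds _ hρ',
          Metric.ball_mem_nhds _ hρ''] with p hp1 hp2 hp3
        rw [hcl]
        rcases lt_trichotomy (cr (T.dir j') (p - T.bdry s')) 0 with h | h | h
        · exact Or.inl (h2 p hp2 h)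
        · exact Or.inr ((h3 p hp3).2 h)
        · exact Or.inl (h1 p hp1 h)
    · exact Or.inr hpc
  have hb : Bornology.IsBounded (univ : Set ℂ) := by
    rw [← compl_union_self V]
    exact (T.isBounded.closure.subset (hsub.trans interior_subset)).union hVf.isBounded
  exact NormedSpace.unbounded_univ ℝ ℂ hb

/-- The domain is on the left of its boundary, and only there. -/
lemma half_disc {j : T.Side} {s : ℝ} (hs : s ∈ Ioo (T.lo j) (T.hi j)) :
    ∃ ρ > 0, ∀ p ∈ Metric.ball (T.lineP j s) ρ,
        p ∈ T.P ↔ 0 < cr (T.dir j) (p - T.lineP j s) := by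
  obtain ⟨ρ, hρ, h1, h2⟩ := T.half_disc_aux hs
  obtain ⟨ρ', hρ', h3⟩ := Metric.eventually_nhds_iff_ball.1 (T.eventually_mem_range_iff hs)
  have hb := T.bdry_eq (Ioo_subset_Icc_self hs)
  rw [hb] at h1 h2 h3
  have h2 := h2.resolve_left fun h => T.not_rightIn hs ⟨ρ, hρ, h⟩
  refine ⟨min ρ ρ', lt_min hρ hρ', fun p hp => ⟨fun hpP => ?_, fun hpos => ?_⟩⟩
  · by_contra! hcon
    rcases hcon.eq_or_lt with h | h
    · obtain ⟨s', rfl⟩ := (h3 p (Metric.ball_subset_ball (min_le_right _ _) hp)).2 h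
      exact T.bdry_notMem _ hpP
    · exact h2 p (Metric.ball_subset_ball (min_le_left _ _) hp) h hpP
  · exact h1 p (Metric.ball_subset_ball (min_le_left _ _) hp) hpos

end PolygonalTable

namespace PolygonalTable

variable (T : PolygonalTable)

/-- The unit vector which makes the signed angle `θ` with the inner normal of the side `i`. -/
def dirAt (i : T.Side) (θ : ℝ) : ℂ := Real.sin θ • T.dir i + Real.cos θ • (Complex.I * T.dir i)

/-- The cosine of the angle of incidence on the side `j` of a ray leaving the side `i`. -/
def inc (i j : T.Side) (θ : ℝ) : ℝ := cr (T.dirAt i θ) (T.dir j)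

/-- The specular angle of reflection on the side `j`. -/
def refl (i j : T.Side) (θ : ℝ) : ℝ :=
  Real.arcsin ((T.dirAt i θ * (starRingEnd ℂ) (T.dir j)).re)

/-- The parameter at which a ray leaving the side `i` meets the line through the side `j`. -/
def arr (i j : T.Side) (z : ℝ × ℝ) : ℝ :=
  T.lo j + cr (T.dirAt i z.2) (T.lineP i z.1 - T.lineP j (T.lo j)) / T.inc i j z.2

/-- The time at which a ray leaving the side `i` meets the line through the side `j`. -/
def tim (i j : T.Side) (z : ℝ × ℝ) : ℝ :=
  cr (T.dir j) (T.lineP i z.1 - T.lineP j (T.lo j)) / T.inc i j z.2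

/-- The formula for the billiard map, for a ray from the side `i` to the side `j`. -/
def step (f : ℝ → ℝ) (i j : T.Side) (z : ℝ × ℝ) : ℝ × ℝ := (T.arr i j z, f (T.refl i j z.2))

/-- The ray of `z` at time `t`. -/
def ray (i : T.Side) (z : ℝ × ℝ) (t : ℝ) : ℂ := T.lineP i z.1 + t • T.dirAt i z.2

@[fun_prop]
lemma continuous_dirAt (i : T.Side) : Continuous (T.dirAt i) := by unfold dirAt; fun_prop

@[fun_prop]
lemma continuous_inc (i j : T.Side) : Continuous (T.inc i j) := by unfold inc; fun_prop

@[fun_prop]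
lemma continuous_refl (i j : T.Side) : Continuous (T.refl i j) := by unfold refl; fun_prop

lemma continuous_ray (i : T.Side) : Continuous fun p : (ℝ × ℝ) × ℝ => T.ray i p.1 p.2 := by
  unfold ray; fun_prop

lemma continuousAt_arr {i j : T.Side} {z : ℝ × ℝ} (h : T.inc i j z.2 ≠ 0) :
    ContinuousAt (T.arr i j) z := by
  unfold arr
  refine continuousAt_const.add (ContinuousAt.div ?_ ?_ h)
  · exact Continuous.continuousAt (by fun_prop)
  · exact Continuous.continuousAt (by fun_prop)

lemma continuousAt_tim {i j : T.Side} {z : ℝ × ℝ} (h : T.inc i j z.2 ≠ 0) :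
    ContinuousAt (T.tim i j) z := by
  unfold tim
  refine ContinuousAt.div ?_ ?_ h
  · exact Continuous.continuousAt (by fun_prop)
  · exact Continuous.continuousAt (by fun_prop)

lemma dirAt_re (i : T.Side) (θ : ℝ) :
    (T.dirAt i θ).re = Real.sin θ * (T.dir i).re - Real.cos θ * (T.dir i).im := by
  simp only [dirAt, Complex.add_re, Complex.real_smul, Complex.mul_re, Complex.ofReal_re,
    Complex.ofReal_im, Complex.I_re, Complex.I_im, Complex.mul_im]
  ring
lemma dirAt_im (i : T.Side) (θ : ℝ) :
    (T.dirAt i θ).im = Real.sin θ * (T.dir i).im + Real.cos θ * (T.dir i).re := by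
  simp only [dirAt, Complex.add_im, Complex.real_smul, Complex.mul_re, Complex.ofReal_re,
    Complex.ofReal_im, Complex.I_re, Complex.I_im, Complex.mul_im]
  ring

lemma cr_dirAt_dir (i : T.Side) (θ : ℝ) : cr (T.dirAt i θ) (T.dir i) = - Real.cos θ := by
  simp only [cr, dirAt_re, dirAt_im]
  linear_combination (-Real.cos θ) * T.dir_sq i

lemma cr_dir_dirAt (i : T.Side) (θ : ℝ) : cr (T.dir i) (T.dirAt i θ) = Real.cos θ := by
  rw [cr_swap, cr_dirAt_dir, neg_neg]

lemma cr_dirAt_dirAt (i : T.Side) (θ θ' : ℝ) :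
    cr (T.dirAt i θ) (T.dirAt i θ') = Real.sin (θ - θ') := by
  simp only [cr, dirAt_re, dirAt_im, Real.sin_sub]
  linear_combination (Real.sin θ * Real.cos θ' - Real.cos θ * Real.sin θ') * T.dir_sq i

lemma dirAt_sq (i : T.Side) (θ : ℝ) : (T.dirAt i θ).re ^ 2 + (T.dirAt i θ).im ^ 2 = 1 := by
  simp only [dirAt_re, dirAt_im]
  linear_combination T.dir_sq i * (Real.sin θ ^ 2 + Real.cos θ ^ 2) + Real.sin_sq_add_cos_sq θ

lemma norm_dirAt (i : T.Side) (θ : ℝ) : ‖T.dirAt i θ‖ = 1 := by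
  have h := Complex.sq_norm (T.dirAt i θ)
  rw [Complex.normSq_apply] at h
  have := T.dirAt_sq i θ
  nlinarith [norm_nonneg (T.dirAt i θ)]

/-- The deviation, at distance `h`, of the ray of `z` from the ray of `y`. -/
def dev (y z : ℝ × ℝ) (h : ℝ) : ℝ := (z.1 - y.1) * Real.cos z.2 + h * Real.sin (z.2 - y.2)

lemma cr_ray_sub (i : T.Side) (y z : ℝ × ℝ) (h : ℝ) :
    cr (T.dirAt i z.2) (T.ray i y h - T.lineP i z.1) = dev y z h := by
  have e : T.ray i y h - T.lineP i z.1 = (y.1 - z.1) • T.dir i + h • T.dirAt i y.2 := by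
    rw [ray, ← T.lineP_sub]; ring
  rw [e, cr_add_right, cr_smul_right, cr_smul_right, cr_dirAt_dir, cr_dirAt_dirAt, dev]; ring

lemma inc_sq (i j : T.Side) (θ : ℝ) :
    (T.dirAt i θ * (starRingEnd ℂ) (T.dir j)).re ^ 2 + T.inc i j θ ^ 2 = 1 := by
  simp only [inc, cr, Complex.mul_re, Complex.conj_re, Complex.conj_im]
  have h1 := T.dirAt_sq i θ
  have h2 := T.dir_sq j
  linear_combination ((T.dir j).re ^ 2 + (T.dir j).im ^ 2) * h1 + h2

lemma smul_cr_identity (p D u : ℂ) : cr D u • p = cr D p • u - cr u p • D := by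
  apply Complex.ext
  · simp only [cr, Complex.real_smul, Complex.mul_re, Complex.sub_re, Complex.ofReal_re,
      Complex.ofReal_im]
    ring
  · simp only [cr, Complex.real_smul, Complex.mul_im, Complex.sub_im, Complex.ofReal_re,
      Complex.ofReal_im]
    ring

lemma ray_tim {i j : T.Side} {z : ℝ × ℝ} (h : T.inc i j z.2 ≠ 0) :
    T.ray i z (T.tim i j z) = T.lineP j (T.arr i j z) := by
  have h1 := smul_cr_identity (T.lineP i z.1 - T.lineP j (T.lo j)) (T.dirAt i z.2) (T.dir j)
  have e : T.lineP j (T.arr i j z) = T.lineP j (T.lo j) + (T.arr i j z - T.lo j) • T.dir j := by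
    rw [← T.lineP_sub]; ring
  rw [e, ray, tim, arr, add_sub_cancel_left]
  obtain ⟨p, hp⟩ : ∃ p, p = T.lineP i z.1 - T.lineP j (T.lo j) := ⟨_, rfl⟩
  rw [← hp] at h1 ⊢
  rw [show T.lineP i z.1 = T.lineP j (T.lo j) + p by rw [hp]; ring, add_assoc]
  congr 1
  have h3 : p = (T.inc i j z.2)⁻¹ • (T.inc i j z.2 • p) := by rw [inv_smul_smul₀ h]
  have h4 : T.inc i j z.2 • p = _ := h1
  rw [h4] at h3
  rw [div_eq_inv_mul, div_eq_inv_mul, mul_smul, mul_smul, ← eq_sub_iff_add_eq, ← smul_sub]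
  exact h3

lemma eq_tim_arr {i j : T.Side} {z : ℝ × ℝ} (h : T.inc i j z.2 ≠ 0) {t s : ℝ}
    (he : T.ray i z t = T.lineP j s) : t = T.tim i j z ∧ s = T.arr i j z := by
  have e : T.lineP i z.1 - T.lineP j (T.lo j) = (s - T.lo j) • T.dir j - t • T.dirAt i z.2 := by
    rw [← T.lineP_sub, ← he, ray]; ring
  have h' : T.inc i j z.2 = cr (T.dirAt i z.2) (T.dir j) := rfl
  constructor
  · rw [tim, e, cr_sub_right, cr_smul_right, cr_self, cr_smul_right, cr_swap, ← h']
    field_simp; ring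
  · rw [arr, e, cr_sub_right, cr_smul_right, cr_smul_right, cr_self, ← h']
    field_simp; ring

/-- The deviation is carried over to the next side. -/
lemma dev_tim {i j : T.Side} {y z : ℝ × ℝ} (hy : T.inc i j y.2 ≠ 0) (hz : T.inc i j z.2 ≠ 0) :
    dev y z (T.tim i j y) = (T.arr i j y - T.arr i j z) * T.inc i j z.2 := by
  rw [← T.cr_ray_sub i, T.ray_tim hy]
  have e : T.lineP j (T.arr i j y) - T.lineP i z.1 =
      (T.arr i j y - T.arr i j z) • T.dir j + T.tim i j z • T.dirAt i z.2 := by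
    rw [← T.lineP_sub, ← T.ray_tim hz, ray]; ring
  rw [e, cr_add_right, cr_smul_right, cr_smul_right, cr_self, inc]; ring

lemma sin_refl (i j : T.Side) (θ : ℝ) :
    Real.sin (T.refl i j θ) = (T.dirAt i θ * (starRingEnd ℂ) (T.dir j)).re := by
  have h := T.inc_sq i j θ
  exact Real.sin_arcsin (by nlinarith [sq_nonneg (T.inc i j θ)])
    (by nlinarith [sq_nonneg (T.inc i j θ)])

lemma cos_refl {i j : T.Side} {θ : ℝ} (h0 : 0 ≤ T.inc i j θ) :
    Real.cos (T.refl i j θ) = T.inc i j θ := by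
  have h := T.inc_sq i j θ
  rw [refl, Real.cos_arcsin, ← Real.sqrt_sq h0]
  congr 1; linarith

lemma refl_mem_Icc (i j : T.Side) (θ : ℝ) :
    T.refl i j θ ∈ Icc (-(Real.pi / 2)) (Real.pi / 2) := Real.arcsin_mem_Icc _

lemma refl_mem_Ioo {i j : T.Side} {θ : ℝ} (h0 : 0 < T.inc i j θ) :
    T.refl i j θ ∈ Ioo (-(Real.pi / 2)) (Real.pi / 2) := by
  have h := T.refl_mem_Icc i j θ
  have hc := T.cos_refl h0.le
  constructor
  · refine lt_of_le_of_ne h.1 fun he => ?_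
    rw [← he] at hc; simp at hc; linarith
  · refine lt_of_le_of_ne h.2 fun he => ?_
    rw [he] at hc; simp at hc; linarith

/-- The reflected angle is a translate of minus the angle. -/
lemma refl_sub {i j : T.Side} {θ θ' : ℝ} (h : 0 < T.inc i j θ) (h' : 0 < T.inc i j θ')
    (hθ : θ ∈ Icc (-(Real.pi / 2)) (Real.pi / 2)) (hθ' : θ' ∈ Icc (-(Real.pi / 2)) (Real.pi / 2)) :
    T.refl i j θ' - T.refl i j θ = θ - θ' := by
  have a := T.refl_mem_Ioo h
  have a' := T.refl_mem_Ioo h'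
  suffices (T.refl i j θ' - T.refl i j θ) - (θ - θ') = 0 by linarith
  rw [← Real.cos_eq_one_iff_of_lt_of_lt (by linarith [a.2, a'.1, hθ.2, hθ'.1])
    (by linarith [a.1, a'.2, hθ.1, hθ'.2])]
  have h1 := T.dir_sq i
  have h2 := T.dir_sq j
  rw [Real.cos_sub, Real.cos_sub (T.refl i j θ'), Real.sin_sub (T.refl i j θ'),
    T.cos_refl h.le, T.cos_refl h'.le, T.sin_refl, T.sin_refl]
  have e1 : T.inc i j θ' * T.inc i j θ + (T.dirAt i θ' * (starRingEnd ℂ) (T.dir j)).re *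
      (T.dirAt i θ * (starRingEnd ℂ) (T.dir j)).re = Real.cos (θ - θ') := by
    simp only [inc, cr, Complex.mul_re, Complex.conj_re, Complex.conj_im, dirAt_re, dirAt_im,
      Real.cos_sub]
    linear_combination (Real.cos θ * Real.cos θ' + Real.sin θ * Real.sin θ') *
      (((T.dir j).re ^ 2 + (T.dir j).im ^ 2) * h1 + h2)
  have e2 : (T.dirAt i θ' * (starRingEnd ℂ) (T.dir j)).re * T.inc i j θ - T.inc i j θ' *
      (T.dirAt i θ * (starRingEnd ℂ) (T.dir j)).re = Real.sin (θ - θ') := by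
    simp only [inc, cr, Complex.mul_re, Complex.conj_re, Complex.conj_im, dirAt_re, dirAt_im,
      Real.sin_sub]
    linear_combination (Real.sin θ * Real.cos θ' - Real.cos θ * Real.sin θ') *
      (((T.dir j).re ^ 2 + (T.dir j).im ^ 2) * h1 + h2)
  rw [e1, e2]
  linarith [Real.sin_sq_add_cos_sq (θ - θ')]

/-- The vectors based in the interior of a side, and not tangent to it. -/
def Base (i : T.Side) (z : ℝ × ℝ) : Prop :=
  z.1 ∈ Ioo (T.lo i) (T.hi i) ∧ z.2 ∈ Ioo (-(Real.pi / 2)) (Real.pi / 2)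

/-- The first collision of `z`, based in the interior of the side `i`, is in the interior of the
side `j`. -/
def Fly (i j : T.Side) (z : ℝ × ℝ) : Prop :=
  T.Base i z ∧ T.hitParam z ∈ Ioo (T.lo j) (T.hi j)

lemma isOpen_base (i : T.Side) : IsOpen {z | T.Base i z} :=
  (isOpen_Ioo.preimage continuous_fst).inter (isOpen_Ioo.preimage continuous_snd)

variable {T}

lemma Base.direction {i : T.Side} {z : ℝ × ℝ} (h : T.Base i z) :
    T.direction z = T.dirAt i z.2 := by
  rw [PolygonalTable.direction, dirAt, T.deriv_bdry h.1]

lemma Base.bdry {i : T.Side} {z : ℝ × ℝ} (h : T.Base i z) : T.bdry z.1 = T.lineP i z.1 :=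
  T.bdry_eq (Ioo_subset_Icc_self h.1)

lemma Base.cos_pos {i : T.Side} {z : ℝ × ℝ} (h : T.Base i z) : 0 < Real.cos z.2 :=
  Real.cos_pos_of_mem_Ioo h.2

lemma Base.hitTime {i : T.Side} {z : ℝ × ℝ} (h : T.Base i z) :
    T.hitTime z = sInf {t : ℝ | 0 < t ∧ T.ray i z t ∉ T.P} := by
  simp only [PolygonalTable.hitTime, ray, h.direction, h.bdry]

lemma Base.hitPoint {i : T.Side} {z : ℝ × ℝ} (h : T.Base i z) :
    T.hitPoint z = T.ray i z (T.hitTime z) := by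
  simp only [PolygonalTable.hitPoint, ray, h.direction, h.bdry]

/-- Near the initial point, the rays are in the domain. -/
lemma Base.ray_near {i : T.Side} {z : ℝ × ℝ} (h : T.Base i z) :
    ∃ ρ > 0, ∀ᶠ z' in 𝓝 z, ∀ t ∈ Ioo 0 ρ, T.ray i z' t ∈ T.P := by
  obtain ⟨ρ, hρ, hP⟩ := T.half_disc h.1
  refine ⟨ρ / 2, by positivity, ?_⟩
  have h1 : ∀ᶠ z' : ℝ × ℝ in 𝓝 z, T.lineP i z'.1 ∈ Metric.ball (T.lineP i z.1) (ρ / 2) := by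
    have : Continuous fun z' : ℝ × ℝ => T.lineP i z'.1 := by fun_prop
    exact this.continuousAt.eventually_mem (Metric.ball_mem_nhds _ (by positivity))
  filter_upwards [h1, (T.isOpen_base i).mem_nhds h] with z' h1 h2 t ht
  rw [hP]
  · have e : T.ray i z' t - T.lineP i z.1 = (z'.1 - z.1) • T.dir i + t • T.dirAt i z'.2 := by
      rw [ray, ← T.lineP_sub]; ring
    rw [e, cr_add_right, cr_smul_right, cr_smul_right, cr_self, cr_dir_dirAt, mul_zero, zero_add]
    exact mul_pos ht.1 h2.cos_pos
  · rw [Metric.mem_ball, ray]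
    refine lt_of_le_of_lt (dist_triangle _ (T.lineP i z'.1) _) ?_
    rw [Metric.mem_ball] at h1
    have : dist (T.lineP i z'.1 + t • T.dirAt i z'.2) (T.lineP i z'.1) = t := by
      simp [T.norm_dirAt, abs_of_pos ht.1]
    rw [this]; linarith [ht.2]

/-- A uniform bound on the collision times. -/
lemma exists_time_bound (T : PolygonalTable) : ∃ R > 0, ∀ (i : T.Side) (z : ℝ × ℝ), T.Base i z →
    T.ray i z R ∉ T.P := by
  obtain ⟨R0, hR0⟩ := T.isBounded.closure.subset_closedBall (0:ℂ)
  have hR0' : 0 ≤ R0 := by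
    obtain ⟨p, hp⟩ := T.isConnected.nonempty
    have := hR0 (subset_closure hp)
    rw [mem_closedBall_zero_iff] at this
    exact (norm_nonneg _).trans this
  refine ⟨2 * R0 + 1, by linarith, fun i z hz hP => ?_⟩
  have h1 : ‖T.lineP i z.1‖ ≤ R0 := by
    rw [← hz.bdry]
    have : T.bdry z.1 ∈ closure T.P := by
      apply frontier_subset_closure
      rw [T.frontier_eq]; exact ⟨_, rfl⟩
    simpa using hR0 this
  have h2 : ‖T.ray i z (2 * R0 + 1)‖ ≤ R0 := by simpa using hR0 (subset_closure hP)
  have h3 : (2 * R0 + 1) • T.dirAt i z.2 = T.ray i z (2 * R0 + 1) - T.lineP i z.1 := by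
    rw [ray]; ring
  have h4 : ‖(2 * R0 + 1) • T.dirAt i z.2‖ = 2 * R0 + 1 := by
    rw [norm_smul, T.norm_dirAt, mul_one, Real.norm_eq_abs, abs_of_pos (by linarith)]
  rw [h3] at h4
  have := norm_sub_le (T.ray i z (2 * R0 + 1)) (T.lineP i z.1)
  linarith

lemma Base.hitTime_le {i : T.Side} {z : ℝ × ℝ} (h : T.Base i z) {t : ℝ} (ht : 0 < t)
    (hP : T.ray i z t ∉ T.P) : T.hitTime z ≤ t := by
  rw [h.hitTime]
  exact csInf_le ⟨0, fun t (ht : 0 < t ∧ T.ray i z t ∉ T.P) => ht.1.le⟩ ⟨ht, hP⟩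

lemma Base.ray_mem {i : T.Side} {z : ℝ × ℝ} (h : T.Base i z) {t : ℝ} (ht : 0 < t)
    (ht' : t < T.hitTime z) : T.ray i z t ∈ T.P := by
  by_contra hcon
  exact absurd (h.hitTime_le ht hcon) (not_le.2 ht')

lemma Base.hitTime_pos {i : T.Side} {z : ℝ × ℝ} (h : T.Base i z) : 0 < T.hitTime z := by
  obtain ⟨ρ, hρ, hev⟩ := h.ray_near
  obtain ⟨R, hR, hRP⟩ := T.exists_time_bound
  refine hρ.trans_le ?_
  rw [h.hitTime]
  refine le_csInf ⟨R, hR, hRP i z h⟩ fun t ht => ?_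
  by_contra! hcon
  exact ht.2 (hev.self_of_nhds t ⟨ht.1, hcon⟩)

lemma Base.hitPoint_notMem {i : T.Side} {z : ℝ × ℝ} (h : T.Base i z) :
    T.ray i z (T.hitTime z) ∉ T.P := by
  intro hP
  have hc : Continuous fun t => T.ray i z t := (T.continuous_ray i).comp (by fun_prop : Continuous fun t : ℝ => (z, t))
  have h1 : ∀ᶠ t in 𝓝 (T.hitTime z), T.ray i z t ∈ T.P :=
    hc.continuousAt.eventually_mem (T.isOpen.mem_nhds hP)
  obtain ⟨ε, hε, hb⟩ := Metric.eventually_nhds_iff_ball.1 h1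
  obtain ⟨R, hR, hRP⟩ := T.exists_time_bound
  have hlt : T.hitTime z < T.hitTime z + ε := by linarith
  conv_lhs at hlt => rw [h.hitTime]
  have hne : {t : ℝ | 0 < t ∧ T.ray i z t ∉ T.P}.Nonempty := ⟨R, hR, hRP i z h⟩
  obtain ⟨t, ht, ht'⟩ := exists_lt_of_csInf_lt hne hlt
  have h2 := h.hitTime_le ht.1 ht.2
  refine ht.2 (hb t ?_)
  rw [Metric.mem_ball, Real.dist_eq, abs_lt]
  constructor <;> linarith

lemma Base.hitPoint_mem_range {i : T.Side} {z : ℝ × ℝ} (h : T.Base i z) :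
    T.ray i z (T.hitTime z) ∈ range T.bdry := by
  rw [← T.frontier_eq, T.isOpen.frontier_eq]
  refine ⟨?_, h.hitPoint_notMem⟩
  have hc : Continuous fun t => T.ray i z t := (T.continuous_ray i).comp (by fun_prop : Continuous fun t : ℝ => (z, t))
  have : T.hitTime z ∈ closure (Ioo 0 (T.hitTime z)) := by
    rw [closure_Ioo h.hitTime_pos.ne]; exact ⟨h.hitTime_pos.le, le_rfl⟩
  exact map_mem_closure hc this fun t ht => h.ray_mem ht.1 ht.2

lemma Base.bdry_hitParam {i : T.Side} {z : ℝ × ℝ} (h : T.Base i z) :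
    T.bdry (T.hitParam z) = T.ray i z (T.hitTime z) ∧ T.hitParam z ∈ Ico (0:ℝ) 1 := by
  have hex : ∃ s ∈ Ico (0:ℝ) 1, T.bdry s = T.hitPoint z := by
    rw [h.hitPoint]
    obtain ⟨s, hs⟩ := h.hitPoint_mem_range
    refine ⟨Int.fract s, ⟨Int.fract_nonneg _, Int.fract_lt_one _⟩, ?_⟩
    rw [← hs, ← T.bdry_add_int (Int.fract s) ⌊s⌋]; simp
  rw [← h.hitPoint]
  exact ⟨Function.invFunOn_eq hex, Function.invFunOn_mem hex⟩

lemma Fly.ray_hitTime {i j : T.Side} {z : ℝ × ℝ} (h : T.Fly i j z) :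
    T.ray i z (T.hitTime z) = T.lineP j (T.hitParam z) := by
  rw [← h.1.bdry_hitParam.1, T.bdry_eq (Ioo_subset_Icc_self h.2)]

/-- Collisions are transversal, and come from the left. -/
lemma Fly.inc_pos {i j : T.Side} {z : ℝ × ℝ} (h : T.Fly i j z) : 0 < T.inc i j z.2 := by
  obtain ⟨ρ, hρ, hP⟩ := T.half_disc h.2
  have hb := h.1
  have h0 := hb.hitTime_pos
  obtain ⟨ε, hε, hε'⟩ := exists_between (lt_min hρ h0)
  have e : T.ray i z (T.hitTime z - ε) - T.lineP j (T.hitParam z) = (-ε) • T.dirAt i z.2 := by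
    rw [← h.ray_hitTime]; simp only [ray]; rw [add_sub_add_left_eq_sub, ← sub_smul]; congr 1; ring
  have h1 := hb.ray_mem (t := T.hitTime z - ε) (by linarith [min_le_right ρ (T.hitTime z)])
    (by linarith)
  rw [hP] at h1
  · rw [e, cr_smul_right, cr_swap] at h1
    unfold inc
    nlinarith
  · rw [Metric.mem_ball, dist_eq_norm, e, norm_smul, T.norm_dirAt]
    simp [abs_of_pos hε]; linarith [min_le_left ρ (T.hitTime z)]

lemma Fly.hitTime_eq {i j : T.Side} {z : ℝ × ℝ} (h : T.Fly i j z) :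
    T.hitTime z = T.tim i j z := (T.eq_tim_arr h.inc_pos.ne' h.ray_hitTime).1

lemma Fly.hitParam_eq {i j : T.Side} {z : ℝ × ℝ} (h : T.Fly i j z) :
    T.hitParam z = T.arr i j z := (T.eq_tim_arr h.inc_pos.ne' h.ray_hitTime).2

lemma Fly.tim_pos {i j : T.Side} {z : ℝ × ℝ} (h : T.Fly i j z) : 0 < T.tim i j z := by
  rw [← h.hitTime_eq]; exact h.1.hitTime_pos

lemma Fly.arr_mem {i j : T.Side} {z : ℝ × ℝ} (h : T.Fly i j z) :
    T.arr i j z ∈ Ioo (T.lo j) (T.hi j) := by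
  rw [← h.hitParam_eq]; exact h.2

lemma Fly.billiardMap_eq {i j : T.Side} {z : ℝ × ℝ} (h : T.Fly i j z) (f : ℝ → ℝ) :
    T.billiardMap f z = T.step f i j z := by
  unfold billiardMap specularMap step refl
  rw [h.1.direction, T.deriv_bdry h.2, h.hitParam_eq]

/-- A criterion for the first collision. -/
lemma Base.fly_of_ray {i j : T.Side} {z : ℝ × ℝ} (h : T.Base i z) {t s : ℝ} (ht : 0 < t)
    (hs : s ∈ Ioo (T.lo j) (T.hi j)) (hj : j.2 = 0) (he : T.ray i z t = T.lineP j s)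
    (hP : ∀ t' ∈ Ioo 0 t, T.ray i z t' ∈ T.P) : T.Fly i j z := by
  have h1 : T.hitTime z ≤ t := h.hitTime_le ht (by
    rw [he]; exact T.lineP_notMem (Ioo_subset_Icc_self hs))
  have h2 : T.hitTime z = t := by
    refine le_antisymm h1 ?_
    by_contra! hcon
    exact h.hitPoint_notMem (hP _ ⟨h.hitTime_pos, hcon⟩)
  refine ⟨h, ?_⟩
  obtain ⟨h3, h4⟩ := h.bdry_hitParam
  rw [h2, he, ← T.bdry_eq (Ioo_subset_Icc_self hs)] at h3
  have h5 : s ∈ Ico (0:ℝ) 1 := by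
    have a := T.corner_nonneg j.1.castSucc
    have b := T.corner_le_one j.1.succ
    unfold lo hi at hs
    rw [hj] at hs
    push_cast at hs
    exact ⟨by linarith [hs.1], by linarith [hs.2]⟩
  rw [T.injOn h4 h5 h3]; exact hs

lemma Fly.snd_eq_zero {i j : T.Side} {z : ℝ × ℝ} (h : T.Fly i j z) : j.2 = 0 := by
  have h1 := h.1.bdry_hitParam.2
  have h2 := h.2
  have a := T.corner_nonneg j.1.castSucc
  have b := T.corner_le_one j.1.succ
  unfold lo hi at h2
  have c1 : (j.2 : ℝ) < 1 := by linarith [h2.1, h1.2]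
  have c2 : (-1 : ℝ) < j.2 := by linarith [h2.2, h1.1]
  have c1' : j.2 < 1 := by exact_mod_cast c1
  have c2' : -1 < j.2 := by exact_mod_cast c2
  omega

/-- The side of the first collision is locally constant. -/
lemma Fly.eventually {i j : T.Side} {z : ℝ × ℝ} (h : T.Fly i j z) :
    ∀ᶠ z' in 𝓝 z, T.Fly i j z' := by
  obtain ⟨ρ, hρ, hnear⟩ := h.1.ray_near
  obtain ⟨ρ', hρ', hP⟩ := T.half_disc h.2
  have hinc := h.inc_pos
  have c1 : ∀ᶠ z' : ℝ × ℝ in 𝓝 z, 0 < T.inc i j z'.2 := by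
    have : Continuous fun z' : ℝ × ℝ => T.inc i j z'.2 := by fun_prop
    exact this.continuousAt.eventually_mem (isOpen_Ioi.mem_nhds hinc)
  have c2 : ∀ᶠ z' : ℝ × ℝ in 𝓝 z, T.arr i j z' ∈ Ioo (T.lo j) (T.hi j) :=
    (T.continuousAt_arr hinc.ne').eventually_mem (isOpen_Ioo.mem_nhds h.arr_mem)
  have ht := h.tim_pos
  obtain ⟨δ, hδ, hδ'⟩ := exists_between (lt_min ht (half_pos hρ'))
  have hδ1 : δ < T.tim i j z := hδ'.trans_le (min_le_left _ _)
  have hδ2 : δ < ρ' / 2 := hδ'.trans_le (min_le_right _ _)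
  have c3 : ∀ᶠ z' : ℝ × ℝ in 𝓝 z, T.tim i j z' ∈ Ioo (T.tim i j z - δ/2) (T.tim i j z + δ/2) :=
    (T.continuousAt_tim hinc.ne').eventually_mem (isOpen_Ioo.mem_nhds ⟨by linarith, by linarith⟩)
  have c4 : ∀ᶠ z' : ℝ × ℝ in 𝓝 z, ∀ t ∈ Icc (ρ/2) (T.tim i j z - δ/2), T.ray i z' t ∈ T.P := by
    refine isCompact_Icc.eventually_forall_of_forall_eventually ?_
    intro t ht
    have hc := (T.continuous_ray i).continuousAt (x := (z, t))
    refine hc.eventually_mem (T.isOpen.mem_nhds (h.1.ray_mem ?_ ?_))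
    · linarith [ht.1]
    · rw [h.hitTime_eq]; linarith [ht.2]
  have c5 : ∀ᶠ z' : ℝ × ℝ in 𝓝 z,
      T.lineP j (T.arr i j z') ∈ Metric.ball (T.lineP j (T.hitParam z)) (ρ' / 2) := by
    rw [h.hitParam_eq]
    exact ((T.continuous_lineP j).continuousAt.comp (T.continuousAt_arr hinc.ne')).eventually_mem
      (Metric.ball_mem_nhds _ (by positivity))
  filter_upwards [c1, c2, c3, c4, c5, hnear, (T.isOpen_base i).mem_nhds h.1] with
    z' c1 c2 c3 c4 c5 c6 hb
  refine hb.fly_of_ray (by linarith [c3.1]) c2 h.snd_eq_zero (T.ray_tim c1.ne') ?_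
  intro t ht'
  by_cases hA : t < ρ
  · exact c6 t ⟨ht'.1, hA⟩
  by_cases hB : t ≤ T.tim i j z - δ/2
  · exact c4 t ⟨by linarith, hB⟩
  push Not at hA hB
  have e : T.ray i z' t = T.lineP j (T.arr i j z') - (T.tim i j z' - t) • T.dirAt i z'.2 := by
    rw [← T.ray_tim c1.ne']; simp only [ray]; rw [sub_smul]; ring
  have hlt : T.tim i j z' - t < δ := by linarith [c3.2]
  rw [hP]
  · have e2 : T.ray i z' t - T.lineP j (T.hitParam z) =
        (T.arr i j z' - T.hitParam z) • T.dir j - (T.tim i j z' - t) • T.dirAt i z'.2 := by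
      rw [e, ← T.lineP_sub]; ring
    rw [e2, cr_sub_right, cr_smul_right, cr_smul_right, cr_self, cr_swap]
    change _ < _ - _ * -(T.inc i j z'.2)
    nlinarith [ht'.2]
  · rw [e, Metric.mem_ball, dist_eq_norm]
    have n1 : ‖(T.tim i j z' - t) • T.dirAt i z'.2‖ = T.tim i j z' - t := by
      rw [norm_smul, T.norm_dirAt, Real.norm_eq_abs, abs_of_pos (by linarith [ht'.2]), mul_one]
    rw [Metric.mem_ball, dist_eq_norm] at c5
    have : T.lineP j (T.arr i j z') - (T.tim i j z' - t) • T.dirAt i z'.2 -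
      T.lineP j (T.hitParam z) = (T.lineP j (T.arr i j z') - T.lineP j (T.hitParam z)) -
      (T.tim i j z' - t) • T.dirAt i z'.2 := by ring
    rw [this]
    have := norm_sub_le (T.lineP j (T.arr i j z') - T.lineP j (T.hitParam z))
      ((T.tim i j z' - t) • T.dirAt i z'.2)
    linarith

end PolygonalTable

namespace PolygonalTable

variable (T : PolygonalTable)

/-- The set of the vertices. -/
def verts : Set ℂ := range fun k => T.bdry (T.corner k)

lemma finite_verts : T.verts.Finite := finite_range _

lemma bdry_mem_verts {s : ℝ} : T.bdry s ∈ T.verts ↔ T.IsCorner s := by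
  unfold verts IsCorner
  constructor
  · rintro ⟨k, hk⟩; exact ⟨k, hk.symm⟩
  · rintro ⟨k, hk⟩; exact ⟨k, hk.symm⟩

variable {T}

lemma Base.fly_or {i : T.Side} {z : ℝ × ℝ} (h : T.Base i z) :
    (∃ j, T.Fly i j z) ∨ T.ray i z (T.hitTime z) ∈ T.verts := by
  by_cases hc : T.IsCorner (T.hitParam z)
  · right
    rw [← h.bdry_hitParam.1]
    exact T.bdry_mem_verts.2 hc
  · left
    obtain ⟨j, hj⟩ := T.exists_side_of_not_isCorner hc
    exact ⟨j, h, hj⟩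

lemma Base.mem_phaseSpace {i : T.Side} {z : ℝ × ℝ} (h : T.Base i z) : z ∈ phaseSpace :=
  Ioo_subset_Icc_self h.2

lemma Base.mem_singularSet_iff {i : T.Side} {z : ℝ × ℝ} (h : T.Base i z) :
    z ∈ T.singularSet ↔ T.ray i z (T.hitTime z) ∈ T.verts := by
  have hnc := T.not_isCorner_of_mem h.1
  constructor
  · rintro ((h1 | h1) | h1)
    · exact absurd h1.1 hnc
    · obtain ⟨-, -, k, hk⟩ := h1
      rw [← h.hitPoint]
      exact ⟨k, hk.symm⟩
    · rcases h1 with h1 | h1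
      · exact absurd h.2.1 (by rw [h1]; exact lt_irrefl _)
      · exact absurd h.2.2 (by rw [h1]; exact lt_irrefl _)
  · rintro ⟨k, hk⟩
    refine Or.inl (Or.inr ⟨hnc, h.2, k, ?_⟩)
    rw [h.hitPoint]; exact hk.symm

lemma Fly.ray_notMem_verts {i j : T.Side} {z : ℝ × ℝ} (h : T.Fly i j z) :
    T.ray i z (T.hitTime z) ∉ T.verts := by
  rw [← h.1.bdry_hitParam.1, T.bdry_mem_verts]
  exact T.not_isCorner_of_mem h.2

lemma Fly.notMem_singularSet {i j : T.Side} {z : ℝ × ℝ} (h : T.Fly i j z) :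
    z ∉ T.singularSet := by
  rw [h.1.mem_singularSet_iff]
  exact h.ray_notMem_verts

lemma exists_base {z : ℝ × ℝ} (hz : z.2 ∈ Ioo (-(Real.pi / 2)) (Real.pi / 2))
    (hc : ¬ T.IsCorner z.1) : ∃ i, T.Base i z := by
  obtain ⟨i, hi⟩ := T.exists_side_of_not_isCorner hc
  exact ⟨i, hi, hz⟩

lemma exists_fly {z : ℝ × ℝ} (hz : z ∈ phaseSpace) (hs : z ∉ T.singularSet) :
    ∃ i j, T.Fly i j z := by
  have h2 : z.2 ∈ Ioo (-(Real.pi / 2)) (Real.pi / 2) := by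
    refine ⟨lt_of_le_of_ne hz.1 fun h => hs (Or.inr (Or.inl h.symm)),
      lt_of_le_of_ne hz.2 fun h => hs (Or.inr (Or.inr h))⟩
  have hc : ¬ T.IsCorner z.1 := fun h => hs (Or.inl (Or.inl ⟨h, h2⟩))
  obtain ⟨i, hi⟩ := exists_base h2 hc
  rcases hi.fly_or with ⟨j, hj⟩ | h
  · exact ⟨i, j, hj⟩
  · exact absurd (hi.mem_singularSet_iff.2 h) hs

lemma Fly.unique {i j i' j' : T.Side} {z : ℝ × ℝ} (h : T.Fly i j z) (h' : T.Fly i' j' z) :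
    i = i' ∧ j = j' :=
  ⟨T.side_eq_of_mem h.1.1 (Ioo_subset_Icc_self h'.1.1),
    T.side_eq_of_mem h.2 (Ioo_subset_Icc_self h'.2)⟩

lemma isOpen_fly (i j : T.Side) : IsOpen {z | T.Fly i j z} :=
  isOpen_iff_mem_nhds.2 fun _ h => Fly.eventually h

/-- Vertices on rays close to the ray of `y` are on the ray of `y`. -/
lemma eventually_vertex (i : T.Side) (y : ℝ × ℝ) {τ : ℝ × ℝ → ℝ} (hτ : ContinuousAt τ y) :
    ∀ᶠ z in 𝓝 y, ∀ v ∈ T.verts, ∀ l ∈ Icc (0:ℝ) 1, T.ray i z (l * τ z) = v →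
      ∃ l' ∈ Icc (0:ℝ) 1, T.ray i y (l' * τ y) = v ∧ dev y z (l' * τ y) = 0 := by
  have key : ∀ v ∈ T.verts, ∀ᶠ z in 𝓝 y, ∀ l ∈ Icc (0:ℝ) 1, T.ray i z (l * τ z) = v →
      ∃ l' ∈ Icc (0:ℝ) 1, T.ray i y (l' * τ y) = v ∧ dev y z (l' * τ y) = 0 := by
    intro v hv
    by_cases hex : ∃ l' ∈ Icc (0:ℝ) 1, T.ray i y (l' * τ y) = v
    · obtain ⟨l', hl', he⟩ := hex
      refine Eventually.of_forall fun z l hl hz => ⟨l', hl', he, ?_⟩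
      rw [← T.cr_ray_sub i, he, ← hz, ray, add_sub_cancel_left, cr_smul_right, cr_self, mul_zero]
    · push Not at hex
      have : ∀ᶠ z in 𝓝 y, ∀ l ∈ Icc (0:ℝ) 1, T.ray i z (l * τ z) ≠ v := by
        refine isCompact_Icc.eventually_forall_of_forall_eventually fun l hl => ?_
        have h1 : ContinuousAt (fun p : (ℝ × ℝ) × ℝ => T.ray i p.1 (p.2 * τ p.1)) (y, l) := by
          have h2 : ContinuousAt (fun p : (ℝ × ℝ) × ℝ => (p.1, p.2 * τ p.1)) (y, l) :=
            continuousAt_fst.prodMk (continuousAt_snd.mul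
              (ContinuousAt.comp (f := Prod.fst) (x := (y, l)) hτ continuousAt_fst))
          exact ContinuousAt.comp (T.continuous_ray i).continuousAt h2
        exact h1.eventually_ne (hex l hl)
      filter_upwards [this] with z hz l hl he
      exact absurd he (hz l hl)
  exact (T.finite_verts.eventually_all).2 key

/-- The sides on which rays close to the ray of `y` arrive, transversally. -/
structure Acc (i j : T.Side) (y : ℝ × ℝ) : Prop where
  mem : y.1 ∈ Icc (T.lo i) (T.hi i)
  inc_pos : 0 < T.inc i j y.2
  freq : ∃ᶠ z in 𝓝 y, T.Fly i j z

lemma Acc.snd_eq_zero {i j : T.Side} {y : ℝ × ℝ} (h : Acc i j y) : j.2 = 0 := by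
  obtain ⟨z, hz⟩ := h.freq.exists
  exact hz.snd_eq_zero

lemma Acc.arr_mem {i j : T.Side} {y : ℝ × ℝ} (h : Acc i j y) :
    T.arr i j y ∈ Icc (T.lo j) (T.hi j) :=
  isClosed_Icc.mem_of_frequently_of_tendsto
    (h.freq.mono fun _ hz => Ioo_subset_Icc_self hz.arr_mem) (T.continuousAt_arr h.inc_pos.ne')

lemma Acc.tim_nonneg {i j : T.Side} {y : ℝ × ℝ} (h : Acc i j y) : 0 ≤ T.tim i j y :=
  isClosed_Ici.mem_of_frequently_of_tendsto (s := Ici (0:ℝ))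
    (h.freq.mono fun _ hz => hz.tim_pos.le) (T.continuousAt_tim h.inc_pos.ne')

lemma eventually_inc_pos {i j : T.Side} {y : ℝ × ℝ} (h : 0 < T.inc i j y.2) :
    ∀ᶠ z : ℝ × ℝ in 𝓝 y, 0 < T.inc i j z.2 := by
  have : Continuous fun z' : ℝ × ℝ => T.inc i j z'.2 := by fun_prop
  exact this.continuousAt.eventually_mem (isOpen_Ioi.mem_nhds h)

/-- Parameters of the same point in two closed sides. -/
lemma eq_or_of_bdry_eq {j j' : T.Side} {s s' : ℝ} (hs : s ∈ Icc (T.lo j) (T.hi j))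
    (hs' : s' ∈ Icc (T.lo j') (T.hi j')) (he : T.lineP j s = T.lineP j' s') :
    j.1 = j'.1 ∨ (s = T.lo j ∧ s' = T.hi j') ∨ (s = T.hi j ∧ s' = T.lo j') := by
  rw [← T.bdry_eq hs, ← T.bdry_eq hs'] at he
  obtain ⟨n, rfl⟩ := T.exists_int_of_bdry_eq he
  have a := T.lo_shift j n
  have b := T.hi_shift j n
  have hm : s + n ∈ Icc (T.lo (j.1, j.2 + n)) (T.hi (j.1, j.2 + n)) := by
    rw [a, b]; constructor <;> linarith [hs.1, hs.2]
  rcases hs'.1.eq_or_lt with h1 | h1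
  · rcases hm.1.eq_or_lt with h2 | h2
    · left
      rw [← h1] at h2
      have := T.side_eq_of_lo h2
      rw [← this]
    · rcases hm.2.eq_or_lt with h3 | h3
      · right; right
        exact ⟨by linarith, h1.symm⟩
      · left
        have := T.side_eq_of_mem ⟨h2, h3⟩ hs'
        rw [← this]
  · rcases hs'.2.eq_or_lt with h1' | h1'
    · rcases hm.2.eq_or_lt with h2 | h2
      · left
        rw [h1'] at h2
        have := T.side_eq_of_hi h2
        rw [this]
      · rcases hm.1.eq_or_lt with h3 | h3
        · right; left
          exact ⟨by linarith, h1'⟩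
        · left
          have := T.side_eq_of_mem ⟨h3, h2⟩ hs'
          rw [← this]
    · left
      have := T.side_eq_of_mem ⟨h1, h1'⟩ hm
      rw [this]

lemma dir_congr {j j' : T.Side} (h : j.1 = j'.1) : T.dir j = T.dir j' := by
  unfold dir; simp only [h]

lemma Base.tim_ne_zero {i j : T.Side} {z : ℝ × ℝ} (h : T.Base i z) (hi : 0 < T.inc i j z.2)
    (ha : T.arr i j z ∈ Icc (T.lo j) (T.hi j)) : T.tim i j z ≠ 0 := by
  intro h0
  have e := T.ray_tim hi.ne'
  rw [h0, ray, zero_smul, add_zero] at e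
  rcases eq_or_of_bdry_eq (Ioo_subset_Icc_self h.1) ha e with h1 | h1 | h1
  · rw [inc, ← dir_congr h1, cr_dirAt_dir] at hi
    linarith [h.cos_pos]
  · exact h.1.1.ne' h1.1
  · exact h.1.2.ne h1.1

lemma Acc.eventually_tim_pos {i j : T.Side} {y : ℝ × ℝ} (h : Acc i j y) :
    ∀ᶠ z in 𝓝 y, T.Base i z → 0 < T.tim i j z := by
  rcases h.tim_nonneg.eq_or_lt with h0 | h0
  · have e := T.ray_tim h.inc_pos.ne'
    rw [← h0, ray, zero_smul, add_zero] at e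
    have key : ∀ z : ℝ × ℝ, 0 < T.inc i j z.2 →
        T.tim i j z * T.inc i j z.2 = (z.1 - y.1) * cr (T.dir j) (T.dir i) := by
      intro z hz
      have e2 : T.lineP i z.1 - T.lineP j (T.lo j) = (z.1 - y.1) • T.dir i +
          (T.arr i j y - T.lo j) • T.dir j := by
        rw [← T.lineP_sub, ← T.lineP_sub, e]; ring
      rw [tim, div_mul_cancel₀ _ hz.ne', e2, cr_add_right, cr_smul_right, cr_smul_right, cr_self]
      ring
    have hcor : y.1 = T.lo i ∨ y.1 = T.hi i := by
      rcases eq_or_of_bdry_eq h.mem h.arr_mem e with h1 | h1 | h1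
      · exfalso
        obtain ⟨z, hz⟩ := h.freq.exists
        have := hz.inc_pos
        rw [inc, ← dir_congr h1, cr_dirAt_dir] at this
        linarith [hz.1.cos_pos]
      · exact Or.inl h1.1
      · exact Or.inr h1.1
    obtain ⟨z0, hz0⟩ := h.freq.exists
    have k0 := key z0 hz0.inc_pos
    have p0 := mul_pos hz0.tim_pos hz0.inc_pos
    filter_upwards [eventually_inc_pos h.inc_pos] with z hz hb
    have k1 := key z hz
    have : 0 < T.tim i j z * T.inc i j z.2 := by
      rw [k1]; rw [k0] at p0
      rcases hcor with hc | hc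
      · have a1 := hz0.1.1.1
        have a2 := hb.1.1
        rw [← hc] at a1 a2
        have := (pos_iff_pos_of_mul_pos p0).1 (by linarith)
        exact mul_pos (by linarith) this
      · have a1 := hz0.1.1.2
        have a2 := hb.1.2
        rw [← hc] at a1 a2
        have : cr (T.dir j) (T.dir i) < 0 := by nlinarith
        nlinarith
    exact pos_of_mul_pos_left this hz.le
  · have := (T.continuousAt_tim h.inc_pos.ne').eventually_mem (isOpen_Ioi.mem_nhds h0)
    filter_upwards [this] with z hz _ using hz

/-- Along a connected family of rays which do not meet the vertices on the ray of `y`, the side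
of the first collision does not change. -/
lemma Acc.fly_of_isPreconnected {i j : T.Side} {y : ℝ × ℝ} (h : Acc i j y) :
    ∃ W ∈ 𝓝 y, ∀ A ⊆ W, IsPreconnected A → (∀ z ∈ A, T.Base i z) →
      (∀ z ∈ A, ∀ t ∈ Icc 0 (T.tim i j y), T.ray i y t ∈ T.verts → dev y z t ≠ 0) →
      ∀ z₀ ∈ A, T.Fly i j z₀ → ∀ z ∈ A, T.Fly i j z := by
  refine ⟨_, (eventually_inc_pos h.inc_pos).and
    (eventually_vertex i y (T.continuousAt_tim h.inc_pos.ne')), ?_⟩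
  intro A hAW hA hb hd z₀ hz₀ hf
  refine hA.subset_of_closure_inter_subset (isOpen_fly i j) ⟨z₀, hz₀, hf⟩ ?_
  rintro z ⟨hzc, hzA⟩
  obtain ⟨hinc, hv⟩ := hAW hzA
  have hB := hb z hzA
  have hfr : ∃ᶠ z' in 𝓝 z, T.Fly i j z' := mem_closure_iff_frequently.1 hzc
  have hacc : Acc i j z := ⟨Ioo_subset_Icc_self hB.1, hinc, hfr⟩
  have htpos : 0 < T.tim i j z :=
    lt_of_le_of_ne hacc.tim_nonneg (hB.tim_ne_zero hinc hacc.arr_mem).symm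
  have hle : T.hitTime z ≤ T.tim i j z := hB.hitTime_le htpos (by
    rw [T.ray_tim hinc.ne']; exact T.lineP_notMem hacc.arr_mem)
  rcases hB.fly_or with ⟨j', hj'⟩ | hvert
  · obtain ⟨z', h1, h2⟩ := (hfr.and_eventually hj'.eventually).exists
    rw [(h1.unique h2).2]; exact hj'
  · exfalso
    obtain ⟨l', hl', h1, h2⟩ := hv _ hvert (T.hitTime z / T.tim i j z)
      ⟨div_nonneg hB.hitTime_pos.le htpos.le, (div_le_one htpos).2 hle⟩
      (by rw [div_mul_cancel₀ _ htpos.ne'])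
    have hn := h.tim_nonneg
    refine hd z hzA (l' * T.tim i j y) ⟨mul_nonneg hl'.1 hn, ?_⟩ (h1 ▸ hvert) h2
    nlinarith [hl'.2]

/-- For `z` close to `y`, the first collision is not after the ray of `z` meets the closed side `j`. -/
lemma Acc.eventually_hitTime_le {i j : T.Side} {y : ℝ × ℝ} (h : Acc i j y) :
    ∀ᶠ z in 𝓝 y, T.Base i z → T.arr i j z ∈ Icc (T.lo j) (T.hi j) →
      T.hitTime z ≤ T.tim i j z := by
  filter_upwards [h.eventually_tim_pos, eventually_inc_pos h.inc_pos] with z h1 h2 hb ha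
  exact hb.hitTime_le (h1 hb) (by rw [T.ray_tim h2.ne']; exact T.lineP_notMem ha)

lemma Acc.eventually_dev {i j : T.Side} {y : ℝ × ℝ} (h : Acc i j y) :
    ∀ᶠ z in 𝓝 y, dev y z (T.tim i j y) = (T.arr i j y - T.arr i j z) * T.inc i j z.2 ∧
      0 < T.inc i j z.2 := by
  filter_upwards [eventually_inc_pos h.inc_pos] with z hz
  exact ⟨T.dev_tim h.inc_pos.ne' hz.ne', hz⟩

/-- Rays close to the ray of `y` which first arrive at different sides are separated by a vertex
on the ray of `y`: the case of the nearer side. -/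
lemma Acc.separation_of_le {i j j' : T.Side} {y : ℝ × ℝ} (h : Acc i j y) (h' : Acc i j' y)
    (hne : j ≠ j') (hle : T.tim i j y ≤ T.tim i j' y) :
    ∃ σ : ℝ, (σ = 1 ∨ σ = -1) ∧ ∀ᶠ z in 𝓝 y, (T.Fly i j z → 0 < σ * dev y z (T.tim i j y)) ∧
      (T.Fly i j' z → σ * dev y z (T.tim i j y) < 0) := by
  have hne1 : j.1 ≠ j'.1 := fun e => hne (Prod.ext e (by rw [h.snd_eq_zero, h'.snd_eq_zero]))
  -- the case of equal times
  have heq : T.tim i j y = T.tim i j' y →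
      (T.arr i j y = T.lo j ∧ T.arr i j' y = T.hi j') ∨
      (T.arr i j y = T.hi j ∧ T.arr i j' y = T.lo j') := by
    intro e
    have e1 := T.ray_tim h.inc_pos.ne'
    have e2 := T.ray_tim h'.inc_pos.ne'
    rw [e, e2] at e1
    exact (eq_or_of_bdry_eq h.arr_mem h'.arr_mem e1.symm).resolve_left hne1
  -- the case of different times
  have hlt : T.tim i j y < T.tim i j' y → ∀ᶠ z in 𝓝 y, T.Fly i j' z →
      T.arr i j z ∉ Icc (T.lo j) (T.hi j) := by
    intro hlt
    obtain ⟨t, ht1, ht2⟩ := exists_between hlt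
    filter_upwards [h.eventually_hitTime_le,
      (T.continuousAt_tim h.inc_pos.ne').eventually_mem (isOpen_Iio.mem_nhds ht1),
      (T.continuousAt_tim h'.inc_pos.ne').eventually_mem (isOpen_Ioi.mem_nhds ht2)] with
      z h1 h2 h3 hf ha
    have := h1 hf.1 ha
    rw [hf.hitTime_eq] at this
    exact absurd this (not_le.2 (lt_trans h2 h3))
  have hL := T.lo_lt_hi j
  have hlo : ∀ᶠ z in 𝓝 y, T.arr i j y = T.lo j → T.arr i j z < T.hi j := by
    by_cases e : T.arr i j y = T.lo j
    · filter_upwards [(T.continuousAt_arr h.inc_pos.ne').eventually_mem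
        (isOpen_Iio.mem_nhds (show T.arr i j y < T.hi j by rw [e]; exact hL))] with z hz _ using hz
    · exact Eventually.of_forall fun z hz => absurd hz e
  have hhi : ∀ᶠ z in 𝓝 y, T.arr i j y = T.hi j → T.lo j < T.arr i j z := by
    by_cases e : T.arr i j y = T.hi j
    · filter_upwards [(T.continuousAt_arr h.inc_pos.ne').eventually_mem
        (isOpen_Ioi.mem_nhds (show T.lo j < T.arr i j y by rw [e]; exact hL))] with z hz _ using hz
    · exact Eventually.of_forall fun z hz => absurd hz e
  rcases hle.eq_or_lt with e | hl
  · rcases heq e with ⟨e1, e2⟩ | ⟨e1, e2⟩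
    · refine ⟨-1, Or.inr rfl, ?_⟩
      filter_upwards [h.eventually_dev, h'.eventually_dev] with z ⟨d1, p1⟩ ⟨d2, p2⟩
      refine ⟨fun hf => ?_, fun hf => ?_⟩
      · rw [d1, e1]; nlinarith [hf.arr_mem.1]
      · rw [e, d2, e2]; nlinarith [hf.arr_mem.2]
    · refine ⟨1, Or.inl rfl, ?_⟩
      filter_upwards [h.eventually_dev, h'.eventually_dev] with z ⟨d1, p1⟩ ⟨d2, p2⟩
      refine ⟨fun hf => ?_, fun hf => ?_⟩
      · rw [d1, e1]; nlinarith [hf.arr_mem.2]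
      · rw [e, d2, e2]; nlinarith [hf.arr_mem.1]
  · have hl := hlt hl
    rcases h.arr_mem.1.eq_or_lt with e1 | e1
    · refine ⟨-1, Or.inr rfl, ?_⟩
      filter_upwards [h.eventually_dev, hl, hlo] with z ⟨d1, p1⟩ d2 d3
      refine ⟨fun hf => ?_, fun hf => ?_⟩
      · rw [d1, ← e1]; nlinarith [hf.arr_mem.1]
      · have := d2 hf
        rw [d1, ← e1]
        have h5 : T.arr i j z < T.lo j := by
          by_contra! hcon
          exact this ⟨hcon, (d3 e1.symm).le⟩
        nlinarith
    · rcases h.arr_mem.2.eq_or_lt with e2 | e2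
      · refine ⟨1, Or.inl rfl, ?_⟩
        filter_upwards [h.eventually_dev, hl, hhi] with z ⟨d1, p1⟩ d2 d3
        refine ⟨fun hf => ?_, fun hf => ?_⟩
        · rw [d1, e2]; nlinarith [hf.arr_mem.2]
        · have := d2 hf
          rw [d1, e2]
          have h5 : T.hi j < T.arr i j z := by
            by_contra! hcon
            exact this ⟨(d3 e2).le, hcon⟩
          nlinarith
      · exfalso
        have h1 := (T.continuousAt_arr h.inc_pos.ne').eventually_mem (isOpen_Ioo.mem_nhds ⟨e1, e2⟩)
        obtain ⟨z, hz, h2, h3⟩ := (h'.freq.and_eventually (h1.and hl)).exists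
        exact h3 hz (Ioo_subset_Icc_self h2)

/-- Rays close to the ray of `y` which first arrive at different sides are separated by a vertex
on the ray of `y`. -/
lemma Acc.separation {i j j' : T.Side} {y : ℝ × ℝ} (h : Acc i j y) (h' : Acc i j' y)
    (hne : j ≠ j') :
    ∃ t, 0 ≤ t ∧ t ≤ T.tim i j y ∧ t ≤ T.tim i j' y ∧ ∃ σ : ℝ, (σ = 1 ∨ σ = -1) ∧
      ∀ᶠ z in 𝓝 y, (T.Fly i j z → 0 < σ * dev y z t) ∧ (T.Fly i j' z → σ * dev y z t < 0) := by
  rcases le_total (T.tim i j y) (T.tim i j' y) with hle | hle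
  · obtain ⟨σ, hσ, he⟩ := h.separation_of_le h' hne hle
    exact ⟨_, h.tim_nonneg, le_rfl, hle, σ, hσ, he⟩
  · obtain ⟨σ, hσ, he⟩ := h'.separation_of_le h hne.symm hle
    refine ⟨_, h'.tim_nonneg, hle, le_rfl, -σ, by rcases hσ with rfl | rfl <;> simp, ?_⟩
    filter_upwards [he] with z hz
    refine ⟨fun hf => ?_, fun hf => ?_⟩
    · have := hz.2 hf; linarith
    · have := hz.1 hf; linarith

lemma dir_ne_of_corner {a b : T.Side} {k} (ha : T.hi a = T.lo b) (hb : T.lo b = T.corner k) :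
    T.dir a ≠ T.dir b := by
  intro e
  refine T.angle k ?_
  rw [← hb]
  have h1 := T.lo_lt_hi a
  have h2 := T.lo_lt_hi b
  have : T.bdry =ᶠ[𝓝 (T.lo b)] T.lineP b := by
    filter_upwards [Ioo_mem_nhds (show T.lo a < T.lo b by linarith) h2] with s hs
    rcases le_total s (T.lo b) with hle | hle
    · rw [T.bdry_eq (j := a) ⟨hs.1.le, by linarith⟩]
      have a1 := T.lineP_sub a s (T.hi a)
      have a2 := T.lineP_sub b s (T.lo b)
      rw [sub_eq_iff_eq_add] at a1 a2
      rw [a1, a2, T.lineP_lo, T.lineP_hi, ha, e]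
    · exact T.bdry_eq ⟨hle, hs.2.le⟩
  rw [this.differentiableAt_iff]
  unfold lineP
  fun_prop

/-- Rays close to the ray of `y` which first arrive at the same side pass on the same side of each
vertex on the ray of `y`. -/
lemma Acc.passage {i j : T.Side} {y : ℝ × ℝ} (h : Acc i j y) {t : ℝ}
    (ht : t ∈ Icc 0 (T.tim i j y)) (hv : T.ray i y t ∈ T.verts) :
    ∃ σ : ℝ, (σ = 1 ∨ σ = -1) ∧ ∀ᶠ z in 𝓝 y, T.Fly i j z → 0 < σ * dev y z t := by
  rcases ht.2.eq_or_lt with e | hlt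
  · rw [e, T.ray_tim h.inc_pos.ne', ← T.bdry_eq h.arr_mem, T.bdry_mem_verts] at hv
    rw [e]
    rcases h.arr_mem.1.eq_or_lt with e1 | e1
    · refine ⟨-1, Or.inr rfl, ?_⟩
      filter_upwards [h.eventually_dev] with z ⟨d1, p1⟩ hf
      rw [d1, ← e1]; nlinarith [hf.arr_mem.1]
    · rcases h.arr_mem.2.eq_or_lt with e2 | e2
      · refine ⟨1, Or.inl rfl, ?_⟩
        filter_upwards [h.eventually_dev] with z ⟨d1, p1⟩ hf
        rw [d1, e2]; nlinarith [hf.arr_mem.2]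
      · exact absurd hv (T.not_isCorner_of_mem ⟨e1, e2⟩)
  rcases ht.1.eq_or_lt with e | hpos
  · rw [← e] at hv ⊢
    rw [ray, zero_smul, add_zero, ← T.bdry_eq h.mem, T.bdry_mem_verts] at hv
    rcases h.mem.1.eq_or_lt with e1 | e1
    · refine ⟨1, Or.inl rfl, Eventually.of_forall fun z hf => ?_⟩
      have := hf.1.cos_pos
      have := hf.1.1.1
      rw [e1] at this
      rw [dev]; nlinarith
    · rcases h.mem.2.eq_or_lt with e2 | e2
      · refine ⟨-1, Or.inr rfl, Eventually.of_forall fun z hf => ?_⟩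
        have := hf.1.cos_pos
        have := hf.1.1.2
        rw [← e2] at this
        rw [dev]; nlinarith
      · exact absurd hv (T.not_isCorner_of_mem ⟨e1, e2⟩)
  obtain ⟨k, hk⟩ := hv
  obtain ⟨b, hb⟩ := IsCorner.exists_lo (T := T) (s := T.corner k) ⟨k, rfl⟩
  obtain ⟨a, ha⟩ := T.lo_add_one_side b
  have hvb : T.ray i y t = T.lineP b (T.lo b) := by rw [T.lineP_lo, hb]; exact hk.symm
  have hva : T.ray i y t = T.lineP a (T.hi a) := by rw [T.lineP_hi, ha, hb]; exact hk.symm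
  obtain ⟨t', ht1, ht2⟩ := exists_between hlt
  have hj := (T.continuousAt_tim h.inc_pos.ne').eventually_mem (isOpen_Ioi.mem_nhds ht2)
  -- a side at the vertex which is transversal to the ray
  have key : ∀ c : T.Side, T.inc i c y.2 ≠ 0 → T.tim i c y = t → ∀ᶠ z in 𝓝 y, T.Fly i j z →
      T.arr i c z ∉ Icc (T.lo c) (T.hi c) := by
    intro c hc htc
    have c1 := (T.continuousAt_tim hc).eventually_mem
      (isOpen_Ioo.mem_nhds (show T.tim i c y ∈ Ioo 0 t' by rw [htc]; exact ⟨hpos, ht1⟩))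
    have c2 : ∀ᶠ z : ℝ × ℝ in 𝓝 y, T.inc i c z.2 ≠ 0 := by
      have : Continuous fun z' : ℝ × ℝ => T.inc i c z'.2 := by fun_prop
      exact this.continuousAt.eventually_ne hc
    filter_upwards [hj, c1, c2] with z h1 h2 h3 hf ha
    have := hf.1.hitTime_le h2.1 (by rw [T.ray_tim h3]; exact T.lineP_notMem ha)
    rw [hf.hitTime_eq] at this
    exact absurd this (not_le.2 (h2.2.trans h1))
  have hsign : ∀ c : T.Side, T.inc i c y.2 ≠ 0 → ∃ σ : ℝ, (σ = 1 ∨ σ = -1) ∧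
      ∀ᶠ z : ℝ × ℝ in 𝓝 y, 0 < σ * T.inc i c z.2 := by
    intro c hc
    have : Continuous fun z' : ℝ × ℝ => T.inc i c z'.2 := by fun_prop
    rcases lt_or_gt_of_ne hc with h1 | h1
    · refine ⟨-1, Or.inr rfl, ?_⟩
      filter_upwards [this.continuousAt.eventually_mem (isOpen_Iio.mem_nhds h1)] with z hz
      have hz : T.inc i c z.2 < 0 := hz
      linarith
    · refine ⟨1, Or.inl rfl, ?_⟩
      filter_upwards [this.continuousAt.eventually_mem (isOpen_Ioi.mem_nhds h1)] with z hz
      have hz : 0 < T.inc i c z.2 := hz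
      linarith
  by_cases hib : T.inc i b y.2 = 0
  · have hia : T.inc i a y.2 ≠ 0 := by
      intro hia
      have e1 := eq_smul_of_cr_eq_zero (T.norm_dirAt i y.2) hia
      have e2 := eq_smul_of_cr_eq_zero (T.norm_dirAt i y.2) hib
      set x1 := (T.dirAt i y.2).re * (T.dir a).re + (T.dirAt i y.2).im * (T.dir a).im with hx1
      set x2 := (T.dirAt i y.2).re * (T.dir b).re + (T.dirAt i y.2).im * (T.dir b).im with hx2
      have n1 := congrArg norm e1
      have n2 := congrArg norm e2
      rw [norm_smul, T.norm_dir, T.norm_dirAt, mul_one, Real.norm_eq_abs] at n1 n2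
      have hx : x1 = x2 ∨ x2 = -x1 := by
        rcases abs_eq (by norm_num) |>.1 n1.symm with h1 | h1 <;>
        rcases abs_eq (by norm_num) |>.1 n2.symm with h2 | h2 <;> simp [h1, h2]
      rcases hx with hx | hx
      · exact dir_ne_of_corner ha hb (by rw [e1, e2, hx])
      · exact T.dir_ne_neg_dir ha (by rw [e1, e2, hx, neg_smul])
    obtain ⟨e1, e2⟩ := T.eq_tim_arr hia hva
    obtain ⟨σ, hσ, hs⟩ := hsign a hia
    refine ⟨-σ, by rcases hσ with rfl | rfl <;> simp, ?_⟩
    have hL := T.lo_lt_hi a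
    have c3 := (T.continuousAt_arr hia).eventually_mem
      (isOpen_Ioi.mem_nhds (show T.lo a < T.arr i a y by rw [← e2]; exact hL))
    filter_upwards [key a hia e1.symm, hs, c3] with z h1 h2 h3 hf
    have h4 : T.hi a < T.arr i a z := by
      by_contra! hcon
      exact h1 hf ⟨le_of_lt h3, hcon⟩
    have h5 : T.inc i a z.2 ≠ 0 := by intro h0; rw [h0] at h2; simp at h2
    rw [e1, T.dev_tim hia h5, ← e2]
    nlinarith
  · obtain ⟨e1, e2⟩ := T.eq_tim_arr hib hvb
    obtain ⟨σ, hσ, hs⟩ := hsign b hib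
    refine ⟨σ, hσ, ?_⟩
    have hL := T.lo_lt_hi b
    have c3 := (T.continuousAt_arr hib).eventually_mem
      (isOpen_Iio.mem_nhds (show T.arr i b y < T.hi b by rw [← e2]; exact hL))
    filter_upwards [key b hib e1.symm, hs, c3] with z h1 h2 h3 hf
    have h4 : T.arr i b z < T.lo b := by
      by_contra! hcon
      exact h1 hf ⟨hcon, le_of_lt h3⟩
    have h5 : T.inc i b z.2 ≠ 0 := by intro h0; rw [h0] at h2; simp at h2
    rw [e1, T.dev_tim hib h5, ← e2]
    nlinarith

end PolygonalTable

/-! ### The reflection law -/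

namespace IsContractingLaw

variable {f : ℝ → ℝ} (hf : IsContractingLaw f)
include hf

lemma strictMonoOn : StrictMonoOn f (Icc (-(Real.pi / 2)) (Real.pi / 2)) := by
  refine strictMonoOn_of_deriv_pos (convex_Icc _ _) hf.contDiffOn.continuousOn fun x hx => ?_
  rw [interior_Icc] at hx
  exact hf.deriv_pos x hx

lemma exists_bound : ∃ b, 0 < b ∧ b < Real.pi / 2 ∧
    ∀ θ ∈ Icc (-(Real.pi / 2)) (Real.pi / 2), |f θ| ≤ b := by
  obtain ⟨c, hc, hd⟩ := hf.contracting
  have hpi := Real.pi_pos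
  have h0 : (0:ℝ) ∈ Ioo (-(Real.pi / 2)) (Real.pi / 2) := by constructor <;> linarith
  have hc0 : 0 < c := (abs_pos.2 (hf.deriv_pos 0 h0).ne').trans_le (hd 0 h0)
  have hdiff : DifferentiableOn ℝ f (interior (Icc (-(Real.pi / 2)) (Real.pi / 2))) :=
    (hf.contDiffOn.differentiableOn (by norm_num)).mono interior_subset
  have key := (convex_Icc (-(Real.pi / 2)) (Real.pi / 2)).image_sub_le_mul_sub_of_deriv_le
    hf.contDiffOn.continuousOn hdiff (C := c) (fun x hx => by
      rw [interior_Icc] at hx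
      exact (le_abs_self _).trans (hd x hx))
  refine ⟨c * (Real.pi / 2), by positivity, by nlinarith, fun θ hθ => ?_⟩
  rcases le_total 0 θ with h | h
  · have h1 := key 0 ⟨h0.1.le, h0.2.le⟩ θ hθ h
    have h2 := hf.strictMonoOn.monotoneOn ⟨h0.1.le, h0.2.le⟩ hθ h
    rw [hf.map_zero] at h1 h2
    rw [abs_of_nonneg h2]
    nlinarith [hθ.2]
  · have h1 := key θ hθ 0 ⟨h0.1.le, h0.2.le⟩ h
    have h2 := hf.strictMonoOn.monotoneOn hθ ⟨h0.1.le, h0.2.le⟩ h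
    rw [hf.map_zero] at h1 h2
    rw [abs_of_nonpos h2]
    nlinarith [hθ.1]

lemma map_mem_Ioo {θ : ℝ} (hθ : θ ∈ Icc (-(Real.pi / 2)) (Real.pi / 2)) :
    f θ ∈ Ioo (-(Real.pi / 2)) (Real.pi / 2) := by
  obtain ⟨b, -, hb, h⟩ := hf.exists_bound
  have := abs_le.1 (h θ hθ)
  constructor <;> linarith

end IsContractingLaw

/-- On a preconnected set covered by open sets which are equal or disjoint, one of them suffices. -/
lemma IsPreconnected.subset_of_open_cover {X ι : Type*} [TopologicalSpace X] {A : Set X}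
    (hA : IsPreconnected A) {O : ι → Set X} (ho : ∀ i, IsOpen (O i))
    (hd : ∀ i j, ∀ z ∈ O i, z ∈ O j → O i = O j) (hc : ∀ z ∈ A, ∃ i, z ∈ O i)
    {i : ι} {z : X} (hz : z ∈ A) (hzi : z ∈ O i) : A ⊆ O i := by
  refine hA.subset_left_of_subset_union (ho i)
    (isOpen_biUnion fun j (_ : j ∈ {j | O j ≠ O i}) => ho j) ?_ ?_ ⟨z, hz, hzi⟩
  · rw [disjoint_left]
    intro w hw hw'
    obtain ⟨j, hj, hwj⟩ := mem_iUnion₂.1 hw'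
    have hj : O j ≠ O i := hj
    exact hj (hd j i w hwj hw)
  · intro w hw
    obtain ⟨j, hj⟩ := hc w hw
    by_cases h : O j = O i
    · exact Or.inl (h ▸ hj)
    · exact Or.inr (mem_iUnion₂.2 ⟨j, h, hj⟩)

namespace PolygonalTable

variable (T : PolygonalTable)

lemma continuous_map_refl {f : ℝ → ℝ} (hf : IsContractingLaw f) (i j : T.Side) :
    Continuous fun θ => f (T.refl i j θ) :=
  hf.contDiffOn.continuousOn.comp_continuous (T.continuous_refl i j) fun θ => T.refl_mem_Icc i j θ

lemma continuousAt_step {f : ℝ → ℝ} (hf : IsContractingLaw f) {i j : T.Side} {z : ℝ × ℝ}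
    (h : T.inc i j z.2 ≠ 0) : ContinuousAt (T.step f i j) z :=
  (T.continuousAt_arr h).prodMk
    (((T.continuous_map_refl hf i j).comp continuous_snd).continuousAt)

lemma map_refl_lt {f : ℝ → ℝ} (hf : IsContractingLaw f) {i j : T.Side} {θ θ' : ℝ}
    (h : 0 < T.inc i j θ) (h' : 0 < T.inc i j θ')
    (hθ : θ ∈ Icc (-(Real.pi / 2)) (Real.pi / 2)) (hθ' : θ' ∈ Icc (-(Real.pi / 2)) (Real.pi / 2))
    (hlt : θ < θ') : f (T.refl i j θ') < f (T.refl i j θ) := by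
  refine hf.strictMonoOn (T.refl_mem_Icc _ _ _) (T.refl_mem_Icc _ _ _) ?_
  have := T.refl_sub h h' hθ hθ'
  linarith

lemma sin_sub_sign {θ θ' : ℝ} (h : θ ∈ Icc (-(Real.pi / 2)) (Real.pi / 2))
    (h' : θ' ∈ Ioo (-(Real.pi / 2)) (Real.pi / 2)) :
    (0 ≤ θ' - θ → 0 ≤ Real.sin (θ' - θ)) ∧ (0 < θ' - θ → 0 < Real.sin (θ' - θ)) ∧
    (θ' - θ ≤ 0 → Real.sin (θ' - θ) ≤ 0) ∧ (θ' - θ < 0 → Real.sin (θ' - θ) < 0) := by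
  refine ⟨fun h0 => Real.sin_nonneg_of_nonneg_of_le_pi h0 (by linarith [h.1, h'.2]),
    fun h0 => Real.sin_pos_of_pos_of_lt_pi h0 (by linarith [h.1, h'.2]),
    fun h0 => Real.sin_nonpos_of_nonpos_of_neg_pi_le h0 (by linarith [h.2, h'.1]),
    fun h0 => Real.sin_neg_of_neg_of_neg_pi_lt h0 (by linarith [h.2, h'.1])⟩

/-- The points based on the side `i` whose coordinates both differ from those of `y` in the
direction of the sign `σ`; if `y` is tangent to the boundary, only the angle matters. -/
def Cone (σ : ℝ) (i : T.Side) (y z : ℝ × ℝ) : Prop :=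
  T.Base i z ∧ 0 ≤ σ * (z.2 - y.2) ∧ (Real.cos y.2 ≠ 0 → 0 ≤ σ * (z.1 - y.1)) ∧ z ≠ y

variable {T} {σ : ℝ} {i j : T.Side} {y z : ℝ × ℝ}

lemma sign_sin (hσ : σ = 1 ∨ σ = -1) (hy : y.2 ∈ Icc (-(Real.pi / 2)) (Real.pi / 2))
    (hz : z.2 ∈ Ioo (-(Real.pi / 2)) (Real.pi / 2)) (h : 0 ≤ σ * (z.2 - y.2)) :
    0 ≤ σ * Real.sin (z.2 - y.2) ∧ (Real.sin (z.2 - y.2) = 0 → z.2 = y.2) := by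
  obtain ⟨h1, h2, h3, h4⟩ := sin_sub_sign hy hz
  constructor
  · rcases hσ with rfl | rfl
    · have := h1 (by linarith); linarith
    · have := h3 (by linarith); linarith
  · intro h0
    rcases lt_trichotomy (z.2 - y.2) 0 with h5 | h5 | h5
    · have := h4 h5; linarith
    · linarith
    · have := h2 h5; linarith

/-- Near a vector tangent to the boundary. -/
lemma dev_of_cos_eq_zero (hc : Real.cos y.2 = 0) (h : ℝ) :
    dev y z h = (z.1 - y.1 - Real.sin y.2 * h) * Real.cos z.2 := by
  rw [dev, Real.sin_sub, hc]; ring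

lemma sin_sq_of_cos_eq_zero {θ : ℝ} (hc : Real.cos θ = 0) : Real.sin θ ^ 2 = 1 := by
  have := Real.sin_sq_add_cos_sq θ; rw [hc] at this; linarith

lemma dirAt_of_cos_eq_zero (i : T.Side) {θ : ℝ} (hc : Real.cos θ = 0) :
    T.dirAt i θ = Real.sin θ • T.dir i := by
  rw [dirAt, hc, zero_smul, add_zero]

lemma Base.lineP_notMem_verts (h : T.Base i z) : T.lineP i z.1 ∉ T.verts := by
  rw [← h.bdry, T.bdry_mem_verts]
  exact T.not_isCorner_of_mem h.1

lemma Cone.dev_ne_zero (hσ : σ = 1 ∨ σ = -1) (hy : y.2 ∈ Icc (-(Real.pi / 2)) (Real.pi / 2))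
    (h : T.Cone σ i y z) {t : ℝ} (ht : 0 ≤ t) (hv : T.ray i y t ∈ T.verts) :
    dev y z t ≠ 0 := by
  obtain ⟨hb, h2, h1, hne⟩ := h
  intro h0
  have hcz := hb.cos_pos
  by_cases hc : Real.cos y.2 = 0
  · rw [dev_of_cos_eq_zero hc] at h0
    have h3 := (mul_eq_zero.1 h0).resolve_right hcz.ne'
    have : T.ray i y t = T.lineP i z.1 := by
      have e := T.lineP_sub i z.1 y.1
      have e2 : z.1 - y.1 = t * Real.sin y.2 := by linarith
      rw [e2, mul_smul, ← dirAt_of_cos_eq_zero i hc] at e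
      rw [ray, ← e]; ring
    rw [this] at hv
    exact hb.lineP_notMem_verts hv
  · have h1 := h1 hc
    obtain ⟨h3, h4⟩ := sign_sin hσ hy hb.2 h2
    have e : σ * (z.1 - y.1) * Real.cos z.2 + t * (σ * Real.sin (z.2 - y.2)) = 0 := by
      rw [dev] at h0; linear_combination σ * h0
    have e1 : 0 ≤ σ * (z.1 - y.1) * Real.cos z.2 := mul_nonneg h1 hcz.le
    have e2 : 0 ≤ t * (σ * Real.sin (z.2 - y.2)) := mul_nonneg ht h3
    have hσ0 : σ ≠ 0 := by rcases hσ with rfl | rfl <;> norm_num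
    have e3 : z.1 = y.1 := by
      have : σ * (z.1 - y.1) * Real.cos z.2 = 0 := by linarith
      have := (mul_eq_zero.1 ((mul_eq_zero.1 this).resolve_right hcz.ne')).resolve_left hσ0
      linarith
    have e4 : t * (σ * Real.sin (z.2 - y.2)) = 0 := by linarith
    rcases mul_eq_zero.1 e4 with h5 | h5
    · rw [h5, ray, zero_smul, add_zero, ← e3] at hv
      exact hb.lineP_notMem_verts hv
    · exact hne (Prod.ext e3 (h4 ((mul_eq_zero.1 h5).resolve_left hσ0)))

lemma convex_cone (hσ : σ = 1 ∨ σ = -1) : Convex ℝ {z | T.Cone σ i y z} := by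
  intro z hz w hw a b ha hb hab
  obtain ⟨hz1, hz2, hz3, hz4⟩ : T.Cone σ i y z := hz
  obtain ⟨hw1, hw2, hw3, hw4⟩ : T.Cone σ i y w := hw
  have eb : b = 1 - a := by linarith
  have hB : T.Base i (a • z + b • w) :=
    ⟨convex_Ioo _ _ hz1.1 hw1.1 ha hb hab, convex_Ioo _ _ hz1.2 hw1.2 ha hb hab⟩
  have e1 : σ * ((a • z + b • w).1 - y.1) = a * (σ * (z.1 - y.1)) + b * (σ * (w.1 - y.1)) := by
    simp only [Prod.fst_add, Prod.smul_fst, smul_eq_mul, eb]; ring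
  have e2 : σ * ((a • z + b • w).2 - y.2) = a * (σ * (z.2 - y.2)) + b * (σ * (w.2 - y.2)) := by
    simp only [Prod.snd_add, Prod.smul_snd, smul_eq_mul, eb]; ring
  refine ⟨hB, by rw [e2]; positivity, fun hc => ?_, fun he => ?_⟩
  · have := hz3 hc
    have := hw3 hc
    rw [e1]; positivity
  · have hc : Real.cos y.2 ≠ 0 := by rw [← he]; exact hB.cos_pos.ne'
    have h1 := hz3 hc
    have h2 := hw3 hc
    rw [he, sub_self, mul_zero] at e1 e2
    have hσ0 : σ ≠ 0 := by rcases hσ with rfl | rfl <;> norm_num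
    rcases ha.eq_or_lt with h0 | h0
    · apply hw4
      rw [← he, ← h0, eb, ← h0]; simp
    · apply hz4
      have f1 : a * (σ * (z.1 - y.1)) = 0 := by
        have := mul_nonneg ha h1; have := mul_nonneg hb h2; linarith
      have f2 : a * (σ * (z.2 - y.2)) = 0 := by
        have := mul_nonneg ha hz2; have := mul_nonneg hb hw2; linarith
      have g1 := (mul_eq_zero.1 ((mul_eq_zero.1 f1).resolve_left h0.ne')).resolve_left hσ0
      have g2 := (mul_eq_zero.1 ((mul_eq_zero.1 f2).resolve_left h0.ne')).resolve_left hσ0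
      exact Prod.ext (by linarith) (by linarith)

lemma _root_.IsPreconnected.fly {A : Set (ℝ × ℝ)} (hA : IsPreconnected A)
    (hc : ∀ z ∈ A, ∃ i j, T.Fly i j z) (hz : z ∈ A) (hzf : T.Fly i j z) :
    ∀ w ∈ A, T.Fly i j w := by
  have := hA.subset_of_open_cover (O := fun p : T.Side × T.Side => {z | T.Fly p.1 p.2 z})
    (fun p => isOpen_fly _ _) (fun p q z hz hz' => by
      have e := Fly.unique (T := T) hz hz'
      have : p = q := Prod.ext e.1 e.2
      rw [this]) (fun z hz => by
      obtain ⟨i, j, h⟩ := hc z hz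
      exact ⟨(i, j), h⟩) (i := (i, j)) hz hzf
  exact fun w hw => this hw

lemma Cone.eventually_fly (hσ : σ = 1 ∨ σ = -1) (hy : y.2 ∈ Icc (-(Real.pi / 2)) (Real.pi / 2))
    (hfr : ∃ᶠ z in 𝓝 y, T.Cone σ i y z) :
    ∃ j, ∀ᶠ z in 𝓝 y, T.Cone σ i y z → T.Fly i j z := by
  obtain ⟨R, hR, hRP⟩ := T.exists_time_bound
  have hev : ∀ᶠ z in 𝓝 y, T.Cone σ i y z → ∃ i j, T.Fly i j z := by
    filter_upwards [eventually_vertex i y (τ := fun _ => R) continuousAt_const] with z hz hzc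
    have hb := hzc.1
    rcases hb.fly_or with ⟨j, hj⟩ | hv
    · exact ⟨i, j, hj⟩
    · exfalso
      have h1 := hb.hitTime_le hR (hRP i z hb)
      obtain ⟨l', hl', he, hd⟩ := hz _ hv (T.hitTime z / R)
        ⟨div_nonneg hb.hitTime_pos.le hR.le, (div_le_one hR).2 h1⟩
        (by rw [div_mul_cancel₀ _ hR.ne'])
      exact hzc.dev_ne_zero hσ hy (mul_nonneg hl'.1 hR.le) (he ▸ hv) hd
  obtain ⟨ρ, hρ, hb⟩ := Metric.eventually_nhds_iff_ball.1 hev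
  have hconv : IsPreconnected ({z | T.Cone σ i y z} ∩ Metric.ball y ρ) :=
    ((convex_cone hσ).inter (convex_ball y ρ)).isPreconnected
  obtain ⟨z₀, hz₀, hz₀'⟩ := (hfr.and_eventually (Metric.ball_mem_nhds y hρ)).exists
  obtain ⟨i', j, hj⟩ := hb z₀ hz₀' hz₀
  have e : i' = i := T.side_eq_of_mem hj.1.1 (Ioo_subset_Icc_self hz₀.1.1)
  subst e
  refine ⟨j, ?_⟩
  filter_upwards [Metric.ball_mem_nhds y hρ] with z hz hzc
  exact hconv.fly (fun w hw => hb w hw.2 hw.1) ⟨hz₀, hz₀'⟩ hj z ⟨hzc, hz⟩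

lemma tim_mul_inc (h : T.inc i j z.2 ≠ 0) :
    T.tim i j z * T.inc i j z.2 = cr (T.dir j) (T.lineP i z.1 - T.lineP j (T.lo j)) := by
  rw [tim, div_mul_cancel₀ _ h]

lemma cr_lineP_sub (i j : T.Side) (y z : ℝ × ℝ) :
    cr (T.dir j) (T.lineP i z.1 - T.lineP j (T.lo j)) =
      cr (T.dir j) (T.lineP i y.1 - T.lineP j (T.lo j)) +
        (z.1 - y.1) * cr (T.dir j) (T.dir i) := by
  rw [← cr_smul_right, ← cr_add_right, ← T.lineP_sub]; congr 1; ring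

lemma Cone.inc_pos (hσ : σ = 1 ∨ σ = -1) (hy : y.2 ∈ Icc (-(Real.pi / 2)) (Real.pi / 2))
    (hfr : ∃ᶠ z in 𝓝 y, T.Cone σ i y z ∧ T.Fly i j z) : 0 < T.inc i j y.2 := by
  obtain ⟨R, hR, hRP⟩ := T.exists_time_bound
  have hci : Continuous fun z : ℝ × ℝ => T.inc i j z.2 := by fun_prop
  have hcl : Continuous fun z : ℝ × ℝ => cr (T.dir j) (T.lineP i z.1 - T.lineP j (T.lo j)) := by
    fun_prop
  have hcd : Continuous fun z : ℝ × ℝ =>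
      R * T.inc i j z.2 - cr (T.dir j) (T.lineP i z.1 - T.lineP j (T.lo j)) := by fun_prop
  have h0 : 0 ≤ T.inc i j y.2 := isClosed_Ici.mem_of_frequently_of_tendsto (s := Ici (0:ℝ))
    (hfr.mono fun z hz => hz.2.inc_pos.le) hci.continuousAt
  refine lt_of_le_of_ne h0 fun h0 => ?_
  have h1 : 0 ≤ cr (T.dir j) (T.lineP i y.1 - T.lineP j (T.lo j)) :=
    isClosed_Ici.mem_of_frequently_of_tendsto (s := Ici (0:ℝ))
      (hfr.mono fun z hz => by
        rw [mem_Ici, ← tim_mul_inc hz.2.inc_pos.ne']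
        exact mul_nonneg hz.2.tim_pos.le hz.2.inc_pos.le) hcl.continuousAt
  have h2 : 0 ≤ R * T.inc i j y.2 - cr (T.dir j) (T.lineP i y.1 - T.lineP j (T.lo j)) :=
    isClosed_Ici.mem_of_frequently_of_tendsto (s := Ici (0:ℝ))
      (hfr.mono fun z hz => by
        have := hz.2.1.hitTime_le hR (hRP i z hz.2.1)
        rw [hz.2.hitTime_eq] at this
        rw [mem_Ici, ← tim_mul_inc hz.2.inc_pos.ne', ← sub_mul]
        exact mul_nonneg (by linarith) hz.2.inc_pos.le)
      hcd.continuousAt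
  rw [← h0, mul_zero] at h2
  have h3 : cr (T.dir j) (T.lineP i y.1 - T.lineP j (T.lo j)) = 0 := by linarith
  obtain ⟨z, hz, hzf⟩ := hfr.exists
  obtain ⟨e, he⟩ : ∃ e : ℝ, T.dir j = e • T.dirAt i y.2 :=
    ⟨_, eq_smul_of_cr_eq_zero (T.norm_dirAt i y.2) h0.symm⟩
  have p1 : 0 < e * Real.sin (z.2 - y.2) := by
    have := hzf.inc_pos
    rwa [inc, he, cr_smul_right, cr_dirAt_dirAt] at this
  have p2 : 0 < - e * (z.1 - y.1) * Real.cos y.2 := by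
    have := mul_pos hzf.tim_pos hzf.inc_pos
    rw [tim_mul_inc hzf.inc_pos.ne', cr_lineP_sub i j y z, h3, zero_add, he, cr_smul_left,
      cr_dirAt_dir] at this
    linarith
  have hcy : 0 ≤ Real.cos y.2 := Real.cos_nonneg_of_mem_Icc hy
  have hcy' : Real.cos y.2 ≠ 0 := fun h => by rw [h, mul_zero] at p2; exact lt_irrefl _ p2
  have s1 := (sign_sin hσ hy hz.1.2 hz.2.1).1
  have s2 := hz.2.2.1 hcy'
  have hσ2 : σ ^ 2 = 1 := by rcases hσ with rfl | rfl <;> norm_num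
  have s3 := mul_nonneg s1 (mul_nonneg s2 hcy)
  have p3 := mul_pos p1 p2
  have : 0 < - (e ^ 2 * (Real.sin (z.2 - y.2) * ((z.1 - y.1) * Real.cos y.2))) := by linarith
  have s4 : 0 ≤ Real.sin (z.2 - y.2) * ((z.1 - y.1) * Real.cos y.2) := by
    have : Real.sin (z.2 - y.2) * ((z.1 - y.1) * Real.cos y.2) =
      σ * Real.sin (z.2 - y.2) * (σ * (z.1 - y.1) * Real.cos y.2) := by
      linear_combination (-(Real.sin (z.2 - y.2) * ((z.1 - y.1) * Real.cos y.2))) * hσ2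
    rw [this]; exact s3
  have := mul_nonneg (sq_nonneg e) s4
  linarith

lemma Cone.eventually_dev_nonneg (hσ : σ = 1 ∨ σ = -1)
    (hy : y.2 ∈ Icc (-(Real.pi / 2)) (Real.pi / 2)) (ha : Acc i j y) :
    ∀ᶠ z in 𝓝 y, T.Cone σ i y z → T.Fly i j z → 0 ≤ σ * dev y z (T.tim i j y) := by
  have ht := ha.tim_nonneg
  have hσ2 : σ ^ 2 = 1 := by rcases hσ with rfl | rfl <;> norm_num
  by_cases hc : Real.cos y.2 = 0
  · have hs := sin_sq_of_cos_eq_zero hc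
    -- the signs
    have hsig : ∀ z, T.Cone σ i y z → σ = - Real.sin y.2 := by
      intro z hz
      have h1 := (sign_sin hσ hy hz.1.2 hz.2.1).1
      rw [Real.sin_sub, hc, mul_zero, zero_sub] at h1
      have h2 : 0 ≤ - (σ * Real.sin y.2) := by
        have := hz.1.cos_pos
        by_contra! hcon
        nlinarith
      rcases hσ with rfl | rfl
      · have : (Real.sin y.2 - 1) * (Real.sin y.2 + 1) = 0 := by linarith
        rcases mul_eq_zero.1 this with h | h <;> linarith
      · have : (Real.sin y.2 - 1) * (Real.sin y.2 + 1) = 0 := by linarith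
        rcases mul_eq_zero.1 this with h | h <;> linarith
    have hkey : ∀ z, T.Cone σ i y z → 0 ≤ T.tim i j y - Real.sin y.2 * (z.1 - y.1) →
        0 ≤ σ * dev y z (T.tim i j y) := by
      intro z hz h
      rw [dev_of_cos_eq_zero hc, hsig z hz]
      have : -Real.sin y.2 * ((z.1 - y.1 - Real.sin y.2 * T.tim i j y) * Real.cos z.2) =
        (T.tim i j y - Real.sin y.2 * (z.1 - y.1)) * Real.cos z.2 := by
        linear_combination (T.tim i j y * Real.cos z.2) * hs
      rw [this]
      exact mul_nonneg h hz.1.cos_pos.le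
    rcases ht.eq_or_lt with h0 | h0
    · refine Eventually.of_forall fun z hz hzf => hkey z hz ?_
      rw [← h0]
      have e1 := tim_mul_inc (T := T) (z := y) ha.inc_pos.ne'
      rw [← h0, zero_mul] at e1
      have e2 := mul_pos hzf.tim_pos hzf.inc_pos
      rw [tim_mul_inc hzf.inc_pos.ne', cr_lineP_sub i j y z, ← e1, zero_add] at e2
      have e3 := ha.inc_pos
      rw [inc, dirAt_of_cos_eq_zero i hc, cr_smul_left, cr_swap] at e3
      by_contra! hcon
      nlinarith [mul_pos e2 e3]
    · have : ∀ᶠ z : ℝ × ℝ in 𝓝 y, 0 < T.tim i j y - Real.sin y.2 * (z.1 - y.1) := by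
        have hc : Continuous fun z : ℝ × ℝ => T.tim i j y - Real.sin y.2 * (z.1 - y.1) := by
          fun_prop
        exact hc.continuousAt.eventually_mem (isOpen_Ioi.mem_nhds (by simpa using h0))
      filter_upwards [this] with z hz hzc _
      exact hkey z hzc hz.le
  · refine Eventually.of_forall fun z hz _ => ?_
    have h1 := (sign_sin hσ hy hz.1.2 hz.2.1).1
    have h2 := hz.2.2.1 hc
    rw [dev]
    have := mul_nonneg h2 hz.1.cos_pos.le
    have := mul_nonneg ht h1
    linarith

/-- The rays of a cone have the same, transversal, first collision, and the image of the cone is in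
the opposite cone. -/
theorem Cone.exists_fly {f : ℝ → ℝ} (hf : IsContractingLaw f) (hσ : σ = 1 ∨ σ = -1)
    (hy1 : y.1 ∈ Icc (T.lo i) (T.hi i)) (hy : y.2 ∈ Icc (-(Real.pi / 2)) (Real.pi / 2))
    (hfr : ∃ᶠ z in 𝓝 y, T.Cone σ i y z) :
    ∃ j, Acc i j y ∧ ∀ᶠ z in 𝓝 y, T.Cone σ i y z →
      T.Fly i j z ∧ T.Cone (-σ) j (T.step f i j y) (T.step f i j z) := by
  obtain ⟨j, hj⟩ := Cone.eventually_fly hσ hy hfr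
  have hfr' : ∃ᶠ z in 𝓝 y, T.Cone σ i y z ∧ T.Fly i j z :=
    (hfr.and_eventually hj).mono fun z hz => ⟨hz.1, hz.2 hz.1⟩
  have ha : Acc i j y := ⟨hy1, Cone.inc_pos hσ hy hfr', hfr'.mono fun z hz => hz.2⟩
  refine ⟨j, ha, ?_⟩
  filter_upwards [hj, Cone.eventually_dev_nonneg hσ hy ha] with z hzf hzd hzc
  have hfl := hzf hzc
  have hd := hzd hzc hfl
  have hσ0 : σ ≠ 0 := by rcases hσ with rfl | rfl <;> norm_num
  have hz2 : z.2 ∈ Icc (-(Real.pi / 2)) (Real.pi / 2) := Ioo_subset_Icc_self hzc.1.2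
  have e := T.dev_tim (i := i) (j := j) ha.inc_pos.ne' hfl.inc_pos.ne'
  refine ⟨hfl, ⟨hfl.arr_mem, hf.map_mem_Ioo (T.refl_mem_Icc _ _ _)⟩, ?_, fun _ => ?_, fun he => ?_⟩
  · change 0 ≤ -σ * (f (T.refl i j z.2) - f (T.refl i j y.2))
    have h2 := hzc.2.1
    rcases hσ with rfl | rfl
    · rcases (show y.2 ≤ z.2 by linarith).eq_or_lt with h3 | h3
      · rw [h3]; simp
      · have := T.map_refl_lt hf ha.inc_pos hfl.inc_pos hy hz2 h3
        linarith
    · rcases (show z.2 ≤ y.2 by linarith).eq_or_lt with h3 | h3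
      · rw [h3]; simp
      · have := T.map_refl_lt hf hfl.inc_pos ha.inc_pos hz2 hy h3
        linarith
  · change 0 ≤ -σ * (T.arr i j z - T.arr i j y)
    rw [e] at hd
    have := hfl.inc_pos
    by_contra! hcon
    nlinarith
  · have e1 : T.arr i j z = T.arr i j y := congrArg Prod.fst he
    have e2 : f (T.refl i j z.2) = f (T.refl i j y.2) := congrArg Prod.snd he
    have e3 : z.2 = y.2 := by
      rcases lt_trichotomy z.2 y.2 with h3 | h3 | h3
      · have := T.map_refl_lt hf hfl.inc_pos ha.inc_pos hz2 hy h3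
        linarith
      · exact h3
      · have := T.map_refl_lt hf ha.inc_pos hfl.inc_pos hy hz2 h3
        linarith
    rw [e1, sub_self, zero_mul, dev, e3, sub_self, Real.sin_zero, mul_zero, add_zero, ← e3] at e
    have e4 := (mul_eq_zero.1 e).resolve_right hzc.1.cos_pos.ne'
    exact hzc.2.2.2 (Prod.ext (by linarith) e3)

end PolygonalTable

namespace PolygonalTable

variable (T : PolygonalTable)

/-- The formula for the orbit of a point along a given sequence of sides. -/
def trk (f : ℝ → ℝ) (ι : ℕ → T.Side) (z : ℝ × ℝ) : ℕ → ℝ × ℝ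
  | 0 => z
  | k + 1 => T.step f (ι k) (ι (k + 1)) (trk f ι z k)

/-- The first `n` collisions of `z` are in the interiors of the sides `ι 1, …, ι n`. -/
def Itin (f : ℝ → ℝ) (ι : ℕ → T.Side) (n : ℕ) (z : ℝ × ℝ) : Prop :=
  ∀ k < n, T.Fly (ι k) (ι (k + 1)) (T.trk f ι z k)

variable {T} {f : ℝ → ℝ} {ι ι' : ℕ → T.Side} {n : ℕ} {z y : ℝ × ℝ} {i j : T.Side}

lemma trk_succ' (k : ℕ) :
    T.trk f ι z (k + 1) = T.trk f (fun m => ι (m + 1)) (T.step f (ι 0) (ι 1) z) k := by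
  induction k with
  | zero => rfl
  | succ k ih => rw [trk, ih]; rfl

lemma trk_congr (h : ∀ k ≤ n, ι k = ι' k) {k : ℕ} (hk : k ≤ n) :
    T.trk f ι z k = T.trk f ι' z k := by
  induction k with
  | zero => rfl
  | succ k ih => rw [trk, trk, ih (by omega), h k (by omega), h (k + 1) hk]

lemma itin_succ : T.Itin f ι (n + 1) z ↔
    T.Fly (ι 0) (ι 1) z ∧ T.Itin f (fun m => ι (m + 1)) n (T.step f (ι 0) (ι 1) z) := by
  constructor
  · intro h
    refine ⟨h 0 (by omega), fun k hk => ?_⟩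
    rw [← trk_succ']
    exact h (k + 1) (by omega)
  · rintro ⟨h0, h⟩ k hk
    rcases k with _ | k
    · exact h0
    · rw [trk_succ']
      exact h k (by omega)

lemma Itin.mono (h : T.Itin f ι n z) {m : ℕ} (hm : m ≤ n) : T.Itin f ι m z :=
  fun k hk => h k (by omega)

lemma itin_congr (h : ∀ k ≤ n, ι k = ι' k) : T.Itin f ι n z ↔ T.Itin f ι' n z := by
  refine forall₂_congr fun k hk => ?_
  rw [trk_congr h hk.le, h k hk.le, h (k + 1) hk]

lemma Itin.iterate_eq (h : T.Itin f ι n z) {k : ℕ} (hk : k ≤ n) :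
    (T.billiardMap f)^[k] z = T.trk f ι z k := by
  induction k with
  | zero => rfl
  | succ k ih =>
    rw [Function.iterate_succ_apply', ih (by omega), (h k (by omega)).billiardMap_eq]; rfl

lemma Itin.notMem (h : T.Itin f ι n z) : z ∉ T.singularSetOfOrder f n := by
  rintro ⟨-, k, hk, hs⟩
  rw [h.iterate_eq hk.le] at hs
  exact (h k hk).notMem_singularSet hs

lemma Itin.unique (h : T.Itin f ι n z) (h' : T.Itin f ι' n z) (hn : 1 ≤ n) {k : ℕ} (hk : k ≤ n) :
    ι k = ι' k := by
  rcases k with _ | k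
  · exact (Fly.unique (h 0 hn) (h' 0 hn)).1
  · have h1 := h k hk
    have h2 := h' k hk
    rw [← h.iterate_eq (by omega)] at h1
    rw [← h'.iterate_eq (by omega)] at h2
    exact (Fly.unique h1 h2).2

lemma Fly.base_step (hf : IsContractingLaw f) (h : T.Fly i j z) : T.Base j (T.step f i j z) :=
  ⟨h.arr_mem, hf.map_mem_Ioo (T.refl_mem_Icc _ _ _)⟩

lemma Fly.mem_succ_iff (hf : IsContractingLaw f) (h : T.Fly i j z) :
    z ∈ T.singularSetOfOrder f (n + 1) ↔ T.step f i j z ∈ T.singularSetOfOrder f n := by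
  have e := h.billiardMap_eq f
  constructor
  · rintro ⟨-, k, hk, hs⟩
    rcases k with _ | k
    · exact absurd hs h.notMem_singularSet
    · rw [Function.iterate_succ_apply, e] at hs
      exact ⟨(h.base_step hf).mem_phaseSpace, k, by omega, hs⟩
  · rintro ⟨-, k, hk, hs⟩
    refine ⟨h.1.mem_phaseSpace, k + 1, by omega, ?_⟩
    rw [Function.iterate_succ_apply, e]
    exact hs

lemma Base.exists_itin (hf : IsContractingLaw f) (hb : T.Base i z)
    (hn : z ∉ T.singularSetOfOrder f n) : ∃ ι, ι 0 = i ∧ T.Itin f ι n z := by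
  induction n generalizing i z with
  | zero => exact ⟨fun _ => i, rfl, fun k hk => absurd hk (by omega)⟩
  | succ n ih =>
    have h0 : z ∉ T.singularSet := fun h => hn ⟨hb.mem_phaseSpace, 0, by omega, h⟩
    obtain ⟨i', j, hj⟩ := exists_fly hb.mem_phaseSpace h0
    have e : i' = i := T.side_eq_of_mem hj.1.1 (Ioo_subset_Icc_self hb.1)
    subst e
    rw [hj.mem_succ_iff hf] at hn
    obtain ⟨ι, rfl, hι⟩ := ih (hj.base_step hf) hn
    refine ⟨fun k => Nat.casesOn k i' ι, rfl, itin_succ.2 ⟨hj, hι⟩⟩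

lemma exists_itin (hf : IsContractingLaw f) (hn1 : 1 ≤ n) (hz : z ∈ phaseSpace)
    (hn : z ∉ T.singularSetOfOrder f n) : ∃ ι, T.Itin f ι n z := by
  have h0 : z ∉ T.singularSet := fun h => hn ⟨hz, 0, by omega, h⟩
  obtain ⟨i, j, hj⟩ := exists_fly hz h0
  obtain ⟨ι, -, h⟩ := hj.1.exists_itin hf hn
  exact ⟨ι, h⟩

lemma continuousAt_trk (hf : IsContractingLaw f) (h : ∀ k < n, T.inc (ι k) (ι (k + 1)) (T.trk f ι y k).2 ≠ 0) {k : ℕ}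
    (hk : k ≤ n) : ContinuousAt (fun z => T.trk f ι z k) y := by
  induction k with
  | zero => exact continuousAt_id
  | succ k ih =>
    exact ContinuousAt.comp (f := fun z => T.trk f ι z k)
      (g := T.step f (ι k) (ι (k + 1))) (T.continuousAt_step hf (h k hk)) (ih (by omega))

lemma Itin.eventually (hf : IsContractingLaw f) (h : T.Itin f ι n y) :
    ∀ᶠ z in 𝓝 y, T.Itin f ι n z := by
  have : ∀ k < n, ∀ᶠ z in 𝓝 y, T.Fly (ι k) (ι (k + 1)) (T.trk f ι z k) := fun k hk =>
    (continuousAt_trk hf (fun k hk => (h k hk).inc_pos.ne') hk.le).eventually (h k hk).eventually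
  have h2 := (eventually_all_finite (finite_Iio n)).2 this
  filter_upwards [h2] with z hz k hk using hz k hk

lemma isOpen_itin (hf : IsContractingLaw f) (ι : ℕ → T.Side) (n : ℕ) :
    IsOpen {z | T.Itin f ι n z} :=
  isOpen_iff_mem_nhds.2 fun _ h => Itin.eventually hf h

lemma _root_.IsPreconnected.itin (hf : IsContractingLaw f) (hn : 1 ≤ n) {A : Set (ℝ × ℝ)}
    (hA : IsPreconnected A) (hc : ∀ w ∈ A, w ∈ phaseSpace \ T.singularSetOfOrder f n) (hz : z ∈ A)
    (hzi : T.Itin f ι n z) : ∀ w ∈ A, T.Itin f ι n w := by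
  have := hA.subset_of_open_cover (O := fun ι : ℕ → T.Side => {z | T.Itin f ι n z})
    (fun ι => isOpen_itin hf ι n) (fun ι ι' z hz hz' => by
      have e : ∀ k ≤ n, ι k = ι' k := fun k hk => Itin.unique (T := T) hz hz' hn hk
      ext w; exact itin_congr e) (fun w hw => exists_itin hf hn (hc w hw).1 (hc w hw).2)
      (i := ι) hz hzi
  exact fun w hw => this hw

theorem Cone.exists_itin (hf : IsContractingLaw f) {σ : ℝ} (hσ : σ = 1 ∨ σ = -1)
    (hy1 : y.1 ∈ Icc (T.lo i) (T.hi i)) (hy : y.2 ∈ Icc (-(Real.pi / 2)) (Real.pi / 2))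
    (hfr : ∃ᶠ z in 𝓝 y, T.Cone σ i y z) (n : ℕ) :
    ∃ ι, ι 0 = i ∧ (∀ k < n, Acc (ι k) (ι (k + 1)) (T.trk f ι y k)) ∧
      ∀ᶠ z in 𝓝 y, T.Cone σ i y z → T.Itin f ι n z := by
  induction n generalizing σ i y with
  | zero =>
    exact ⟨fun _ => i, rfl, fun k hk => absurd hk (by omega),
      Eventually.of_forall fun z _ k hk => absurd hk (by omega)⟩
  | succ n ih =>
    obtain ⟨j, ha, hev⟩ := Cone.exists_fly hf hσ hy1 hy hfr
    have hct := T.continuousAt_step hf (i := i) (j := j) ha.inc_pos.ne'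
    have hfr' : ∃ᶠ w in 𝓝 (T.step f i j y), T.Cone (-σ) j (T.step f i j y) w :=
      Filter.Tendsto.frequently hct ((hfr.and_eventually hev).mono fun z hz => (hz.2 hz.1).2)
    obtain ⟨ι, rfl, h1, h2⟩ := ih (σ := -σ) (by rcases hσ with rfl | rfl <;> simp) ha.arr_mem
      (Ioo_subset_Icc_self (hf.map_mem_Ioo (T.refl_mem_Icc _ _ _))) hfr'
    refine ⟨fun k => Nat.casesOn k i ι, rfl, fun k hk => ?_, ?_⟩
    · rcases k with _ | k
      · exact ha
      · rw [trk_succ']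
        exact h1 k (by omega)
    · filter_upwards [hev, hct.eventually h2] with z hz hz2 hzc
      exact itin_succ.2 ⟨(hz hzc).1, hz2 (hz hzc).2⟩

lemma Cone.eventually_notMem (hf : IsContractingLaw f) {σ : ℝ} (hσ : σ = 1 ∨ σ = -1)
    (hy1 : y.1 ∈ Icc (T.lo i) (T.hi i)) (hy : y.2 ∈ Icc (-(Real.pi / 2)) (Real.pi / 2)) (n : ℕ) :
    ∀ᶠ z in 𝓝 y, T.Cone σ i y z → z ∉ T.singularSetOfOrder f n := by
  by_cases hfr : ∃ᶠ z in 𝓝 y, T.Cone σ i y z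
  · obtain ⟨ι, -, -, h⟩ := Cone.exists_itin hf hσ hy1 hy hfr n
    filter_upwards [h] with z hz hzc
    exact (hz hzc).notMem
  · filter_upwards [not_frequently.1 hfr] with z hz hzc
    exact absurd hzc hz

end PolygonalTable

/-- Regular `C²` arcs issuing from `x`, and otherwise disjoint. -/
structure ArcStar (x : ℝ × ℝ) {m : ℕ} (γ : Fin m → ℝ → ℝ × ℝ) : Prop where
  arc : ∀ i, γ i 0 = x ∧ ContDiffOn ℝ 2 (γ i) (Icc 0 1) ∧ InjOn (γ i) (Icc 0 1) ∧
      ∀ t ∈ Icc (0 : ℝ) 1, derivWithin (γ i) (Icc 0 1) t ≠ 0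
  disj : ∀ i j, i ≠ j → Disjoint (γ i '' Ioc 0 1) (γ j '' Ioc 0 1)

namespace ArcStar

variable {x : ℝ × ℝ} {m : ℕ} {γ : Fin m → ℝ → ℝ × ℝ} (hγ : ArcStar x γ)
include hγ

lemma continuousOn (i : Fin m) : ContinuousOn (γ i) (Icc 0 1) := (hγ.arc i).2.1.continuousOn

lemma isClosed_image (i : Fin m) {a b : ℝ} (ha : 0 ≤ a) (hb : b ≤ 1) :
    IsClosed (γ i '' Icc a b) :=
  (isCompact_Icc.image_of_continuousOn
    ((hγ.continuousOn i).mono (Icc_subset_Icc ha hb))).isClosed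

lemma mem_Ioc {i : Fin m} {t : ℝ} (ht : t ∈ Icc (0:ℝ) 1) (h : γ i t ≠ x) : t ∈ Ioc (0:ℝ) 1 :=
  ⟨lt_of_le_of_ne ht.1 fun h0 => h (by rw [← h0, (hγ.arc i).1]), ht.2⟩

lemma ne_of_mem_Ioc {i : Fin m} {t : ℝ} (ht : t ∈ Ioc (0:ℝ) 1) : γ i t ≠ x := fun h => by
  have := (hγ.arc i).2.2.1 ⟨ht.1.le, ht.2⟩ ⟨le_rfl, zero_le_one⟩ (h.trans (hγ.arc i).1.symm)
  exact ht.1.ne' this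

lemma eq_of_mem {i j : Fin m} {p : ℝ × ℝ} (hi : p ∈ γ i '' Icc 0 1) (hj : p ∈ γ j '' Icc 0 1)
    (hp : p ≠ x) : i = j := by
  by_contra hne
  obtain ⟨t, ht, rfl⟩ := hi
  obtain ⟨t', ht', he⟩ := hj
  exact disjoint_left.1 (hγ.disj i j hne) ⟨t, hγ.mem_Ioc ht hp, rfl⟩
    ⟨t', hγ.mem_Ioc ht' (by rw [he]; exact hp), he⟩

lemma hasDerivAt {i : Fin m} {t : ℝ} (ht : t ∈ Ioo (0:ℝ) 1) :
    ∃ v, v ≠ 0 ∧ HasDerivAt (γ i) v t := by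
  have h1 := (((hγ.arc i).2.1.differentiableOn (by norm_num)) t
    (Ioo_subset_Icc_self ht)).hasDerivWithinAt
  exact ⟨_, (hγ.arc i).2.2.2 t (Ioo_subset_Icc_self ht), h1.hasDerivAt (Icc_mem_nhds ht.1 ht.2)⟩

/-- A chord of `B` from a supported point `q`, contained in the arcs and missing their origin, is in
one of them, and ends it. -/
lemma segment_end {B : Set (ℝ × ℝ)} (hB : ∀ i, γ i '' Icc 0 1 ⊆ B) {q c : ℝ × ℝ}
    (hseg : segment ℝ q c ⊆ ⋃ i, γ i '' Icc 0 1) (hx : x ∉ segment ℝ q c)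
    (l : ℝ × ℝ →L[ℝ] ℝ) (hmax : ∀ p ∈ B, l p ≤ l q) (hlt : l c < l q) :
    ∃ k t, t ∈ Ioc (0:ℝ) 1 ∧ γ k t = c ∧ γ k 1 = q ∧ segment ℝ q c ⊆ γ k '' Icc 0 1 ∧
      γ k '' Icc t 1 ⊆ segment ℝ q c := by
  have hqc : q ≠ c := fun h => by rw [h] at hlt; exact lt_irrefl _ hlt
  have hpre : IsPreconnected (segment ℝ q c) := (convex_segment q c).isPreconnected
  have hq := left_mem_segment ℝ q c
  have hc := right_mem_segment ℝ q c
  obtain ⟨k, hk⟩ := mem_iUnion.1 (hseg hq)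
  have hsub : segment ℝ q c ⊆ γ k '' Icc 0 1 := by
    rcases isPreconnected_iff_subset_of_disjoint_closed.1 hpre (γ k '' Icc 0 1)
      (⋃ i ∈ {i | i ≠ k}, γ i '' Icc 0 1) (hγ.isClosed_image k le_rfl le_rfl)
      ((toFinite _).isClosed_biUnion fun i _ => hγ.isClosed_image i le_rfl le_rfl)
      (fun p hp => by
        obtain ⟨i, hi⟩ := mem_iUnion.1 (hseg hp)
        by_cases h : i = k
        · exact Or.inl (h ▸ hi)
        · exact Or.inr (mem_iUnion₂.2 ⟨i, h, hi⟩))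
      (by
        rw [eq_empty_iff_forall_notMem]
        rintro p ⟨hp, hp1, hp2⟩
        obtain ⟨i, hi, hpi⟩ := mem_iUnion₂.1 hp2
        exact hi (hγ.eq_of_mem hpi hp1 fun h => hx (h ▸ hp))) with h | h
    · exact h
    · obtain ⟨i, hi, hpi⟩ := mem_iUnion₂.1 (h hq)
      exact absurd (hγ.eq_of_mem hpi hk fun h => hx (h ▸ hq)) hi
  obtain ⟨t1, ht1, hqt⟩ := hk
  obtain ⟨t, ht, hct⟩ := hsub hc
  have hne : t ≠ t1 := fun h => hqc (by rw [← hqt, ← hct, h])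
  have hord : ∀ a ∈ Icc (0:ℝ) 1, ∀ b ∈ Icc (0:ℝ) 1, γ k a ∈ segment ℝ q c →
      γ k b ∈ segment ℝ q c → ∀ s ∈ Icc a b, γ k s ∈ segment ℝ q c := by
    intro a ha b hb hga hgb s hs
    have hcont : Continuous (fun s : Icc (0:ℝ) 1 => γ k s) :=
      continuousOn_iff_continuous_domRestrict.1 (hγ.continuousOn k)
    have h1 := hpre.preimage_of_isClosedMap (f := fun s : Icc (0:ℝ) 1 => γ k s)
      (fun s s' h => Subtype.ext ((hγ.arc k).2.2.1 s.2 s'.2 h)) hcont.isClosedMap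
      (fun p hp => by obtain ⟨s, hs, rfl⟩ := hsub hp; exact ⟨⟨s, hs⟩, rfl⟩)
    have h2 := (h1.image Subtype.val continuous_subtype_val.continuousOn).ordConnected
    obtain ⟨s', hs', rfl⟩ := h2.out ⟨⟨a, ha⟩, hga, rfl⟩ ⟨⟨b, hb⟩, hgb, rfl⟩ hs
    exact hs'
  have hsegu : ∀ s ∈ uIcc t t1, γ k s ∈ segment ℝ q c := by
    intro s hs
    rcases le_total t t1 with h | h
    · rw [uIcc_of_le h] at hs
      exact hord t ht t1 ht1 (hct ▸ hc) (hqt ▸ hq) s hs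
    · rw [uIcc_of_ge h] at hs
      exact hord t1 ht1 t ht (hqt ▸ hq) (hct ▸ hc) s hs
  have ht1' : t1 = 1 := by
    by_contra h1
    have h0 : t1 ∈ Ioo (0:ℝ) 1 :=
      ⟨(hγ.mem_Ioc ht1 (by rw [hqt]; exact fun h => hx (h ▸ hq))).1, lt_of_le_of_ne ht1.2 h1⟩
    obtain ⟨v, hv, hd⟩ := hγ.hasDerivAt (i := k) h0
    have hlv : l v = 0 := by
      refine IsLocalMax.hasDerivAt_eq_zero (f := fun s => l (γ k s)) (a := t1) ?_
        (l.hasFDerivAt.comp_hasDerivAt t1 hd)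
      filter_upwards [Icc_mem_nhds h0.1 h0.2] with s hs
      rw [hqt]
      exact hmax _ (hB k ⟨s, hs, rfl⟩)
    have hcross : ∀ p ∈ segment ℝ q c, (c.1 - q.1) * p.2 - (c.2 - q.2) * p.1 =
        (c.1 - q.1) * q.2 - (c.2 - q.2) * q.1 := by
      intro p hp
      rw [segment_eq_image_lineMap] at hp
      obtain ⟨a, -, rfl⟩ := hp
      simp only [AffineMap.lineMap_apply, vsub_eq_sub, vadd_eq_add, Prod.fst_add, Prod.snd_add,
        Prod.smul_fst, Prod.smul_snd, Prod.fst_sub, Prod.snd_sub, smul_eq_mul]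
      ring
    have hd2 : HasDerivAt (fun s => (c.1 - q.1) * (γ k s).2 - (c.2 - q.2) * (γ k s).1)
        ((c.1 - q.1) * v.2 - (c.2 - q.2) * v.1) t1 :=
      (((hasFDerivAt_snd (𝕜 := ℝ)).comp_hasDerivAt t1 hd).const_mul _).sub
        (((hasFDerivAt_fst (𝕜 := ℝ)).comp_hasDerivAt t1 hd).const_mul _)
    have hd3 : HasDerivWithinAt (fun s => (c.1 - q.1) * (γ k s).2 - (c.2 - q.2) * (γ k s).1)
        0 (uIcc t t1) t1 :=
      (hasDerivWithinAt_const t1 _ ((c.1 - q.1) * q.2 - (c.2 - q.2) * q.1)).congr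
        (fun s hs => hcross _ (hsegu s hs)) (hcross _ (hsegu t1 right_mem_uIcc))
    have huniq : UniqueDiffWithinAt ℝ (uIcc t t1) t1 :=
      uniqueDiffOn_Icc (by rcases lt_or_gt_of_ne hne with h | h <;> simp [h]) t1 right_mem_uIcc
    have hLv : (c.1 - q.1) * v.2 - (c.2 - q.2) * v.1 = 0 :=
      huniq.eq_deriv _ hd2.hasDerivWithinAt hd3
    have hrep : ∀ w : ℝ × ℝ, l w = w.1 * l (1, 0) + w.2 * l (0, 1) := by
      intro w
      have : w = w.1 • ((1, 0) : ℝ × ℝ) + w.2 • ((0, 1) : ℝ × ℝ) := by ext <;> simp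
      conv_lhs => rw [this]
      rw [map_add, map_smul, map_smul, smul_eq_mul, smul_eq_mul]
    have hlc : l (c - q) ≠ 0 := by rw [map_sub]; linarith
    rw [hrep] at hlv hlc
    simp only [Prod.fst_sub, Prod.snd_sub] at hlc
    apply hv
    have e1 : v.1 * ((c.1 - q.1) * l (1, 0) + (c.2 - q.2) * l (0, 1)) = 0 := by
      linear_combination (c.1 - q.1) * hlv - l (0, 1) * hLv
    have e2 : v.2 * ((c.1 - q.1) * l (1, 0) + (c.2 - q.2) * l (0, 1)) = 0 := by
      linear_combination (c.2 - q.2) * hlv + l (1, 0) * hLv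
    exact Prod.ext ((mul_eq_zero.1 e1).resolve_right hlc) ((mul_eq_zero.1 e2).resolve_right hlc)
  subst ht1'
  refine ⟨k, t, hγ.mem_Ioc ht (by rw [hct]; exact fun h => hx (h ▸ hc)), hct, hqt, hsub, ?_⟩
  rintro _ ⟨s, hs, rfl⟩
  exact hord t ht 1 ht1 (hct ▸ hc) (hqt ▸ hq) s hs

lemma half_chord {B : Set (ℝ × ℝ)} (hB : ∀ i, γ i '' Icc 0 1 ⊆ B) {q q' : ℝ × ℝ}
    (hseg : segment ℝ q q' ⊆ ⋃ i, γ i '' Icc 0 1)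
    (l : ℝ × ℝ →L[ℝ] ℝ) (hmax : ∀ p ∈ B, l p ≤ l q) (hlt : l q' < l q) {a b : ℝ}
    (hb : b ∈ Icc (0:ℝ) 1) (hxb : x = AffineMap.lineMap q q' b) (ha : 0 ≤ a) (hab : a < b)
    {i : Fin m} {t : ℝ} (ht : t ∈ Icc (0:ℝ) 1) (hit : γ i t = AffineMap.lineMap q q' a) {t' : ℝ}
    (ht' : t' ∈ Ioc (0:ℝ) 1) : γ i t' ∈ segment ℝ q q' := by
  have hqq : q ≠ q' := fun h => by rw [h] at hlt; exact lt_irrefl _ hlt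
  have hcl : IsClosed (γ i '' Icc t' 1) := hγ.isClosed_image i ht'.1.le le_rfl
  have hxn : (AffineMap.lineMap q q' b : ℝ × ℝ) ∈ (γ i '' Icc t' 1)ᶜ := by
    rintro ⟨s, hs, he⟩
    exact hγ.ne_of_mem_Ioc (i := i) ⟨ht'.1.trans_le hs.1, hs.2⟩ (he.trans hxb.symm)
  have hc : ContinuousAt (fun u : ℝ => (AffineMap.lineMap q q' u : ℝ × ℝ)) b :=
    AffineMap.lineMap_continuous.continuousAt
  have hev := (hc.eventually_mem (hcl.isOpen_compl.mem_nhds hxn)).filter_mono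
    (nhdsWithin_le_nhds (s := Iio b))
  obtain ⟨u, hu1, hu2⟩ := (hev.and (Ioo_mem_nhdsLT hab)).exists
  have hu0 : 0 < u := ha.trans_lt hu2.1
  have hseg' : segment ℝ q (AffineMap.lineMap q q' u) ⊆ segment ℝ q q' :=
    (convex_segment q q').segment_subset (left_mem_segment ℝ q q')
      (by rw [segment_eq_image_lineMap]; exact ⟨u, ⟨hu0.le, by linarith [hu2.2, hb.2]⟩, rfl⟩)
  have hsub : ∀ p, p ∈ segment ℝ q (AffineMap.lineMap q q' u) ↔
      ∃ v ∈ Icc 0 u, p = AffineMap.lineMap q q' v := by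
    intro p
    rw [segment_eq_image_lineMap]
    constructor
    · rintro ⟨v, hv, rfl⟩
      refine ⟨v * u, ⟨mul_nonneg hv.1 hu0.le, by nlinarith [hv.2]⟩, ?_⟩
      simp only [AffineMap.lineMap_apply, vsub_eq_sub, vadd_eq_add, add_sub_cancel_right, smul_smul]
    · rintro ⟨v, hv, rfl⟩
      refine ⟨v / u, ⟨div_nonneg hv.1 hu0.le, (div_le_one hu0).2 hv.2⟩, ?_⟩
      simp only [AffineMap.lineMap_apply, vsub_eq_sub, vadd_eq_add, add_sub_cancel_right, smul_smul]
      rw [div_mul_cancel₀ _ hu0.ne']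
  have hxs : x ∉ segment ℝ q (AffineMap.lineMap q q' u) := by
    rw [hsub]
    rintro ⟨v, hv, he⟩
    rw [hxb] at he
    have := AffineMap.lineMap_injective ℝ hqq he
    linarith [hv.2, hu2.2]
  have hlu : l (AffineMap.lineMap q q' u) < l q := by
    rw [AffineMap.lineMap_apply, vsub_eq_sub, vadd_eq_add, map_add, map_smul, map_sub, smul_eq_mul]
    nlinarith
  obtain ⟨k, s, hs, hks, -, hk1, hk2⟩ :=
    hγ.segment_end hB (hseg'.trans hseg) hxs l hmax hlu
  have hki : k = i := by
    refine hγ.eq_of_mem (hk1 ((hsub _).2 ⟨a, ⟨ha, hu2.1.le⟩, rfl⟩)) ⟨t, ht, hit⟩ fun h => ?_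
    exact hab.ne (AffineMap.lineMap_injective ℝ hqq (h.trans hxb))
  subst hki
  refine hseg' (hk2 ⟨t', ⟨?_, ht'.2⟩, rfl⟩)
  by_contra! hcon
  exact hu1 ⟨s, ⟨hcon.le, hs.2⟩, hks⟩

lemma chord {B : Set (ℝ × ℝ)} (hB : ∀ i, γ i '' Icc 0 1 ⊆ B) {q q' : ℝ × ℝ}
    (hseg : segment ℝ q q' ⊆ ⋃ i, γ i '' Icc 0 1)
    (l : ℝ × ℝ →L[ℝ] ℝ) (hmax : ∀ p ∈ B, l p ≤ l q) (hlt : l q' < l q)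
    (l' : ℝ × ℝ →L[ℝ] ℝ) (hmax' : ∀ p ∈ B, l' p ≤ l' q') (hlt' : l' q < l' q') :
    x ∈ segment ℝ q q' ∧ ∀ i, ∀ t ∈ Ioc (0:ℝ) 1, γ i t ∈ segment ℝ q q' →
      ∀ t' ∈ Icc (0:ℝ) 1, γ i t' ∈ segment ℝ q q' := by
  have hqq : q ≠ q' := fun h => by rw [h] at hlt; exact lt_irrefl _ hlt
  have hx : x ∈ segment ℝ q q' := by
    by_contra hx
    obtain ⟨k, -, -, -, hk, h1, -⟩ := hγ.segment_end hB hseg hx l hmax hlt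
    rw [segment_symm] at hseg hx
    obtain ⟨k', -, -, -, hk', -, -⟩ := hγ.segment_end hB hseg hx l' hmax' hlt'
    have hq' := right_mem_segment ℝ q q'
    have : k' = k := hγ.eq_of_mem ⟨1, ⟨zero_le_one, le_rfl⟩, hk'⟩ (h1 hq') (fun h => by
      rw [segment_symm] at hx; exact hx (h ▸ hq'))
    rw [this] at hk'
    exact hqq (hk.symm.trans hk')
  refine ⟨hx, fun i t ht hit t' ht' => ?_⟩
  rcases ht'.1.eq_or_lt with h0 | h0
  · rw [← h0, (hγ.arc i).1]; exact hx
  have hx' := hx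
  rw [segment_eq_image_lineMap] at hx'
  obtain ⟨b, hb, hxb⟩ := hx'
  have hit' := hit
  rw [segment_eq_image_lineMap] at hit'
  obtain ⟨a, ha, hita⟩ := hit'
  rcases lt_trichotomy a b with hab | hab | hab
  · exact hγ.half_chord hB hseg l hmax hlt hb hxb.symm ha.1 hab ⟨ht.1.le, ht.2⟩ hita.symm ⟨h0, ht'.2⟩
  · exact absurd (by rw [← hita, ← hxb, hab]) (hγ.ne_of_mem_Ioc (i := i) ht)
  · rw [segment_symm] at hseg ⊢
    refine hγ.half_chord hB hseg l' hmax' hlt' (a := 1 - a) (b := 1 - b)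
      ⟨by linarith [hb.2], by linarith [hb.1]⟩ ?_ (by linarith [ha.2]) (by linarith)
      ⟨ht.1.le, ht.2⟩ ?_ ⟨h0, ht'.2⟩
    · rw [AffineMap.lineMap_apply_one_sub, hxb]
    · rw [AffineMap.lineMap_apply_one_sub, hita]

end ArcStar

lemma closure_phaseBall {x : ℝ × ℝ} (hx : x ∈ phaseSpace) {r : ℝ} (hr : 0 < r) :
    closure (phaseBall x r) =
      {p | p ∈ phaseSpace ∧ (p.1 - x.1) ^ 2 + (p.2 - x.2) ^ 2 ≤ r ^ 2} := by
  apply Subset.antisymm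
  · refine closure_minimal (fun p hp => ⟨hp.1, hp.2.le⟩) (IsClosed.inter ?_ ?_)
    · exact isClosed_Icc.preimage continuous_snd
    · exact isClosed_le (f := fun p : ℝ × ℝ => (p.1 - x.1) ^ 2 + (p.2 - x.2) ^ 2) (by fun_prop)
        continuous_const
  · rintro p ⟨hp, hd⟩
    have hc : Continuous fun u : ℝ => (AffineMap.lineMap x p u : ℝ × ℝ) :=
      AffineMap.lineMap_continuous
    have h1 : (1:ℝ) ∈ closure (Ioo (0:ℝ) 1) := by
      rw [closure_Ioo zero_ne_one]; exact ⟨zero_le_one, le_rfl⟩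
    have := map_mem_closure hc h1 (t := phaseBall x r) (fun u hu => ?_)
    · simpa using this
    · have e1 : (AffineMap.lineMap x p u : ℝ × ℝ).1 = x.1 + u * (p.1 - x.1) := by
        simp [AffineMap.lineMap_apply]; ring
      have e2 : (AffineMap.lineMap x p u : ℝ × ℝ).2 = x.2 + u * (p.2 - x.2) := by
        simp [AffineMap.lineMap_apply]; ring
      refine ⟨?_, ?_⟩
      · change _ ∈ Icc _ _
        rw [e2]
        have hx1 := hx.1
        have hx2 := hx.2
        have hp1 := hp.1
        have hp2 := hp.2
        constructor <;> nlinarith [hu.1, hu.2]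
      · rw [e1, e2]
        have : (x.1 + u * (p.1 - x.1) - x.1) ^ 2 + (x.2 + u * (p.2 - x.2) - x.2) ^ 2 =
          u ^ 2 * ((p.1 - x.1) ^ 2 + (p.2 - x.2) ^ 2) := by ring
        rw [this]
        have hu2 : u ^ 2 < 1 := by nlinarith [hu.1, hu.2]
        have : 0 < r ^ 2 := by positivity
        nlinarith [sq_nonneg u]

/-- Linear functionals of the plane. -/
def linFun (a b : ℝ) : ℝ × ℝ →L[ℝ] ℝ :=
  a • ContinuousLinearMap.fst ℝ ℝ ℝ + b • ContinuousLinearMap.snd ℝ ℝ ℝ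

lemma linFun_apply (a b : ℝ) (p : ℝ × ℝ) : linFun a b p = a * p.1 + b * p.2 := by
  simp [linFun]

lemma linFun_le {x p q : ℝ × ℝ} {r : ℝ} (hp : (p.1 - x.1) ^ 2 + (p.2 - x.2) ^ 2 ≤ r ^ 2)
    (hq : (q.1 - x.1) ^ 2 + (q.2 - x.2) ^ 2 = r ^ 2) :
    linFun (q.1 - x.1) (q.2 - x.2) p ≤ linFun (q.1 - x.1) (q.2 - x.2) q := by
  rw [linFun_apply, linFun_apply]
  nlinarith [sq_nonneg (p.1 - q.1), sq_nonneg (p.2 - q.2)]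

namespace ArcStar

variable {x : ℝ × ℝ} {m : ℕ} {γ : Fin m → ℝ → ℝ × ℝ} (hγ : ArcStar x γ)
include hγ

lemma vertical_chord {r : ℝ} (hx : x ∈ phaseSpace) (hr : 0 < r)
    (hB : ∀ i, γ i '' Icc 0 1 ⊆ closure (phaseBall x r)) {c : ℝ} (hc : |c - x.1| < r)
    (hN : ∀ p ∈ closure (phaseBall x r), p.1 = c → p ∈ ⋃ i, γ i '' Icc 0 1) :
    x.1 = c ∧ ∀ i, ∀ t ∈ Ioc (0:ℝ) 1, (γ i t).1 = c → ∀ t' ∈ Icc (0:ℝ) 1, (γ i t').1 = c := by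
  rw [closure_phaseBall hx hr] at hB hN
  have hpi := Real.pi_pos
  have hx1 := hx.1
  have hx2 := hx.2
  have hc2 : (c - x.1) ^ 2 < r ^ 2 := by
    rw [← sq_abs (c - x.1)]; have := abs_nonneg (c - x.1); nlinarith
  obtain ⟨w, hw, hw2⟩ : ∃ w > 0, w ^ 2 = r ^ 2 - (c - x.1) ^ 2 :=
    ⟨√(r ^ 2 - (c - x.1) ^ 2), Real.sqrt_pos.2 (by linarith), Real.sq_sqrt (by linarith)⟩
  obtain ⟨b, hb⟩ : ∃ b, b = min (Real.pi / 2) (x.2 + w) := ⟨_, rfl⟩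
  obtain ⟨a, ha⟩ : ∃ a, a = max (-(Real.pi / 2)) (x.2 - w) := ⟨_, rfl⟩
  have hab : a < b := by
    rw [ha, hb, max_lt_iff, lt_min_iff, lt_min_iff]
    refine ⟨⟨?_, ?_⟩, ?_, ?_⟩ <;> linarith
  have hseg : segment ℝ ((c, a) : ℝ × ℝ) (c, b) = (fun y => (c, y)) '' Icc a b := by
    rw [← segment_eq_Icc hab.le, Prod.image_mk_segment_right]
  have hmem : ∀ p : ℝ × ℝ, p.1 = c → (p ∈ phaseSpace ∧ (p.1 - x.1) ^ 2 + (p.2 - x.2) ^ 2 ≤ r ^ 2 ↔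
      p ∈ segment ℝ ((c, a) : ℝ × ℝ) (c, b)) := by
    intro p hp
    have e : p ∈ segment ℝ ((c, a) : ℝ × ℝ) (c, b) ↔ p.2 ∈ Icc a b := by
      rw [hseg]
      constructor
      · rintro ⟨y, hy, rfl⟩; exact hy
      · intro h; exact ⟨p.2, h, Prod.ext hp.symm rfl⟩
    rw [e, hp, ha, hb, mem_Icc, max_le_iff, le_min_iff]
    constructor
    · rintro ⟨h1, h2⟩
      have h3 : (p.2 - x.2) ^ 2 ≤ w ^ 2 := by linarith
      have h4 := abs_le.1 (abs_le_of_sq_le_sq h3 hw.le)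
      exact ⟨⟨h1.1, by linarith⟩, h1.2, by linarith⟩
    · rintro ⟨⟨h1, h2⟩, h3, h4⟩
      refine ⟨⟨h1, h3⟩, ?_⟩
      have : (p.2 - x.2) ^ 2 ≤ w ^ 2 := sq_le_sq' (by linarith) (by linarith)
      linarith
  have hsub : segment ℝ ((c, a) : ℝ × ℝ) (c, b) ⊆ ⋃ i, γ i '' Icc 0 1 := by
    intro p hp
    have hpc : p.1 = c := by rw [hseg] at hp; obtain ⟨y, -, rfl⟩ := hp; rfl
    exact hN p ((hmem p hpc).2 hp) hpc
  obtain ⟨l', hl', hlt'⟩ : ∃ l : ℝ × ℝ →L[ℝ] ℝ, (∀ p ∈ {p : ℝ × ℝ | p ∈ phaseSpace ∧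
      (p.1 - x.1) ^ 2 + (p.2 - x.2) ^ 2 ≤ r ^ 2}, l p ≤ l (c, b)) ∧ l (c, a) < l (c, b) := by
    rcases le_total (Real.pi / 2) (x.2 + w) with h | h
    · rw [min_eq_left h] at hb
      refine ⟨linFun 0 1, fun p hp => ?_, ?_⟩
      · have := hp.1.2
        simpa [linFun_apply, hb] using this
      · simpa [linFun_apply] using hab
    · rw [min_eq_right h] at hb
      refine ⟨linFun (c - x.1) (b - x.2), fun p hp => linFun_le (q := (c, b)) hp.2 ?_, ?_⟩
      · simp only [hb]; linear_combination hw2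
      · simp only [linFun_apply]
        have : 0 < b - x.2 := by rw [hb]; linarith
        nlinarith
  obtain ⟨l, hl, hlt⟩ : ∃ l : ℝ × ℝ →L[ℝ] ℝ, (∀ p ∈ {p : ℝ × ℝ | p ∈ phaseSpace ∧
      (p.1 - x.1) ^ 2 + (p.2 - x.2) ^ 2 ≤ r ^ 2}, l p ≤ l (c, a)) ∧ l (c, b) < l (c, a) := by
    rcases le_total (-(Real.pi / 2)) (x.2 - w) with h | h
    · rw [max_eq_right h] at ha
      refine ⟨linFun (c - x.1) (a - x.2), fun p hp => linFun_le (q := (c, a)) hp.2 ?_, ?_⟩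
      · simp only [ha]; linear_combination hw2
      · simp only [linFun_apply]
        have : a - x.2 < 0 := by rw [ha]; linarith
        nlinarith
    · rw [max_eq_left h] at ha
      refine ⟨linFun 0 (-1), fun p hp => ?_, ?_⟩
      · have := hp.1.1
        simp only [linFun_apply, ha]; linarith
      · simp only [linFun_apply]; linarith
  obtain ⟨h1, h2⟩ := hγ.chord hB hsub l hl hlt l' hl' hlt'
  have hfst : ∀ p ∈ segment ℝ ((c, a) : ℝ × ℝ) (c, b), p.1 = c := by
    intro p hp; rw [hseg] at hp; obtain ⟨y, -, rfl⟩ := hp; rfl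
  exact ⟨hfst _ h1, fun i t ht hit t' ht' =>
    hfst _ (h2 i t ht ((hmem _ hit).1 (hB i ⟨t, ⟨ht.1.le, ht.2⟩, rfl⟩)) t' ht')⟩

lemma horizontal_chord {r : ℝ} (hx : x ∈ phaseSpace) (hr : 0 < r)
    (hB : ∀ i, γ i '' Icc 0 1 ⊆ closure (phaseBall x r)) {c : ℝ} (hc : |c - x.2| < r)
    (hcm : c ∈ Icc (-(Real.pi / 2)) (Real.pi / 2))
    (hN : ∀ p ∈ closure (phaseBall x r), p.2 = c → p ∈ ⋃ i, γ i '' Icc 0 1) :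
    x.2 = c ∧ ∀ i, ∀ t ∈ Ioc (0:ℝ) 1, (γ i t).2 = c → ∀ t' ∈ Icc (0:ℝ) 1, (γ i t').2 = c := by
  rw [closure_phaseBall hx hr] at hB hN
  have hc2 : (c - x.2) ^ 2 < r ^ 2 := by
    rw [← sq_abs (c - x.2)]; have := abs_nonneg (c - x.2); nlinarith
  obtain ⟨w, hw, hw2⟩ : ∃ w > 0, w ^ 2 = r ^ 2 - (c - x.2) ^ 2 :=
    ⟨√(r ^ 2 - (c - x.2) ^ 2), Real.sqrt_pos.2 (by linarith), Real.sq_sqrt (by linarith)⟩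
  have hseg : segment ℝ ((x.1 - w, c) : ℝ × ℝ) (x.1 + w, c) =
      (fun y => (y, c)) '' Icc (x.1 - w) (x.1 + w) := by
    rw [← segment_eq_Icc (by linarith), Prod.image_mk_segment_left]
  have hmem : ∀ p : ℝ × ℝ, p.2 = c → (p ∈ phaseSpace ∧ (p.1 - x.1) ^ 2 + (p.2 - x.2) ^ 2 ≤ r ^ 2 ↔
      p ∈ segment ℝ ((x.1 - w, c) : ℝ × ℝ) (x.1 + w, c)) := by
    intro p hp
    have e : p ∈ segment ℝ ((x.1 - w, c) : ℝ × ℝ) (x.1 + w, c) ↔ p.1 ∈ Icc (x.1 - w) (x.1 + w) := by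
      rw [hseg]
      constructor
      · rintro ⟨y, hy, rfl⟩; exact hy
      · intro h; exact ⟨p.1, h, Prod.ext rfl hp.symm⟩
    rw [e, hp, mem_Icc]
    constructor
    · rintro ⟨-, h2⟩
      have h3 : (p.1 - x.1) ^ 2 ≤ w ^ 2 := by linarith
      have h4 := abs_le.1 (abs_le_of_sq_le_sq h3 hw.le)
      constructor <;> linarith
    · rintro ⟨h1, h2⟩
      refine ⟨?_, ?_⟩
      · change p.2 ∈ Icc _ _; rw [hp]; exact hcm
      have : (p.1 - x.1) ^ 2 ≤ w ^ 2 := sq_le_sq' (by linarith) (by linarith)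
      linarith
  have hfst : ∀ p ∈ segment ℝ ((x.1 - w, c) : ℝ × ℝ) (x.1 + w, c), p.2 = c := by
    intro p hp; rw [hseg] at hp; obtain ⟨y, -, rfl⟩ := hp; rfl
  have hsub : segment ℝ ((x.1 - w, c) : ℝ × ℝ) (x.1 + w, c) ⊆ ⋃ i, γ i '' Icc 0 1 :=
    fun p hp => hN p ((hmem p (hfst p hp)).2 hp) (hfst p hp)
  obtain ⟨h1, h2⟩ := hγ.chord hB hsub
    (linFun (x.1 - w - x.1) (c - x.2))
    (fun p hp => linFun_le (q := (x.1 - w, c)) hp.2 (by linear_combination hw2))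
    (by simp only [linFun_apply]; nlinarith)
    (linFun (x.1 + w - x.1) (c - x.2))
    (fun p hp => linFun_le (q := (x.1 + w, c)) hp.2 (by linear_combination hw2))
    (by simp only [linFun_apply]; nlinarith)
  exact ⟨hfst _ h1, fun i t ht hit t' ht' =>
    hfst _ (h2 i t ht ((hmem _ hit).1 (hB i ⟨t, ⟨ht.1.le, ht.2⟩, rfl⟩)) t' ht')⟩

lemma not_isLocalExtr {i : Fin m} {t : ℝ} (ht : t ∈ Ioo (0:ℝ) 1)
    (h1 : IsLocalExtr (fun s => (γ i s).1) t) (h2 : IsLocalExtr (fun s => (γ i s).2) t) :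
    False := by
  obtain ⟨v, hv, hd⟩ := hγ.hasDerivAt (i := i) ht
  have e1 : HasDerivAt (fun s => (γ i s).1) v.1 t :=
    (ContinuousLinearMap.fst ℝ ℝ ℝ).hasFDerivAt.comp_hasDerivAt t hd
  have e2 : HasDerivAt (fun s => (γ i s).2) v.2 t :=
    (ContinuousLinearMap.snd ℝ ℝ ℝ).hasFDerivAt.comp_hasDerivAt t hd
  exact hv (Prod.ext (h1.hasDerivAt_eq_zero e1) (h2.hasDerivAt_eq_zero e2))

lemma continuousAt {i : Fin m} {t : ℝ} (ht : t ∈ Ioo (0:ℝ) 1) : ContinuousAt (γ i) t :=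
  (hγ.continuousOn i).continuousAt (Icc_mem_nhds ht.1 ht.2)

lemma eventually_ne {i : Fin m} {t : ℝ} (ht : t ∈ Ioo (0:ℝ) 1) :
    ∀ᶠ t' in 𝓝 t, t' ∈ Ioo (0:ℝ) 1 ∧ (t' ≠ t → γ i t' ≠ γ i t) := by
  filter_upwards [isOpen_Ioo.mem_nhds ht] with t' ht'
  exact ⟨ht', fun hne he => hne ((hγ.arc i).2.2.1 (Ioo_subset_Icc_self ht')
    (Ioo_subset_Icc_self ht) he)⟩

end ArcStar

namespace PolygonalTable

variable {T : PolygonalTable} {f : ℝ → ℝ} {n : ℕ} {x : ℝ × ℝ} {r : ℝ}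

lemma exists_side_toward {σ : ℝ} (hσ : σ = 1 ∨ σ = -1) (s : ℝ) :
    ∃ i : T.Side, s ∈ Icc (T.lo i) (T.hi i) ∧
      ∀ᶠ s' in 𝓝 s, 0 < σ * (s' - s) → s' ∈ Ioo (T.lo i) (T.hi i) := by
  rcases hσ with rfl | rfl
  · obtain ⟨i, hi⟩ := T.exists_side_Ico s
    refine ⟨i, Ico_subset_Icc_self hi, ?_⟩
    filter_upwards [Iio_mem_nhds hi.2] with s' hs' h
    exact ⟨by linarith [hi.1], hs'⟩
  · obtain ⟨i, hi⟩ := T.exists_side_Ioc s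
    refine ⟨i, Ioc_subset_Icc_self hi, ?_⟩
    filter_upwards [Ioi_mem_nhds hi.1] with s' hs' h
    exact ⟨hs', by linarith [hi.2]⟩

lemma mem_of_isCorner (hn : 1 ≤ n) {p : ℝ × ℝ} (hp : p ∈ phaseSpace) (h : T.IsCorner p.1) :
    p ∈ T.singularSetOfOrder f n := by
  refine ⟨hp, 0, hn, ?_⟩
  rcases hp.1.eq_or_lt with h1 | h1
  · exact Or.inr (Or.inl h1.symm)
  rcases hp.2.eq_or_lt with h2 | h2
  · exact Or.inr (Or.inr h2)
  exact Or.inl (Or.inl ⟨h, h1, h2⟩)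

lemma mem_of_mem_phaseBoundary (hn : 1 ≤ n) {p : ℝ × ℝ} (h : p.2 = -(Real.pi / 2) ∨ p.2 = Real.pi / 2) :
    p ∈ T.singularSetOfOrder f n := by
  have := Real.pi_pos
  refine ⟨?_, 0, hn, Or.inr h⟩
  change p.2 ∈ Icc _ _
  rcases h with h | h <;> rw [h] <;> constructor <;> linarith

/-- At an interior point, which is not based at a vertex, the singular set is locally in the second
and fourth quadrants. -/
lemma Base.eventually_mul_neg (hf : IsContractingLaw f) {i : T.Side} {p : ℝ × ℝ} (hp : T.Base i p) :
    ∀ᶠ q in 𝓝 p, q ∈ T.singularSetOfOrder f n → q ≠ p → (q.1 - p.1) * (q.2 - p.2) < 0 := by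
  have h1 := Cone.eventually_notMem (T := T) hf (Or.inl rfl) (Ioo_subset_Icc_self hp.1)
    (Ioo_subset_Icc_self hp.2) n
  have h2 := Cone.eventually_notMem (T := T) hf (Or.inr rfl) (Ioo_subset_Icc_self hp.1)
    (Ioo_subset_Icc_self hp.2) n
  filter_upwards [h1, h2, (T.isOpen_base i).mem_nhds hp] with q h1 h2 hb hq hne
  have hb : T.Base i q := hb
  by_contra! hcon
  rcases le_total 0 (q.1 - p.1) with h3 | h3
  · rcases le_total 0 (q.2 - p.2) with h4 | h4
    · exact h1 ⟨hb, by linarith, fun _ => by linarith, hne⟩ hq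
    · rcases h3.eq_or_lt with h5 | h5
      · exact h2 ⟨hb, by linarith, fun _ => by linarith, hne⟩ hq
      · have h6 : q.2 - p.2 = 0 := by nlinarith
        exact h1 ⟨hb, by linarith, fun _ => by linarith, hne⟩ hq
  · rcases le_total 0 (q.2 - p.2) with h4 | h4
    · rcases h3.eq_or_lt with h5 | h5
      · exact h1 ⟨hb, by linarith, fun _ => by linarith, hne⟩ hq
      · have h6 : q.2 - p.2 = 0 := by nlinarith
        exact h2 ⟨hb, by linarith, fun _ => by linarith, hne⟩ hq
    · exact h2 ⟨hb, by linarith, fun _ => by linarith, hne⟩ hq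

end PolygonalTable

namespace PolygonalTable

variable {T : PolygonalTable} {f : ℝ → ℝ} {n : ℕ} {x : ℝ × ℝ} {r : ℝ}

/-- The arcs cut out in a ball: vertical, horizontal, or monotone. -/
theorem arc_type (hf : IsContractingLaw f) (hn : 1 ≤ n) (hx : x ∈ phaseSpace) (hr : 0 < r) {m : ℕ}
    {γ : Fin m → ℝ → ℝ × ℝ} (hγ : ArcStar x γ)
    (hN : T.singularSetOfOrder f n ∩ closure (phaseBall x r) = ⋃ i, γ i '' Icc 0 1) (i : Fin m) :
    (T.IsCorner x.1 ∧ ∀ t ∈ Icc (0:ℝ) 1, (γ i t).1 = x.1) ∨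
    ((x.2 = -(Real.pi / 2) ∨ x.2 = Real.pi / 2) ∧ ∀ t ∈ Icc (0:ℝ) 1, (γ i t).2 = x.2) ∨
    ((∀ t ∈ Ioc (0:ℝ) 1, γ i t ∈ phaseBall x r →
        (γ i t).2 ∈ Ioo (-(Real.pi / 2)) (Real.pi / 2)) ∧
      ∃ σ : ℝ, (σ = 1 ∨ σ = -1) ∧ ∀ t ∈ Icc (0:ℝ) 1, ∀ t' ∈ Icc (0:ℝ) 1, t < t' →
        0 < σ * ((γ i t').1 - (γ i t).1) ∧ σ * ((γ i t').2 - (γ i t).2) < 0) := by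
  have hpi := Real.pi_pos
  have hB : ∀ i, γ i '' Icc 0 1 ⊆ closure (phaseBall x r) := fun i p hp =>
    (hN.superset (mem_iUnion.2 ⟨i, hp⟩)).2
  by_cases hV : ∃ t ∈ Ioc (0:ℝ) 1, T.IsCorner (γ i t).1 ∧ |(γ i t).1 - x.1| < r
  · left
    obtain ⟨t, ht, hc, hlt⟩ := hV
    obtain ⟨h1, h2⟩ := hγ.vertical_chord hx hr hB hlt (fun p hp hpc => by
      rw [← hN]
      refine ⟨mem_of_isCorner hn ?_ (by rw [hpc]; exact hc), hp⟩
      rw [closure_phaseBall hx hr] at hp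
      exact hp.1)
    rw [h1]
    exact ⟨hc, h2 i t ht rfl⟩
  by_cases hH : ∃ t ∈ Ioc (0:ℝ) 1, ((γ i t).2 = -(Real.pi / 2) ∨ (γ i t).2 = Real.pi / 2) ∧
      |(γ i t).2 - x.2| < r
  · right; left
    obtain ⟨t, ht, hc, hlt⟩ := hH
    obtain ⟨h1, h2⟩ := hγ.horizontal_chord hx hr hB hlt
      (by rcases hc with h | h <;> rw [h] <;> constructor <;> linarith)
      (fun p hp hpc => by
        rw [← hN]
        exact ⟨mem_of_mem_phaseBoundary hn (by rw [hpc]; exact hc), hp⟩)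
    rw [h1]
    exact ⟨hc, h2 i t ht rfl⟩
  right; right
  have hmemN : ∀ t ∈ Icc (0:ℝ) 1, γ i t ∈ T.singularSetOfOrder f n := fun t ht =>
    (hN.superset (mem_iUnion.2 ⟨i, ⟨t, ht, rfl⟩⟩)).1
  have hmemB : ∀ t ∈ Icc (0:ℝ) 1, γ i t ∈ phaseSpace ∧
      ((γ i t).1 - x.1) ^ 2 + ((γ i t).2 - x.2) ^ 2 ≤ r ^ 2 := fun t ht => by
    have := hB i ⟨t, ht, rfl⟩
    rwa [closure_phaseBall hx hr] at this
  constructor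
  · intro t ht hU
    have hlt : |(γ i t).2 - x.2| < r := by
      refine abs_lt_of_sq_lt_sq ?_ hr.le
      have := hU.2
      nlinarith [sq_nonneg ((γ i t).1 - x.1)]
    have h1 := hU.1
    refine ⟨lt_of_le_of_ne h1.1 fun h => hH ⟨t, ht, Or.inl h.symm, hlt⟩,
      lt_of_le_of_ne h1.2 fun h => hH ⟨t, ht, Or.inr h, hlt⟩⟩
  have hIoc : ∀ {t : ℝ}, t ∈ Ioo (0:ℝ) 1 → t ∈ Ioc (0:ℝ) 1 := fun h => Ioo_subset_Ioc_self h
  have hIcc : ∀ {t : ℝ}, t ∈ Ioo (0:ℝ) 1 → t ∈ Icc (0:ℝ) 1 := fun h => Ioo_subset_Icc_self h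
  -- the points of the arc are not based at vertices
  have hnc : ∀ t ∈ Ioo (0:ℝ) 1, ¬ T.IsCorner (γ i t).1 := by
    intro t ht hc
    have hle : r ≤ |(γ i t).1 - x.1| := by
      by_contra! h; exact hV ⟨t, hIoc ht, hc, h⟩
    obtain ⟨hp1, hp2⟩ := hmemB t (hIcc ht)
    have hsq : r ^ 2 ≤ ((γ i t).1 - x.1) ^ 2 := by
      rw [← sq_abs ((γ i t).1 - x.1)]; nlinarith
    have h2 : (γ i t).2 = x.2 := by
      have : ((γ i t).2 - x.2) ^ 2 = 0 := le_antisymm (by linarith) (sq_nonneg _)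
      have := pow_eq_zero_iff (two_ne_zero) |>.1 this
      linarith
    have hpI : (γ i t).2 ∈ Ioo (-(Real.pi / 2)) (Real.pi / 2) := by
      have hz : |(γ i t).2 - x.2| < r := by rw [h2]; simpa using hr
      exact ⟨lt_of_le_of_ne hp1.1 fun h => hH ⟨t, hIoc ht, Or.inl h.symm, hz⟩,
        lt_of_le_of_ne hp1.2 fun h => hH ⟨t, hIoc ht, Or.inr h, hz⟩⟩
    obtain ⟨e, he, her⟩ : ∃ e : ℝ, (e = 1 ∨ e = -1) ∧ (γ i t).1 - x.1 = e * r := by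
      have : ((γ i t).1 - x.1 - r) * ((γ i t).1 - x.1 + r) = 0 := by
        rw [h2] at hp2; nlinarith
      rcases mul_eq_zero.1 this with h | h
      · exact ⟨1, Or.inl rfl, by linarith⟩
      · exact ⟨-1, Or.inr rfl, by linarith⟩
    have he' : -e = 1 ∨ -e = -1 := by rcases he with rfl | rfl <;> simp
    obtain ⟨k, hk, hkev⟩ := exists_side_toward (T := T) he' (γ i t).1
    have hev := Cone.eventually_notMem (T := T) (y := γ i t) hf he' hk hp1 n
    have hcont := hγ.continuousAt (i := i) ht
    have hcont1 : ContinuousAt (fun s => (γ i s).1) t := continuous_fst.continuousAt.comp hcont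
    have hcont2 : ContinuousAt (fun s => (γ i s).2) t := continuous_snd.continuousAt.comp hcont
    have key : ∀ᶠ t' in 𝓝 t, 0 ≤ -e * ((γ i t').1 - (γ i t).1) ∧
        0 ≤ e * ((γ i t').2 - (γ i t).2) := by
      filter_upwards [hcont.eventually hev, hcont1.eventually hkev, hγ.eventually_ne (i := i) ht,
        hcont2.eventually_mem (isOpen_Ioo.mem_nhds hpI)] with t' h3 h4 h5 h6
      obtain ⟨hq1, hq2⟩ := hmemB t' (hIcc h5.1)
      have hge : 0 ≤ -e * ((γ i t').1 - (γ i t).1) := by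
        have hq3 : ((γ i t').1 - x.1) ^ 2 ≤ r ^ 2 := by nlinarith [sq_nonneg ((γ i t').2 - x.2)]
        have := abs_le.1 (abs_le_of_sq_le_sq hq3 hr.le)
        rcases he with rfl | rfl <;> linarith
      refine ⟨hge, ?_⟩
      rcases hge.eq_or_lt with h7 | h7
      · have h8 : (γ i t').1 = (γ i t).1 := by rcases he with rfl | rfl <;> linarith
        have h9 : ((γ i t').2 - x.2) ^ 2 = 0 := le_antisymm (by rw [h8] at hq2; linarith) (sq_nonneg _)
        have h10 : (γ i t').2 = (γ i t).2 := by
          have := pow_eq_zero_iff (two_ne_zero) |>.1 h9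
          linarith
        rw [h10]; simp
      · by_contra! hcon
        refine h3 ⟨⟨h4 h7, h6⟩, by linarith, fun _ => hge, fun h => ?_⟩ (hmemN t' (hIcc h5.1))
        rw [h] at hcon; simp at hcon
    refine hγ.not_isLocalExtr (i := i) ht ?_ ?_
    · rcases he with rfl | rfl
      · exact Or.inr (key.mono fun t' h => by change (γ i t').1 ≤ (γ i t).1; linarith [h.1])
      · exact Or.inl (key.mono fun t' h => by change (γ i t).1 ≤ (γ i t').1; linarith [h.1])
    · rcases he with rfl | rfl
      · exact Or.inl (key.mono fun t' h => by change (γ i t).2 ≤ (γ i t').2; linarith [h.2])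
      · exact Or.inr (key.mono fun t' h => by change (γ i t').2 ≤ (γ i t).2; linarith [h.2])
  -- nor tangent to the boundary
  have hint : ∀ t ∈ Ioo (0:ℝ) 1, (γ i t).2 ∈ Ioo (-(Real.pi / 2)) (Real.pi / 2) := by
    intro t ht
    obtain ⟨hp1, hp2⟩ := hmemB t (hIcc ht)
    by_contra hcon
    have hb : (γ i t).2 = -(Real.pi / 2) ∨ (γ i t).2 = Real.pi / 2 := by
      by_contra! h
      exact hcon ⟨lt_of_le_of_ne hp1.1 fun h' => h.1 h'.symm, lt_of_le_of_ne hp1.2 h.2⟩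
    have hle : r ≤ |(γ i t).2 - x.2| := by
      by_contra! h; exact hH ⟨t, hIoc ht, hb, h⟩
    have hsq : r ^ 2 ≤ ((γ i t).2 - x.2) ^ 2 := by
      rw [← sq_abs ((γ i t).2 - x.2)]; nlinarith
    have h1 : (γ i t).1 = x.1 := by
      have : ((γ i t).1 - x.1) ^ 2 = 0 := le_antisymm (by linarith) (sq_nonneg _)
      have := pow_eq_zero_iff (two_ne_zero) |>.1 this
      linarith
    obtain ⟨k, hk⟩ := T.exists_side_of_not_isCorner (hnc t ht)
    obtain ⟨σ, hσ, hσb⟩ : ∃ σ : ℝ, (σ = 1 ∨ σ = -1) ∧ (γ i t).2 = -σ * (Real.pi / 2) := by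
      rcases hb with h | h
      · exact ⟨1, Or.inl rfl, by linarith⟩
      · exact ⟨-1, Or.inr rfl, by linarith⟩
    have hev := Cone.eventually_notMem (T := T) (y := γ i t) hf hσ (Ioo_subset_Icc_self hk) hp1 n
    have hcont := hγ.continuousAt (i := i) ht
    have hcont1 : ContinuousAt (fun s => (γ i s).1) t := continuous_fst.continuousAt.comp hcont
    have hcont2 : ContinuousAt (fun s => (γ i s).2) t := continuous_snd.continuousAt.comp hcont
    have hnear : ∀ᶠ t' in 𝓝 t, (γ i t').2 ≠ σ * (Real.pi / 2) := by
      refine hcont2.eventually_ne ?_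
      rw [hσb]; rcases hσ with rfl | rfl <;> intro h <;> linarith
    have key : ∀ᶠ t' in 𝓝 t, t' = t := by
      filter_upwards [hcont.eventually hev, hcont1.eventually_mem (isOpen_Ioo.mem_nhds hk),
        hγ.eventually_ne (i := i) ht, hnear] with t' h3 h4 h5 h6
      by_contra hne
      have hpq := h5.2 hne
      obtain ⟨hq1, hq2⟩ := hmemB t' (hIcc h5.1)
      have h7 : (γ i t').2 ≠ -σ * (Real.pi / 2) := by
        intro h
        apply hpq
        have h8 : (γ i t').2 = (γ i t).2 := by rw [h, hσb]
        have h9 : ((γ i t').1 - x.1) ^ 2 = 0 :=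
          le_antisymm (by rw [h8] at hq2; linarith) (sq_nonneg _)
        have := pow_eq_zero_iff (two_ne_zero) |>.1 h9
        exact Prod.ext (by linarith) h8
      have h8 : (γ i t').2 ∈ Ioo (-(Real.pi / 2)) (Real.pi / 2) := by
        have a := hq1.1
        have b := hq1.2
        rcases hσ with rfl | rfl
        · exact ⟨lt_of_le_of_ne a fun h => h7 (by linarith), lt_of_le_of_ne b fun h => h6 (by linarith)⟩
        · exact ⟨lt_of_le_of_ne a fun h => h6 (by linarith), lt_of_le_of_ne b fun h => h7 (by linarith)⟩
      refine h3 ⟨⟨h4, h8⟩, ?_, fun hc => ?_, hpq⟩ (hmemN t' (hIcc h5.1))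
      · rw [hσb]; rcases hσ with rfl | rfl
        · linarith [h8.1]
        · linarith [h8.2]
      · exfalso; apply hc; rw [hσb]; rcases hσ with rfl | rfl <;> simp
    have h2 := (key.filter_mono (nhdsWithin_le_nhds (s := {t}ᶜ))).and
      (eventually_mem_nhdsWithin)
    obtain ⟨t', h3, h4⟩ := h2.exists
    exact h4 h3
  have hmul : ∀ t ∈ Ioo (0:ℝ) 1, ∀ᶠ t' in 𝓝 t, t' ∈ Ioo (0:ℝ) 1 ∧ (t' ≠ t →
      ((γ i t').1 - (γ i t).1) * ((γ i t').2 - (γ i t).2) < 0) := by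
    intro t ht
    obtain ⟨k, hk⟩ := T.exists_side_of_not_isCorner (hnc t ht)
    have hb : T.Base k (γ i t) := ⟨hk, hint t ht⟩
    filter_upwards [(hγ.continuousAt (i := i) ht).eventually (hb.eventually_mul_neg (n := n) hf),
      hγ.eventually_ne (i := i) ht] with t' h1 h2
    exact ⟨h2.1, fun hne => h1 (hmemN t' (hIcc h2.1)) (h2.2 hne)⟩
  have hext : ∀ t ∈ Ioo (0:ℝ) 1, (IsLocalExtr (fun s => (γ i s).1) t ↔
      IsLocalExtr (fun s => (γ i s).2) t) := by
    intro t ht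
    have hm := hmul t ht
    constructor
    · rintro (h | h)
      · right
        filter_upwards [h, hm] with t' h1 h2
        by_contra! hcon
        have := h2.2 (by rintro rfl; exact lt_irrefl _ hcon)
        nlinarith
      · left
        filter_upwards [h, hm] with t' h1 h2
        by_contra! hcon
        have := h2.2 (by rintro rfl; exact lt_irrefl _ hcon)
        nlinarith
    · rintro (h | h)
      · right
        filter_upwards [h, hm] with t' h1 h2
        by_contra! hcon
        have := h2.2 (by rintro rfl; exact lt_irrefl _ hcon)
        nlinarith
      · left
        filter_upwards [h, hm] with t' h1 h2
        by_contra! hcon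
        have := h2.2 (by rintro rfl; exact lt_irrefl _ hcon)
        nlinarith
  have hc1 : ContinuousOn (fun s => (γ i s).1) (Icc 0 1) :=
    continuous_fst.comp_continuousOn (hγ.continuousOn i)
  have hc2 : ContinuousOn (fun s => (γ i s).2) (Icc 0 1) :=
    continuous_snd.comp_continuousOn (hγ.continuousOn i)
  have hinj : ∀ g : ℝ → ℝ, ContinuousOn g (Icc 0 1) → (∀ t ∈ Ioo (0:ℝ) 1, ¬ IsLocalExtr g t) →
      InjOn g (Icc 0 1) := by
    intro g hg hne
    have aux : ∀ a ∈ Icc (0:ℝ) 1, ∀ b ∈ Icc (0:ℝ) 1, a < b → g a ≠ g b := by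
      intro a ha b hb hab he
      obtain ⟨c, hc, hce⟩ := exists_isLocalExtr_Ioo hab
        (hg.mono (Icc_subset_Icc ha.1 hb.2)) he
      exact hne c ⟨ha.1.trans_lt hc.1, hc.2.trans_le hb.2⟩ hce
    intro a ha b hb he
    rcases lt_trichotomy a b with h | h | h
    · exact absurd he (aux a ha b hb h)
    · exact h
    · exact absurd he.symm (aux b hb a ha h)
  have hi1 := hinj _ hc1 fun t ht h => hγ.not_isLocalExtr ht h ((hext t ht).1 h)
  have hi2 := hinj _ hc2 fun t ht h => hγ.not_isLocalExtr ht ((hext t ht).2 h) h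
  have hhalf : (1/2 : ℝ) ∈ Ioo (0:ℝ) 1 := by norm_num
  have h3 := ((hmul (1/2) hhalf).filter_mono (nhdsWithin_le_nhds (s := Ioi (1/2)))).and
    eventually_mem_nhdsWithin
  obtain ⟨t', ⟨h4, h5⟩, h6⟩ := h3.exists
  have h6 : (1/2 : ℝ) < t' := h6
  have h7 := h5 h6.ne'
  rcases hc1.strictMonoOn_of_injOn_Icc' zero_le_one hi1 with m1 | m1 <;>
  rcases hc2.strictMonoOn_of_injOn_Icc' zero_le_one hi2 with m2 | m2
  · have a := m1 (hIcc hhalf) (hIcc h4) h6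
    have b := m2 (hIcc hhalf) (hIcc h4) h6
    simp only at a b
    nlinarith
  · refine ⟨1, Or.inl rfl, fun t ht t' ht' h => ?_⟩
    have a := m1 ht ht' h
    have b := m2 ht ht' h
    simp only at a b
    constructor <;> linarith
  · refine ⟨-1, Or.inr rfl, fun t ht t' ht' h => ?_⟩
    have a := m1 ht ht' h
    have b := m2 ht ht' h
    simp only at a b
    constructor <;> linarith
  · have a := m1 (hIcc hhalf) (hIcc h4) h6
    have b := m2 (hIcc hhalf) (hIcc h4) h6
    simp only at a b
    nlinarith

end PolygonalTable

lemma exists_of_mem_segment {a b p : ℝ × ℝ} (h : p ∈ segment ℝ a b) :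
    ∃ u ∈ Icc (0:ℝ) 1, p.1 = a.1 + u * (b.1 - a.1) ∧ p.2 = a.2 + u * (b.2 - a.2) := by
  rw [segment_eq_image_lineMap] at h
  obtain ⟨u, hu, rfl⟩ := h
  refine ⟨u, hu, ?_, ?_⟩ <;> simp [AffineMap.lineMap_apply] <;> ring

lemma mem_ball_prod {p q : ℝ × ℝ} {ρ : ℝ} :
    p ∈ Metric.ball q ρ ↔ |p.1 - q.1| < ρ ∧ |p.2 - q.2| < ρ := by
  rw [Metric.mem_ball, Prod.dist_eq, max_lt_iff, Real.dist_eq, Real.dist_eq]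

namespace PolygonalTable

variable {T : PolygonalTable} {f : ℝ → ℝ} {n : ℕ} {x : ℝ × ℝ} {r : ℝ} {Δ : Set (ℝ × ℝ)}

lemma IsSectorBall.exists_star (hB : T.IsSectorBall f n x r) :
    0 < r ∧ x ∈ phaseSpace ∧ ∃ (m : ℕ) (γ : Fin m → ℝ → ℝ × ℝ), ArcStar x γ ∧
      T.singularSetOfOrder f n ∩ closure (phaseBall x r) = ⋃ i, γ i '' Icc 0 1 := by
  obtain ⟨hr, hx, m, γ, h1, h2, h3⟩ := hB
  exact ⟨hr, hx.1, m, γ, ⟨h1, h2⟩, h3⟩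

lemma mem_Ioo_of_notMem (hn : 1 ≤ n) {p : ℝ × ℝ} (hp : p ∈ phaseSpace)
    (h : p ∉ T.singularSetOfOrder f n) : p.2 ∈ Ioo (-(Real.pi / 2)) (Real.pi / 2) :=
  ⟨lt_of_le_of_ne hp.1 fun he => h (mem_of_mem_phaseBoundary hn (Or.inl he.symm)),
    lt_of_le_of_ne hp.2 fun he => h (mem_of_mem_phaseBoundary hn (Or.inr he))⟩

lemma isOpen_compl_singularSet (hn : 1 ≤ n) (hB : T.IsSectorBall f n x r) :
    IsOpen (phaseBall x r \ T.singularSetOfOrder f n) := by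
  obtain ⟨hr, hx, m, γ, hγ, hN⟩ := hB.exists_star
  have e : phaseBall x r \ T.singularSetOfOrder f n =
      {p : ℝ × ℝ | p.2 ∈ Ioo (-(Real.pi / 2)) (Real.pi / 2) ∧
        (p.1 - x.1) ^ 2 + (p.2 - x.2) ^ 2 < r ^ 2} \ ⋃ i, γ i '' Icc 0 1 := by
    ext p
    constructor
    · rintro ⟨h1, h2⟩
      exact ⟨⟨mem_Ioo_of_notMem hn h1.1 h2, h1.2⟩, fun h => h2 (hN.superset h).1⟩
    · rintro ⟨⟨h1, h2⟩, h3⟩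
      have hp : p ∈ phaseBall x r := ⟨Ioo_subset_Icc_self h1, h2⟩
      exact ⟨hp, fun h => h3 (hN.subset ⟨h, subset_closure hp⟩)⟩
  rw [e]
  refine IsOpen.sdiff ((isOpen_Ioo.preimage continuous_snd).inter
    (isOpen_lt (f := fun p : ℝ × ℝ => (p.1 - x.1) ^ 2 + (p.2 - x.2) ^ 2) (by fun_prop)
      continuous_const)) ?_
  exact isClosed_iUnion_of_finite fun i => hγ.isClosed_image i le_rfl le_rfl

lemma sector_subset (hΔ : Δ ∈ T.sectors f n x r) :
    Δ ⊆ phaseBall x r \ T.singularSetOfOrder f n := by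
  obtain ⟨y, -, rfl⟩ := hΔ
  exact connectedComponentIn_subset _ _

lemma sector_nonempty (hΔ : Δ ∈ T.sectors f n x r) : Δ.Nonempty := by
  obtain ⟨y, hy, rfl⟩ := hΔ
  exact ⟨y, mem_connectedComponentIn hy⟩

lemma isPreconnected_sector (hΔ : Δ ∈ T.sectors f n x r) : IsPreconnected Δ := by
  obtain ⟨y, -, rfl⟩ := hΔ
  exact isPreconnected_connectedComponentIn

lemma isOpen_sector (hn : 1 ≤ n) (hB : T.IsSectorBall f n x r) (hΔ : Δ ∈ T.sectors f n x r) :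
    IsOpen Δ := by
  obtain ⟨y, -, rfl⟩ := hΔ
  exact (isOpen_compl_singularSet hn hB).connectedComponentIn

lemma sector_eq (hΔ : Δ ∈ T.sectors f n x r) {z : ℝ × ℝ} (hz : z ∈ Δ) :
    Δ = connectedComponentIn (phaseBall x r \ T.singularSetOfOrder f n) z := by
  obtain ⟨y, -, rfl⟩ := hΔ
  exact connectedComponentIn_eq hz

lemma subset_sector (hΔ : Δ ∈ T.sectors f n x r) {z : ℝ × ℝ} (hz : z ∈ Δ) {A : Set (ℝ × ℝ)}
    (hA : IsPreconnected A) (hzA : z ∈ A)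
    (hsub : A ⊆ phaseBall x r \ T.singularSetOfOrder f n) : A ⊆ Δ := by
  rw [sector_eq hΔ hz]
  exact hA.subset_connectedComponentIn hzA hsub

lemma mem_sector_of_mem_closure (hn : 1 ≤ n) (hB : T.IsSectorBall f n x r)
    (hΔ : Δ ∈ T.sectors f n x r) {z : ℝ × ℝ} (hz : z ∈ closure Δ)
    (hzO : z ∈ phaseBall x r \ T.singularSetOfOrder f n) : z ∈ Δ := by
  have ho : IsOpen (connectedComponentIn (phaseBall x r \ T.singularSetOfOrder f n) z) :=
    (isOpen_compl_singularSet hn hB).connectedComponentIn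
  obtain ⟨w, hw1, hw2⟩ := mem_closure_iff.1 hz _ ho (mem_connectedComponentIn hzO)
  exact subset_sector hΔ hw2 isPreconnected_connectedComponentIn hw1
    (connectedComponentIn_subset _ _) (mem_connectedComponentIn hzO)

/-- All sectors of the vertex `x` reach `x`. -/
theorem mem_closure_sector (hf : IsContractingLaw f) (hn : 1 ≤ n) (hB : T.IsSectorBall f n x r)
    (hΔ : Δ ∈ T.sectors f n x r) : x ∈ closure Δ := by
  obtain ⟨hr, hx, m, γ, hγ, hN⟩ := hB.exists_star
  obtain ⟨D, hD⟩ : ∃ D : ℝ × ℝ → ℝ, D = fun p => (p.1 - x.1) ^ 2 + (p.2 - x.2) ^ 2 := ⟨_, rfl⟩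
  have hDp : ∀ p, D p = (p.1 - x.1) ^ 2 + (p.2 - x.2) ^ 2 := fun p => by rw [hD]
  have hDc : Continuous D := by rw [hD]; fun_prop
  have hsub := sector_subset hΔ
  have hcomp : IsCompact (closure Δ) := by
    refine Metric.isCompact_of_isClosed_isBounded isClosed_closure
      (Bornology.IsBounded.closure ((Metric.isBounded_closedBall (x := x) (r := r)).subset ?_))
    intro p hp
    have h2 := (hsub hp).1.2
    rw [Metric.mem_closedBall, Prod.dist_eq, max_le_iff, Real.dist_eq, Real.dist_eq]
    exact ⟨abs_le_of_sq_le_sq (by nlinarith [sq_nonneg (p.2 - x.2)]) hr.le,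
      abs_le_of_sq_le_sq (by nlinarith [sq_nonneg (p.1 - x.1)]) hr.le⟩
  obtain ⟨z₀, hz₀, hmin⟩ := hcomp.exists_isMinOn (sector_nonempty hΔ).closure hDc.continuousOn
  have hmin : ∀ p ∈ closure Δ, D z₀ ≤ D p := fun p hp => hmin hp
  by_contra hxΔ
  have hzx : z₀ ≠ x := fun h => hxΔ (h ▸ hz₀)
  have hDpos : 0 < D z₀ := by
    rw [hDp]
    have : 0 ≤ (z₀.1 - x.1) ^ 2 + (z₀.2 - x.2) ^ 2 := by positivity
    refine lt_of_le_of_ne this fun h => hzx (Prod.ext ?_ ?_)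
    · nlinarith [sq_nonneg (z₀.1 - x.1), sq_nonneg (z₀.2 - x.2)]
    · nlinarith [sq_nonneg (z₀.1 - x.1), sq_nonneg (z₀.2 - x.2)]
  have hps : ∀ p ∈ closure Δ, p ∈ phaseSpace := fun p hp =>
    (closure_minimal (fun p hp => (hsub hp).1.1)
      (isClosed_Icc.preimage continuous_snd) : closure Δ ⊆ phaseSpace) hp
  have hz₀U : z₀ ∈ phaseBall x r := by
    refine ⟨hps _ hz₀, ?_⟩
    obtain ⟨y, hy⟩ := sector_nonempty hΔ
    have := hmin y (subset_closure hy)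
    rw [hDp, hDp] at this
    exact this.trans_lt (hsub hy).1.2
  have hDline : ∀ u : ℝ, D (z₀ + u • (x - z₀)) = (1 - u) ^ 2 * D z₀ := by
    intro u
    rw [hDp, hDp]
    simp only [Prod.fst_add, Prod.snd_add, Prod.smul_fst, Prod.smul_snd, Prod.fst_sub,
      Prod.snd_sub, smul_eq_mul]
    ring
  have hlinec : Continuous fun u : ℝ => z₀ + u • (x - z₀) := by fun_prop
  have hDlt : ∀ u ∈ Ioo (0:ℝ) 1, D (z₀ + u • (x - z₀)) < D z₀ := by
    intro u hu
    rw [hDline]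
    have : (1 - u) ^ 2 < 1 := by nlinarith [hu.1, hu.2]
    nlinarith
  have hline : ∀ᶠ u : ℝ in 𝓝[>] 0, u ∈ Ioo (0:ℝ) 1 := Ioo_mem_nhdsGT one_pos
  by_cases hzN : z₀ ∈ T.singularSetOfOrder f n
  swap
  · have h1 := mem_sector_of_mem_closure hn hB hΔ hz₀ ⟨hz₀U, hzN⟩
    have h2 : ∀ᶠ u : ℝ in 𝓝[>] 0, z₀ + u • (x - z₀) ∈ Δ :=
      (hlinec.continuousAt (x := 0)).eventually_mem
        ((isOpen_sector hn hB hΔ).mem_nhds (by simpa using h1)) |>.filter_mono nhdsWithin_le_nhds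
    obtain ⟨u, h3, h4⟩ := (h2.and hline).exists
    exact absurd (hmin _ (subset_closure h3)) (not_le.2 (hDlt u h4))
  obtain ⟨i, hi⟩ := mem_iUnion.1 (hN.subset ⟨hzN, subset_closure hz₀U⟩)
  -- near the nearest point, there is only one arc
  obtain ⟨ρ, hρ, hball⟩ : ∃ ρ > 0, ∀ p ∈ Metric.ball z₀ ρ, D p < r ^ 2 ∧
      (p ∈ T.singularSetOfOrder f n → p ∈ γ i '' Icc 0 1) := by
    have h1 : ∀ᶠ p in 𝓝 z₀, D p < r ^ 2 :=
      hDc.continuousAt.eventually_lt continuousAt_const (by rw [hDp]; exact hz₀U.2)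
    have h2 : ∀ᶠ p in 𝓝 z₀, p ∉ ⋃ j ∈ {j | j ≠ i}, γ j '' Icc 0 1 := by
      refine (((toFinite _).isClosed_biUnion fun j _ =>
        hγ.isClosed_image j le_rfl le_rfl).isOpen_compl).mem_nhds ?_
      intro h
      obtain ⟨j, hj, hzj⟩ := mem_iUnion₂.1 h
      exact hj (hγ.eq_of_mem hzj hi hzx)
    obtain ⟨ρ, hρ, hb⟩ := Metric.eventually_nhds_iff_ball.1 (h1.and h2)
    refine ⟨ρ, hρ, fun p hp => ⟨(hb p hp).1, fun hpN => ?_⟩⟩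
    have hpB : p ∈ closure (phaseBall x r) :=
      subset_closure ⟨hpN.1, by have := (hb p hp).1; rwa [hDp] at this⟩
    obtain ⟨j, hj⟩ := mem_iUnion.1 (hN.subset ⟨hpN, hpB⟩)
    by_cases hji : j = i
    · exact hji ▸ hj
    · exact absurd (mem_iUnion₂.2 ⟨j, hji, hj⟩) (hb p hp).2
  have hfreq : ∃ᶠ z in 𝓝 z₀, z ∈ Δ := mem_closure_iff_frequently.1 hz₀
  -- the case of a straight arc
  have hstraight : ∀ c : ℝ × ℝ →L[ℝ] ℝ, (∀ t ∈ Icc (0:ℝ) 1, c (γ i t) = c x) →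
      (∀ p ∈ Δ, c p ≠ c x) → False := by
    intro c hc1 hc2
    have h2 : ∀ᶠ u : ℝ in 𝓝[>] 0, z₀ + u • (x - z₀) ∈ Metric.ball z₀ ρ :=
      (hlinec.continuousAt (x := 0)).eventually_mem
        (Metric.isOpen_ball.mem_nhds (by simpa using hρ)) |>.filter_mono nhdsWithin_le_nhds
    obtain ⟨u, h3, h4⟩ := (h2.and hline).exists
    have hcz : Continuous fun z : ℝ × ℝ => z + u • (x - z) := by fun_prop
    have h5 : ∀ᶠ z in 𝓝 z₀, z + u • (x - z) ∈ Metric.ball z₀ ρ :=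
      hcz.continuousAt.eventually_mem (Metric.isOpen_ball.mem_nhds h3)
    have h6 : ∃ᶠ z in 𝓝 z₀, z + u • (x - z) ∈ Δ := by
      refine (hfreq.and_eventually (h5.and (Metric.ball_mem_nhds z₀ hρ))).mono ?_
      rintro z ⟨hz, hz1, hz2⟩
      refine subset_sector hΔ hz (convex_segment z (z + u • (x - z))).isPreconnected
        (left_mem_segment _ _ _) ?_ (right_mem_segment _ _ _)
      intro p hp
      have hpb := hball p ((convex_ball z₀ ρ).segment_subset hz2 hz1 hp)
      rw [segment_eq_image_lineMap] at hp
      obtain ⟨v, hv, rfl⟩ := hp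
      have e : (AffineMap.lineMap z (z + u • (x - z)) v : ℝ × ℝ) = z + (v * u) • (x - z) := by
        rw [AffineMap.lineMap_apply, vsub_eq_sub, add_sub_cancel_left, smul_smul, vadd_eq_add,
          add_comm]
      rw [e] at hpb ⊢
      have hvu : v * u ∈ Ico (0:ℝ) 1 :=
        ⟨mul_nonneg hv.1 h4.1.le, by nlinarith [hv.1, hv.2, h4.1, h4.2]⟩
      refine ⟨⟨?_, by have := hpb.1; rwa [hDp] at this⟩, fun hpN => ?_⟩
      · have hzp := (hsub hz).1.1
        have a1 := hzp.1
        have a2 := hzp.2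
        have a3 := hx.1
        have a4 := hx.2
        change (z + (v * u) • (x - z)).2 ∈ Icc _ _
        simp only [Prod.snd_add, Prod.smul_snd, Prod.snd_sub, smul_eq_mul]
        obtain ⟨w, hw⟩ : ∃ w, w = v * u := ⟨_, rfl⟩
        rw [← hw] at hvu ⊢
        constructor <;> nlinarith [hvu.1, hvu.2]
      · obtain ⟨t, ht, hte⟩ := hpb.2 hpN
        have := hc1 t ht
        rw [hte, map_add, map_smul, map_sub, smul_eq_mul] at this
        have h7 : (1 - v * u) * (c z - c x) = 0 := by linarith
        rcases mul_eq_zero.1 h7 with h8 | h8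
        · linarith [hvu.2]
        · exact hc2 z hz (by linarith)
    have h7 : z₀ + u • (x - z₀) ∈ closure Δ :=
      isClosed_closure.mem_of_frequently_of_tendsto (h6.mono fun _ h => subset_closure h)
        hcz.continuousAt
    exact absurd (hmin _ h7) (not_le.2 (hDlt u h4))
  obtain ⟨t₀, ht₀, rfl⟩ := hi
  rcases arc_type hf hn hx hr hγ hN i with ⟨h1, h2⟩ | ⟨h1, h2⟩ | ⟨h1, σ, hσ, h2⟩
  · refine hstraight (ContinuousLinearMap.fst ℝ ℝ ℝ) (fun t ht => h2 t ht) fun p hp he => ?_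
    have he : p.1 = x.1 := he
    exact (hsub hp).2 (mem_of_isCorner hn (hsub hp).1.1 (by rw [he]; exact h1))
  · refine hstraight (ContinuousLinearMap.snd ℝ ℝ ℝ) (fun t ht => h2 t ht) fun p hp he => ?_
    have he : p.2 = x.2 := he
    exact (hsub hp).2 (mem_of_mem_phaseBoundary hn (by rw [he]; exact h1))
  -- the case of a monotone arc
  have hzI := h1 t₀ (hγ.mem_Ioc ht₀ hzx) hz₀U
  obtain ⟨ρ', hρ', hball'⟩ : ∃ ρ > 0, ∀ p ∈ Metric.ball (γ i t₀) ρ, p ∉ γ i '' Icc 0 1 →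
      p ∈ phaseBall x r \ T.singularSetOfOrder f n := by
    have h3 : ∀ᶠ p in 𝓝 (γ i t₀), p.2 ∈ Ioo (-(Real.pi / 2)) (Real.pi / 2) :=
      continuous_snd.continuousAt.eventually_mem (isOpen_Ioo.mem_nhds hzI)
    obtain ⟨ρ', hρ', hb⟩ := Metric.eventually_nhds_iff_ball.1
      (h3.and (Metric.ball_mem_nhds (γ i t₀) hρ))
    refine ⟨ρ', hρ', fun p hp hpγ => ⟨⟨Ioo_subset_Icc_self (hb p hp).1, ?_⟩, fun hpN => ?_⟩⟩
    · have := (hball p (hb p hp).2).1; rwa [hDp] at this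
    · exact hpγ ((hball p (hb p hp).2).2 hpN)
  have ht₀' := hγ.mem_Ioc ht₀ hzx
  obtain ⟨t₁, ht₁, ht₁'⟩ : ∃ t₁ ∈ Ioo 0 t₀, γ i t₁ ∈ Metric.ball (γ i t₀) ρ' := by
    have hc : ContinuousWithinAt (γ i) (Ioo 0 t₀) t₀ :=
      ((hγ.continuousOn i) t₀ ht₀).mono fun t ht => ⟨ht.1.le, ht.2.le.trans ht₀.2⟩
    have h3 := hc (Metric.ball_mem_nhds (γ i t₀) hρ')
    have : (𝓝[Ioo 0 t₀] t₀).NeBot := by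
      rw [← mem_closure_iff_nhdsWithin_neBot, closure_Ioo ht₀'.1.ne]
      exact ⟨ht₀'.1.le, le_rfl⟩
    obtain ⟨t, h4, h5⟩ := ((show ∀ᶠ t in 𝓝[Ioo 0 t₀] t₀, γ i t ∈ Metric.ball (γ i t₀) ρ' from h3).and
      eventually_mem_nhdsWithin).exists
    exact ⟨t, h5, h4⟩
  have ht₁c : t₁ ∈ Icc (0:ℝ) 1 := ⟨ht₁.1.le, ht₁.2.le.trans ht₀.2⟩
  have m1 := h2 0 ⟨le_rfl, zero_le_one⟩ t₁ ht₁c ht₁.1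
  have m2 := h2 t₁ ht₁c t₀ ht₀ ht₁.2
  rw [(hγ.arc i).1] at m1
  have hσ2 : σ ^ 2 = 1 := by rcases hσ with rfl | rfl <;> norm_num
  have hD1 : D (γ i t₁) < D (γ i t₀) := by
    rw [hDp, hDp]
    rcases hσ with rfl | rfl <;> nlinarith
  obtain ⟨ε, hε, he1, he2, he3, he4⟩ : ∃ ε > 0,
      ((γ i t₁).1, (γ i t₁).2 + σ * ε) ∈ Metric.ball (γ i t₀) ρ' ∧
      D ((γ i t₁).1, (γ i t₁).2 + σ * ε) < D (γ i t₀) ∧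
      ((γ i t₁).1 - σ * ε, (γ i t₁).2) ∈ Metric.ball (γ i t₀) ρ' ∧
      D ((γ i t₁).1 - σ * ε, (γ i t₁).2) < D (γ i t₀) := by
    have c1 : Continuous fun ε : ℝ => (((γ i t₁).1, (γ i t₁).2 + σ * ε) : ℝ × ℝ) := by fun_prop
    have c2 : Continuous fun ε : ℝ => (((γ i t₁).1 - σ * ε, (γ i t₁).2) : ℝ × ℝ) := by fun_prop
    have e1 : ∀ᶠ ε : ℝ in 𝓝 0, ((γ i t₁).1, (γ i t₁).2 + σ * ε) ∈ Metric.ball (γ i t₀) ρ' :=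
      c1.continuousAt.eventually_mem (Metric.isOpen_ball.mem_nhds (by simpa using ht₁'))
    have e2 : ∀ᶠ ε : ℝ in 𝓝 0, ((γ i t₁).1 - σ * ε, (γ i t₁).2) ∈ Metric.ball (γ i t₀) ρ' :=
      c2.continuousAt.eventually_mem (Metric.isOpen_ball.mem_nhds (by simpa using ht₁'))
    have e3 : ∀ᶠ ε : ℝ in 𝓝 0, D ((γ i t₁).1, (γ i t₁).2 + σ * ε) < D (γ i t₀) :=
      (hDc.comp c1).continuousAt.eventually_lt continuousAt_const (by simpa using hD1)
    have e4 : ∀ᶠ ε : ℝ in 𝓝 0, D ((γ i t₁).1 - σ * ε, (γ i t₁).2) < D (γ i t₀) :=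
      (hDc.comp c2).continuousAt.eventually_lt continuousAt_const (by simpa using hD1)
    obtain ⟨ε, ⟨⟨⟨a, b⟩, c⟩, d⟩, e⟩ := ((((e1.and e2).and e3).and e4).filter_mono
      (nhdsWithin_le_nhds (s := Ioi 0))).and eventually_mem_nhdsWithin |>.exists
    exact ⟨ε, e, a, c, b, d⟩
  have hnear : ∀ᶠ z in 𝓝 (γ i t₀), z ∈ Metric.ball (γ i t₀) ρ' ∧ 0 < σ * (z.1 - (γ i t₁).1) ∧
      σ * (z.2 - (γ i t₁).2) < 0 := by
    have c1 : Continuous fun z : ℝ × ℝ => σ * (z.1 - (γ i t₁).1) := by fun_prop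
    have c2 : Continuous fun z : ℝ × ℝ => σ * (z.2 - (γ i t₁).2) := by fun_prop
    filter_upwards [Metric.ball_mem_nhds _ hρ', c1.continuousAt.eventually_mem
      (isOpen_Ioi.mem_nhds m2.1), c2.continuousAt.eventually_mem (isOpen_Iio.mem_nhds m2.2)]
      with z h3 h4 h5 using ⟨h3, h4, h5⟩
  obtain ⟨z, hz, hzb, hz1, hz2⟩ := (hfreq.and_eventually hnear).exists
  have hzγ : z ∉ γ i '' Icc 0 1 := fun h =>
    (hsub hz).2 (hN.superset (mem_iUnion.2 ⟨i, h⟩)).1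
  have hbz := mem_ball_prod.1 hzb
  have hb1 := mem_ball_prod.1 he1
  have hb3 := mem_ball_prod.1 he3
  have hpath : ∀ c e : ℝ × ℝ, c ∈ Metric.ball (γ i t₀) ρ' → e ∈ Metric.ball (γ i t₀) ρ' →
      D e < D (γ i t₀) → (∀ p ∈ segment ℝ z c, p ∉ γ i '' Icc 0 1) →
      (∀ p ∈ segment ℝ c e, p ∉ γ i '' Icc 0 1) → False := by
    intro c e hc he hDe hs1 hs2
    have hcΔ : c ∈ Δ := subset_sector hΔ hz (convex_segment z c).isPreconnected
      (left_mem_segment _ _ _) (fun p hp => hball' p ((convex_ball _ _).segment_subset hzb hc hp)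
        (hs1 p hp)) (right_mem_segment _ _ _)
    have heΔ : e ∈ Δ := subset_sector hΔ hcΔ (convex_segment c e).isPreconnected
      (left_mem_segment _ _ _) (fun p hp => hball' p ((convex_ball _ _).segment_subset hc he hp)
        (hs2 p hp)) (right_mem_segment _ _ _)
    exact absurd (hmin _ (subset_closure heΔ)) (not_le.2 hDe)
  have hσe : σ * (σ * ε) = ε := by linear_combination ε * hσ2
  by_cases hab : ∀ t ∈ Icc (0:ℝ) 1, (γ i t).1 = z.1 → σ * (γ i t).2 < σ * z.2
  · refine hpath (z.1, (γ i t₁).2 + σ * ε) _ (mem_ball_prod.2 ⟨hbz.1, hb1.2⟩) he1 he2 ?_ ?_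
    · rintro p hp ⟨t, ht, rfl⟩
      obtain ⟨u, hu, e1, e2⟩ := exists_of_mem_segment hp
      simp only [sub_self, mul_zero, add_zero] at e1
      have h3 := hab t ht e1
      rw [e2] at h3
      have h4 : 0 ≤ u * (σ * ((γ i t₁).2 + σ * ε - z.2)) := by
        refine mul_nonneg hu.1 ?_
        rw [mul_sub, mul_add, hσe]; linarith
      linarith
    · rintro p hp ⟨t, ht, rfl⟩
      obtain ⟨u, hu, e1, e2⟩ := exists_of_mem_segment hp
      simp only [sub_self, mul_zero, add_zero] at e1 e2
      have e2' : σ * (γ i t).2 = σ * (γ i t₁).2 + ε := by rw [e2, mul_add, hσe]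
      have e1' : σ * (γ i t₁).1 ≤ σ * (γ i t).1 := by
        rw [e1]
        nlinarith [hu.1, hu.2]
      rcases lt_trichotomy t t₁ with h3 | h3 | h3
      · have := h2 t ht t₁ ht₁c h3; linarith
      · rw [h3] at e2'; linarith
      · have := h2 t₁ ht₁c t ht h3; linarith
  · push Not at hab
    obtain ⟨t, ht, hte, htl⟩ := hab
    have htl' : σ * z.2 < σ * (γ i t).2 := by
      refine lt_of_le_of_ne htl fun he => hzγ ⟨t, ht, Prod.ext hte ?_⟩
      rcases hσ with rfl | rfl <;> linarith
    refine hpath ((γ i t₁).1 - σ * ε, z.2) _ (mem_ball_prod.2 ⟨hb3.1, hbz.2⟩) he3 he4 ?_ ?_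
    · rintro p hp ⟨t', ht', rfl⟩
      obtain ⟨u, hu, e1, e2⟩ := exists_of_mem_segment hp
      simp only [sub_self, mul_zero, add_zero] at e1 e2
      have e1' : σ * (γ i t').1 ≤ σ * z.1 := by
        have h4 : 0 ≤ u * (σ * (z.1 - ((γ i t₁).1 - σ * ε))) := by
          refine mul_nonneg hu.1 ?_
          rw [mul_sub, mul_sub, hσe]; linarith
        rw [e1]; linarith
      rcases lt_trichotomy t' t with h3 | h3 | h3
      · have := h2 t' ht' t ht h3
        rw [e2] at this; linarith
      · rw [h3] at e2; rw [e2] at htl'; exact lt_irrefl _ htl'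
      · have := h2 t ht t' ht' h3
        rw [hte] at this; linarith
    · rintro p hp ⟨t', ht', rfl⟩
      obtain ⟨u, hu, e1, e2⟩ := exists_of_mem_segment hp
      simp only [sub_self, mul_zero, add_zero] at e1 e2
      have e1' : σ * (γ i t').1 = σ * (γ i t₁).1 - ε := by rw [e1, mul_sub, hσe]
      have e2' : σ * (γ i t').2 ≤ σ * (γ i t₁).2 := by
        rw [e2]
        nlinarith [hu.1, hu.2]
      rcases lt_trichotomy t' t₁ with h3 | h3 | h3
      · have := h2 t' ht' t₁ ht₁c h3; linarith
      · rw [h3] at e1'; linarith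
      · have := h2 t₁ ht₁c t' ht' h3; linarith

end PolygonalTable

namespace PolygonalTable

variable (T : PolygonalTable)

/-- The angles along a given sequence of sides. -/
def th (f : ℝ → ℝ) (ι : ℕ → T.Side) (θ : ℝ) : ℕ → ℝ
  | 0 => θ
  | k + 1 => f (T.refl (ι k) (ι (k + 1)) (th f ι θ k))

/-- The absolute value of the derivative with respect to the base point, along a given sequence of
sides. -/
def al (f : ℝ → ℝ) (ι : ℕ → T.Side) (θ : ℝ) : ℕ → ℝ
  | 0 => 1
  | k + 1 => al f ι θ k * (Real.cos (T.th f ι θ k) / T.inc (ι k) (ι (k + 1)) (T.th f ι θ k))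

variable {T} {f : ℝ → ℝ} {ι ι' : ℕ → T.Side} {n : ℕ} {x y z : ℝ × ℝ} {r : ℝ} {Δ : Set (ℝ × ℝ)}

lemma trk_snd (k : ℕ) : (T.trk f ι z k).2 = T.th f ι z.2 k := by
  induction k with
  | zero => rfl
  | succ k ih => rw [trk, th, ← ih]; rfl

lemma continuous_th (hf : IsContractingLaw f) (ι : ℕ → T.Side) (k : ℕ) :
    Continuous fun θ => T.th f ι θ k := by
  induction k with
  | zero => exact continuous_id
  | succ k ih => exact (T.continuous_map_refl hf (ι k) (ι (k + 1))).comp ih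

lemma continuous_inc_th (hf : IsContractingLaw f) (ι : ℕ → T.Side) (k : ℕ) :
    Continuous fun θ => T.inc (ι k) (ι (k + 1)) (T.th f ι θ k) :=
  (T.continuous_inc _ _).comp (continuous_th hf ι k)

lemma continuousAt_al (hf : IsContractingLaw f) {θ : ℝ}
    (h : ∀ k < n, T.inc (ι k) (ι (k + 1)) (T.th f ι θ k) ≠ 0) {k : ℕ} (hk : k ≤ n) :
    ContinuousAt (fun θ => T.al f ι θ k) θ := by
  induction k with
  | zero => exact continuousAt_const
  | succ k ih =>
    exact (ih (by omega)).mul (((Real.continuous_cos.comp (continuous_th hf ι k)).continuousAt).div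
      (continuous_inc_th hf ι k).continuousAt (h k hk))

lemma arr_sub {i j : T.Side} {s s' θ : ℝ} (h : T.inc i j θ ≠ 0) :
    T.arr i j (s, θ) - T.arr i j (s', θ) = - (Real.cos θ / T.inc i j θ) * (s - s') := by
  have := T.dev_tim (i := i) (j := j) (y := (s', θ)) (z := (s, θ)) h h
  simp only [dev, sub_self, Real.sin_zero, mul_zero, add_zero] at this
  field_simp
  linarith

lemma trk_sub {s s' θ : ℝ} (h : ∀ k < n, T.inc (ι k) (ι (k + 1)) (T.th f ι θ k) ≠ 0) {k : ℕ}
    (hk : k ≤ n) : (T.trk f ι (s, θ) k).1 - (T.trk f ι (s', θ) k).1 =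
      (-1) ^ k * T.al f ι θ k * (s - s') := by
  induction k with
  | zero => simp [trk, al]
  | succ k ih =>
    have e1 : T.trk f ι (s, θ) k = ((T.trk f ι (s, θ) k).1, T.th f ι θ k) :=
      Prod.ext rfl (trk_snd k)
    have e2 : T.trk f ι (s', θ) k = ((T.trk f ι (s', θ) k).1, T.th f ι θ k) :=
      Prod.ext rfl (trk_snd k)
    change T.arr _ _ (T.trk f ι (s, θ) k) - T.arr _ _ (T.trk f ι (s', θ) k) = _
    rw [e1, e2, arr_sub (h k hk), ih (by omega), al, pow_succ]
    ring

lemma Itin.inc_th_pos (h : T.Itin f ι n z) {k : ℕ} (hk : k < n) :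
    0 < T.inc (ι k) (ι (k + 1)) (T.th f ι z.2 k) := by
  rw [← trk_snd]; exact (h k hk).inc_pos

lemma Itin.cos_th_pos (h : T.Itin f ι n z) {k : ℕ} (hk : k < n) :
    0 < Real.cos (T.th f ι z.2 k) := by
  rw [← trk_snd]; exact (h k hk).1.cos_pos

lemma Itin.al_pos (h : T.Itin f ι n z) {k : ℕ} (hk : k ≤ n) : 0 < T.al f ι z.2 k := by
  induction k with
  | zero => exact one_pos
  | succ k ih =>
    exact mul_pos (ih (by omega)) (div_pos (h.cos_th_pos hk) (h.inc_th_pos hk))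

lemma inc_le_one (i j : T.Side) (θ : ℝ) : T.inc i j θ ≤ 1 := by
  have := T.inc_sq i j θ
  nlinarith [sq_nonneg ((T.dirAt i θ * (starRingEnd ℂ) (T.dir j)).re)]

lemma Itin.le_al_mul_inc (h : T.Itin f ι n z) {c : ℝ} (hc : 0 < c)
    (hcos : ∀ k < n, c ≤ Real.cos (T.th f ι z.2 k)) {k : ℕ} (hk : k ≤ n) :
    c ^ k ≤ T.al f ι z.2 k ∧
      ∀ m < k, c ^ k ≤ T.al f ι z.2 k * T.inc (ι m) (ι (m + 1)) (T.th f ι z.2 m) := by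
  induction k with
  | zero => exact ⟨by simp [al], fun m hm => absurd hm (by omega)⟩
  | succ k ih =>
    obtain ⟨ih1, ih2⟩ := ih (by omega)
    have hi := h.inc_th_pos hk
    have hle := T.inc_le_one (ι k) (ι (k + 1)) (T.th f ι z.2 k)
    have hcc := hcos k hk
    have hdiv : c ≤ Real.cos (T.th f ι z.2 k) / T.inc (ι k) (ι (k + 1)) (T.th f ι z.2 k) := by
      rw [le_div_iff₀ hi]; nlinarith
    have hck : 0 < c ^ k := by positivity
    refine ⟨?_, fun m hm => ?_⟩
    · rw [pow_succ, al]
      exact mul_le_mul ih1 hdiv hc.le (hck.le.trans ih1)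
    · rw [pow_succ, al]
      rcases (Nat.lt_succ_iff.1 hm).eq_or_lt with rfl | hm'
      · rw [mul_assoc, div_mul_cancel₀ _ hi.ne']
        exact mul_le_mul ih1 hcc hc.le (hck.le.trans ih1)
      · have := ih2 m hm'
        rw [mul_right_comm]
        exact mul_le_mul this hdiv hc.le (hck.le.trans this)

/-- A map which is `C¹` within a set has bounded derivatives nearby. -/
lemma _root_.ContDiffWithinAt.exists_bound_fderiv {g : ℝ × ℝ → ℝ × ℝ} {s : Set (ℝ × ℝ)} {x : ℝ × ℝ}
    (h : ContDiffWithinAt ℝ 2 g s x) (hx : x ∈ s) : ∃ u : Set (ℝ × ℝ), ∃ g' : ℝ × ℝ → ℝ × ℝ →L[ℝ] ℝ × ℝ,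
      ∃ C > 0, ∀ᶠ z in 𝓝 x, z ∈ s → z ∈ u ∧ HasFDerivWithinAt g (g' z) u z ∧ ‖g' z‖ ≤ C := by
  have h1 : ContDiffWithinAt ℝ (0 + 1) g s x := h.of_le (by norm_num)
  obtain ⟨u, hu, -, g', hg', hc⟩ := (contDiffWithinAt_succ_iff_hasFDerivWithinAt (by simp)).1 h1
  rw [insert_eq_of_mem hx] at hu
  refine ⟨u, g', ‖g' x‖ + 1, by positivity, ?_⟩
  have h2 : ∀ᶠ z in 𝓝[u] x, ‖g' z‖ < ‖g' x‖ + 1 :=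
    hc.continuousWithinAt.norm.eventually_lt continuousWithinAt_const (by simp)
  have h3 : ∀ᶠ z in 𝓝 x, z ∈ u → ‖g' z‖ < ‖g' x‖ + 1 := eventually_nhdsWithin_iff.1 h2
  have h4 : ∀ᶠ z in 𝓝 x, z ∈ s → z ∈ u := eventually_nhdsWithin_iff.1 hu
  filter_upwards [h3, h4] with z h3 h4 hz
  exact ⟨h4 hz, hg' z (h4 hz), (h3 (h4 hz)).le⟩

theorem IsRegular.exists_al_bound (hf : IsContractingLaw f) (hn : 1 ≤ n)
    (hB : T.IsSectorBall f n x r) (hΔ : Δ ∈ T.sectors f n x r) (hreg : T.IsRegular f n Δ)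
    (hι : ∀ z ∈ Δ, T.Itin f ι n z) :
    ∃ C > 0, ∀ᶠ z in 𝓝 x, z ∈ Δ → T.al f ι z.2 n ≤ C ∧ 1 ≤ C * T.al f ι z.2 n := by
  obtain ⟨Ψ, Ψ', hΨ, hΨc, hinv, hΨc'⟩ := hreg
  have hxΔ := mem_closure_sector hf hn hB hΔ
  have hΔo := isOpen_sector hn hB hΔ
  obtain ⟨u, g, C, hC, hev⟩ := (hΨc x hxΔ).exists_bound_fderiv hxΔ
  obtain ⟨u', g', C', hC', hev'⟩ := (hΨc' (Ψ x) ⟨x, hxΔ, rfl⟩).exists_bound_fderiv ⟨x, hxΔ, rfl⟩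
  have hev2 : ∀ᶠ z in 𝓝 x, z ∈ closure Δ → Ψ z ∈ u' ∧ HasFDerivWithinAt Ψ' (g' (Ψ z)) u' (Ψ z) ∧
      ‖g' (Ψ z)‖ ≤ C' := by
    have h1 : Tendsto Ψ (𝓝[closure Δ] x) (𝓝 (Ψ x)) := (hΨc x hxΔ).continuousWithinAt
    have h2 := eventually_nhdsWithin_iff.1 (h1.eventually hev')
    filter_upwards [h2] with z hz hzΔ
    exact hz hzΔ ⟨z, hzΔ, rfl⟩
  refine ⟨C + C', by positivity, ?_⟩
  filter_upwards [hev, hev.eventually_nhds, hev2, hev2.eventually_nhds] with z h1 h2 h3 h4 hz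
  have hzc := subset_closure hz
  have hnear : ∀ᶠ w in 𝓝 z, w ∈ Δ := hΔo.mem_nhds hz
  obtain ⟨-, hd, hb⟩ := h1 hzc
  obtain ⟨-, hd', hb'⟩ := h3 hzc
  have hu : u ∈ 𝓝 z := by
    filter_upwards [h2, hnear] with w hw1 hw2 using (hw1 (subset_closure hw2)).1
  have hal := (hι z hz).al_pos le_rfl
  have hcurve : HasDerivAt (fun s : ℝ => ((s, z.2) : ℝ × ℝ)) (1, 0) z.1 :=
    (hasDerivAt_id z.1).prodMk (hasDerivAt_const z.1 z.2)
  have hcc : ContinuousAt (fun s : ℝ => ((s, z.2) : ℝ × ℝ)) z.1 := hcurve.continuousAt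
  have hD1 : HasDerivAt (fun s : ℝ => Ψ (s, z.2)) (g z (1, 0)) z.1 :=
    (hd.hasFDerivAt hu).comp_hasDerivAt z.1 hcurve
  have hD2 : HasDerivAt (fun s : ℝ => Ψ (s, z.2)) ((-1) ^ n * T.al f ι z.2 n, 0) z.1 := by
    have h5 : HasDerivAt (fun s : ℝ => (((T.trk f ι z n).1 + (-1) ^ n * T.al f ι z.2 n * (s - z.1),
        T.th f ι z.2 n) : ℝ × ℝ)) ((-1) ^ n * T.al f ι z.2 n, 0) z.1 := by
      refine HasDerivAt.prodMk ?_ (hasDerivAt_const _ _)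
      have := (((hasDerivAt_id z.1).sub_const z.1).const_mul
        ((-1) ^ n * T.al f ι z.2 n)).const_add (T.trk f ι z n).1
      simpa using this
    refine h5.congr_of_eventuallyEq ?_
    filter_upwards [hcc.eventually hnear] with s hs
    rw [hΨ hs, (hι _ hs).iterate_eq le_rfl]
    refine Prod.ext ?_ (trk_snd n)
    have := trk_sub (f := f) (ι := ι) (s := s) (s' := z.1) (θ := z.2)
      (fun k hk => ((hι z hz).inc_th_pos hk).ne') (le_refl n)
    simp only [Prod.mk.eta] at this
    simp only
    linarith
  have hv := hD1.unique hD2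
  have hnorm : ‖((-1) ^ n * T.al f ι z.2 n, (0:ℝ))‖ = T.al f ι z.2 n := by
    rw [Prod.norm_def, norm_zero, norm_mul, norm_pow, norm_neg, norm_one, one_pow, one_mul,
      Real.norm_of_nonneg hal.le, max_eq_left hal.le]
  have hone : ‖((1:ℝ), (0:ℝ))‖ = 1 := by rw [Prod.norm_def]; simp
  constructor
  · have := (g z).le_opNorm (1, 0)
    rw [hv, hnorm, hone, mul_one] at this
    linarith
  · have hS : {s : ℝ | Ψ (s, z.2) ∈ u'} ∈ 𝓝 z.1 := by
      filter_upwards [hcc.eventually h4, hcc.eventually hnear] with s hs1 hs2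
      exact (hs1 (subset_closure hs2)).1
    have h5 : HasDerivAt (fun s : ℝ => Ψ' (Ψ (s, z.2))) (g' (Ψ z) ((-1) ^ n * T.al f ι z.2 n, 0))
        z.1 :=
      (HasFDerivWithinAt.comp_hasDerivWithinAt z.1 (t := u') (s := {s : ℝ | Ψ (s, z.2) ∈ u'})
        (f := fun s : ℝ => Ψ (s, z.2)) hd' hD2.hasDerivWithinAt fun s hs => hs).hasDerivAt hS
    have h6 : HasDerivAt (fun s : ℝ => Ψ' (Ψ (s, z.2))) (1, 0) z.1 := by
      refine hcurve.congr_of_eventuallyEq ?_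
      filter_upwards [hcc.eventually hnear] with s hs
      exact hinv (subset_closure hs)
    have h7 := h6.unique h5
    have := (g' (Ψ z)).le_opNorm ((-1) ^ n * T.al f ι z.2 n, 0)
    rw [← h7, hnorm, hone] at this
    nlinarith

lemma frequently_mem_sector (hf : IsContractingLaw f) (hn : 1 ≤ n)
    (hB : T.IsSectorBall f n x r) (hΔ : Δ ∈ T.sectors f n x r) : ∃ᶠ z in 𝓝 x, z ∈ Δ :=
  mem_closure_iff_frequently.1 (mem_closure_sector hf hn hB hΔ)

lemma exists_itin_sector (hf : IsContractingLaw f) (hn : 1 ≤ n) (hΔ : Δ ∈ T.sectors f n x r) :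
    ∃ ι, ∀ z ∈ Δ, T.Itin f ι n z := by
  have hsub := sector_subset hΔ
  obtain ⟨z, hz⟩ := sector_nonempty hΔ
  obtain ⟨ι, hι⟩ := exists_itin hf hn (hsub hz).1.1 (hsub hz).2
  exact ⟨ι, (isPreconnected_sector hΔ).itin hf hn
    (fun w hw => ⟨(hsub hw).1.1, (hsub hw).2⟩) hz hι⟩

lemma al_eq_zero {θ : ℝ} (hc : Real.cos θ = 0) {k : ℕ} (hk : 1 ≤ k) : T.al f ι θ k = 0 := by
  induction k, hk using Nat.le_induction with
  | base => simp [al, th, hc]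
  | succ k _ ih => rw [al, ih, zero_mul]

lemma al_congr (h : ∀ k ≤ n, ι k = ι' k) {θ : ℝ} {k : ℕ} (hk : k ≤ n) :
    T.th f ι θ k = T.th f ι' θ k ∧ T.al f ι θ k = T.al f ι' θ k := by
  induction k with
  | zero => exact ⟨rfl, rfl⟩
  | succ k ih =>
    obtain ⟨h1, h2⟩ := ih (by omega)
    constructor
    · rw [th, th, h1, h k (by omega), h (k + 1) hk]
    · rw [al, al, h1, h2, h k (by omega), h (k + 1) hk]

/-- The trajectories issuing from a regular sector have limits, which do not graze the boundary. -/
theorem IsRegular.exists_acc (hf : IsContractingLaw f) (hn : 1 ≤ n)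
    (hB : T.IsSectorBall f n x r) (hΔ : Δ ∈ T.sectors f n x r) (hreg : T.IsRegular f n Δ) :
    x.2 ∈ Ioo (-(Real.pi / 2)) (Real.pi / 2) ∧ ∃ ι, (∀ z ∈ Δ, T.Itin f ι n z) ∧
      ∀ k < n, Acc (ι k) (ι (k + 1)) (T.trk f ι x k) := by
  obtain ⟨ι, hι⟩ := exists_itin_sector hf hn hΔ
  obtain ⟨C, hC, hev⟩ := hreg.exists_al_bound hf hn hB hΔ hι
  have hfr := frequently_mem_sector hf hn hB hΔ
  have hxp : x ∈ phaseSpace := hB.exists_star.2.1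
  have hx1 : x.1 ∈ Icc (T.lo (ι 0)) (T.hi (ι 0)) :=
    isClosed_Icc.mem_of_frequently_of_tendsto
      (hfr.mono fun z hz => Ioo_subset_Icc_self (hι z hz 0 hn).1.1) continuous_fst.continuousAt
  have hxI : x.2 ∈ Ioo (-(Real.pi / 2)) (Real.pi / 2) := by
    by_contra hcon
    have hb : x.2 = -(Real.pi / 2) ∨ x.2 = Real.pi / 2 := by
      by_contra! h
      exact hcon ⟨lt_of_le_of_ne hxp.1 fun h' => h.1 h'.symm, lt_of_le_of_ne hxp.2 h.2⟩
    have hc : Real.cos x.2 = 0 := by rcases hb with h | h <;> rw [h] <;> simp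
    obtain ⟨σ, hσ, hσb⟩ : ∃ σ : ℝ, (σ = 1 ∨ σ = -1) ∧ x.2 = -σ * (Real.pi / 2) := by
      rcases hb with h | h
      · exact ⟨1, Or.inl rfl, by linarith⟩
      · exact ⟨-1, Or.inr rfl, by linarith⟩
    have hcone : ∀ z ∈ Δ, T.Cone σ (ι 0) x z := by
      intro z hz
      have hbz := (hι z hz 0 hn).1
      refine ⟨hbz, ?_, fun h => absurd hc h, fun h => hcon (h ▸ hbz.2)⟩
      have := hbz.2
      change z.2 ∈ _ at this
      rw [hσb]
      rcases hσ with rfl | rfl <;> linarith [this.1, this.2]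
    obtain ⟨ι', -, hacc, hev'⟩ := Cone.exists_itin hf hσ hx1 hxp (hfr.mono hcone) n
    obtain ⟨z, hz, hz'⟩ := (hfr.and_eventually hev').exists
    have he : ∀ k ≤ n, ι k = ι' k := fun k hk => (hι z hz).unique (hz' (hcone z hz)) hn hk
    have hinc : ∀ k < n, T.inc (ι' k) (ι' (k + 1)) (T.th f ι' x.2 k) ≠ 0 := fun k hk => by
      rw [← trk_snd]; exact (hacc k hk).inc_pos.ne'
    have hcont : ContinuousAt (fun z : ℝ × ℝ => C * T.al f ι' z.2 n) x :=
      continuousAt_const.mul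
        (ContinuousAt.comp (f := fun z : ℝ × ℝ => z.2) (g := fun θ => T.al f ι' θ n) (continuousAt_al hf hinc le_rfl)
          continuous_snd.continuousAt)
    have h1 : ∀ᶠ z in 𝓝 x, C * T.al f ι' z.2 n < 1 :=
      hcont.eventually_lt continuousAt_const (by rw [al_eq_zero hc hn]; simp)
    obtain ⟨z, hz, h2, h3⟩ := (hfr.and_eventually (h1.and hev)).exists
    have := (h3 hz).2
    rw [(al_congr he le_rfl).2] at this
    linarith
  refine ⟨hxI, ι, hι, ?_⟩
  obtain ⟨b, hb0, hb, hbd⟩ := hf.exists_bound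
  have hcx := Real.cos_pos_of_mem_Ioo hxI
  have hcb : 0 < Real.cos b := Real.cos_pos_of_mem_Ioo ⟨by linarith, hb⟩
  obtain ⟨c, hc, hc1, hc2⟩ : ∃ c > 0, c < Real.cos x.2 ∧ c ≤ Real.cos b :=
    ⟨min (Real.cos x.2 / 2) (Real.cos b), lt_min (by linarith) hcb,
      (min_le_left _ _).trans_lt (by linarith), min_le_right _ _⟩
  have hcosx : ∀ᶠ z : ℝ × ℝ in 𝓝 x, c < Real.cos z.2 :=
    (Real.continuous_cos.comp continuous_snd).continuousAt.eventually_mem (isOpen_Ioi.mem_nhds hc1)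
  have hinc : ∀ k < n, 0 < T.inc (ι k) (ι (k + 1)) (T.th f ι x.2 k) := by
    intro k hk
    have h1 : ∃ᶠ z : ℝ × ℝ in 𝓝 x, T.inc (ι k) (ι (k + 1)) (T.th f ι z.2 k) ∈ Ici (c ^ n / C) := by
      refine (hfr.and_eventually (hev.and hcosx)).mono ?_
      rintro z ⟨hz, h2, h3⟩
      have hal := (h2 hz).1
      have hcos : ∀ m < n, c ≤ Real.cos (T.th f ι z.2 m) := by
        intro m hm
        rcases m with _ | m
        · exact h3.le
        · have := hbd _ (T.refl_mem_Icc (ι m) (ι (m + 1)) (T.th f ι z.2 m))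
          rw [th, ← Real.cos_abs]
          exact hc2.trans (Real.cos_le_cos_of_nonneg_of_le_pi (abs_nonneg _) (by linarith) this)
      have h4 := ((hι z hz).le_al_mul_inc hc hcos le_rfl).2 k hk
      rw [mem_Ici, div_le_iff₀ hC]
      have h5 := (hι z hz).inc_th_pos hk
      nlinarith
    have h2 := isClosed_Ici.mem_of_frequently_of_tendsto h1
      ((continuous_inc_th hf ι k).comp continuous_snd).continuousAt
    exact (show (0:ℝ) < c ^ n / C by positivity).trans_le h2
  have hinc' : ∀ k < n, T.inc (ι k) (ι (k + 1)) (T.trk f ι x k).2 ≠ 0 := fun k hk => by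
    rw [trk_snd]; exact (hinc k hk).ne'
  intro k
  induction k with
  | zero => exact fun hk => ⟨hx1, hinc 0 hk, hfr.mono fun z hz => hι z hz 0 hk⟩
  | succ k ih =>
    intro hk
    refine ⟨(ih (by omega)).arr_mem, by rw [trk_snd]; exact hinc (k + 1) hk, ?_⟩
    exact Filter.Tendsto.frequently (continuousAt_trk hf hinc' hk.le)
      (hfr.mono fun z hz => hι z hz (k + 1) hk)

end PolygonalTable

namespace PolygonalTable

variable (T : PolygonalTable)

/-- The orbit of `x` along the sides `ι 0, …, ι n` is a limit of orbits, with no grazing. -/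
structure AccPath (f : ℝ → ℝ) (ι : ℕ → T.Side) (n : ℕ) (x : ℝ × ℝ) : Prop where
  angle : x.2 ∈ Ioo (-(Real.pi / 2)) (Real.pi / 2)
  acc : ∀ k < n, Acc (ι k) (ι (k + 1)) (T.trk f ι x k)

/-- Angles from which the collisions along a given sequence of sides are transversal. -/
def Transv (f : ℝ → ℝ) (ι : ℕ → T.Side) (n : ℕ) (θ : ℝ) : Prop :=
  θ ∈ Ioo (-(Real.pi / 2)) (Real.pi / 2) ∧ ∀ m < n, 0 < T.inc (ι m) (ι (m + 1)) (T.th f ι θ m)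

/-- The times of flight along the orbit of `x`. -/
def tm (f : ℝ → ℝ) (ι : ℕ → T.Side) (x : ℝ × ℝ) (k : ℕ) : ℝ :=
  T.tim (ι k) (ι (k + 1)) (T.trk f ι x k)

/-- The normalized displacement of the angle at time `m`. -/
def ka (f : ℝ → ℝ) (ι : ℕ → T.Side) (x : ℝ × ℝ) (m : ℕ) (θ : ℝ) : ℝ :=
  (-1) ^ m * Real.sin (T.th f ι θ m - T.th f ι x.2 m) /
    (T.al f ι θ m * Real.cos (T.th f ι θ m))

/-- The time elapsed during the `m`-th flight, at the time `t` of the `k`-th flight. -/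
def wt (f : ℝ → ℝ) (ι : ℕ → T.Side) (x : ℝ × ℝ) (k : ℕ) (t : ℝ) (m : ℕ) : ℝ :=
  if m < k then T.tm f ι x m else if m = k then t else 0

/-- The displacement of the base point for which the orbit meets the orbit of `x` at the time `t` of
the `k`-th flight is `- rh`. -/
def rh (f : ℝ → ℝ) (ι : ℕ → T.Side) (x : ℝ × ℝ) (n k : ℕ) (t θ : ℝ) : ℝ :=
  ∑ m ∈ Finset.range n, T.wt f ι x k t m * T.ka f ι x m θ

variable {T} {f : ℝ → ℝ} {ι ι' : ℕ → T.Side} {n : ℕ} {x y z : ℝ × ℝ} {r : ℝ} {Δ : Set (ℝ × ℝ)}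

lemma th_mem (hf : IsContractingLaw f) {θ : ℝ} (h : θ ∈ Ioo (-(Real.pi / 2)) (Real.pi / 2)) (m : ℕ) :
    T.th f ι θ m ∈ Ioo (-(Real.pi / 2)) (Real.pi / 2) := by
  rcases m with _ | m
  · exact h
  · exact hf.map_mem_Ioo (T.refl_mem_Icc _ _ _)

lemma Transv.cos_pos (hf : IsContractingLaw f) {θ : ℝ} (h : T.Transv f ι n θ) (m : ℕ) :
    0 < Real.cos (T.th f ι θ m) := Real.cos_pos_of_mem_Ioo (th_mem hf h.1 m)

lemma Transv.al_pos (hf : IsContractingLaw f) {θ : ℝ} (h : T.Transv f ι n θ) {k : ℕ} (hk : k ≤ n) :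
    0 < T.al f ι θ k := by
  induction k with
  | zero => exact one_pos
  | succ k ih => exact mul_pos (ih (by omega)) (div_pos (h.cos_pos hf k) (h.2 k hk))

lemma AccPath.transv (h : T.AccPath f ι n x) : T.Transv f ι n x.2 :=
  ⟨h.angle, fun m hm => by rw [← trk_snd]; exact (h.acc m hm).inc_pos⟩

lemma AccPath.tm_nonneg (h : T.AccPath f ι n x) {k : ℕ} (hk : k < n) : 0 ≤ T.tm f ι x k :=
  (h.acc k hk).tim_nonneg

lemma isOpen_transv (hf : IsContractingLaw f) (ι : ℕ → T.Side) (n : ℕ) :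
    IsOpen {θ | T.Transv f ι n θ} := by
  have : {θ | T.Transv f ι n θ} = Ioo (-(Real.pi / 2)) (Real.pi / 2) ∩ ⋂ m ∈ Iio n,
      {θ | 0 < T.inc (ι m) (ι (m + 1)) (T.th f ι θ m)} := by
    ext θ
    constructor
    · rintro ⟨h1, h2⟩
      exact ⟨h1, mem_iInter₂.2 fun m hm => h2 m hm⟩
    · rintro ⟨h1, h2⟩
      exact ⟨h1, fun m hm => mem_iInter₂.1 h2 m hm⟩
  rw [this]
  exact isOpen_Ioo.inter ((finite_Iio n).isOpen_biInter fun m _ =>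
    isOpen_lt continuous_const (continuous_inc_th hf ι m))

lemma Itin.transv (h : T.Itin f ι n z) (hn : 1 ≤ n) : T.Transv f ι n z.2 :=
  ⟨(h 0 hn).1.2, fun _ hm => h.inc_th_pos hm⟩

lemma neg_one_pow_cases (m : ℕ) : ((-1:ℝ)) ^ m = 1 ∨ ((-1:ℝ)) ^ m = -1 := neg_one_pow_eq_or ℝ m

lemma Transv.th_lt (hf : IsContractingLaw f) {θ θ' : ℝ} (h : T.Transv f ι n θ)
    (h' : T.Transv f ι n θ') (hlt : θ < θ') {m : ℕ} (hm : m ≤ n) :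
    0 < (-1) ^ m * (T.th f ι θ' m - T.th f ι θ m) := by
  induction m with
  | zero => simpa [th] using hlt
  | succ m ih =>
    have ih := ih (by omega)
    have a := Ioo_subset_Icc_self (th_mem (ι := ι) hf h.1 m)
    have b := Ioo_subset_Icc_self (th_mem (ι := ι) hf h'.1 m)
    rw [pow_succ, th, th]
    rcases neg_one_pow_cases m with e | e <;> rw [e] at ih ⊢
    · have := T.map_refl_lt hf (h.2 m hm) (h'.2 m hm) a b (by linarith)
      linarith
    · have := T.map_refl_lt hf (h'.2 m hm) (h.2 m hm) b a (by linarith)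
      linarith

lemma Transv.ka_sign (hf : IsContractingLaw f) {θ : ℝ} (hx : T.Transv f ι n x.2)
    (h : T.Transv f ι n θ) {m : ℕ} (hm : m ≤ n) :
    (x.2 < θ → 0 < T.ka f ι x m θ) ∧ (θ < x.2 → T.ka f ι x m θ < 0) ∧
      (θ = x.2 → T.ka f ι x m θ = 0) := by
  have hd : 0 < T.al f ι θ m * Real.cos (T.th f ι θ m) := mul_pos (h.al_pos hf hm) (h.cos_pos hf m)
  have a := th_mem (ι := ι) hf hx.1 m
  have b := th_mem (ι := ι) hf h.1 m
  obtain ⟨-, s2, -, s4⟩ := sin_sub_sign (Ioo_subset_Icc_self a) b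
  refine ⟨fun hlt => div_pos ?_ hd, fun hlt => div_neg_of_neg_of_pos ?_ hd, fun he => ?_⟩
  · have := hx.th_lt hf h hlt hm
    rcases neg_one_pow_cases m with e | e <;> rw [e] at this ⊢
    · have := s2 (by linarith); linarith
    · have := s4 (by linarith); linarith
  · have := h.th_lt hf hx hlt hm
    rcases neg_one_pow_cases m with e | e <;> rw [e] at this ⊢
    · have := s4 (by linarith); linarith
    · have := s2 (by linarith); linarith
  · rw [ka, he, sub_self, Real.sin_zero, mul_zero, zero_div]

lemma rh_eq {k : ℕ} (hk : k < n) (t θ : ℝ) : T.rh f ι x n k t θ =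
    ∑ m ∈ Finset.range k, T.tm f ι x m * T.ka f ι x m θ + t * T.ka f ι x k θ := by
  rw [rh, ← Finset.sum_subset (Finset.range_subset_range.2 (Nat.succ_le_of_lt hk)) (fun m _ hm => ?_),
    Finset.sum_range_succ]
  · congr 1
    · refine Finset.sum_congr rfl fun m hm => ?_
      rw [wt, if_pos (Finset.mem_range.1 hm)]
    · rw [wt, if_neg (lt_irrefl k), if_pos rfl]
  · have : ¬ m < k + 1 := fun h => hm (Finset.mem_range.2 h)
    rw [wt, if_neg (by omega), if_neg (by omega), zero_mul]

lemma trk_sub_eq (hf : IsContractingLaw f) (hx : T.Transv f ι n x.2) (hz : T.Transv f ι n z.2)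
    {k : ℕ} (hk : k ≤ n) : (-1) ^ k * ((T.trk f ι z k).1 - (T.trk f ι x k).1) =
      T.al f ι z.2 k * ((z.1 - x.1) + ∑ m ∈ Finset.range k, T.tm f ι x m * T.ka f ι x m z.2) := by
  induction k with
  | zero => simp [trk, al]
  | succ k ih =>
    have ih := ih (by omega)
    have i1 : T.inc (ι k) (ι (k + 1)) (T.trk f ι x k).2 ≠ 0 := by
      rw [trk_snd]; exact (hx.2 k hk).ne'
    have i2 : T.inc (ι k) (ι (k + 1)) (T.trk f ι z k).2 ≠ 0 := by
      rw [trk_snd]; exact (hz.2 k hk).ne'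
    have e := T.dev_tim i1 i2
    rw [dev, trk_snd, trk_snd] at e
    have hc := (hz.cos_pos hf k).ne'
    have ha := (hz.al_pos hf (show k ≤ n by omega)).ne'
    have hi := (hz.2 k hk).ne'
    have hka : T.al f ι z.2 k * Real.cos (T.th f ι z.2 k) * T.ka f ι x k z.2 =
        (-1) ^ k * Real.sin (T.th f ι z.2 k - T.th f ι x.2 k) := by
      rw [ka]; field_simp
    rw [Finset.sum_range_succ, al, pow_succ]
    change (-1) ^ k * -1 * (T.arr (ι k) (ι (k + 1)) (T.trk f ι z k) -
      T.arr (ι k) (ι (k + 1)) (T.trk f ι x k)) = _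
    rw [mul_div_assoc', div_mul_eq_mul_div, eq_div_iff hi]
    rw [tm]
    linear_combination (-(-1) ^ k) * e + Real.cos (T.th f ι z.2 k) * ih -
      T.tim (ι k) (ι (k + 1)) (T.trk f ι x k) * hka

/-- The deviation at the time `t` of the `k`-th flight. -/
lemma dev_trk (hf : IsContractingLaw f) (hx : T.Transv f ι n x.2) (hz : T.Transv f ι n z.2)
    {k : ℕ} (hk : k < n) (t : ℝ) : (-1) ^ k * dev (T.trk f ι x k) (T.trk f ι z k) t =
      T.al f ι z.2 k * Real.cos (T.th f ι z.2 k) * ((z.1 - x.1) + T.rh f ι x n k t z.2) := by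
  have e := trk_sub_eq hf hx hz hk.le
  have hc := (hz.cos_pos hf k).ne'
  have ha := (hz.al_pos hf hk.le).ne'
  have hka : T.al f ι z.2 k * Real.cos (T.th f ι z.2 k) * T.ka f ι x k z.2 =
      (-1) ^ k * Real.sin (T.th f ι z.2 k - T.th f ι x.2 k) := by
    rw [ka]; field_simp
  rw [rh_eq hk, dev, trk_snd, trk_snd]
  linear_combination Real.cos (T.th f ι z.2 k) * e - t * hka

lemma dev_trk_sign (hf : IsContractingLaw f) (hx : T.Transv f ι n x.2) (hz : T.Transv f ι n z.2)
    {k : ℕ} (hk : k < n) (t σ : ℝ) : 0 < σ * dev (T.trk f ι x k) (T.trk f ι z k) t ↔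
      0 < σ * (-1) ^ k * ((z.1 - x.1) + T.rh f ι x n k t z.2) := by
  have e := dev_trk hf hx hz hk t
  have hp := mul_pos (hz.al_pos hf hk.le) (hz.cos_pos hf k)
  have h1 : ((-1:ℝ)) ^ k * (-1) ^ k = 1 := by
    rcases neg_one_pow_cases k with h | h <;> rw [h] <;> norm_num
  have : σ * dev (T.trk f ι x k) (T.trk f ι z k) t =
      (T.al f ι z.2 k * Real.cos (T.th f ι z.2 k)) *
        (σ * (-1) ^ k * ((z.1 - x.1) + T.rh f ι x n k t z.2)) := by
    linear_combination σ * (-1) ^ k * e - σ * dev (T.trk f ι x k) (T.trk f ι z k) t * h1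
  rw [this, mul_pos_iff_of_pos_left hp]

lemma continuousAt_ka (hf : IsContractingLaw f) {θ : ℝ} (h : T.Transv f ι n θ) {m : ℕ}
    (hm : m ≤ n) : ContinuousAt (T.ka f ι x m) θ := by
  unfold ka
  have hc := continuous_th hf ι m
  refine ContinuousAt.div (Continuous.continuousAt (by fun_prop)) ?_
    (mul_pos (h.al_pos hf hm) (h.cos_pos hf m)).ne'
  exact (continuousAt_al hf (fun k hk => (h.2 k hk).ne') hm).mul
    (Real.continuous_cos.comp hc).continuousAt

lemma continuousAt_rh (hf : IsContractingLaw f) {θ : ℝ} (h : T.Transv f ι n θ) (k : ℕ) (t : ℝ) :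
    ContinuousAt (T.rh f ι x n k t) θ := by
  unfold rh
  refine tendsto_finsetSum _ fun m hm => ?_
  exact continuousAt_const.mul (continuousAt_ka hf h (Finset.mem_range.1 hm).le)

lemma rh_self (hf : IsContractingLaw f) (h : T.Transv f ι n x.2) (k : ℕ) (t : ℝ) :
    T.rh f ι x n k t x.2 = 0 := by
  unfold rh
  refine Finset.sum_eq_zero fun m hm => ?_
  rw [(h.ka_sign hf h (Finset.mem_range.1 hm).le).2.2 rfl, mul_zero]

/-- The order of the checkpoints `(k, t)`. -/
def ChkLE (k : ℕ) (t : ℝ) (k' : ℕ) (t' : ℝ) : Prop := k < k' ∨ k = k' ∧ t ≤ t'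

lemma ChkLE.total (k : ℕ) (t : ℝ) (k' : ℕ) (t' : ℝ) : ChkLE k t k' t' ∨ ChkLE k' t' k t := by
  rcases lt_trichotomy k k' with h | h | h
  · exact Or.inl (Or.inl h)
  · rcases le_total t t' with h' | h'
    · exact Or.inl (Or.inr ⟨h, h'⟩)
    · exact Or.inr (Or.inr ⟨h.symm, h'⟩)
  · exact Or.inr (Or.inl h)

lemma AccPath.wt_le (h : T.AccPath f ι n x) {k k' : ℕ} {t t' : ℝ} (hk' : k' < n)
    (ht : t ≤ T.tm f ι x k) (ht' : 0 ≤ t') (hle : ChkLE k t k' t') (m : ℕ) :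
    T.wt f ι x k t m ≤ T.wt f ι x k' t' m := by
  unfold wt
  rcases hle with hlt | ⟨rfl, hle⟩
  · split_ifs with h1 h2 h3 h4 h5 h6 h7
    · exact le_rfl
    · omega
    · omega
    · subst h4; exact ht
    · omega
    · omega
    · exact h.tm_nonneg (by omega)
    · exact ht'
    · exact le_rfl
  · split_ifs with h1 h2
    · exact le_rfl
    · exact hle
    · exact le_rfl

lemma AccPath.rh_mono (hf : IsContractingLaw f) (h : T.AccPath f ι n x) {k k' : ℕ} {t t' : ℝ}
    (hk' : k' < n) (ht : t ≤ T.tm f ι x k) (ht' : 0 ≤ t') (hle : ChkLE k t k' t') {θ : ℝ}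
    (hθ : T.Transv f ι n θ) :
    (x.2 ≤ θ → T.rh f ι x n k t θ ≤ T.rh f ι x n k' t' θ) ∧
      (θ ≤ x.2 → T.rh f ι x n k' t' θ ≤ T.rh f ι x n k t θ) := by
  have hw := h.wt_le hk' ht ht' hle
  constructor
  · intro h0
    refine Finset.sum_le_sum fun m hm => ?_
    have hs := h.transv.ka_sign hf hθ (Finset.mem_range.1 hm).le
    have : 0 ≤ T.ka f ι x m θ := by
      rcases h0.eq_or_lt with e | e
      · exact (hs.2.2 e.symm).ge
      · exact (hs.1 e).le
    exact mul_le_mul_of_nonneg_right (hw m) this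
  · intro h0
    refine Finset.sum_le_sum fun m hm => ?_
    have hs := h.transv.ka_sign hf hθ (Finset.mem_range.1 hm).le
    have : T.ka f ι x m θ ≤ 0 := by
      rcases h0.eq_or_lt with e | e
      · exact (hs.2.2 e).le
      · exact (hs.2.1 e).le
    exact mul_le_mul_of_nonpos_right (hw m) this

lemma AccPath.rh_strict (hf : IsContractingLaw f) (h : T.AccPath f ι n x) {k k' : ℕ} {t t' : ℝ}
    (hk' : k' < n) (ht : t ≤ T.tm f ι x k) (ht' : 0 ≤ t') (hle : ChkLE k t k' t') {θ : ℝ}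
    (hne : T.rh f ι x n k t θ ≠ T.rh f ι x n k' t' θ) {θ' : ℝ}
    (hθ' : T.Transv f ι n θ') :
    (x.2 < θ' → T.rh f ι x n k t θ' < T.rh f ι x n k' t' θ') ∧
      (θ' < x.2 → T.rh f ι x n k' t' θ' < T.rh f ι x n k t θ') := by
  have hw := h.wt_le hk' ht ht' hle
  have hm := h.rh_mono hf hk' ht ht' hle hθ'
  obtain ⟨m, hmn, hwm⟩ : ∃ m ∈ Finset.range n, T.wt f ι x k t m < T.wt f ι x k' t' m := by
    by_contra! hcon
    apply hne
    refine Finset.sum_congr rfl fun m hm => ?_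
    rw [le_antisymm (hw m) (hcon m hm)]
  constructor
  · intro h0
    refine Finset.sum_lt_sum (fun m hm => ?_) ⟨m, hmn, ?_⟩
    · have hs := (h.transv.ka_sign hf hθ' (Finset.mem_range.1 hm).le).1 h0
      exact mul_le_mul_of_nonneg_right (hw m) hs.le
    · have hs := (h.transv.ka_sign hf hθ' (Finset.mem_range.1 hmn).le).1 h0
      exact mul_lt_mul_of_pos_right hwm hs
  · intro h0
    refine Finset.sum_lt_sum (fun m hm => ?_) ⟨m, hmn, ?_⟩
    · have hs := (h.transv.ka_sign hf hθ' (Finset.mem_range.1 hm).le).2.1 h0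
      exact mul_le_mul_of_nonpos_right (hw m) hs.le
    · have hs := (h.transv.ka_sign hf hθ' (Finset.mem_range.1 hmn).le).2.1 h0
      exact mul_lt_mul_of_neg_right hwm hs

end PolygonalTable

/-- An open set of the plane with connected nonempty horizontal sections over an interval. -/
lemma isPreconnected_of_sections {O : Set (ℝ × ℝ)} (hO : IsOpen O) {I : Set ℝ}
    (hI : IsPreconnected I) (hsec : ∀ θ ∈ I, IsPreconnected {s | (s, θ) ∈ O})
    (hne : ∀ θ ∈ I, ∃ s, (s, θ) ∈ O) : IsPreconnected {z | z ∈ O ∧ z.2 ∈ I} := by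
  rw [isPreconnected_iff_subset_of_disjoint]
  intro u v hu hv hcov hdisj
  have hop : ∀ w : Set (ℝ × ℝ), IsOpen w → IsOpen (Prod.snd '' (O ∩ w)) := fun w hw =>
    isOpenMap_snd _ (hO.inter hw)
  have hnot : ∀ p q : ℝ × ℝ, p ∈ O → q ∈ O → p ∈ u → q ∈ v → p.2 = q.2 → p.2 ∈ I → False := by
    intro p q hp hq hpu hqv he hpI
    have hs := hsec p.2 hpI
    have hc : Continuous fun s : ℝ => ((s, p.2) : ℝ × ℝ) := by fun_prop
    obtain ⟨s, hs1, hs2, hs3⟩ := hs (((fun s : ℝ => ((s, p.2) : ℝ × ℝ))) ⁻¹' u)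
      (((fun s : ℝ => ((s, p.2) : ℝ × ℝ))) ⁻¹' v) (hu.preimage hc) (hv.preimage hc)
      (fun s hs => hcov ⟨hs, hpI⟩) ⟨p.1, hp, hpu⟩
      ⟨q.1, by change (q.1, p.2) ∈ O; rw [he]; exact hq, by change (q.1, p.2) ∈ v; rw [he]; exact hqv⟩
    have : ((s, p.2) : ℝ × ℝ) ∈ (∅ : Set (ℝ × ℝ)) := hdisj ▸ ⟨⟨hs1, hpI⟩, hs2, hs3⟩
    exact this
  rcases isPreconnected_iff_subset_of_disjoint.1 hI _ _ (hop u hu) (hop v hv)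
    (fun θ hθ => by
      obtain ⟨s, hs⟩ := hne θ hθ
      rcases hcov ⟨hs, hθ⟩ with h | h
      · exact Or.inl ⟨_, ⟨hs, h⟩, rfl⟩
      · exact Or.inr ⟨_, ⟨hs, h⟩, rfl⟩)
    (by
      rw [eq_empty_iff_forall_notMem]
      rintro θ ⟨hθ, ⟨p, hp, rfl⟩, q, hq, he⟩
      exact hnot p q hp.1 hq.1 hp.2 hq.2 he.symm hθ) with h | h
  · left
    rintro p ⟨hp, hpI⟩
    rcases hcov ⟨hp, hpI⟩ with h1 | h1
    · exact h1
    · obtain ⟨q, hq, he⟩ := h hpI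
      exact (hnot q p hq.1 hp hq.2 h1 he (he ▸ hpI)).elim
  · right
    rintro p ⟨hp, hpI⟩
    rcases hcov ⟨hp, hpI⟩ with h1 | h1
    · obtain ⟨q, hq, he⟩ := h hpI
      exact (hnot p q hp hq.1 h1 hq.2 he.symm hpI).elim
    · exact h1

namespace PolygonalTable

variable {T : PolygonalTable} {f : ℝ → ℝ} {ι ι' : ℕ → T.Side} {n : ℕ} {x y z : ℝ × ℝ} {r : ℝ}
  {Δ Δ' : Set (ℝ × ℝ)}

/-- The times, up to `b`, at which the ray of `y` is at a vertex. -/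
def vtimes (T : PolygonalTable) (i : T.Side) (y : ℝ × ℝ) (b : ℝ) : Set ℝ :=
  {t | t ∈ Icc 0 b ∧ T.ray i y t ∈ T.verts}

lemma ray_injective (i : T.Side) (y : ℝ × ℝ) : Function.Injective (T.ray i y) := by
  intro t t' h
  unfold ray at h
  have h1 : (t - t') • T.dirAt i y.2 = 0 := by
    rw [sub_smul]; exact sub_eq_zero.2 (add_left_cancel h)
  have h2 : T.dirAt i y.2 ≠ 0 := fun h0 => by
    have := T.norm_dirAt i y.2; rw [h0, norm_zero] at this; exact zero_ne_one this
  have := (smul_eq_zero.1 h1).resolve_right h2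
  linarith

lemma finite_vtimes (i : T.Side) (y : ℝ × ℝ) (b : ℝ) : (T.vtimes i y b).Finite :=
  Finite.subset (T.finite_verts.preimage (ray_injective i y).injOn) fun _ ht => ht.2

/-- The checkpoints of the orbit of `x`. -/
def chks (T : PolygonalTable) (f : ℝ → ℝ) (ι : ℕ → T.Side) (n : ℕ) (x : ℝ × ℝ) : Set (ℕ × ℝ) :=
  {c | c.1 < n ∧ c.2 ∈ T.vtimes (ι c.1) (T.trk f ι x c.1) (T.tm f ι x c.1)}

lemma finite_chks (f : ℝ → ℝ) (ι : ℕ → T.Side) (n : ℕ) (x : ℝ × ℝ) : (T.chks f ι n x).Finite := by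
  have : (⋃ k ∈ Iio n, (fun t => (k, t)) '' T.vtimes (ι k) (T.trk f ι x k) (T.tm f ι x k)).Finite :=
    (finite_Iio n).biUnion fun k _ => (finite_vtimes _ _ _).image _
  refine this.subset fun c hc => ?_
  exact mem_iUnion₂.2 ⟨c.1, hc.1, c.2, hc.2, rfl⟩

lemma AccPath.continuousAt_trk (hf : IsContractingLaw f) (h : T.AccPath f ι n x) {k : ℕ}
    (hk : k ≤ n) : ContinuousAt (fun z => T.trk f ι z k) x :=
  PolygonalTable.continuousAt_trk hf (fun k hk => (h.acc k hk).inc_pos.ne') hk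

lemma AccPath.eventually_transv (hf : IsContractingLaw f) (h : T.AccPath f ι n x) :
    ∀ᶠ z : ℝ × ℝ in 𝓝 x, T.Transv f ι n z.2 :=
  continuous_snd.continuousAt.eventually_mem ((isOpen_transv hf ι n).mem_nhds h.transv)

/-- The signs at the checkpoints are constant. -/
lemma AccPath.exists_signs (hf : IsContractingLaw f) (h : T.AccPath f ι n x) :
    ∃ s : ℕ × ℝ → ℝ, (∀ c, s c = 1 ∨ s c = -1) ∧ ∀ᶠ z in 𝓝 x, T.Itin f ι n z →
      ∀ c ∈ T.chks f ι n x, 0 < s c * ((z.1 - x.1) + T.rh f ι x n c.1 c.2 z.2) := by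
  have key : ∀ c ∈ T.chks f ι n x, ∃ σ : ℝ, (σ = 1 ∨ σ = -1) ∧ ∀ᶠ z in 𝓝 x, T.Itin f ι n z →
      0 < σ * ((z.1 - x.1) + T.rh f ι x n c.1 c.2 z.2) := by
    rintro ⟨k, t⟩ ⟨hk, ht⟩
    have hk : k < n := hk
    obtain ⟨σ, hσ, hev⟩ := (h.acc k hk).passage ht.1 ht.2
    refine ⟨σ * (-1) ^ k, ?_, ?_⟩
    · rcases hσ with rfl | rfl <;> rcases neg_one_pow_cases k with e | e <;> rw [e] <;> simp
    · filter_upwards [(h.continuousAt_trk hf hk.le).eventually hev, h.eventually_transv hf]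
        with z h1 h2 hz
      exact (dev_trk_sign hf h.transv h2 hk t σ).1 (h1 (hz k hk))
  choose! s hs1 hs2 using key
  refine ⟨fun c => by classical exact if c ∈ T.chks f ι n x then s c else 1, fun c => ?_, ?_⟩
  · dsimp only
    split_ifs with hc
    · exact hs1 c hc
    · exact Or.inl rfl
  · have := (eventually_all_finite (finite_chks f ι n x)).2 hs2
    filter_upwards [this] with z hz hzi c hc
    rw [if_pos hc]
    exact hz c hc hzi

/-- A point close to `y` which is on the same side of `y` as a point of the side `i`. -/
lemma eventually_mem_side {i : T.Side} {s : ℝ} (hs : s ∈ Icc (T.lo i) (T.hi i)) :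
    ∀ᶠ s' in 𝓝 s, ∀ s₀ ∈ Ioo (T.lo i) (T.hi i), (T.IsCorner s → 0 < (s' - s) * (s₀ - s)) →
      s' ∈ Ioo (T.lo i) (T.hi i) := by
  rcases hs.1.eq_or_lt with h | h
  · filter_upwards [Iio_mem_nhds (h ▸ T.lo_lt_hi i)] with s' h1 s₀ h2 h3
    have := h3 (h ▸ T.isCorner_lo i)
    refine ⟨?_, h1⟩
    rw [h] at h2
    have h4 : 0 < s₀ - s := by linarith [h2.1]
    have := (pos_iff_pos_of_mul_pos this).2 h4
    linarith
  rcases hs.2.eq_or_lt with h' | h'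
  · filter_upwards [Ioi_mem_nhds h] with s' h1 s₀ h2 h3
    have := h3 (h' ▸ T.isCorner_hi i)
    refine ⟨h1, ?_⟩
    have h4 : s₀ - s < 0 := by linarith [h2.2]
    have : s' - s < 0 := (neg_iff_neg_of_mul_pos this).2 h4
    linarith
  · filter_upwards [isOpen_Ioo.mem_nhds ⟨h, h'⟩] with s' h1 _ _ _ using h1

/-- Points close to `x` with the same itinerary of length `n` are connected by such points. -/
theorem AccPath.exists_isPreconnected (hf : IsContractingLaw f) (hn : 1 ≤ n)
    (h : T.AccPath f ι n x) {W : Set (ℝ × ℝ)} (hW : W ∈ 𝓝 x) :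
    ∃ W' ∈ 𝓝 x, ∀ z ∈ W', ∀ z' ∈ W', T.Itin f ι n z → T.Itin f ι n z' →
      ∃ A ⊆ W, IsPreconnected A ∧ z ∈ A ∧ z' ∈ A ∧ ∀ w ∈ A, T.Itin f ι n w := by
  obtain ⟨s, hs, hsev⟩ := h.exists_signs hf
  have hx := h.transv
  -- the conditions that hold near `x`
  have hfly : ∀ k < n, ∃ V ∈ 𝓝 (T.trk f ι x k), ∀ A ⊆ V, IsPreconnected A →
      (∀ z ∈ A, T.Base (ι k) z) → (∀ z ∈ A, ∀ t ∈ Icc 0 (T.tm f ι x k),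
        T.ray (ι k) (T.trk f ι x k) t ∈ T.verts → dev (T.trk f ι x k) z t ≠ 0) →
      ∀ z₀ ∈ A, T.Fly (ι k) (ι (k + 1)) z₀ → ∀ z ∈ A, T.Fly (ι k) (ι (k + 1)) z :=
    fun k hk => (h.acc k hk).fly_of_isPreconnected
  choose! V hV hVfly using hfly
  have hgood : ∀ᶠ z in 𝓝 x, z ∈ W ∧ T.Transv f ι n z.2 ∧ (∀ k ∈ Iio n, T.trk f ι z k ∈ V k) ∧
      (T.Itin f ι n z → ∀ c ∈ T.chks f ι n x,
        0 < s c * ((z.1 - x.1) + T.rh f ι x n c.1 c.2 z.2)) ∧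
      (∀ s₀ ∈ Ioo (T.lo (ι 0)) (T.hi (ι 0)), (T.IsCorner x.1 → 0 < (z.1 - x.1) * (s₀ - x.1)) →
      z.1 ∈ Ioo (T.lo (ι 0)) (T.hi (ι 0))) := by
    have h1 : ∀ᶠ z in 𝓝 x, ∀ k ∈ Iio n, T.trk f ι z k ∈ V k :=
      (eventually_all_finite (finite_Iio n)).2 fun k hk =>
        (h.continuousAt_trk hf (le_of_lt hk)).eventually (hV k hk)
    have h2 : ∀ᶠ z : ℝ × ℝ in 𝓝 x, z.1 ∈ {s' : ℝ | ∀ s₀ ∈ Ioo (T.lo (ι 0)) (T.hi (ι 0)),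
        (T.IsCorner x.1 → 0 < (s' - x.1) * (s₀ - x.1)) → s' ∈ Ioo (T.lo (ι 0)) (T.hi (ι 0))} :=
      continuous_fst.continuousAt.eventually (eventually_mem_side (h.acc 0 hn).mem)
    filter_upwards [hW, h.eventually_transv hf, h1, hsev, h2] with z a b c d e
    exact ⟨a, b, c, d, e⟩
  obtain ⟨ε, hε, hball⟩ := Metric.eventually_nhds_iff_ball.1 hgood
  have hrh : ∀ᶠ z : ℝ × ℝ in 𝓝 x, ∀ c ∈ T.chks f ι n x, |T.rh f ι x n c.1 c.2 z.2| < ε := by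
    refine (eventually_all_finite (finite_chks f ι n x)).2 fun c _ => ?_
    have hc : ContinuousAt (fun z : ℝ × ℝ => |T.rh f ι x n c.1 c.2 z.2|) x :=
      (ContinuousAt.comp (f := fun z : ℝ × ℝ => z.2) (g := T.rh f ι x n c.1 c.2)
        (continuousAt_rh hf hx _ _) continuous_snd.continuousAt).abs
    exact hc.eventually_lt continuousAt_const (by rw [rh_self hf hx]; simpa using hε)
  obtain ⟨ε', hε', hball'⟩ := Metric.eventually_nhds_iff_ball.1 hrh
  obtain ⟨η, hη, hηε, hηε'⟩ : ∃ η > 0, η ≤ ε ∧ η ≤ ε' :=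
    ⟨min ε ε', lt_min hε hε', min_le_left _ _, min_le_right _ _⟩
  -- the open set
  obtain ⟨O, hOdef⟩ : ∃ O : Set (ℝ × ℝ), O = {z | (|z.1 - x.1| < ε ∧ |z.2 - x.2| < η) ∧
      ∀ c ∈ T.chks f ι n x, 0 < s c * ((z.1 - x.1) + T.rh f ι x n c.1 c.2 z.2)} := ⟨_, rfl⟩
  have hO : ∀ z, z ∈ O ↔ (|z.1 - x.1| < ε ∧ |z.2 - x.2| < η) ∧
      ∀ c ∈ T.chks f ι n x, 0 < s c * ((z.1 - x.1) + T.rh f ι x n c.1 c.2 z.2) := fun z => by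
    rw [hOdef]; rfl
  have hOb : ∀ z ∈ O, z ∈ Metric.ball x ε := fun z hz =>
    mem_ball_prod.2 ⟨((hO z).1 hz).1.1, ((hO z).1 hz).1.2.trans_le hηε⟩
  have hOo : IsOpen O := by
    rw [isOpen_iff_mem_nhds]
    intro z hz
    have hz' := (hO z).1 hz
    have c1 : Continuous fun w : ℝ × ℝ => |w.1 - x.1| := by fun_prop
    have c2 : Continuous fun w : ℝ × ℝ => |w.2 - x.2| := by fun_prop
    have c3 : ∀ᶠ w in 𝓝 z, ∀ c ∈ T.chks f ι n x,
        0 < s c * ((w.1 - x.1) + T.rh f ι x n c.1 c.2 w.2) := by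
      refine (eventually_all_finite (finite_chks f ι n x)).2 fun c hc => ?_
      have hcz : ContinuousAt (fun w : ℝ × ℝ => s c * ((w.1 - x.1) + T.rh f ι x n c.1 c.2 w.2)) z :=
        continuousAt_const.mul (ContinuousAt.add (Continuous.continuousAt (by fun_prop))
          (ContinuousAt.comp (f := fun z : ℝ × ℝ => z.2) (g := T.rh f ι x n c.1 c.2)
          (continuousAt_rh hf (hball z (hOb z hz)).2.1 _ _) continuous_snd.continuousAt))
      exact hcz.eventually_mem (isOpen_Ioi.mem_nhds (hz'.2 c hc))
    filter_upwards [c1.continuousAt.eventually_lt continuousAt_const hz'.1.1,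
      c2.continuousAt.eventually_lt continuousAt_const hz'.1.2, c3] with w h1 h2 h3
    exact (hO w).2 ⟨⟨h1, h2⟩, h3⟩
  refine ⟨Metric.ball x η, Metric.ball_mem_nhds x hη, fun z hz z' hz' hzi hzi' => ?_⟩
  have hbε : ∀ w ∈ Metric.ball x η, w ∈ Metric.ball x ε := fun w hw =>
    Metric.ball_subset_ball hηε hw
  have hmemO : ∀ w ∈ Metric.ball x η, T.Itin f ι n w → w ∈ O := fun w hw hwi =>
    (hO w).2 ⟨⟨(mem_ball_prod.1 (hbε w hw)).1, (mem_ball_prod.1 hw).2⟩,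
      (hball w (hbε w hw)).2.2.2.1 hwi⟩
  have hzO := hmemO z hz hzi
  have hzO' := hmemO z' hz' hzi'
  have hpre : IsPreconnected {w | w ∈ O ∧ w.2 ∈ uIcc z.2 z'.2} := by
    refine isPreconnected_of_sections hOo isPreconnected_uIcc (fun θ hθ => ?_) (fun θ hθ => ?_)
    · refine Convex.isPreconnected ?_
      have : {s' | (s', θ) ∈ O} = {s' | |s' - x.1| < ε ∧ |θ - x.2| < η} ∩
          ⋂ c ∈ T.chks f ι n x, {s' | 0 < s c * ((s' - x.1) + T.rh f ι x n c.1 c.2 θ)} := by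
        ext s'
        constructor
        · intro h1
          have h1 := (hO _).1 h1
          exact ⟨h1.1, mem_iInter₂.2 fun c hc => h1.2 c hc⟩
        · rintro ⟨h1, h2⟩
          exact (hO _).2 ⟨h1, fun c hc => mem_iInter₂.1 h2 c hc⟩
      rw [this]
      refine Convex.inter ?_ (convex_iInter₂ fun c _ => ?_)
      · rintro a ⟨ha, ha'⟩ b ⟨hb, -⟩ p q hp hq hpq
        exact ⟨convex_ball x.1 ε (mem_ball_iff_norm.2 ha) (mem_ball_iff_norm.2 hb) hp hq hpq
          |> mem_ball_iff_norm.1, ha'⟩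
      · intro a ha b hb p q hp hq hpq
        have ha : 0 < s c * ((a - x.1) + T.rh f ι x n c.1 c.2 θ) := ha
        have hb : 0 < s c * ((b - x.1) + T.rh f ι x n c.1 c.2 θ) := hb
        change 0 < s c * ((p • a + q • b - x.1) + T.rh f ι x n c.1 c.2 θ)
        obtain rfl : q = 1 - p := by linarith
        simp only [smul_eq_mul]
        have e : s c * ((p * a + (1 - p) * b - x.1) + T.rh f ι x n c.1 c.2 θ) =
          p * (s c * ((a - x.1) + T.rh f ι x n c.1 c.2 θ)) +
            (1 - p) * (s c * ((b - x.1) + T.rh f ι x n c.1 c.2 θ)) := by ring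
        rw [e]
        rcases hp.eq_or_lt with h0 | h0
        · rw [← h0]; simpa using hb
        · have := mul_pos h0 ha
          have := mul_nonneg hq hb.le
          linarith
    · classical
      have hzz := (mem_ball_prod.1 hz).2
      have hzz' := (mem_ball_prod.1 hz').2
      have hθη : |θ - x.2| < η := by
        rw [abs_lt] at hzz hzz' ⊢
        rcases le_total z.2 z'.2 with hle | hle
        · rw [uIcc_of_le hle] at hθ
          constructor <;> linarith [hθ.1, hθ.2]
        · rw [uIcc_of_ge hle] at hθ
          constructor <;> linarith [hθ.1, hθ.2]
      have hθx : ((x.1, θ) : ℝ × ℝ) ∈ Metric.ball x η := mem_ball_prod.2 ⟨by simpa using hη, hθη⟩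
      have hθT : T.Transv f ι n θ := (hball _ (hbε _ hθx)).2.1
      have hθr : ∀ c ∈ T.chks f ι n x, |T.rh f ι x n c.1 c.2 θ| < ε' ∨
        |T.rh f ι x n c.1 c.2 θ| < ε := fun c hc => Or.inr
          (hball' (x.1, θ) (Metric.ball_subset_ball hηε' hθx) c hc)
      have hzT := hzi.transv hn
      have hzT' := hzi'.transv hn
      have hfin := finite_chks f ι n x
      obtain ⟨w, hw1, hw2⟩ := Order.exists_between_finsets
        (insert (-ε) ((hfin.toFinset.filter fun c => s c = 1).image
          fun c => - T.rh f ι x n c.1 c.2 θ))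
        (insert ε ((hfin.toFinset.filter fun c => s c = -1).image
          fun c => - T.rh f ι x n c.1 c.2 θ)) (by
        intro a ha b hb
        rw [Finset.mem_insert, Finset.mem_image] at ha hb
        rcases ha with rfl | ⟨c, hc, rfl⟩
        · rcases hb with rfl | ⟨c', hc', rfl⟩
          · linarith
          · rw [Finset.mem_filter, hfin.mem_toFinset] at hc'
            have := abs_lt.1 (hball' (x.1, θ) (Metric.ball_subset_ball hηε' hθx) c' hc'.1)
            simp only at this
            linarith [this.2]
        · rw [Finset.mem_filter, hfin.mem_toFinset] at hc
          rcases hb with rfl | ⟨c', hc', rfl⟩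
          · have := abs_lt.1 (hball' (x.1, θ) (Metric.ball_subset_ball hηε' hθx) c hc.1)
            simp only at this
            linarith [this.1]
          · rw [Finset.mem_filter, hfin.mem_toFinset] at hc'
            have g1 := ((hO z).1 hzO).2 c hc.1
            have g2 := ((hO z).1 hzO).2 c' hc'.1
            have g1' := ((hO z').1 hzO').2 c hc.1
            have g2' := ((hO z').1 hzO').2 c' hc'.1
            rw [hc.2] at g1 g1'
            rw [hc'.2] at g2 g2'
            have k1 : T.rh f ι x n c'.1 c'.2 z.2 < T.rh f ι x n c.1 c.2 z.2 := by linarith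
            have k1' : T.rh f ι x n c'.1 c'.2 z'.2 < T.rh f ι x n c.1 c.2 z'.2 := by linarith
            have hcv := hc.1
            have hcv' := hc'.1
            rcases ChkLE.total c.1 c.2 c'.1 c'.2 with hle | hle
            · have m1 := h.rh_mono hf hcv'.1 hcv.2.1.2 hcv'.2.1.1 hle hzT
              have m1' := h.rh_mono hf hcv'.1 hcv.2.1.2 hcv'.2.1.1 hle hzT'
              have n1 : z.2 < x.2 := by
                by_contra! hcon; exact absurd (m1.1 hcon) (not_le.2 k1)
              have n1' : z'.2 < x.2 := by
                by_contra! hcon; exact absurd (m1'.1 hcon) (not_le.2 k1')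
              have n2 : θ < x.2 := by
                rcases le_total z.2 z'.2 with hle | hle
                · rw [uIcc_of_le hle] at hθ; linarith [hθ.2]
                · rw [uIcc_of_ge hle] at hθ; linarith [hθ.2]
              have := (h.rh_strict hf hcv'.1 hcv.2.1.2 hcv'.2.1.1 hle k1.ne' hθT).2 n2
              linarith
            · have m1 := h.rh_mono hf hcv.1 hcv'.2.1.2 hcv.2.1.1 hle hzT
              have m1' := h.rh_mono hf hcv.1 hcv'.2.1.2 hcv.2.1.1 hle hzT'
              have n1 : x.2 < z.2 := by
                by_contra! hcon; exact absurd (m1.2 hcon) (not_le.2 k1)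
              have n1' : x.2 < z'.2 := by
                by_contra! hcon; exact absurd (m1'.2 hcon) (not_le.2 k1')
              have n2 : x.2 < θ := by
                rcases le_total z.2 z'.2 with hle | hle
                · rw [uIcc_of_le hle] at hθ; linarith [hθ.1]
                · rw [uIcc_of_ge hle] at hθ; linarith [hθ.1]
              have := (h.rh_strict hf hcv.1 hcv'.2.1.2 hcv.2.1.1 hle k1.ne hθT).1 n2
              linarith)
      refine ⟨x.1 + w, (hO _).2 ⟨⟨?_, hθη⟩, fun c hc => ?_⟩⟩
      · have a1 := hw1 (-ε) (Finset.mem_insert_self _ _)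
        have a2 := hw2 ε (Finset.mem_insert_self _ _)
        rw [add_sub_cancel_left, abs_lt]
        exact ⟨a1, a2⟩
      · simp only [add_sub_cancel_left]
        rcases hs c with e | e
        · have := hw1 (- T.rh f ι x n c.1 c.2 θ) (Finset.mem_insert_of_mem (Finset.mem_image.2
            ⟨c, Finset.mem_filter.2 ⟨hfin.mem_toFinset.2 hc, e⟩, rfl⟩))
          rw [e]; linarith
        · have := hw2 (- T.rh f ι x n c.1 c.2 θ) (Finset.mem_insert_of_mem (Finset.mem_image.2
            ⟨c, Finset.mem_filter.2 ⟨hfin.mem_toFinset.2 hc, e⟩, rfl⟩))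
          rw [e]; linarith
  refine ⟨{w | w ∈ O ∧ w.2 ∈ uIcc z.2 z'.2}, fun w hw => (hball w (hOb w hw.1)).1, hpre,
    ⟨hzO, left_mem_uIcc⟩, ⟨hzO', right_mem_uIcc⟩, ?_⟩
  obtain ⟨A, hA⟩ : ∃ A : Set (ℝ × ℝ), A = {w | w ∈ O ∧ w.2 ∈ uIcc z.2 z'.2} := ⟨_, rfl⟩
  have hAO : ∀ w ∈ A, w ∈ O := fun w hw => by rw [hA] at hw; exact hw.1
  have hzA : z ∈ A := by rw [hA]; exact ⟨hzO, left_mem_uIcc⟩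
  rw [← hA] at hpre ⊢
  have hgw : ∀ w ∈ A, _ := fun w hw => hball w (hOb w (hAO w hw))
  -- the itinerary is constant
  have hstep : ∀ k < n, (∀ w ∈ A, T.Base (ι k) (T.trk f ι w k)) →
      ∀ w ∈ A, T.Fly (ι k) (ι (k + 1)) (T.trk f ι w k) := by
    intro k hk hb w hw
    have himg : IsPreconnected ((fun w => T.trk f ι w k) '' A) :=
      hpre.image _ fun w hw => (PolygonalTable.continuousAt_trk hf (n := n)
        (fun m hm => by rw [trk_snd]; exact ((hgw w hw).2.1.2 m hm).ne') hk.le).continuousWithinAt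
    refine hVfly k hk _ ?_ himg ?_ ?_ _ ⟨z, hzA, rfl⟩ (hzi k hk) _ ⟨w, hw, rfl⟩
    · rintro _ ⟨w, hw, rfl⟩
      exact (hgw w hw).2.2.1 k hk
    · rintro _ ⟨w, hw, rfl⟩
      exact hb w hw
    · rintro _ ⟨w, hw, rfl⟩ t ht hv h0
      have h1 := ((hO w).1 (hAO w hw)).2 (k, t) ⟨hk, ht, hv⟩
      have h2 : s (k, t) = s (k, t) * (-1) ^ k * (-1) ^ k := by
        rcases neg_one_pow_cases k with e | e <;> rw [e] <;> ring
      rw [h2] at h1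
      have := (dev_trk_sign hf hx (hgw w hw).2.1 hk t _).2 h1
      rw [h0, mul_zero] at this
      exact lt_irrefl _ this
  have hall : ∀ k < n, ∀ w ∈ A, T.Fly (ι k) (ι (k + 1)) (T.trk f ι w k) := by
    intro k
    induction k with
    | zero =>
      refine fun hk => hstep 0 hk fun w hw => ⟨?_, (hgw w hw).2.1.1⟩
      refine (hgw w hw).2.2.2.2 z.1 (hzi 0 hn).1.1 fun hc => ?_
      have hmem : ((0, 0) : ℕ × ℝ) ∈ T.chks f ι n x := by
        refine ⟨hn, ⟨le_rfl, h.tm_nonneg hn⟩, ?_⟩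
        change T.ray (ι 0) x 0 ∈ T.verts
        rw [ray, zero_smul, add_zero, ← T.bdry_eq (show x.1 ∈ _ from (h.acc 0 hn).mem)]
        exact T.bdry_mem_verts.2 hc
      have h1 := ((hO w).1 (hAO w hw)).2 _ hmem
      have h2 := ((hO z).1 hzO).2 _ hmem
      have h3 : ∀ θ, T.rh f ι x n 0 0 θ = 0 := fun θ => by rw [rh_eq hn]; simp
      simp only [h3, add_zero] at h1 h2
      rcases hs (0, 0) with e | e <;> rw [e] at h1 h2 <;> nlinarith
    | succ k ih =>
      intro hk
      exact hstep (k + 1) hk fun w hw => (ih (by omega) w hw).base_step hf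
  exact fun w hw k hk => hall k hk w hw

/-- Distinct sectors have distinct itineraries. -/
theorem AccPath.sector_eq (hf : IsContractingLaw f) (hn : 1 ≤ n) (hB : T.IsSectorBall f n x r)
    (hΔ : Δ ∈ T.sectors f n x r) (hΔ' : Δ' ∈ T.sectors f n x r) (h : T.AccPath f ι n x)
    (hι : ∀ z ∈ Δ, T.Itin f ι n z) (hι' : ∀ z ∈ Δ', T.Itin f ι n z) : Δ = Δ' := by
  have hr := hB.1
  have hW : {w : ℝ × ℝ | (w.1 - x.1) ^ 2 + (w.2 - x.2) ^ 2 < r ^ 2} ∈ 𝓝 x :=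
    (isOpen_lt (f := fun w : ℝ × ℝ => (w.1 - x.1) ^ 2 + (w.2 - x.2) ^ 2) (by fun_prop)
      continuous_const).mem_nhds (by change (x.1 - x.1) ^ 2 + (x.2 - x.2) ^ 2 < r ^ 2; simp; positivity)
  obtain ⟨W', hW', hc⟩ := h.exists_isPreconnected hf hn hW
  obtain ⟨z, hz, hzW⟩ := ((frequently_mem_sector hf hn hB hΔ).and_eventually hW').exists
  obtain ⟨z', hz', hzW'⟩ := ((frequently_mem_sector hf hn hB hΔ').and_eventually hW').exists
  obtain ⟨A, hAW, hA, hzA, hzA', hAi⟩ := hc z hzW z' hzW' (hι z hz) (hι' z' hz')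
  have hsub : A ⊆ phaseBall x r \ T.singularSetOfOrder f n := fun w hw =>
    ⟨⟨(hAi w hw 0 hn).1.mem_phaseSpace, hAW hw⟩, (hAi w hw).notMem⟩
  have h1 := subset_sector hΔ hz hA hzA hsub hzA'
  rw [PolygonalTable.sector_eq hΔ h1, PolygonalTable.sector_eq hΔ' hz']

end PolygonalTable

namespace PolygonalTable

variable {T : PolygonalTable} {f : ℝ → ℝ} {i j : T.Side} {y z : ℝ × ℝ} {h τ : ℝ}

/-- The hitting time is lower semicontinuous. -/
lemma Base.eventually_le_hitTime (hb : T.Base i z) {a : ℝ} (ha : a < T.hitTime z) :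
    ∀ᶠ z' in 𝓝 z, T.Base i z' → a ≤ T.hitTime z' := by
  obtain ⟨ρ, hρ, hnear⟩ := hb.ray_near
  have c4 : ∀ᶠ z' : ℝ × ℝ in 𝓝 z, ∀ t ∈ Icc (ρ/2) a, T.ray i z' t ∈ T.P := by
    refine isCompact_Icc.eventually_forall_of_forall_eventually fun t ht => ?_
    exact ((T.continuous_ray i).continuousAt (x := (z, t))).eventually_mem
      (T.isOpen.mem_nhds (hb.ray_mem (by linarith [ht.1]) (ht.2.trans_lt ha)))
  filter_upwards [hnear, c4] with z' h1 h2 hb'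
  by_contra! hlt
  refine hb'.hitPoint_notMem ?_
  rcases lt_or_ge (T.hitTime z') ρ with h | h
  · exact h1 _ ⟨hb'.hitTime_pos, h⟩
  · exact h2 _ ⟨by linarith, hlt.le⟩

/-- If the first collision of `z` is at a vertex, then the same is true for the vectors close to `z`
whose lines pass through this vertex. -/
lemma Base.eventually_hit_vertex (hb : T.Base i z) (hv : T.ray i z (T.hitTime z) ∈ T.verts) :
    ∀ᶠ z' in 𝓝 z, T.Base i z' →
      cr (T.dirAt i z'.2) (T.ray i z (T.hitTime z) - T.lineP i z'.1) = 0 →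
      z' ∈ T.singularSet := by
  obtain ⟨v, hvdef⟩ : ∃ v, v = T.ray i z (T.hitTime z) := ⟨_, rfl⟩
  rw [← hvdef] at hv ⊢
  obtain ⟨K, hK⟩ : ∃ K, K = ⋃ k ∈ {k : Fin T.d |
      v ∉ T.lineP (k, 0) '' Icc (T.lo (k, 0)) (T.hi (k, 0))},
      T.lineP (k, 0) '' Icc (T.lo (k, 0)) (T.hi (k, 0)) := ⟨_, rfl⟩
  have hKc : IsClosed K := by
    rw [hK]
    exact (toFinite _).isClosed_biUnion fun k _ =>
      (isCompact_Icc.image (T.continuous_lineP (k, 0))).isClosed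
  have hvK : v ∉ K := by
    rw [hK]
    simp only [mem_iUnion, not_exists]
    exact fun k hk h => hk h
  obtain ⟨δ, hδ, hball⟩ := Metric.isOpen_iff.1 hKc.isOpen_compl v hvK
  obtain ⟨tv, htv⟩ : ∃ tv : ℝ × ℝ → ℝ, tv = fun z' =>
      (T.dirAt i z'.2).re * (v - T.lineP i z'.1).re +
        (T.dirAt i z'.2).im * (v - T.lineP i z'.1).im := ⟨_, rfl⟩
  have hcont : Continuous tv := by
    have h1 : Continuous fun z' : ℝ × ℝ => T.dirAt i z'.2 :=
      (T.continuous_dirAt i).comp continuous_snd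
    have h2 : Continuous fun z' : ℝ × ℝ => v - T.lineP i z'.1 :=
      continuous_const.sub ((T.continuous_lineP i).comp continuous_fst)
    rw [htv]
    exact ((Complex.continuous_re.comp h1).mul (Complex.continuous_re.comp h2)).add
      ((Complex.continuous_im.comp h1).mul (Complex.continuous_im.comp h2))
  have hray : ∀ z' : ℝ × ℝ, cr (T.dirAt i z'.2) (v - T.lineP i z'.1) = 0 →
      T.ray i z' (tv z') = v := fun z' h0 => by
    have := eq_smul_of_cr_eq_zero (T.norm_dirAt i z'.2) h0
    rw [htv, ray]
    dsimp only
    rw [← this]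
    ring
  have htz : tv z = T.hitTime z := by
    refine ray_injective i z ?_
    rw [← hvdef, hray z]
    rw [hvdef, ray, add_sub_cancel_left, cr_smul_right, cr_self, mul_zero]
  have hpos := hb.hitTime_pos
  have c1 : ∀ᶠ z' in 𝓝 z, tv z' ∈ Ioo 0 (T.hitTime z + δ / 2) :=
    hcont.continuousAt.eventually_mem (isOpen_Ioo.mem_nhds (by rw [htz]; constructor <;> linarith))
  filter_upwards [c1, hb.eventually_le_hitTime (a := T.hitTime z - δ / 2) (by linarith)]
    with z' h1 h2 hb' h0
  have hr := hray z' h0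
  rcases hb'.fly_or with ⟨j, hj⟩ | h
  · exfalso
    have hvP : v ∉ T.P := by
      obtain ⟨k, rfl⟩ := hv
      exact T.bdry_notMem _
    have h3 := hb'.hitTime_le h1.1 (hr ▸ hvP)
    have h2 := h2 hb'
    have h4 : T.ray i z' (T.hitTime z') ∈ Metric.ball v δ := by
      rw [mem_ball_iff_norm, ← hr, ray, ray, add_sub_add_left_eq_sub, ← sub_smul, norm_smul,
        T.norm_dirAt, mul_one, Real.norm_eq_abs, abs_lt]
      constructor <;> linarith [h1.2]
    have h5 := hball h4
    have hj2 := hj.snd_eq_zero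
    have hjj : j = (j.1, 0) := Prod.ext rfl hj2
    have h6 : T.ray i z' (T.hitTime z') ∈ T.lineP j '' Icc (T.lo j) (T.hi j) :=
      ⟨_, Ioo_subset_Icc_self hj.2, hj.ray_hitTime.symm⟩
    have h7 : v ∈ T.lineP j '' Icc (T.lo j) (T.hi j) := by
      by_contra h8
      refine h5 ?_
      rw [hK]
      rw [hjj] at h6 h8
      exact mem_iUnion₂.2 ⟨j.1, h8, h6⟩
    obtain ⟨s, hs, hsv⟩ := h7
    have h9 := (T.eq_tim_arr hj.inc_pos.ne' (hr.trans hsv.symm)).2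
    rw [← hsv, ← T.bdry_eq hs, T.bdry_mem_verts, h9] at hv
    exact T.not_isCorner_of_mem hj.arr_mem hv
  · exact hb'.mem_singularSet_iff.2 h

/-- The vectors close to `y` whose lines pass through the point of the ray of `y` at time `h`. -/
def branch (y : ℝ × ℝ) (h τ : ℝ) : ℝ × ℝ :=
  (y.1 - h * (Real.sin τ / Real.cos (y.2 + τ)), y.2 + τ)

lemma dev_branch (hc : Real.cos (y.2 + τ) ≠ 0) : dev y (branch y h τ) h = 0 := by
  simp only [dev, branch, add_sub_cancel_left]
  field_simp
  ring

lemma eq_branch (hc : Real.cos z.2 ≠ 0) (h0 : dev y z h = 0) : z = branch y h (z.2 - y.2) := by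
  refine Prod.ext ?_ ?_
  · simp only [dev, branch, add_sub_cancel] at h0 ⊢
    field_simp
    linarith
  · simp [branch]

lemma branch_zero (y : ℝ × ℝ) (h : ℝ) : branch y h 0 = y := by simp [branch]

lemma contDiffAt_branch (hc : Real.cos (y.2 + τ) ≠ 0) : ContDiffAt ℝ 2 (branch y h) τ := by
  unfold branch
  have h1 : ContDiffAt ℝ 2 (fun τ => Real.sin τ) τ := Real.contDiff_sin.contDiffAt
  have h2 : ContDiffAt ℝ 2 (fun τ => Real.cos (y.2 + τ)) τ :=
    (Real.contDiff_cos.comp (contDiff_const.add contDiff_id)).contDiffAt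
  exact (contDiffAt_const.sub (contDiffAt_const.mul (h1.div h2 hc))).prodMk
    (contDiffAt_const.add contDiffAt_id)

lemma cos_add_ne_zero_eventually (hy : y.2 ∈ Ioo (-(Real.pi / 2)) (Real.pi / 2)) (ς : ℝ) :
    ∀ᶠ t in 𝓝 (0:ℝ), y.2 + ς * t ∈ Ioo (-(Real.pi / 2)) (Real.pi / 2) := by
  have : Continuous fun t : ℝ => y.2 + ς * t := by fun_prop
  exact this.continuousAt.eventually_mem (isOpen_Ioo.mem_nhds (by simpa using hy))

lemma sin_div_cos_sub {θ a b : ℝ} (ha : Real.cos (θ + a) ≠ 0) (hb : Real.cos (θ + b) ≠ 0) :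
    Real.sin b / Real.cos (θ + b) - Real.sin a / Real.cos (θ + a) =
      Real.cos θ * Real.sin (b - a) / (Real.cos (θ + b) * Real.cos (θ + a)) := by
  rw [div_sub_div _ _ hb ha]
  congr 1
  rw [Real.cos_add, Real.cos_add, Real.sin_sub]
  ring

/-- The distance to `y` is increasing along a branch. -/
lemma branch_dist_lt (hy : y.2 ∈ Ioo (-(Real.pi / 2)) (Real.pi / 2)) {ς a b : ℝ}
    (hς : ς = 1 ∨ ς = -1) (ha : 0 ≤ a) (hab : a < b) (hb : b < Real.pi)
    (hca : y.2 + ς * a ∈ Ioo (-(Real.pi / 2)) (Real.pi / 2))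
    (hcb : y.2 + ς * b ∈ Ioo (-(Real.pi / 2)) (Real.pi / 2)) :
    ((branch y h (ς * a)).1 - y.1) ^ 2 + ((branch y h (ς * a)).2 - y.2) ^ 2 <
      ((branch y h (ς * b)).1 - y.1) ^ 2 + ((branch y h (ς * b)).2 - y.2) ^ 2 := by
  have h1 := Real.cos_pos_of_mem_Ioo hca
  have h2 := Real.cos_pos_of_mem_Ioo hcb
  have h0 := Real.cos_pos_of_mem_Ioo hy
  have hsub := sin_div_cos_sub h1.ne' h2.ne'
  simp only [branch]
  obtain ⟨p, hp⟩ : ∃ p, p = Real.sin (ς * a) / Real.cos (y.2 + ς * a) := ⟨_, rfl⟩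
  obtain ⟨q, hq⟩ : ∃ q, q = Real.sin (ς * b) / Real.cos (y.2 + ς * b) := ⟨_, rfl⟩
  rw [← hp, ← hq] at hsub ⊢
  have h3 : 0 ≤ ς * p := by
    have : ς * p = ς * Real.sin (ς * a) / Real.cos (y.2 + ς * a) := by rw [hp]; ring
    rw [this]
    refine div_nonneg ?_ h1.le
    have h7 := Real.sin_nonneg_of_nonneg_of_le_pi ha (hab.le.trans hb.le)
    rcases hς with rfl | rfl
    · simpa using h7
    · simpa using h7
  have h4 : 0 ≤ ς * (q - p) := by
    rw [hsub]
    have : ς * (Real.cos y.2 * Real.sin (ς * b - ς * a) /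
      (Real.cos (y.2 + ς * b) * Real.cos (y.2 + ς * a))) = Real.cos y.2 *
        (ς * Real.sin (ς * (b - a))) / (Real.cos (y.2 + ς * b) * Real.cos (y.2 + ς * a)) := by
      rw [mul_sub]; ring
    rw [this]
    refine div_nonneg (mul_nonneg h0.le ?_) (mul_pos h2 h1).le
    have h7 := Real.sin_nonneg_of_nonneg_of_le_pi (sub_nonneg.2 hab.le) (by linarith)
    rcases hς with rfl | rfl
    · simpa using h7
    · rw [neg_one_mul, neg_one_mul, Real.sin_neg, neg_neg]; exact h7
  have h5 : p ^ 2 ≤ q ^ 2 := by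
    rcases hς with rfl | rfl <;> nlinarith
  have h6 : (ς * a) ^ 2 < (ς * b) ^ 2 := by
    rcases hς with rfl | rfl <;> nlinarith
  nlinarith [mul_le_mul_of_nonneg_left h5 (sq_nonneg h)]

/-- A half branch is either in the singular set, close to `y`, or outside it. -/
lemma branch_dichotomy {ς R : ℝ} (hς : ς = 1 ∨ ς = -1)
    (hy : y.2 ∈ Ioo (-(Real.pi / 2)) (Real.pi / 2))
    (hR : 0 < R) (hRP : ∀ z, T.Base i z → T.ray i z R ∉ T.P)
    (hi : y.1 ∈ Icc (T.lo i) (T.hi i))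
    (hev : ∀ᶠ s in 𝓝 y.1, 0 < -ς * (s - y.1) → s ∈ Ioo (T.lo i) (T.hi i))
    (hh : h ∈ T.vtimes i y R) :
    (∀ᶠ t in 𝓝[>] 0, branch y h (ς * t) ∈ T.singularSet) ∨
      (∀ᶠ t in 𝓝[>] 0, branch y h (ς * t) ∉ T.singularSet) := by
  have hcos := (cos_add_ne_zero_eventually hy ς).filter_mono (nhdsWithin_le_nhds (s := Ioi 0))
  rcases hh.1.1.eq_or_lt with h0 | h0
  · left
    filter_upwards [hcos] with t ht
    refine Or.inl (Or.inl ⟨?_, ht⟩)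
    have : T.bdry y.1 ∈ T.verts := by
      have := hh.2
      rwa [← h0, ray, zero_smul, add_zero, ← T.bdry_eq hi] at this
    simpa [branch, ← h0] using T.bdry_mem_verts.1 this
  have hc : ContinuousAt (fun t => branch y h (ς * t)) 0 := by
    refine ContinuousAt.comp (g := branch y h) (f := fun t => ς * t) ?_ (by fun_prop)
    refine (contDiffAt_branch ?_).continuousAt
    simpa using (Real.cos_pos_of_mem_Ioo hy).ne'
  have hb0 : branch y h (ς * 0) = y := by rw [mul_zero, branch_zero]
  have hev1 : ∀ᶠ t in 𝓝[>] (0:ℝ), 0 < -ς * ((branch y h (ς * t)).1 - y.1) →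
      (branch y h (ς * t)).1 ∈ Ioo (T.lo i) (T.hi i) := by
    refine Filter.Eventually.filter_mono nhdsWithin_le_nhds ?_
    have : Tendsto (fun t => (branch y h (ς * t)).1) (𝓝 0) (𝓝 y.1) := by
      have := (continuous_fst.continuousAt (x := branch y h (ς * 0))).tendsto.comp hc.tendsto
      rwa [hb0] at this
    exact this.eventually hev
  have hev2 : ∀ᶠ t in 𝓝[>] (0:ℝ), ∀ v ∈ T.verts, ∀ l ∈ Icc (0:ℝ) 1,
      T.ray i (branch y h (ς * t)) (l * R) = v →
      ∃ l' ∈ Icc (0:ℝ) 1, T.ray i y (l' * R) = v ∧ dev y (branch y h (ς * t)) (l' * R) = 0 := by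
    refine Filter.Eventually.filter_mono nhdsWithin_le_nhds ?_
    have hc' := hc.tendsto
    rw [hb0] at hc'
    exact hc'.eventually (eventually_vertex i y (τ := fun _ => R) continuousAt_const)
  have hpi : ∀ᶠ t in 𝓝[>] (0:ℝ), t ∈ Ioo 0 Real.pi := Ioo_mem_nhdsGT Real.pi_pos
  obtain ⟨ε, hε, hall⟩ := mem_nhdsGT_iff_exists_Ioo_subset.1
    (hcos.and (hev1.and (hev2.and hpi)))
  have hε : 0 < ε := hε
  have hbase : ∀ t ∈ Ioo 0 ε, T.Base i (branch y h (ς * t)) := fun t ht => by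
    obtain ⟨h1, h2, -, h4⟩ := hall ht
    refine ⟨h2 ?_, h1⟩
    have h5 := Real.cos_pos_of_mem_Ioo h1
    have h6 := Real.sin_pos_of_pos_of_lt_pi h4.1 h4.2
    have : -ς * ((branch y h (ς * t)).1 - y.1) =
        h * ((ς * Real.sin (ς * t)) / Real.cos (y.2 + ς * t)) := by
      simp only [branch]; ring
    rw [this]
    refine mul_pos h0 (div_pos ?_ h5)
    rcases hς with rfl | rfl
    · simpa using h6
    · simpa using h6
  have hcont : ∀ t ∈ Ioo 0 ε, ContinuousAt (fun t => branch y h (ς * t)) t := fun t ht => by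
    refine ContinuousAt.comp (g := branch y h) (f := fun t => ς * t) ?_ (by fun_prop)
    exact (contDiffAt_branch (Real.cos_pos_of_mem_Ioo (hall ht).1).ne').continuousAt
  have hcr : ∀ t ∈ Ioo 0 ε, cr (T.dirAt i (branch y h (ς * t)).2)
      (T.ray i y h - T.lineP i (branch y h (ς * t)).1) = 0 := fun t ht => by
    rw [cr_ray_sub, dev_branch (Real.cos_pos_of_mem_Ioo (hall ht).1).ne']
  have hopen1 : IsOpen {t | t ∈ Ioo 0 ε ∧ branch y h (ς * t) ∈ T.singularSet} := by
    rw [isOpen_iff_mem_nhds]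
    rintro t ⟨ht, hs⟩
    have hb := hbase t ht
    have hv := hb.mem_singularSet_iff.1 hs
    have hle := hb.hitTime_le hR (hRP _ hb)
    obtain ⟨l, hl, he, hd⟩ := (hall ht).2.2.1 _ hv (T.hitTime (branch y h (ς * t)) / R)
      ⟨by have := hb.hitTime_pos; positivity, (div_le_one hR).2 hle⟩ (by rw [div_mul_cancel₀ _ hR.ne'])
    have hlh : l * R = h := by
      have h1 := dev_branch (h := h) (Real.cos_pos_of_mem_Ioo (hall ht).1).ne'
      have h2 : (l * R - h) * Real.sin (ς * t) = 0 := by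
        simp only [dev, branch, add_sub_cancel_left] at h1 hd ⊢
        linear_combination hd - h1
      rcases mul_eq_zero.1 h2 with h3 | h3
      · linarith
      · have := Real.sin_pos_of_pos_of_lt_pi (hall ht).2.2.2.1 (hall ht).2.2.2.2
        rcases hς with rfl | rfl
        · rw [one_mul] at h3; exact absurd h3 this.ne'
        · rw [neg_one_mul, Real.sin_neg, neg_eq_zero] at h3; exact absurd h3 this.ne'
    rw [hlh] at he
    have := (hcont t ht).eventually (hb.eventually_hit_vertex hv)
    filter_upwards [this, isOpen_Ioo.mem_nhds ht] with t' h1 h2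
    refine ⟨h2, h1 (hbase t' h2) ?_⟩
    rw [← he]
    exact hcr t' h2
  have hopen2 : IsOpen {t | t ∈ Ioo 0 ε ∧ branch y h (ς * t) ∉ T.singularSet} := by
    rw [isOpen_iff_mem_nhds]
    rintro t ⟨ht, hs⟩
    obtain ⟨j, hj⟩ := (hbase t ht).fly_or.resolve_right
      fun h => hs ((hbase t ht).mem_singularSet_iff.2 h)
    filter_upwards [(hcont t ht).eventually hj.eventually, isOpen_Ioo.mem_nhds ht] with t' h1 h2
    exact ⟨h2, h1.notMem_singularSet⟩
  have hmid : ε / 2 ∈ Ioo 0 ε := ⟨by linarith, by linarith⟩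
  by_cases hm : branch y h (ς * (ε / 2)) ∈ T.singularSet
  · left
    refine mem_nhdsGT_iff_exists_Ioo_subset.2 ⟨ε, hε, ?_⟩
    intro t ht
    by_contra hn
    obtain ⟨p, hp, hp1, hp2⟩ := isPreconnected_Ioo _ _ hopen1 hopen2
      (fun s hs => (em (branch y h (ς * s) ∈ T.singularSet)).imp (fun a => ⟨hs, a⟩)
        fun a => ⟨hs, a⟩) ⟨_, hmid, hmid, hm⟩ ⟨t, ht, ht, hn⟩
    exact hp2.2 hp1.2
  · right
    refine mem_nhdsGT_iff_exists_Ioo_subset.2 ⟨ε, hε, ?_⟩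
    intro t ht hn
    obtain ⟨p, hp, hp1, hp2⟩ := isPreconnected_Ioo _ _ hopen1 hopen2
      (fun s hs => (em (branch y h (ς * s) ∈ T.singularSet)).imp (fun a => ⟨hs, a⟩)
        fun a => ⟨hs, a⟩) ⟨t, ht, ht, hn⟩ ⟨_, hmid, hmid, hm⟩
    exact hp2.2 hp1.2

end PolygonalTable

namespace PolygonalTable

variable {T : PolygonalTable} {f : ℝ → ℝ} {i j : T.Side} {y z : ℝ × ℝ} {h τ : ℝ}

/-- Close to `y`, the singular set is covered by the branches. -/
lemma eventually_eq_branch {R : ℝ} {e : ℝ → T.Side}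
    (hy : y.2 ∈ Ioo (-(Real.pi / 2)) (Real.pi / 2))
    (hR : 0 < R) (hRP : ∀ i z, T.Base i z → T.ray i z R ∉ T.P)
    (he : ∀ ς : ℝ, ς = 1 ∨ ς = -1 → y.1 ∈ Icc (T.lo (e ς)) (T.hi (e ς)))
    (hev : ∀ ς : ℝ, ς = 1 ∨ ς = -1 →
      ∀ᶠ s in 𝓝 y.1, 0 < -ς * (s - y.1) → s ∈ Ioo (T.lo (e ς)) (T.hi (e ς))) :
    ∀ᶠ z in 𝓝 y, z ∈ T.singularSet → z = y ∨ ∃ ς : ℝ, (ς = 1 ∨ ς = -1) ∧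
      ∃ h ∈ T.vtimes (e ς) y R, 0 < ς * (z.2 - y.2) ∧ z = branch y h (z.2 - y.2) := by
  have c0 : ∀ᶠ z : ℝ × ℝ in 𝓝 y, z.2 ∈ Ioo (-(Real.pi / 2)) (Real.pi / 2) :=
    continuous_snd.continuousAt.eventually_mem (isOpen_Ioo.mem_nhds hy)
  have c1 : ∀ ς : ℝ, ς = 1 ∨ ς = -1 → ∀ᶠ z : ℝ × ℝ in 𝓝 y,
      0 < -ς * (z.1 - y.1) → z.1 ∈ Ioo (T.lo (e ς)) (T.hi (e ς)) := fun ς hς =>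
    continuous_fst.continuousAt.eventually (hev ς hς)
  have key : ∀ ς : ℝ, ∀ᶠ z in 𝓝 y, z ∈ T.singularSet → T.Base (e ς) z →
      ∃ h ∈ T.vtimes (e ς) y R, dev y z h = 0 := fun ς => by
    filter_upwards [eventually_vertex (e ς) y (τ := fun _ => R) continuousAt_const]
      with z hz hs hb
    have hv := hb.mem_singularSet_iff.1 hs
    obtain ⟨l, hl, h1, h2⟩ := hz _ hv (T.hitTime z / R)
      ⟨by have := hb.hitTime_pos; positivity,
        (div_le_one hR).2 (hb.hitTime_le hR (hRP _ _ hb))⟩ (by rw [div_mul_cancel₀ _ hR.ne'])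
    exact ⟨l * R, ⟨⟨mul_nonneg hl.1 hR.le, mul_le_of_le_one_left hR.le hl.2⟩, h1 ▸ hv⟩, h2⟩
  have hsin : ∀ z : ℝ × ℝ, z.2 ∈ Ioo (-(Real.pi / 2)) (Real.pi / 2) →
      Real.sin (z.2 - y.2) = 0 → z.2 = y.2 := fun z hz h0 => by
    obtain ⟨-, h2, -, h4⟩ := sin_sub_sign (Ioo_subset_Icc_self hy) hz
    rcases lt_trichotomy (z.2 - y.2) 0 with h | h | h
    · exact absurd h0 (h4 h).ne
    · linarith
    · exact absurd h0 (h2 h).ne'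
  have c2 : ∀ᶠ z in 𝓝 y, ¬ T.IsCorner y.1 → T.Base (e 1) z := by
    by_cases hc : T.IsCorner y.1
    · exact Eventually.of_forall fun _ h => absurd hc h
    · have h1 := he 1 (Or.inl rfl)
      have h2 : T.Base (e 1) y := by
        refine ⟨⟨h1.1.lt_of_ne fun h => hc ?_, h1.2.lt_of_ne fun h => hc ?_⟩, hy⟩
        · exact h ▸ T.isCorner_lo _
        · exact h ▸ T.isCorner_hi _
      filter_upwards [(T.isOpen_base (e 1)).mem_nhds h2] with z hz _ using hz
  filter_upwards [c0, c1 1 (Or.inl rfl), c1 (-1) (Or.inr rfl), key 1, key (-1), c2]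
    with z h0 h1 h1' h2 h2' h3 hs
  by_cases hz2 : z.1 = y.1
  · by_cases hz3 : z.2 = y.2
    · exact Or.inl (Prod.ext hz2 hz3)
    right
    by_cases hc : T.IsCorner y.1
    · have hz4 : 0 < 1 * (z.2 - y.2) ∨ 0 < -1 * (z.2 - y.2) := by
        rcases lt_or_gt_of_ne hz3 with h | h
        · right; linarith
        · left; linarith
      have hh : ∀ ς : ℝ, ς = 1 ∨ ς = -1 → (0:ℝ) ∈ T.vtimes (e ς) y R := fun ς hς => by
        refine ⟨⟨le_rfl, hR.le⟩, ?_⟩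
        rw [ray, zero_smul, add_zero, ← T.bdry_eq (he ς hς)]
        exact T.bdry_mem_verts.2 hc
      have hz5 : z = branch y 0 (z.2 - y.2) := by
        refine Prod.ext ?_ ?_ <;> simp [branch, hz2]
      rcases hz4 with h | h
      · exact ⟨1, Or.inl rfl, 0, hh 1 (Or.inl rfl), h, hz5⟩
      · exact ⟨-1, Or.inr rfl, 0, hh (-1) (Or.inr rfl), h, hz5⟩
    · exfalso
      obtain ⟨h, hh, hd⟩ := h2 hs (h3 hc)
      simp only [dev, hz2, sub_self, zero_mul, zero_add] at hd
      rcases mul_eq_zero.1 hd with h4 | h4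
      · refine hc ?_
        have := hh.2
        rw [h4, ray, zero_smul, add_zero, ← T.bdry_eq (he 1 (Or.inl rfl))] at this
        exact T.bdry_mem_verts.1 this
      · exact hz3 (hsin z h0 h4)
  · right
    have hcos := Real.cos_pos_of_mem_Ioo h0
    have fin : ∀ ς : ℝ, (ς = 1 ∨ ς = -1) → 0 < -ς * (z.1 - y.1) →
        (∃ h ∈ T.vtimes (e ς) y R, dev y z h = 0) → ∃ ς : ℝ, (ς = 1 ∨ ς = -1) ∧
      ∃ h ∈ T.vtimes (e ς) y R, 0 < ς * (z.2 - y.2) ∧ z = branch y h (z.2 - y.2) := by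
      rintro ς hς hp ⟨h, hh, hd⟩
      refine ⟨ς, hς, h, hh, ?_, eq_branch hcos.ne' hd⟩
      have h4 : 0 < h * (ς * Real.sin (z.2 - y.2)) := by
        have h5 := mul_pos hp hcos
        simp only [dev] at hd
        have h6 : h * (ς * Real.sin (z.2 - y.2)) = -ς * (z.1 - y.1) * Real.cos z.2 := by
          linear_combination ς * hd
        rwa [h6]
      obtain ⟨g1, g2, g3, g4⟩ := sin_sub_sign (Ioo_subset_Icc_self hy) h0
      have h5 := (pos_iff_pos_of_mul_pos h4).1 (hh.1.1.lt_of_ne fun h => by simp [← h] at h4)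
      by_contra! hle
      rcases hς with rfl | rfl
      · have := g3 (by linarith); linarith
      · have := g1 (by linarith); linarith
    rcases lt_or_gt_of_ne hz2 with h | h
    · have hp : 0 < -1 * (z.1 - y.1) := by linarith
      exact fin 1 (Or.inl rfl) hp (h2 hs ⟨h1 hp, h0⟩)
    · have hp : 0 < -(-1) * (z.1 - y.1) := by linarith
      exact fin (-1) (Or.inr rfl) hp (h2' hs ⟨h1' hp, h0⟩)

/-- At a singular vector, some half branch is singular. -/
lemma exists_singular_branch {R : ℝ} {e : ℝ → T.Side}
    (hy : y.2 ∈ Ioo (-(Real.pi / 2)) (Real.pi / 2)) (hs : y ∈ T.singularSet)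
    (hR : 0 < R) (hRP : ∀ i z, T.Base i z → T.ray i z R ∉ T.P)
    (he : y.1 ∈ Icc (T.lo (e 1)) (T.hi (e 1))) :
    ∃ h ∈ T.vtimes (e 1) y R, ∀ᶠ t in 𝓝[>] (0:ℝ), branch y h (1 * t) ∈ T.singularSet := by
  have hcos := (cos_add_ne_zero_eventually hy 1).filter_mono (nhdsWithin_le_nhds (s := Ioi 0))
  by_cases hc : T.IsCorner y.1
  · refine ⟨0, ⟨⟨le_rfl, hR.le⟩, ?_⟩, ?_⟩
    · rw [ray, zero_smul, add_zero, ← T.bdry_eq he]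
      exact T.bdry_mem_verts.2 hc
    · filter_upwards [hcos] with t ht
      exact Or.inl (Or.inl ⟨by simpa [branch] using hc, ht⟩)
  · have hb : T.Base (e 1) y := by
      refine ⟨⟨he.1.lt_of_ne fun h => hc ?_, he.2.lt_of_ne fun h => hc ?_⟩, hy⟩
      · exact h ▸ T.isCorner_lo _
      · exact h ▸ T.isCorner_hi _
    have hv := hb.mem_singularSet_iff.1 hs
    refine ⟨T.hitTime y, ⟨⟨hb.hitTime_pos.le, hb.hitTime_le hR (hRP _ _ hb)⟩, hv⟩, ?_⟩
    have hct : Tendsto (fun t => branch y (T.hitTime y) (1 * t)) (𝓝[>] 0) (𝓝 y) := by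
      have h1 : ContinuousAt (fun t => branch y (T.hitTime y) (1 * t)) 0 := by
        refine ContinuousAt.comp (g := branch y (T.hitTime y)) (f := fun t => 1 * t) ?_ (by fun_prop)
        refine (contDiffAt_branch ?_).continuousAt
        simpa using (Real.cos_pos_of_mem_Ioo hy).ne'
      have h2 := h1.tendsto
      rw [mul_zero, branch_zero] at h2
      exact h2.mono_left nhdsWithin_le_nhds
    filter_upwards [hct.eventually (hb.eventually_hit_vertex hv),
      hct.eventually ((T.isOpen_base (e 1)).mem_nhds hb), hcos] with t h1 h2 h3
    refine h1 h2 ?_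
    rw [cr_ray_sub, dev_branch]
    exact (Real.cos_pos_of_mem_Ioo h3).ne'

/-- Small balls centered at a point of the interior of the phase space may be used to define the
sectors of order one. -/
theorem exists_isSectorBall (hy : y.2 ∈ Ioo (-(Real.pi / 2)) (Real.pi / 2))
    (hN : y ∈ T.singularSetOfOrder f 1) :
    ∃ r₀ > 0, ∀ r, 0 < r → r < r₀ → T.IsSectorBall f 1 y r := by
  have hNiff : ∀ z, z ∈ T.singularSetOfOrder f 1 ↔ z ∈ phaseSpace ∧ z ∈ T.singularSet := by
    intro z
    refine and_congr_right fun _ => ⟨?_, fun h => ⟨0, one_pos, h⟩⟩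
    rintro ⟨k, hk, h⟩
    obtain rfl : k = 0 := by omega
    exact h
  obtain ⟨R, hR, hRP⟩ := exists_time_bound T
  have hside : ∀ ς : ℝ, ∃ i : T.Side, (ς = 1 ∨ ς = -1) → y.1 ∈ Icc (T.lo i) (T.hi i) ∧
      ∀ᶠ s' in 𝓝 y.1, 0 < -ς * (s' - y.1) → s' ∈ Ioo (T.lo i) (T.hi i) := fun ς => by
    by_cases hς : ς = 1 ∨ ς = -1
    · obtain ⟨i, h1, h2⟩ := T.exists_side_toward (σ := -ς)
        (by rcases hς with rfl | rfl <;> simp) y.1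
      exact ⟨i, fun _ => ⟨h1, h2⟩⟩
    · exact ⟨(⟨0, by have := T.three_le; omega⟩, 0), fun h => absurd h hς⟩
  choose e he using hside
  -- all the half branches, and the visible ones
  obtain ⟨H, hH⟩ : ∃ H : Set (ℝ × ℝ), H = {p | (p.1 = 1 ∨ p.1 = -1) ∧
    p.2 ∈ T.vtimes (e p.1) y R} := ⟨_, rfl⟩
  have hHfin : H.Finite := by
    have : ((({1, -1} : Set ℝ) ×ˢ (T.vtimes (e 1) y R ∪ T.vtimes (e (-1)) y R))).Finite :=
      (toFinite _).prod ((finite_vtimes _ _ _).union (finite_vtimes _ _ _))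
    refine this.subset ?_
    rintro ⟨ς, h⟩ hp
    rw [hH] at hp
    obtain ⟨rfl | rfl, hp⟩ := hp
    · exact ⟨Or.inl rfl, Or.inl hp⟩
    · exact ⟨Or.inr rfl, Or.inr hp⟩
  obtain ⟨B, hB⟩ : ∃ B : Set (ℝ × ℝ), B = {p ∈ H | ∀ᶠ t in 𝓝[>] (0:ℝ),
    branch y p.2 (p.1 * t) ∈ T.singularSet} := ⟨_, rfl⟩
  have hBfin : B.Finite := hHfin.subset (by rw [hB]; exact sep_subset _ _)
  have hBH : ∀ p ∈ B, p.1 = 1 ∨ p.1 = -1 := fun p hp => by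
    rw [hB, hH] at hp
    exact hp.1.1
  have e1 : ∀ᶠ t in 𝓝[>] (0:ℝ), ∀ p ∈ B, branch y p.2 (p.1 * t) ∈ T.singularSet :=
    (eventually_all_finite hBfin).2 fun p hp => by
      rw [hB] at hp
      exact hp.2
  have e2 : ∀ᶠ t in 𝓝[>] (0:ℝ), ∀ p ∈ H \ B, branch y p.2 (p.1 * t) ∉ T.singularSet :=
    (eventually_all_finite (hHfin.subset sdiff_subset)).2 fun p hp => by
      have hp1 := hp.1
      rw [hH] at hp1
      refine (branch_dichotomy hp1.1 hy hR (hRP _) (he _ hp1.1).1 (he _ hp1.1).2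
        hp1.2).resolve_left fun h => hp.2 ?_
      rw [hB]
      exact ⟨hp.1, h⟩
  have e3 : ∀ᶠ t in 𝓝[>] (0:ℝ), y.2 + 1 * t ∈ Ioo (-(Real.pi / 2)) (Real.pi / 2) ∧
      y.2 + -1 * t ∈ Ioo (-(Real.pi / 2)) (Real.pi / 2) :=
    ((cos_add_ne_zero_eventually hy 1).and (cos_add_ne_zero_eventually hy (-1))).filter_mono
      nhdsWithin_le_nhds
  have e4 : ∀ᶠ t in 𝓝[>] (0:ℝ), t < Real.pi :=
    nhdsWithin_le_nhds (Iio_mem_nhds Real.pi_pos)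
  obtain ⟨ε, hε, hall⟩ := mem_nhdsGT_iff_exists_Ioo_subset.1 (e1.and (e2.and (e3.and e4)))
  have hε : 0 < ε := hε
  obtain ⟨ρ, hρ, hcov⟩ := Metric.eventually_nhds_iff_ball.1
    (eventually_eq_branch hy hR hRP (fun ς hς => (he ς hς).1) (fun ς hς => (he ς hς).2))
  have hBne : B.Nonempty := by
    obtain ⟨h, hh, hev⟩ := exists_singular_branch hy ((hNiff y).1 hN).2 hR hRP
      (he 1 (Or.inl rfl)).1
    refine ⟨(1, h), ?_⟩
    rw [hB, hH]
    exact ⟨⟨Or.inl rfl, hh⟩, hev⟩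
  refine ⟨min ε ρ, lt_min hε hρ, fun r hr hrlt => ?_⟩
  have hrε : r < ε := hrlt.trans_le (min_le_left _ _)
  have hrρ : r < ρ := hrlt.trans_le (min_le_right _ _)
  have hang : ∀ p ∈ B, ∀ t ∈ Icc 0 r, y.2 + p.1 * t ∈ Ioo (-(Real.pi / 2)) (Real.pi / 2) := by
    intro p hp t ht
    rcases ht.1.eq_or_lt with h0 | h0
    · rw [← h0, mul_zero, add_zero]; exact hy
    · have := (hall (a := t) ⟨h0, ht.2.trans_lt hrε⟩).2.2.1
      rcases hBH p hp with h | h <;> rw [h]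
      exacts [this.1, this.2]
  have hpi : r < Real.pi := (hall (a := r) ⟨hr, hrε⟩).2.2.2
  -- the distance to `y` along a half branch
  obtain ⟨g, hg⟩ : ∃ g : ℝ × ℝ → ℝ → ℝ, g = fun p t =>
      ((branch y p.2 (p.1 * t)).1 - y.1) ^ 2 + ((branch y p.2 (p.1 * t)).2 - y.2) ^ 2 := ⟨_, rfl⟩
  have hgmono : ∀ p ∈ B, ∀ a b, 0 ≤ a → a < b → b ≤ r → g p a < g p b := by
    intro p hp a b ha hab hb
    rw [hg]
    exact branch_dist_lt hy (hBH p hp) ha hab (hb.trans_lt hpi)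
      (hang p hp a ⟨ha, hab.le.trans hb⟩) (hang p hp b ⟨ha.trans hab.le, hb⟩)
  have hgle : ∀ p ∈ B, ∀ t, t ^ 2 ≤ g p t := by
    intro p hp t
    have : (p.1 * t) ^ 2 = t ^ 2 := by rcases hBH p hp with h | h <;> rw [h] <;> ring
    rw [hg]
    simp only [branch, add_sub_cancel_left, this]
    nlinarith [sq_nonneg (y.1 - p.2 * (Real.sin (p.1 * t) / Real.cos (y.2 + p.1 * t)) - y.1)]
  have hexit : ∀ p ∈ B, ∃ t ∈ Ioc 0 r, g p t = r ^ 2 := by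
    intro p hp
    have hc : ContinuousOn (g p) (Icc 0 r) := by
      intro t ht
      have h1 : ContinuousAt (fun t => branch y p.2 (p.1 * t)) t := by
        refine ContinuousAt.comp (g := branch y p.2) (f := fun t => p.1 * t) ?_ (by fun_prop)
        exact (contDiffAt_branch (Real.cos_pos_of_mem_Ioo (hang p hp t ht)).ne').continuousAt
      have h2 : ContinuousAt (g p) t := by
        rw [hg]
        exact ((h1.fst.sub continuousAt_const).pow 2).add ((h1.snd.sub continuousAt_const).pow 2)
      exact h2.continuousWithinAt
    have h0 : g p 0 = 0 := by rw [hg]; simp [branch]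
    obtain ⟨t, ht, he⟩ := intermediate_value_Icc hr.le hc
      (show r ^ 2 ∈ Icc (g p 0) (g p r) from ⟨by rw [h0]; positivity, hgle p hp r⟩)
    refine ⟨t, ⟨ht.1.lt_of_ne fun h => ?_, ht.2⟩, he⟩
    rw [← h, h0] at he
    nlinarith
  choose! τ hτ hτr using hexit
  obtain ⟨m, ⟨eqv⟩⟩ := Finite.exists_equiv_fin (α := B) (h := hBfin)
  obtain ⟨p, hp⟩ : ∃ p : Fin m → ℝ × ℝ, p = fun k => ((eqv.symm k : B) : ℝ × ℝ) := ⟨_, rfl⟩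
  have hpB : ∀ k, p k ∈ B := fun k => by rw [hp]; exact (eqv.symm k).2
  have hpinj : ∀ k l, p k = p l → k = l := fun k l h => by
    rw [hp] at h
    exact eqv.symm.injective (Subtype.ext h)
  have hpsurj : ∀ b ∈ B, ∃ k, p k = b := fun b hb => ⟨eqv ⟨b, hb⟩, by rw [hp]; simp⟩
  have hς0 : ∀ k, (p k).1 * τ (p k) ≠ 0 := fun k => by
    have := (hτ _ (hpB k)).1
    rcases hBH _ (hpB k) with h | h <;> rw [h]
    · simpa using this.ne'
    · simpa using this.ne'
  have hmemr : ∀ k, ∀ t ∈ Icc (0:ℝ) 1, τ (p k) * t ∈ Icc 0 r := fun k t ht => by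
    have := hτ _ (hpB k)
    exact ⟨mul_nonneg this.1.le ht.1, (mul_le_of_le_one_right this.1.le ht.2).trans this.2⟩
  have hyp : y ∈ phaseSpace := hN.1
  refine ⟨hr, hN, m, fun k t => branch y (p k).2 ((p k).1 * (τ (p k) * t)), fun k => ⟨?_, ?_, ?_, ?_⟩,
    fun k l hkl => ?_, ?_⟩
  · simp [branch]
  · intro t ht
    refine ContDiffAt.contDiffWithinAt ?_
    refine ContDiffAt.comp (g := branch y (p k).2) (f := fun t => (p k).1 * (τ (p k) * t)) t
      (contDiffAt_branch ?_) (by fun_prop)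
    exact (Real.cos_pos_of_mem_Ioo (hang _ (hpB k) _ (hmemr k t ht))).ne'
  · intro a _ b _ hab
    have h1 := congrArg Prod.snd hab
    simp only [branch, add_right_inj, ← mul_assoc] at h1
    exact mul_left_cancel₀ (hς0 k) h1
  · intro t ht h0
    have hd : DifferentiableAt ℝ (fun t => branch y (p k).2 ((p k).1 * (τ (p k) * t))) t := by
      refine ContDiffAt.differentiableAt (n := 2) ?_ (by norm_num)
      refine ContDiffAt.comp (g := branch y (p k).2) (f := fun t => (p k).1 * (τ (p k) * t)) t
        (contDiffAt_branch ?_) (by fun_prop)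
      exact (Real.cos_pos_of_mem_Ioo (hang _ (hpB k) _ (hmemr k t ht))).ne'
    have hu := uniqueDiffOn_Icc (zero_lt_one (α := ℝ)) t ht
    have h1 := hd.hasDerivAt.hasDerivWithinAt (s := Icc 0 1)
    have h2 : HasDerivWithinAt (fun t => y.2 + (p k).1 * (τ (p k) * t))
        (deriv (fun t => branch y (p k).2 ((p k).1 * (τ (p k) * t))) t).2 (Icc 0 1) t := by
      have := (ContinuousLinearMap.snd ℝ ℝ ℝ).hasFDerivAt.comp_hasDerivWithinAt t h1
      exact this
    rw [← h1.derivWithin hu, h0] at h2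
    have h3 : HasDerivWithinAt (fun t => y.2 + (p k).1 * (τ (p k) * t))
        ((p k).1 * (τ (p k) * 1)) (Icc 0 1) t :=
      (((hasDerivWithinAt_id t _).const_mul (τ (p k))).const_mul (p k).1).const_add y.2
    have h4 := hu.eq_deriv _ h2 h3
    rw [mul_one] at h4
    exact hς0 k h4.symm
  · rw [Set.disjoint_left]
    rintro _ ⟨a, ha, rfl⟩ ⟨b, hb, hab⟩
    have h1 := congrArg Prod.snd hab
    have h2 := congrArg Prod.fst hab
    simp only [branch, add_right_inj] at h1
    simp only [branch, h1, sub_right_inj] at h2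
    have hak := mul_pos (hτ _ (hpB k)).1 ha.1
    have hbl := mul_pos (hτ _ (hpB l)).1 hb.1
    have h3 : (p l).1 = (p k).1 := by
      rcases hBH _ (hpB k) with h | h <;> rcases hBH _ (hpB l) with h' | h' <;>
        rw [h, h'] at h1 ⊢ <;> linarith
    refine hkl (hpinj _ _ (Prod.ext h3.symm ?_))
    have hr' := hmemr k a (Ioc_subset_Icc_self ha)
    have h4 := (Real.cos_pos_of_mem_Ioo (hang _ (hpB k) _ hr')).ne'
    have h5 : Real.sin ((p k).1 * (τ (p k) * a)) ≠ 0 := by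
      have := (Real.sin_pos_of_pos_of_lt_pi hak (hr'.2.trans_lt hpi)).ne'
      rcases hBH _ (hpB k) with h | h <;> rw [h]
      · simpa using this
      · simpa using this
    exact (mul_right_cancel₀ (div_ne_zero h5 h4) h2).symm
  · ext z
    rw [closure_phaseBall hyp hr, mem_iUnion]
    constructor
    · rintro ⟨hzN, hzM, hzr⟩
      have hz1 : |z.1 - y.1| ≤ r := abs_le_of_sq_le_sq (by nlinarith [sq_nonneg (z.2 - y.2)]) hr.le
      have hz2 : |z.2 - y.2| ≤ r := abs_le_of_sq_le_sq (by nlinarith [sq_nonneg (z.1 - y.1)]) hr.le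
      rcases hcov z (mem_ball_prod.2 ⟨hz1.trans_lt hrρ, hz2.trans_lt hrρ⟩) ((hNiff z).1 hzN).2 with
        rfl | ⟨ς, hς, h, hh, hpos, hze⟩
      · obtain ⟨b, hb⟩ := hBne
        obtain ⟨k, -⟩ := hpsurj b hb
        exact ⟨k, 0, ⟨le_rfl, zero_le_one⟩, by simp [branch]⟩
      · have hςς : ς * ς = 1 := by rcases hς with rfl | rfl <;> norm_num
        obtain ⟨t, ht⟩ : ∃ t, t = ς * (z.2 - y.2) := ⟨_, rfl⟩
        have htς : ς * t = z.2 - y.2 := by rw [ht, ← mul_assoc, hςς, one_mul]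
        have htr : t ≤ r := by
          rw [ht]
          refine le_trans ?_ hz2
          rcases hς with rfl | rfl
          · rw [one_mul]; exact le_abs_self _
          · rw [neg_one_mul]; exact neg_le_abs _
        rw [← ht] at hpos
        have hmB : (ς, h) ∈ B := by
          by_contra hnB
          have := (hall (a := t) ⟨hpos, htr.trans_lt hrε⟩).2.1 (ς, h)
            ⟨by rw [hH]; exact ⟨hς, hh⟩, hnB⟩
          rw [htς, ← hze] at this
          exact this ((hNiff z).1 hzN).2
        obtain ⟨k, hk⟩ := hpsurj _ hmB
        have hgt : g (ς, h) t ≤ r ^ 2 := by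
          rw [hg]
          dsimp only
          rw [htς, ← hze]
          exact hzr
        have htτ : t ≤ τ (ς, h) := by
          by_contra! hlt
          have := hgmono _ hmB _ _ (hτ _ hmB).1.le hlt htr
          rw [hτr _ hmB] at this
          linarith
        refine ⟨k, t / τ (ς, h), ⟨div_nonneg hpos.le (hτ _ hmB).1.le,
          (div_le_one (hτ _ hmB).1).2 htτ⟩, ?_⟩
        dsimp only
        rw [hk, mul_div_cancel₀ _ (hτ _ hmB).1.ne', htς, ← hze]
    · rintro ⟨k, t, ht, rfl⟩
      dsimp only
      have hr' := hmemr k t ht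
      have hM : branch y (p k).2 ((p k).1 * (τ (p k) * t)) ∈ phaseSpace :=
        Ioo_subset_Icc_self (hang _ (hpB k) _ hr')
      refine ⟨?_, hM, ?_⟩
      · rcases hr'.1.eq_or_lt with h0 | h0
        · rw [← h0, mul_zero, branch_zero]
          exact hN
        · exact (hNiff _).2 ⟨hM, (hall ⟨h0, hr'.2.trans_lt hrε⟩).1 _ (hpB k)⟩
      · have h1 : τ (p k) * t ≤ τ (p k) := mul_le_of_le_one_right (hτ _ (hpB k)).1.le ht.2
        have h2 : g (p k) (τ (p k) * t) ≤ g (p k) (τ (p k)) := by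
          rcases h1.eq_or_lt with h | h
          · rw [h]
          · exact (hgmono _ (hpB k) _ _ hr'.1 h (hτ _ (hpB k)).2).le
        rw [hτr _ (hpB k), hg] at h2
        exact h2

end PolygonalTable

lemma IsContractingLaw.exists_local_inverse {f : ℝ → ℝ} (hf : IsContractingLaw f) {φ : ℝ}
    (hφ : φ ∈ Ioo (-(Real.pi / 2)) (Real.pi / 2)) :
    ContDiffAt ℝ 2 f φ ∧
      ∃ g : ℝ → ℝ, ContDiffAt ℝ 2 g (f φ) ∧ ∀ᶠ φ' in 𝓝 φ, g (f φ') = φ' := by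
  have h1 : ContDiffAt ℝ 2 f φ := hf.contDiffOn.contDiffAt (Icc_mem_nhds hφ.1 hφ.2)
  have h2 : HasDerivAt f (deriv f φ) φ := (h1.differentiableAt (by norm_num)).hasDerivAt
  have h3 := (hf.deriv_pos φ hφ).ne'
  have h4 : HasFDerivAt f ((ContinuousLinearEquiv.unitsEquivAut ℝ (Units.mk0 _ h3)) : ℝ →L[ℝ] ℝ)
      φ := h2.hasFDerivAt_equiv h3
  exact ⟨h1, h1.localInverse h4 (by norm_num), h1.to_localInverse h4 (by norm_num),
    (h1.hasStrictFDerivAt' h4 (by norm_num)).eventually_left_inverse⟩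

namespace PolygonalTable

variable {T : PolygonalTable} {f : ℝ → ℝ} {i j : T.Side} {y z : ℝ × ℝ} {r : ℝ} {Δ : Set (ℝ × ℝ)}

lemma contDiff_inc (i j : T.Side) : ContDiff ℝ 2 (T.inc i j) := by
  have : T.inc i j = fun θ => (Real.sin θ * (T.dir i).re - Real.cos θ * (T.dir i).im) *
      (T.dir j).im - (Real.sin θ * (T.dir i).im + Real.cos θ * (T.dir i).re) * (T.dir j).re := by
    ext θ
    rw [inc, cr, dirAt_re, dirAt_im]
  rw [this]
  fun_prop

lemma contDiffAt_arr (h : T.inc i j z.2 ≠ 0) : ContDiffAt ℝ 2 (T.arr i j) z := by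
  have : T.arr i j = fun z : ℝ × ℝ => T.lo j +
      ((Real.sin z.2 * (T.dir i).re - Real.cos z.2 * (T.dir i).im) *
        ((T.bdry (T.lo i)).im + (z.1 - T.lo i) * (T.dir i).im - (T.lineP j (T.lo j)).im) -
       (Real.sin z.2 * (T.dir i).im + Real.cos z.2 * (T.dir i).re) *
        ((T.bdry (T.lo i)).re + (z.1 - T.lo i) * (T.dir i).re - (T.lineP j (T.lo j)).re)) /
        T.inc i j z.2 := by
    ext z
    simp [arr, cr, dirAt_re, dirAt_im, lineP]
  rw [this]
  have h1 : ContDiffAt ℝ 2 (fun z : ℝ × ℝ => T.inc i j z.2) z :=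
    ((contDiff_inc i j).comp contDiff_snd).contDiffAt
  refine contDiffAt_const.add (ContDiffAt.div ?_ h1 h)
  fun_prop

/-- The map `Φ` is a diffeomorphism on small sets, where the vectors arrive transversally. -/
lemma exists_nhds_isRegular (hf : IsContractingLaw f) (h : 0 < T.inc i j y.2)
    (hy : y.2 ∈ Ioo (-(Real.pi / 2)) (Real.pi / 2)) :
    ∃ W ∈ 𝓝 y, ∀ Δ, closure Δ ⊆ W → (∀ z ∈ Δ, T.Fly i j z) → T.IsRegular f 1 Δ := by
  obtain ⟨c, hc⟩ : ∃ c, c = T.refl i j y.2 + y.2 := ⟨_, rfl⟩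
  obtain ⟨hf2, g, hg, hgf⟩ := hf.exists_local_inverse (T.refl_mem_Ioo h)
  have hcy : c - y.2 = T.refl i j y.2 := by rw [hc]; ring
  rw [← hcy] at hf2 hg hgf
  have hct : ContinuousAt (fun z : ℝ × ℝ => c - z.2) y := by fun_prop
  have e1 : ∀ᶠ z : ℝ × ℝ in 𝓝 y, ContDiffAt ℝ 2 f (c - z.2) :=
    hct.eventually (hf2.eventually (by norm_num))
  have e2 : ∀ᶠ z : ℝ × ℝ in 𝓝 y, g (f (c - z.2)) = c - z.2 := hct.eventually hgf
  have e3 : ∀ᶠ z : ℝ × ℝ in 𝓝 y, ContDiffAt ℝ 2 g (f (c - z.2)) :=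
    (ContinuousAt.comp (g := f) (f := fun z : ℝ × ℝ => c - z.2) hf2.continuousAt hct).eventually
      (hg.eventually (by norm_num))
  have e4 : ∀ᶠ z : ℝ × ℝ in 𝓝 y, z.2 ∈ Ioo (-(Real.pi / 2)) (Real.pi / 2) :=
    continuous_snd.continuousAt.eventually_mem (isOpen_Ioo.mem_nhds hy)
  refine ⟨_, e1.and (e2.and (e3.and (e4.and (eventually_inc_pos h)))), fun Δ hΔ hfly => ?_⟩
  have hstep : ∀ z ∈ closure Δ, T.step f i j z = (T.arr i j z, f (c - z.2)) := fun z hz => by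
    obtain ⟨-, -, -, h4, h5⟩ := hΔ hz
    have := refl_sub T h h5 (Ioo_subset_Icc_self hy) (Ioo_subset_Icc_self h4)
    rw [step, show T.refl i j z.2 = c - z.2 by rw [hc]; linarith]
  obtain ⟨Ψ', hΨ'⟩ : ∃ Ψ' : ℝ × ℝ → ℝ × ℝ, Ψ' = fun p =>
    (y.1 + ((T.arr i j y - p.1) * T.inc i j (c - g p.2) -
      T.tim i j y * Real.sin (c - g p.2 - y.2)) / Real.cos (c - g p.2), c - g p.2) := ⟨_, rfl⟩
  refine ⟨T.step f i j, Ψ', fun z hz => ((hfly z hz).billiardMap_eq f).symm, ?_, ?_, ?_⟩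
  · refine ContDiffOn.congr (f := fun z => (T.arr i j z, f (c - z.2))) (fun z hz => ?_) hstep
    obtain ⟨h1, -, -, -, h5⟩ := hΔ hz
    refine ContDiffAt.contDiffWithinAt ((contDiffAt_arr h5.ne').prodMk ?_)
    exact ContDiffAt.comp (g := f) (f := fun z : ℝ × ℝ => c - z.2) z h1 (by fun_prop)
  · intro z hz
    obtain ⟨-, h2, -, h4, h5⟩ := hΔ hz
    rw [hstep z hz, hΨ']
    have h6 := T.dev_tim h.ne' h5.ne'
    have h7 := (Real.cos_pos_of_mem_Ioo h4).ne'
    simp only [h2, sub_sub_cancel]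
    refine Prod.ext ?_ rfl
    simp only [dev] at h6
    simp only
    rw [← h6]
    field_simp
    ring
  · rintro _ ⟨z, hz, rfl⟩
    obtain ⟨-, h2, h3, h4, -⟩ := hΔ hz
    refine ContDiffAt.contDiffWithinAt ?_
    rw [hstep z hz, hΨ']
    have k1 : ContDiffAt ℝ 2 (fun p : ℝ × ℝ => c - g p.2) (T.arr i j z, f (c - z.2)) :=
      contDiffAt_const.sub (ContDiffAt.comp (g := g) (f := fun p : ℝ × ℝ => p.2) _ h3
        contDiffAt_snd)
    have k2 : ContDiffAt ℝ 2 (fun p : ℝ × ℝ => T.inc i j (c - g p.2)) (T.arr i j z, f (c - z.2)) :=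
      ContDiffAt.comp (g := T.inc i j) (f := fun p : ℝ × ℝ => c - g p.2) _
        (contDiff_inc i j).contDiffAt k1
    refine ContDiffAt.prodMk (contDiffAt_const.add (ContDiffAt.div ?_ (k1.cos) ?_)) k1
    · exact ((contDiffAt_const.sub contDiffAt_fst).mul k2).sub
        (contDiffAt_const.mul ((k1.sub contDiffAt_const).sin))
    · simp only [h2, sub_sub_cancel]
      exact (Real.cos_pos_of_mem_Ioo h4).ne'

/-- The number of the pairs of sides between which vectors close to `y` fly transversally is at most
the branching number of order one. -/
theorem card_le_branchingNumber (hf : IsContractingLaw f)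
    (hy : y.2 ∈ Ioo (-(Real.pi / 2)) (Real.pi / 2)) (hN : y ∈ T.singularSetOfOrder f 1)
    (Q : Finset (T.Side × T.Side)) (hQ : ∀ q ∈ Q, Acc q.1 q.2 y) :
    (Q.card : ℕ∞) ≤ T.branchingNumber f 1 := by
  obtain ⟨r₀, hr₀, hball⟩ := exists_isSectorBall (f := f) hy hN
  have hW : ∀ q ∈ Q, ∃ W ∈ 𝓝 y, ∀ Δ, closure Δ ⊆ W → (∀ z ∈ Δ, T.Fly q.1 q.2 z) →
      T.IsRegular f 1 Δ := fun q hq => exists_nhds_isRegular hf (hQ q hq).inc_pos hy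
  choose! W hWn hWr using hW
  obtain ⟨ρ, hρ, hρW⟩ := Metric.mem_nhds_iff.1 ((Filter.biInter_mem Q.finite_toSet).2 hWn)
  obtain ⟨r, hr, hrlt⟩ := exists_between (lt_min hr₀ hρ)
  have hB := hball r hr (hrlt.trans_le (min_le_left _ _))
  have hrρ : r < ρ := hrlt.trans_le (min_le_right _ _)
  have hpb : phaseBall y r ∈ 𝓝 y := by
    have h1 : ∀ᶠ z : ℝ × ℝ in 𝓝 y, z.2 ∈ Ioo (-(Real.pi / 2)) (Real.pi / 2) :=
      continuous_snd.continuousAt.eventually_mem (isOpen_Ioo.mem_nhds hy)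
    have hc : Continuous fun z : ℝ × ℝ => (z.1 - y.1) ^ 2 + (z.2 - y.2) ^ 2 := by fun_prop
    have h2 : ∀ᶠ z : ℝ × ℝ in 𝓝 y, (z.1 - y.1) ^ 2 + (z.2 - y.2) ^ 2 < r ^ 2 :=
      hc.continuousAt.eventually_lt continuousAt_const (by simp; positivity)
    filter_upwards [h1, h2] with z a b using ⟨Ioo_subset_Icc_self a, b⟩
  have hz : ∀ q ∈ Q, ∃ z, z ∈ phaseBall y r ∧ T.Fly q.1 q.2 z := fun q hq => by
    obtain ⟨z, h1, h2⟩ := ((hQ q hq).freq.and_eventually hpb).exists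
    exact ⟨z, h2, h1⟩
  choose! z hzb hzf using hz
  have hnot : ∀ q ∈ Q, z q ∉ T.singularSetOfOrder f 1 := by
    rintro q hq ⟨-, k, hk, h⟩
    obtain rfl : k = 0 := by omega
    exact (hzf q hq).notMem_singularSet h
  obtain ⟨D, hD⟩ : ∃ D : T.Side × T.Side → Set (ℝ × ℝ), D = fun q =>
    connectedComponentIn (phaseBall y r \ T.singularSetOfOrder f 1) (z q) := ⟨_, rfl⟩
  have hDs : ∀ q ∈ Q, D q ∈ T.sectors f 1 y r := fun q hq =>
    ⟨z q, ⟨hzb q hq, hnot q hq⟩, by rw [hD]⟩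
  have hzD : ∀ q ∈ Q, z q ∈ D q := fun q hq => by
    rw [hD]
    exact mem_connectedComponentIn ⟨hzb q hq, hnot q hq⟩
  have hDf : ∀ q ∈ Q, ∀ w ∈ D q, T.Fly q.1 q.2 w := fun q hq =>
    (isPreconnected_sector (hDs q hq)).fly (fun w hw => by
      have hw := sector_subset (hDs q hq) hw
      exact exists_fly hw.1.1 fun h => hw.2 ⟨hw.1.1, 0, one_pos, h⟩) (hzD q hq) (hzf q hq)
  have hreg : ∀ q ∈ Q, T.IsRegular f 1 (D q) := fun q hq => by
    refine hWr q hq _ (fun w hw => ?_) (hDf q hq)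
    have h1 : w ∈ closure (phaseBall y r) :=
      closure_mono ((sector_subset (hDs q hq)).trans sdiff_subset) hw
    rw [closure_phaseBall hN.1 hr] at h1
    have h2 : w ∈ Metric.ball y ρ := mem_ball_prod.2
      ⟨(abs_le_of_sq_le_sq (by nlinarith [sq_nonneg (w.2 - y.2), h1.2]) hr.le).trans_lt hrρ,
        (abs_le_of_sq_le_sq (by nlinarith [sq_nonneg (w.1 - y.1), h1.2]) hr.le).trans_lt hrρ⟩
    exact mem_iInter₂.1 (hρW h2) q hq
  have hinj : InjOn D Q := fun q hq q' hq' h => by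
    have h1 := hDf q' hq' (z q) (h ▸ hzD q hq)
    have := (hzf q hq).unique h1
    exact Prod.ext this.1 this.2
  have h1 : (Q.card : ℕ∞) = (D '' Q).encard := by
    rw [hinj.encard_image, Set.encard_coe_eq_coe_finsetCard]
  rw [h1]
  refine le_trans (Set.encard_le_encard ?_)
    (le_iSup_of_le y (le_iSup_of_le r (le_iSup_of_le hB le_rfl)))
  rintro _ ⟨q, hq, rfl⟩
  exact ⟨hDs q hq, hreg q hq⟩

end PolygonalTable

namespace PolygonalTable

variable {T : PolygonalTable} {f : ℝ → ℝ} {ι ι' : ℕ → T.Side} {n : ℕ} {x z : ℝ × ℝ}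

lemma rh_congr {l : ℕ} (hl : l < n) (h : ∀ m ≤ l, ι m = ι' m) (t θ : ℝ) :
    T.rh f ι x n l t θ = T.rh f ι' x n l t θ := by
  have hka : ∀ m ≤ l, T.ka f ι x m θ = T.ka f ι' x m θ := fun m hm => by
    rw [ka, ka, (al_congr (θ := θ) h hm).1, (al_congr (θ := θ) h hm).2,
      (al_congr (θ := x.2) h hm).1]
  rw [rh_eq hl, rh_eq hl, hka l le_rfl]
  congr 1
  refine Finset.sum_congr rfl fun m hm => ?_
  have hm := Finset.mem_range.1 hm
  rw [hka m hm.le, tm, tm, trk_congr h hm.le, h m hm.le, h (m + 1) hm]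

lemma tm_congr {l : ℕ} (h : ∀ m ≤ l + 1, ι m = ι' m) : T.tm f ι x l = T.tm f ι' x l := by
  rw [tm, tm, trk_congr h (Nat.le_succ l), h l (Nat.le_succ l), h (l + 1) le_rfl]

/-- Two itineraries which separate at the `l`-th flight are separated by a checkpoint of this
flight. -/
lemma AccPath.separation (hf : IsContractingLaw f) (h : T.AccPath f ι n x)
    (h' : T.AccPath f ι' n x) {l : ℕ} (hl : l < n) (heq : ∀ m ≤ l, ι m = ι' m)
    (hne : ι (l + 1) ≠ ι' (l + 1)) :
    ∃ t, 0 ≤ t ∧ t ≤ T.tm f ι x l ∧ t ≤ T.tm f ι' x l ∧ ∃ σ : ℝ, (σ = 1 ∨ σ = -1) ∧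
      ∀ᶠ z in 𝓝 x, (T.Itin f ι (l + 1) z → 0 < σ * ((z.1 - x.1) + T.rh f ι x n l t z.2)) ∧
        (T.Itin f ι' (l + 1) z → σ * ((z.1 - x.1) + T.rh f ι' x n l t z.2) < 0) := by
  have hy := trk_congr (T := T) (f := f) (z := x) heq le_rfl
  have ha' := h'.acc l hl
  rw [← heq l le_rfl, ← hy] at ha'
  obtain ⟨t, ht0, ht, ht', σ, hσ, hev⟩ := (h.acc l hl).separation ha' hne
  have h2 : t ≤ T.tm f ι' x l := by rw [tm, ← heq l le_rfl, ← hy]; exact ht'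
  refine ⟨t, ht0, ht, h2, σ * (-1) ^ l, ?_, ?_⟩
  · rcases hσ with rfl | rfl <;> rcases neg_one_pow_cases l with e | e <;> rw [e] <;> simp
  filter_upwards [(h.continuousAt_trk hf hl.le).eventually hev, h.eventually_transv hf]
    with z h3 h4
  refine ⟨fun hz => ?_, fun hz => ?_⟩
  · exact (dev_trk_sign hf h.transv h4 hl t σ).1 (h3.1 (hz l (Nat.lt_succ_self l)))
  · have h5 := hz l (Nat.lt_succ_self l)
    rw [← heq l le_rfl, ← trk_congr heq le_rfl] at h5
    have h6 : 0 < -σ * dev (T.trk f ι x l) (T.trk f ι z l) t := by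
      have := h3.2 h5
      linarith
    have h7 := (dev_trk_sign hf h.transv h4 hl t (-σ)).1 h6
    rw [← rh_congr hl heq]
    linarith

/-- The order between the itineraries of length `k`. -/
def Above (T : PolygonalTable) (f : ℝ → ℝ) (n : ℕ) (x : ℝ × ℝ) (k : ℕ) (ι ι' : ℕ → T.Side) : Prop :=
  ∃ l t, l < k ∧ 0 ≤ t ∧ t ≤ T.tm f ι x l ∧ t ≤ T.tm f ι' x l ∧
    ∀ᶠ z in 𝓝 x, (T.Itin f ι k z → 0 < (z.1 - x.1) + T.rh f ι x n l t z.2) ∧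
      (T.Itin f ι' k z → (z.1 - x.1) + T.rh f ι' x n l t z.2 < 0)

lemma above_of_sign {k l : ℕ} {t σ : ℝ} (hl : l < k) (h0 : 0 ≤ t) (h1 : t ≤ T.tm f ι x l)
    (h2 : t ≤ T.tm f ι' x l) (hσ : σ = 1 ∨ σ = -1)
    (hev : ∀ᶠ z in 𝓝 x, (T.Itin f ι k z → 0 < σ * ((z.1 - x.1) + T.rh f ι x n l t z.2)) ∧
      (T.Itin f ι' k z → σ * ((z.1 - x.1) + T.rh f ι' x n l t z.2) < 0)) :
    T.Above f n x k ι ι' ∨ T.Above f n x k ι' ι := by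
  rcases hσ with rfl | rfl
  · left
    refine ⟨l, t, hl, h0, h1, h2, ?_⟩
    filter_upwards [hev] with z hz
    simpa only [one_mul] using hz
  · right
    refine ⟨l, t, hl, h0, h2, h1, ?_⟩
    filter_upwards [hev] with z hz
    exact ⟨fun h => by linarith [hz.2 h], fun h => by linarith [hz.1 h]⟩

lemma AccPath.above_or_above (hf : IsContractingLaw f) (h : T.AccPath f ι n x)
    (h' : T.AccPath f ι' n x) {k : ℕ} (hk0 : 1 ≤ k) (hk : k ≤ n) (hne : ∃ m ≤ k, ι m ≠ ι' m) :
    T.Above f n x k ι ι' ∨ T.Above f n x k ι' ι := by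
  classical
  obtain ⟨hm1, hm2⟩ := Nat.find_spec hne
  have hmin : ∀ m < Nat.find hne, ι m = ι' m := fun m hm => by
    by_contra h1
    exact Nat.find_min hne hm ⟨by omega, h1⟩
  obtain ⟨m, hm⟩ : ∃ m, m = Nat.find hne := ⟨_, rfl⟩
  rw [← hm] at hm1 hm2 hmin
  rcases m with _ | l
  · have h0 : 0 < n := by omega
    have h1 := (h.acc 0 h0).mem
    have h1' := (h'.acc 0 h0).mem
    have hrh : ∀ (κ : ℕ → T.Side) (θ : ℝ), T.rh f κ x n 0 0 θ = 0 := fun κ θ => by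
      rw [rh_eq h0]; simp
    have hdisj : ∀ s, s ∈ Ioo (T.lo (ι 0)) (T.hi (ι 0)) → s ∉ Icc (T.lo (ι' 0)) (T.hi (ι' 0)) :=
      fun s hs hs' => hm2 (T.side_eq_of_mem hs hs')
    have hdisj' : ∀ s, s ∈ Ioo (T.lo (ι' 0)) (T.hi (ι' 0)) → s ∉ Icc (T.lo (ι 0)) (T.hi (ι 0)) :=
      fun s hs hs' => hm2 (T.side_eq_of_mem hs hs').symm
    have h2 : x.1 ∈ Icc (T.lo (ι 0)) (T.hi (ι 0)) := h1
    have h2' : x.1 ∈ Icc (T.lo (ι' 0)) (T.hi (ι' 0)) := h1'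
    have l1 := T.lo_lt_hi (ι 0)
    have l2 := T.lo_lt_hi (ι' 0)
    have hcases : (x.1 = T.lo (ι 0) ∧ x.1 = T.hi (ι' 0)) ∨ (x.1 = T.hi (ι 0) ∧ x.1 = T.lo (ι' 0)) := by
      have e1 : x.1 = T.lo (ι 0) ∨ x.1 = T.hi (ι 0) := by
        by_contra! hh
        exact hdisj _ ⟨h2.1.lt_of_ne hh.1.symm, h2.2.lt_of_ne hh.2⟩ h2'
      have e2 : x.1 = T.lo (ι' 0) ∨ x.1 = T.hi (ι' 0) := by
        by_contra! hh
        exact hdisj' _ ⟨h2'.1.lt_of_ne hh.1.symm, h2'.2.lt_of_ne hh.2⟩ h2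
      rcases e1 with e1 | e1 <;> rcases e2 with e2 | e2
      · exact absurd (T.side_eq_of_lo (e1.symm.trans e2)) hm2
      · exact Or.inl ⟨e1, e2⟩
      · exact Or.inr ⟨e1, e2⟩
      · exact absurd (T.side_eq_of_hi (e1.symm.trans e2)) hm2
    have hbase : ∀ (κ : ℕ → T.Side) (z : ℝ × ℝ), T.Itin f κ k z → z.1 ∈ Ioo (T.lo (κ 0)) (T.hi (κ 0)) :=
      fun κ z hz => (hz 0 hk0).1.1
    rcases hcases with ⟨e1, e2⟩ | ⟨e1, e2⟩
    · refine above_of_sign (σ := 1) hk0 le_rfl (h.tm_nonneg h0) (h'.tm_nonneg h0) (Or.inl rfl)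
        (Eventually.of_forall fun z => ⟨fun hz => ?_, fun hz => ?_⟩)
      · rw [hrh]; linarith [(hbase _ _ hz).1]
      · rw [hrh]; linarith [(hbase _ _ hz).2]
    · refine above_of_sign (σ := -1) hk0 le_rfl (h.tm_nonneg h0) (h'.tm_nonneg h0) (Or.inr rfl)
        (Eventually.of_forall fun z => ⟨fun hz => ?_, fun hz => ?_⟩)
      · rw [hrh]; linarith [(hbase _ _ hz).2]
      · rw [hrh]; linarith [(hbase _ _ hz).1]
  · obtain ⟨t, h0, h1, h2, σ, hσ, hev⟩ := h.separation hf h' (l := l) (by omega)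
      (fun m hm => hmin m (by omega)) hm2
    refine above_of_sign hm1 h0 h1 h2 hσ ?_
    filter_upwards [hev] with z hz
    exact ⟨fun hi => hz.1 (hi.mono hm1), fun hi => hz.2 (hi.mono hm1)⟩

/-- Signs at three checkpoints, the last one being between the two others, are incompatible with the
monotonicity of the displacements. -/
lemma AccPath.false_of_signs (hf : IsContractingLaw f) (hn : 1 ≤ n) (h : T.AccPath f ι n x)
    (h' : T.AccPath f ι' n x)
    (hfr : ∃ᶠ z in 𝓝 x, T.Itin f ι n z) (hfr' : ∃ᶠ z in 𝓝 x, T.Itin f ι' n z)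
    {k l l' : ℕ} {t s s' : ℝ} (hk : k < n) (hl : l < k) (hl' : l' < k) (ht : 0 ≤ t)
    (hs : 0 ≤ s) (hs' : 0 ≤ s')
    (hsι : s ≤ T.tm f ι x l) (hsι' : s ≤ T.tm f ι' x l)
    (hs'ι : s' ≤ T.tm f ι x l') (hs'ι' : s' ≤ T.tm f ι' x l')
    (hev : ∀ᶠ z in 𝓝 x, T.Itin f ι n z → (z.1 - x.1) + T.rh f ι x n l s z.2 < 0 ∧
      0 < (z.1 - x.1) + T.rh f ι x n l' s' z.2)
    (hev' : ∀ᶠ z in 𝓝 x, T.Itin f ι' n z → (z.1 - x.1) + T.rh f ι' x n l s z.2 < 0 ∧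
      0 < (z.1 - x.1) + T.rh f ι' x n l' s' z.2)
    (hsep : ∀ᶠ z in 𝓝 x, (T.Itin f ι n z → 0 < (z.1 - x.1) + T.rh f ι x n k t z.2) ∧
      (T.Itin f ι' n z → (z.1 - x.1) + T.rh f ι' x n k t z.2 < 0)) : False := by
  obtain ⟨z, hz, h1, h2⟩ := (hfr.and_eventually (hev.and hsep)).exists
  obtain ⟨z', hz', h1', h2'⟩ := (hfr'.and_eventually (hev'.and hsep)).exists
  obtain ⟨a1, a2⟩ := h1 hz
  have a3 := h2.1 hz
  obtain ⟨b1, b2⟩ := h1' hz'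
  have b3 := h2'.2 hz'
  have hpos : x.2 ≤ z.2 := by
    by_contra! hlt
    have := (h.rh_mono hf hk hsι ht (Or.inl hl) (hz.transv hn)).2 hlt.le
    linarith
  have hneg : z'.2 ≤ x.2 := by
    by_contra! hlt
    have := (h'.rh_mono hf hk hs'ι' ht (Or.inl hl') (hz'.transv hn)).1 hlt.le
    linarith
  rcases ChkLE.total l s l' s' with hc | hc
  · have := (h'.rh_mono hf (hl'.trans hk) hsι' hs' hc (hz'.transv hn)).2 hneg
    linarith
  · have := (h.rh_mono hf (hl.trans hk) hs'ι hs hc (hz.transv hn)).1 hpos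
    linarith

/-- An itinerary which is between two other ones does not branch. -/
lemma AccPath.not_branching (hf : IsContractingLaw f) {ι₁ ι₃ : ℕ → T.Side} {k : ℕ} (hk : k < n)
    (h : T.AccPath f ι n x) (h' : T.AccPath f ι' n x)
    (hfr : ∃ᶠ z in 𝓝 x, T.Itin f ι n z) (hfr' : ∃ᶠ z in 𝓝 x, T.Itin f ι' n z)
    (heq : ∀ m ≤ k, ι m = ι' m) (hne : ι (k + 1) ≠ ι' (k + 1))
    (h1 : T.Above f n x k ι₁ ι) (h3 : T.Above f n x k ι ι₃) : False := by
  obtain ⟨l, s, hl, hs, -, hsι, hev1⟩ := h1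
  obtain ⟨l', s', hl', hs', hs'ι, -, hev3⟩ := h3
  obtain ⟨t, ht, -, -, σ, hσ, hsep⟩ := h.separation hf h' hk heq hne
  have hsι' : s ≤ T.tm f ι' x l :=
    hsι.trans_eq (tm_congr fun m hm => heq m (by omega))
  have hs'ι' : s' ≤ T.tm f ι' x l' :=
    hs'ι.trans_eq (tm_congr fun m hm => heq m (by omega))
  have hev : ∀ᶠ z in 𝓝 x, T.Itin f ι n z → (z.1 - x.1) + T.rh f ι x n l s z.2 < 0 ∧
      0 < (z.1 - x.1) + T.rh f ι x n l' s' z.2 := by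
    filter_upwards [hev1, hev3] with z e1 e3 hz
    exact ⟨e1.2 (hz.mono hk.le), e3.1 (hz.mono hk.le)⟩
  have hev' : ∀ᶠ z in 𝓝 x, T.Itin f ι' n z → (z.1 - x.1) + T.rh f ι' x n l s z.2 < 0 ∧
      0 < (z.1 - x.1) + T.rh f ι' x n l' s' z.2 := by
    filter_upwards [hev1, hev3] with z e1 e3 hz
    have hz := (itin_congr heq).2 (hz.mono hk.le)
    rw [← rh_congr (hl.trans hk) fun m hm => heq m (by omega),
      ← rh_congr (hl'.trans hk) fun m hm => heq m (by omega)]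
    exact ⟨e1.2 hz, e3.1 hz⟩
  have hn : 1 ≤ n := by omega
  rcases hσ with rfl | rfl
  · refine AccPath.false_of_signs hf hn h h' hfr hfr' hk hl hl' ht hs hs' hsι hsι' hs'ι
      hs'ι' hev hev' ?_
    filter_upwards [hsep] with z hz
    exact ⟨fun hi => by linarith [hz.1 (hi.mono hk)], fun hi => by linarith [hz.2 (hi.mono hk)]⟩
  · refine AccPath.false_of_signs hf hn h' h hfr' hfr hk hl hl' ht hs hs' hsι' hsι hs'ι'
      hs'ι hev' hev ?_
    filter_upwards [hsep] with z hz
    exact ⟨fun hi => by linarith [hz.2 (hi.mono hk)], fun hi => by linarith [hz.1 (hi.mono hk)]⟩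

end PolygonalTable

namespace PolygonalTable

variable {T : PolygonalTable} {f : ℝ → ℝ} {ι ι' : ℕ → T.Side} {n : ℕ} {x y z : ℝ × ℝ} {r : ℝ}
  {Δ : Set (ℝ × ℝ)}

/-- Outside the singular set, the only accumulated flight is the flight of `y` itself. -/
lemma Acc.eq_of_notMem {i j : T.Side} (hy : y ∈ phaseSpace) (hN : y ∉ T.singularSet)
    (h : Acc i j y) : T.Fly i j y := by
  obtain ⟨i', j', hf⟩ := exists_fly hy hN
  obtain ⟨z, h1, h2⟩ := (h.freq.and_eventually hf.eventually).exists
  obtain ⟨rfl, rfl⟩ := h1.unique h2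
  exact hf

lemma card_le_or_card_le {b : ℕ} (hb : ∀ y : ℝ × ℝ, y.2 ∈ Ioo (-(Real.pi / 2)) (Real.pi / 2) →
      y ∈ T.singularSetOfOrder f 1 → ∀ Q : Finset (T.Side × T.Side),
        (∀ q ∈ Q, Acc q.1 q.2 y) → Q.card ≤ b)
    (hy : y.2 ∈ Ioo (-(Real.pi / 2)) (Real.pi / 2)) (Q : Finset (T.Side × T.Side))
    (hQ : ∀ q ∈ Q, Acc q.1 q.2 y) : Q.card ≤ 1 ∨ Q.card ≤ b := by
  by_cases hN : y ∈ T.singularSetOfOrder f 1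
  · exact Or.inr (hb y hy hN Q hQ)
  · left
    have hyp : y ∈ phaseSpace := Ioo_subset_Icc_self hy
    have hN' : y ∉ T.singularSet := fun h => hN ⟨hyp, 0, one_pos, h⟩
    refine Finset.card_le_one.2 fun q hq q' hq' => ?_
    have := ((hQ q hq).eq_of_notMem hyp hN').unique ((hQ q' hq').eq_of_notMem hyp hN')
    exact Prod.ext this.1 this.2

/-- The beginning of an itinerary, up to the time `k`. -/
def pre (k : ℕ) (ι : ℕ → T.Side) : ℕ → T.Side := fun m => ι (min m k)

lemma pre_eq_iff {k : ℕ} : pre k ι = pre k ι' ↔ ∀ m ≤ k, ι m = ι' m := by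
  constructor
  · intro h m hm
    have := congrFun h m
    simpa [pre, min_eq_left hm] using this
  · intro h
    ext1 m
    exact h _ (min_le_right _ _)

lemma pre_pre (k : ℕ) : pre k (pre (k + 1) ι) = pre k ι := by
  rw [pre_eq_iff]
  intro m hm
  rw [pre, min_eq_left (by omega)]

lemma AccPath.snd_mem (hf : IsContractingLaw f) (h : T.AccPath f ι n x) {k : ℕ} :
    (T.trk f ι x k).2 ∈ Ioo (-(Real.pi / 2)) (Real.pi / 2) := by
  rw [trk_snd]
  exact th_mem hf h.angle k

section Count

variable {b : ℕ} (hf : IsContractingLaw f) (F : Finset (ℕ → T.Side))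
  (hF : ∀ ι ∈ F, T.AccPath f ι n x ∧ ∃ᶠ z in 𝓝 x, T.Itin f ι n z)
  (hb : ∀ y : ℝ × ℝ, y.2 ∈ Ioo (-(Real.pi / 2)) (Real.pi / 2) →
      y ∈ T.singularSetOfOrder f 1 → ∀ Q : Finset (T.Side × T.Side),
        (∀ q ∈ Q, Acc q.1 q.2 y) → Q.card ≤ b)
include hf hF hb

open Classical in
/-- The number of the continuations of a beginning of an itinerary. -/
lemma card_children {k : ℕ} (hk : k < n) (ι : ℕ → T.Side) (hι : ι ∈ F) :
    ((F.image (pre (k + 1))).filter fun a => pre k a = pre k ι).card ≤ 1 ∨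
      ((F.image (pre (k + 1))).filter fun a => pre k a = pre k ι).card ≤ b := by
  obtain ⟨A, hA⟩ : ∃ A, A = (F.image (pre (k + 1))).filter fun a => pre k a = pre k ι := ⟨_, rfl⟩
  rw [← hA]
  have hmem : ∀ a ∈ A, ∃ ι' ∈ F, a = pre (k + 1) ι' ∧ ∀ m ≤ k, ι' m = ι m := fun a ha => by
    rw [hA, Finset.mem_filter, Finset.mem_image] at ha
    obtain ⟨⟨ι', h1, rfl⟩, h2⟩ := ha
    rw [pre_pre, pre_eq_iff] at h2
    exact ⟨ι', h1, rfl, h2⟩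
  have hinj : InjOn (fun a : ℕ → T.Side => (a k, a (k + 1))) A := by
    intro a ha a' ha' h
    obtain ⟨ι₁, -, rfl, e1⟩ := hmem a ha
    obtain ⟨ι₂, -, rfl, e2⟩ := hmem a' ha'
    rw [pre_eq_iff]
    intro m hm
    rcases Nat.lt_or_ge k m with h1 | h1
    · obtain rfl : m = k + 1 := by omega
      simpa [pre] using (Prod.ext_iff.1 h).2
    · rw [e1 m h1, e2 m h1]
  rw [← Finset.card_image_of_injOn hinj]
  refine card_le_or_card_le hb ((hF ι hι).1.snd_mem hf (k := k)) _ fun q hq => ?_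
  obtain ⟨a, ha, rfl⟩ := Finset.mem_image.1 hq
  obtain ⟨ι', h1, rfl, h2⟩ := hmem a ha
  rw [← trk_congr h2 le_rfl]
  have := (hF ι' h1).1.acc k hk
  simpa [pre] using this

open Classical in
lemma card_image_pre_succ {k : ℕ} (hk0 : 1 ≤ k) (hk : k < n) :
    (F.image (pre (k + 1))).card ≤ (F.image (pre k)).card + 2 * b := by
  obtain ⟨c, hc⟩ : ∃ c : (ℕ → T.Side) → ℕ,
    c = fun p => ((F.image (pre (k + 1))).filter fun a => pre k a = p).card := ⟨_, rfl⟩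
  have hmaps : ∀ a ∈ F.image (pre (k + 1)), pre k a ∈ F.image (pre k) := fun a ha => by
    obtain ⟨ι, hι, rfl⟩ := Finset.mem_image.1 ha
    rw [pre_pre]
    exact Finset.mem_image_of_mem _ hι
  have hsum : (F.image (pre (k + 1))).card = ∑ p ∈ F.image (pre k), c p := by
    rw [hc]
    exact Finset.card_eq_sum_card_fiberwise hmaps
  obtain ⟨B, hB⟩ : ∃ B, B = (F.image (pre k)).filter fun p => 1 < c p := ⟨_, rfl⟩
  have hbr : ∀ p ∈ B, ∃ ι ∈ F, pre k ι = p ∧ ∀ ι₁ ∈ F, ∀ ι₃ ∈ F, T.Above f n x k ι₁ ι →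
      T.Above f n x k ι ι₃ → False := fun p hp => by
    rw [hB, Finset.mem_filter, hc, Finset.one_lt_card] at hp
    obtain ⟨-, a, ha, a', ha', hne⟩ := hp
    rw [Finset.mem_filter, Finset.mem_image] at ha ha'
    obtain ⟨⟨ι, hι, rfl⟩, h1⟩ := ha
    obtain ⟨⟨ι', hι', rfl⟩, h2⟩ := ha'
    rw [pre_pre] at h1 h2
    have heq := pre_eq_iff.1 (h1.trans h2.symm)
    refine ⟨ι, hι, h1, fun ι₁ _ ι₃ _ h3 h4 => ?_⟩
    refine AccPath.not_branching hf hk (hF ι hι).1 (hF ι' hι').1 (hF ι hι).2 (hF ι' hι').2 heq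
      (fun h => hne (pre_eq_iff.2 fun m hm => ?_)) h3 h4
    rcases Nat.lt_or_ge k m with h5 | h5
    · obtain rfl : m = k + 1 := by omega
      exact h
    · exact heq m h5
  have hB2 : B.card ≤ 2 := by
    by_contra! hlt
    obtain ⟨p₁, h1, p₂, h2, p₃, h3, h12, h13, h23⟩ := Finset.two_lt_card.1 hlt
    obtain ⟨ι₁, m1, rfl, b1⟩ := hbr _ h1
    obtain ⟨ι₂, m2, rfl, b2⟩ := hbr _ h2
    obtain ⟨ι₃, m3, rfl, b3⟩ := hbr _ h3
    have htot : ∀ ι ∈ F, ∀ ι' ∈ F, pre k ι ≠ pre k ι' →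
        T.Above f n x k ι ι' ∨ T.Above f n x k ι' ι := fun ι hι ι' hι' hne => by
      refine (hF ι hι).1.above_or_above hf (hF ι' hι').1 hk0 hk.le ?_
      by_contra! h
      exact hne (pre_eq_iff.2 h)
    rcases htot _ m1 _ m2 h12 with e12 | e12 <;> rcases htot _ m2 _ m3 h23 with e23 | e23
    · exact b2 _ m1 _ m3 e12 e23
    · rcases htot _ m1 _ m3 h13 with e13 | e13
      · exact b3 _ m1 _ m2 e13 e23
      · exact b1 _ m3 _ m2 e13 e12
    · rcases htot _ m1 _ m3 h13 with e13 | e13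
      · exact b1 _ m2 _ m3 e12 e13
      · exact b3 _ m2 _ m1 e23 e13
    · exact b2 _ m3 _ m1 e23 e12
  have hle : ∀ p ∈ F.image (pre k), c p ≤ 1 + if 1 < c p then b else 0 := fun p hp => by
    obtain ⟨ι, hι, rfl⟩ := Finset.mem_image.1 hp
    have := card_children hf F hF hb hk ι hι
    rw [hc] at *
    dsimp only at *
    split_ifs with h
    · omega
    · omega
  calc (F.image (pre (k + 1))).card = ∑ p ∈ F.image (pre k), c p := hsum
    _ ≤ ∑ p ∈ F.image (pre k), (1 + if 1 < c p then b else 0) := Finset.sum_le_sum hle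
    _ = (F.image (pre k)).card + B.card * b := by
        rw [Finset.sum_add_distrib, ← Finset.sum_filter, ← hB, Finset.sum_const, Finset.sum_const]
        simp
    _ ≤ (F.image (pre k)).card + 2 * b := by gcongr

open Classical in
lemma card_image_pre_one (hn : 1 ≤ n) (hN : x ∈ T.singularSetOfOrder f n) :
    (F.image (pre 1)).card ≤ b := by
  rcases F.eq_empty_or_nonempty with rfl | ⟨ι, hι⟩
  · simp
  have hA := (hF ι hι).1
  have hinj : InjOn (fun a : ℕ → T.Side => (a 0, a 1)) (F.image (pre 1)) := by
    intro a ha a' ha' h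
    obtain ⟨ι₁, -, rfl⟩ := Finset.mem_image.1 ha
    obtain ⟨ι₂, -, rfl⟩ := Finset.mem_image.1 ha'
    rw [pre_eq_iff]
    intro m hm
    rcases Nat.lt_or_ge 0 m with h1 | h1
    · obtain rfl : m = 1 := by omega
      simpa [pre] using (Prod.ext_iff.1 h).2
    · obtain rfl : m = 0 := by omega
      simpa [pre] using (Prod.ext_iff.1 h).1
  have h1b : 1 ≤ b := by
    by_contra! hb0
    have hnot : ∀ k < n, T.trk f ι x k ∉ T.singularSet := fun k hk hs => by
      have := hb (T.trk f ι x k) (hA.snd_mem hf)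
        ⟨Ioo_subset_Icc_self (hA.snd_mem hf), 0, one_pos, hs⟩ {(ι k, ι (k + 1))}
        (by simpa using hA.acc k hk)
      simp at this
      omega
    have hit : T.Itin f ι n x := fun k hk =>
      (hA.acc k hk).eq_of_notMem (Ioo_subset_Icc_self (hA.snd_mem hf)) (hnot k hk)
    exact hit.notMem hN
  rw [← Finset.card_image_of_injOn hinj]
  refine (card_le_or_card_le hb hA.angle _ fun q hq => ?_).elim (fun h => h.trans h1b) id
  obtain ⟨a, ha, rfl⟩ := Finset.mem_image.1 hq
  obtain ⟨ι', h1, rfl⟩ := Finset.mem_image.1 ha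
  have := (hF ι' h1).1.acc 0 hn
  simpa [pre, trk] using this

open Classical in
lemma card_image_pre (hn : 1 ≤ n) (hN : x ∈ T.singularSetOfOrder f n) {k : ℕ} (hk0 : 1 ≤ k)
    (hk : k ≤ n) : (F.image (pre k)).card ≤ (2 * k - 1) * b := by
  induction k, hk0 using Nat.le_induction with
  | base => simpa using card_image_pre_one hf F hF hb hn hN
  | succ k hk0 ih =>
    have h1 := card_image_pre_succ hf F hF hb hk0 hk
    have h2 := ih (by omega)
    have h3 : (2 * (k + 1) - 1) * b = (2 * k - 1) * b + 2 * b := by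
      rw [← add_mul]
      congr 1
      omega
    omega

end Count

/-- The itinerary of a regular sector. -/
lemma IsRegular.exists_accPath (hf : IsContractingLaw f) (hn : 1 ≤ n)
    (hB : T.IsSectorBall f n x r) (hΔ : Δ ∈ T.sectors f n x r) (hreg : T.IsRegular f n Δ) :
    ∃ ι, (∀ z ∈ Δ, T.Itin f ι n z) ∧ T.AccPath f ι n x := by
  obtain ⟨h1, ι, h2, h3⟩ := hreg.exists_acc hf hn hB hΔ
  exact ⟨ι, h2, h1, h3⟩

lemma snd_mem_of_mem_Icc {i : T.Side} {s : ℝ} (h : s ∈ Icc (T.lo i) (T.hi i)) :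
    i.2 = ⌊s⌋ ∨ i.2 = ⌊s⌋ - 1 := by
  have h1 : (i.2 : ℝ) ≤ s := by
    have := T.corner_nonneg i.1.castSucc
    have h2 := h.1
    rw [lo] at h2
    linarith
  have h2 : s ≤ i.2 + 1 := by
    have := T.corner_le_one i.1.succ
    have h2 := h.2
    rw [hi] at h2
    linarith
  have h3 : i.2 ≤ ⌊s⌋ := Int.le_floor.2 h1
  have h4 : ⌊s⌋ ≤ i.2 + 1 := by
    have := Int.floor_le s
    exact_mod_cast this.trans h2
  omega

/-- The number of regular sectors is bounded. -/
lemma encard_regular_le (hf : IsContractingLaw f) (hn : 1 ≤ n) (hB : T.IsSectorBall f n x r) :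
    {Δ ∈ T.sectors f n x r | T.IsRegular f n Δ}.encard ≤ ((T.d * 3) ^ (n + 1) : ℕ) := by
  have hex : ∀ Δ ∈ {Δ ∈ T.sectors f n x r | T.IsRegular f n Δ}, ∃ ι : ℕ → T.Side,
      (∀ z ∈ Δ, T.Itin f ι n z) ∧ T.AccPath f ι n x :=
    fun Δ hΔ => hΔ.2.exists_accPath hf hn hB hΔ.1
  have : Nonempty (ℕ → T.Side) := ⟨fun _ => (⟨0, by have := T.three_le; omega⟩, 0)⟩
  choose! idx hidx hacc using hex
  obtain ⟨S, hS⟩ : ∃ S : Finset T.Side,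
    S = (Finset.univ : Finset (Fin T.d)) ×ˢ ({⌊x.1⌋, ⌊x.1⌋ - 1, 0} : Finset ℤ) := ⟨_, rfl⟩
  have hScard : S.card ≤ T.d * 3 := by
    rw [hS, Finset.card_product, Finset.card_univ, Fintype.card_fin]
    exact Nat.mul_le_mul_left _ Finset.card_le_three
  have hle := Set.encard_le_encard_of_injOn
    (s := {Δ ∈ T.sectors f n x r | T.IsRegular f n Δ})
    (t := (Fintype.piFinset (fun _ : Fin (n + 1) => S) : Set (Fin (n + 1) → T.Side)))
    (f := fun Δ m => idx Δ m) (fun Δ hΔ => ?_) (fun Δ hΔ Δ' hΔ' h => ?_)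
  · refine hle.trans ?_
    rw [Set.encard_coe_eq_coe_finsetCard, Fintype.card_piFinset_const]
    exact_mod_cast Nat.pow_le_pow_left hScard _
  · rw [Finset.mem_coe, Fintype.mem_piFinset]
    intro m
    rw [hS, Finset.mem_product]
    refine ⟨Finset.mem_univ _, ?_⟩
    change (idx Δ m).2 ∈ _
    have ha := (hacc Δ hΔ).acc
    rcases Nat.eq_zero_or_pos (m : ℕ) with h0 | h0
    · rw [h0]
      rcases snd_mem_of_mem_Icc (ha 0 hn).mem with h | h
      · simp [h, trk]
      · simp [h, trk]
    · obtain ⟨k, hk⟩ : ∃ k, (m : ℕ) = k + 1 := ⟨m - 1, by omega⟩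
      rw [hk]
      have := (ha k (by have := m.2; omega)).snd_eq_zero
      simp [this]
  · have heq : ∀ m ≤ n, idx Δ m = idx Δ' m := fun m hm =>
      congrFun h ⟨m, Nat.lt_succ_of_le hm⟩
    exact (hacc Δ hΔ).sector_eq hf hn hB hΔ.1 hΔ'.1 (hidx Δ hΔ)
      fun z hz => (itin_congr heq).2 (hidx Δ' hΔ' z hz)

lemma branchingNumber_ne_top (hf : IsContractingLaw f) (hn : 1 ≤ n) :
    T.branchingNumber f n ≠ ⊤ := by
  refine ne_top_of_le_ne_top (ENat.natCast_ne_top ((T.d * 3) ^ (n + 1))) ?_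
  exact iSup_le fun x => iSup_le fun r => iSup_le fun hB => encard_regular_le hf hn hB

theorem branchingNumber_le (hf : IsContractingLaw f) (hn : 1 ≤ n) :
    T.branchingNumber f n ≤ ((2 * n - 1 : ℕ) : ℕ∞) * T.branchingNumber f 1 := by
  classical
  obtain ⟨b, hb⟩ := ENat.ne_top_iff_exists.1 (branchingNumber_ne_top (T := T) hf le_rfl)
  rw [← hb]
  refine iSup_le fun x => iSup_le fun r => iSup_le fun hB => ?_
  have hfin : {Δ ∈ T.sectors f n x r | T.IsRegular f n Δ}.Finite :=
    Set.finite_of_encard_le_coe (encard_regular_le hf hn hB)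
  have hex : ∀ Δ ∈ {Δ ∈ T.sectors f n x r | T.IsRegular f n Δ}, ∃ ι : ℕ → T.Side,
      (∀ z ∈ Δ, T.Itin f ι n z) ∧ T.AccPath f ι n x :=
    fun Δ hΔ => hΔ.2.exists_accPath hf hn hB hΔ.1
  have : Nonempty (ℕ → T.Side) := ⟨fun _ => (⟨0, by have := T.three_le; omega⟩, 0)⟩
  choose! idx hidx hacc using hex
  have hinj : InjOn (fun Δ => pre n (idx Δ)) hfin.toFinset := by
    intro Δ hΔ Δ' hΔ' h
    rw [hfin.coe_toFinset] at hΔ hΔ'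
    have heq := pre_eq_iff.1 h
    exact (hacc Δ hΔ).sector_eq hf hn hB hΔ.1 hΔ'.1 (hidx Δ hΔ)
      fun z hz => (itin_congr heq).2 (hidx Δ' hΔ' z hz)
  have hcount := card_image_pre (n := n) (x := x) (b := b) hf (hfin.toFinset.image idx)
    (fun ι hι => by
      obtain ⟨Δ, hΔ, rfl⟩ := Finset.mem_image.1 hι
      rw [hfin.mem_toFinset] at hΔ
      exact ⟨hacc Δ hΔ, (frequently_mem_sector hf hn hB hΔ.1).mono (hidx Δ hΔ)⟩)
    (fun y hy hN Q hQ => by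
      have := card_le_branchingNumber hf hy hN Q hQ
      rw [← hb] at this
      exact_mod_cast this) hn hB.2.1 hn le_rfl
  rw [Finset.image_image, Function.comp_def, Finset.card_image_of_injOn hinj] at hcount
  rw [hfin.encard_eq_coe_toFinset_card]
  exact_mod_cast hcount

end PolygonalTable

end

theorem mainTheorem2 (T : PolygonalTable) (f : ℝ → ℝ) (hf : IsContractingLaw f) (n : ℕ)
    (hn : 1 ≤ n) :
    T.branchingNumber f n ≠ ⊤ ∧
      T.branchingNumber f n ≤ ((2 * n - 1 : ℕ) : ℕ∞) * T.branchingNumber f 1 :=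
  ⟨PolygonalTable.branchingNumber_ne_top hf hn, PolygonalTable.branchingNumber_le hf hn⟩
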